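/- **Theorem 1.1.** Let $n\ge 2$, $k\ge 1$, and let $X$ be the total space of $\mathcal{O}_{\mathbb{P}^{n-1}}(-k)$, with its standard complex structure $\mathcal J$ and the map $\mathbb{C}^n\setminus\{0\}\to X$, $z\mapsto z^{\otimes k}$, which identifies $(\mathbb{C}^n\setminus\{0\})/\mathbb{Z}_k$ with the complement of the zero section. Let $g$ be a smooth complete Riemannian metric on $X$ which is ALE of some order $\tau>0$ and which arises from a potential $\phi\in C^\infty((0,\infty))$, that is, the pull-back of $g$ to $\mathbb{C}^n\setminus\{0\}$ is the Kähler metric with Kähler form $\sqrt{-1}\,\partial\bar\partial\,\phi(\mathbf z)$, $\mathbf z=|z_1|^2+\dots+|z_n|^2$. Here ALE of order $\tau$ means: there are a finite group $\Gamma\subset \mathrm{SO}(2n)$ acting freely on $\mathbb{R}^{2n}\setminus\{0\}$, a compact $K\subset X$ and a diffeomorphism $\Phi:X\setminus K\to(\mathbb{R}^{2n}\setminus B(0,R))/\Gamma$ with $\partial^m\big((\Phi_*g)_{ij}-\delta_{ij}\big)=\mathcal{O}(r^{-\tau-m})$ for all $m\ge 0$ as $r\to\infty$. Then there is a function $u:X\to\mathbb{R}$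 which on the complement of the zero section is given by $$u^2=\Big(\mathbf z\,\frac{\partial\phi}{\partial\mathbf z}\Big)^{-2}$$ and which has the following properties. 1. $u$ is smooth, positive and $\mathrm{U}(n)$-invariant on all of $X$, and $u=\mathcal{O}(r^{-2})$ as $r\to\infty$, where $r$ is the $g$-distance to a fixed base point. 2. There is a $\mathrm{U}(n)$-invariant integrable complex structure $\widehat{\mathcal J}$ on $X$, different from $\pm\mathcal J$ at every point, for which $\widehat g=u^2g$ is Kähler. 3. There is a $\mathrm{U}(n)$-equivariant biholomorphism of $(X,\widehat{\mathcal J})$ onto the complement of the point $\infty=[0:\dots:0:1]$ in the compact complex orbifold $\mathbb{CP}^n_{(1,\dots,1,k)}$. In the uniformizing chart $\xi\mapsto[\xi:1]$, $\xi\in\mathbb{C}^n$, around $\infty$ (group $\mathbb{Z}_k$), the metric $\widehat g$ extends over $\xi=0$ as a continuous positive definite tensor, which is of class $C^{1,\alpha}$ for some $\alpha>0$ if $\tau>1$. 4. The conformal factor is unique up to scale: if $v$ is any smooth positive $\mathrm{U}(n)$-invariant function on $X$ with $v=\mathcal{O}(r^{-2})$ as $r\to\infty$ such that $v^2g$ is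 Kähler for some $\mathrm{U}(n)$-invariant complex structure on $X$, then $v=c\,u$ for a constant $c>0$. -/

import Mathlib

open scoped Manifold ContDiff Topology Bundle

noncomputable section

namespace KahlerALE

/-- `ℂⁿ` with its standard Hermitian norm `‖z‖² = |z₁|² + ⋯ + |zₙ|²`. -/
abbrev Cn (n : ℕ) : Type := EuclideanSpace ℂ (Fin n)

/-! ### The total space of `𝒪(-k)` over complex projective space -/

/-- Two pairs `(v, w)`, `(v', w')` with `v, v' ∈ ℂⁿ ∖ {0}` and `w, w' ∈ ℂ` represent the same point
`w · v^{⊗k}` of the `k`-th power of the tautological line. -/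
def bundleSetoid (n k : ℕ) : Setoid {p : Cn n × ℂ // p.1 ≠ 0} where
  r p q := ∃ c : ℂ, c ≠ 0 ∧ q.1.1 = c • p.1.1 ∧ p.1.2 = c ^ k * q.1.2
  iseqv :=
    { refl := fun p => ⟨1, one_ne_zero, by simp, by simp⟩
      symm := by
        rintro p q ⟨c, hc, h1, h2⟩
        refine ⟨c⁻¹, inv_ne_zero hc, ?_, ?_⟩
        · rw [h1, smul_smul, inv_mul_cancel₀ hc, one_smul]
        · rw [h2, ← mul_assoc, ← mul_pow, inv_mul_cancel₀ hc, one_pow, one_mul]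
      trans := by
        rintro p q r ⟨c, hc, h1, h2⟩ ⟨d, hd, h3, h4⟩
        refine ⟨d * c, mul_ne_zero hd hc, ?_, ?_⟩
        · rw [h3, h1, smul_smul]
        · rw [h2, h4, mul_pow]; ring }

/-- The total space of `𝒪(-k) → ℙⁿ⁻¹`, the `k`-th power of the tautological line bundle: its points
are the elements `[v, w] = w · v^{⊗k}` of the lines `(ℂ v)^{⊗k}`. -/
def LineBundle (n k : ℕ) : Type := Quotient (bundleSetoid n k)

namespace LineBundle

variable {n k : ℕ}

instance : TopologicalSpace (LineBundle n k) :=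
  inferInstanceAs (TopologicalSpace (Quotient (bundleSetoid n k)))

/-- The point `[v, w] = w · v^{⊗k}`. -/
def mk (v : Cn n) (hv : v ≠ 0) (w : ℂ) : LineBundle n k :=
  Quotient.mk (bundleSetoid n k) ⟨(v, w), hv⟩

/-- The vector `a` with its `j`-th entry replaced by `1`. -/
def dehom (j : Fin n) (a : Cn n) : Cn n :=
  WithLp.toLp 2 (fun i => if i = j then 1 else a i)

lemma dehom_ne_zero (j : Fin n) (a : Cn n) : dehom j a ≠ 0 := by
  intro h
  have := congrArg (fun v : Cn n => v j) h
  simp [dehom] at this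

/-- The standard holomorphic coordinates on the open set `v_j ≠ 0`: the affine coordinates
`v_i / v_j` (`i ≠ j`) of the base point, and, in the `j`-th slot, the fibre coordinate `w v_j ^ k`. -/
def coord (j : Fin n) : LineBundle n k → Cn n :=
  Quotient.lift
    (fun p : {p : Cn n × ℂ // p.1 ≠ 0} => (WithLp.toLp 2
      (fun i => if i = j then p.1.2 * p.1.1 j ^ k else p.1.1 i / p.1.1 j) : Cn n))
    (by
      rintro p q ⟨c, hc, h1, h2⟩
      ext i
      have e1 : ∀ m, q.1.1 m = c * p.1.1 m := fun m => by rw [h1]; rfl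
      simp only [e1, h2]
      split_ifs
      · rw [mul_pow]; ring
      · rw [mul_div_mul_left _ _ hc])

/-- The inverse of `coord j`; its range is the open set `v_j ≠ 0`. -/
def param (j : Fin n) (a : Cn n) : LineBundle n k := mk (dehom j a) (dehom_ne_zero j a) (a j)

/-- The `j`-th homogeneous coordinate does not vanish. -/
def dom (j : Fin n) : Set (LineBundle n k) := Set.range (param j)

lemma coord_mk (j : Fin n) (v : Cn n) (hv : v ≠ 0) (w : ℂ) (i : Fin n) :
    coord j (mk v hv w : LineBundle n k) i = if i = j then w * v j ^ k else v i / v j := rfl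

lemma coord_param (j : Fin n) (a : Cn n) : coord j (param j a : LineBundle n k) = a := by
  ext i
  rw [param, coord_mk]
  by_cases h : i = j
  · subst h; simp [dehom]
  · simp [dehom, h]

lemma param_coord_mk (j : Fin n) (v : Cn n) (hv : v ≠ 0) (w : ℂ) (h : v j ≠ 0) :
    param j (coord j (mk v hv w : LineBundle n k)) = (mk v hv w : LineBundle n k) := by
  refine Quotient.sound ⟨v j, h, ?_, ?_⟩
  · ext i
    by_cases hi : i = j
    · subst hi; simp [dehom]
    · simp [dehom, hi, coord_mk, mul_div_cancel₀ _ h]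
  · simp [coord_mk, mul_comm]

lemma mk_mem_dom (j : Fin n) (v : Cn n) (hv : v ≠ 0) (w : ℂ) :
    (mk v hv w : LineBundle n k) ∈ dom j ↔ v j ≠ 0 := by
  constructor
  · rintro ⟨a, ha⟩
    obtain ⟨c, hc, h1, -⟩ := Quotient.exact ha
    have : v j = c * dehom j a j := by
      have := congrArg (fun x : Cn n => x j) h1
      simpa using this
    rw [this]
    simpa [dehom] using hc
  · intro h
    exact ⟨_, param_coord_mk j v hv w h⟩

lemma exists_mem_dom (x : LineBundle n k) : ∃ j, x ∈ dom j := by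
  induction x using Quotient.inductionOn with
  | h p =>
    obtain ⟨⟨v, w⟩, hv⟩ := p
    have : ∃ j, v j ≠ 0 := by
      by_contra! h
      exact hv (by ext i; simpa using h i)
    obtain ⟨j, hj⟩ := this
    exact ⟨j, (mk_mem_dom j v hv w).2 hj⟩

lemma continuous_dehom (j : Fin n) : Continuous (dehom (n := n) j) := by
  refine (PiLp.continuous_toLp 2 _).comp (continuous_pi fun i => ?_)
  split_ifs <;> fun_prop

lemma isOpen_dom (j : Fin n) : IsOpen (dom j : Set (LineBundle n k)) := by
  refine (isQuotientMap_quot_mk).isOpen_preimage.1 ?_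
  have : (Quot.mk (bundleSetoid n k) ⁻¹' (dom j : Set (LineBundle n k)))
      = {p : {p : Cn n × ℂ // p.1 ≠ 0} | p.1.1 j ≠ 0} := by
    ext ⟨⟨v, w⟩, hv⟩
    exact mk_mem_dom j v hv w
  rw [this]
  exact isOpen_ne_fun (by fun_prop) continuous_const

/-- The `j`-th standard chart, defined where `v_j ≠ 0`, with values all of `ℂⁿ`. -/
def chart (j : Fin n) : OpenPartialHomeomorph (LineBundle n k) (Cn n) where
  toFun := coord j
  invFun := param j
  source := dom j
  target := Set.univ
  map_source' _ _ := Set.mem_univ _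
  map_target' a _ := ⟨a, rfl⟩
  left_inv' := by rintro _ ⟨a, rfl⟩; rw [coord_param]
  right_inv' a _ := coord_param j a
  open_source := isOpen_dom j
  open_target := isOpen_univ
  continuousOn_toFun := by
    refine ((isQuotientMap_quot_mk (r := bundleSetoid n k)).continuousOn_isOpen_iff
      (isOpen_dom j)).2 ?_
    have hd : ∀ p ∈ (Quot.mk (bundleSetoid n k) ⁻¹' (dom j : Set (LineBundle n k))),
        p.1.1 j ≠ 0 := by
      rintro ⟨⟨v, w⟩, hv⟩ hp
      exact (mk_mem_dom j v hv w).1 hp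
    refine (PiLp.continuous_toLp 2 _).comp_continuousOn (continuousOn_pi.2 fun i => ?_)
    split_ifs
    · fun_prop
    · exact ContinuousOn.div (by fun_prop) (by fun_prop) hd
  continuousOn_invFun := by
    refine Continuous.continuousOn ?_
    refine continuous_quot_mk.comp (Continuous.subtype_mk ?_ _)
    exact (continuous_dehom j).prodMk (by fun_prop)

instance : ChartedSpace (Cn n) (LineBundle n k) where
  atlas := Set.range chart
  chartAt x := chart (exists_mem_dom x).choose
  mem_chart_source x := (exists_mem_dom x).choose_spec
  chart_mem_atlas _ := Set.mem_range_self _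

lemma contDiffOn_transition (i j : Fin n) :
    ContDiffOn ℂ ω (fun a : Cn n => coord j (param i a : LineBundle n k))
      {a | dehom i a j ≠ 0} := by
  have hde : ∀ m, ContDiff ℂ ω (fun a : Cn n => dehom i a m) := by
    intro m
    simp only [dehom]
    split_ifs <;> fun_prop
  refine contDiffOn_piLp (p := 2) |>.2 fun m => ?_
  simp only [param, coord_mk]
  split_ifs
  · exact (ContDiff.mul (by fun_prop) ((hde j).pow k)).contDiffOn
  · exact (hde m).contDiffOn.div (hde j).contDiffOn fun a ha => ha

/-- The standard charts make `𝒪(-k)` a complex manifold of dimension `n`. -/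
instance instIsManifoldComplex : IsManifold 𝓘(ℂ, Cn n) ω (LineBundle n k) := by
  refine isManifold_of_contDiffOn _ _ _ ?_
  rintro _ _ ⟨i, rfl⟩ ⟨j, rfl⟩
  refine (contDiffOn_transition (k := k) i j).mono ?_
  rintro a ⟨ha, -⟩
  exact (mk_mem_dom j _ _ _).1 ha.2

/-- `𝒪(-k)` as a smooth real manifold. -/
instance instIsManifoldReal : IsManifold 𝓘(ℝ, Cn n) ∞ (LineBundle n k) := by
  refine isManifold_of_contDiffOn _ _ _ ?_
  rintro _ _ ⟨i, rfl⟩ ⟨j, rfl⟩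
  refine (((contDiffOn_transition (k := k) i j).restrict_scalars ℝ).of_le le_top).mono ?_
  rintro a ⟨ha, -⟩
  exact (mk_mem_dom j _ _ _).1 ha.2

/-- The quotient map `ℂⁿ ∖ {0} → 𝒪(-k)`, `z ↦ z^{⊗k}`, which identifies `(ℂⁿ ∖ {0}) / ℤ_k` with the
complement of the zero section. The value at `0` (a point of the zero section) is irrelevant. -/
def ofVec [NeZero n] (z : Cn n) : LineBundle n k :=
  open Classical in
  if h : z ≠ 0 then mk z h 1 else param 0 0

/-- The action of `U(n)` on `𝒪(-k)`, `A · [v, w] = [A v, w]`. -/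
def act (A : Cn n ≃ₗᵢ[ℂ] Cn n) : LineBundle n k → LineBundle n k :=
  Quotient.map (sa := bundleSetoid n k) (sb := bundleSetoid n k)
    (fun p => ⟨(A p.1.1, p.1.2), fun h => p.2 (A.map_eq_zero_iff.1 h)⟩)
    (by
      rintro p q ⟨c, hc, h1, h2⟩
      exact ⟨c, hc, by simp [h1], h2⟩)

end LineBundle

open LineBundle

/-! ### Tensors on the total space -/

variable {n k : ℕ}

/-- The real tangent space of `𝒪(-k)` at `x`. -/
abbrev Tan (x : LineBundle n k) : Type := TangentSpace 𝓘(ℝ, Cn n) x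

/-- Covariant two-tensors. -/
abbrev TwoTensor (n k : ℕ) : Type := ∀ x : LineBundle n k, Tan x →L[ℝ] Tan x →L[ℝ] ℝ

/-- Fields of endomorphisms of the tangent spaces. -/
abbrev EndField (n k : ℕ) : Type := ∀ x : LineBundle n k, Tan x →L[ℝ] Tan x

/-- Smooth Riemannian metrics on the total space of `𝒪(-k)`. -/
abbrev RiemMetric (n k : ℕ) : Type :=
  Bundle.ContMDiffRiemannianMetric 𝓘(ℝ, Cn n) ∞ (Cn n) (fun x : LineBundle n k => Tan x)

/-- The pull-back `F^* T` of a two-tensor under a map `F` from a normed space. -/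
def pullback {V : Type*} [NormedAddCommGroup V] [NormedSpace ℝ V] (F : V → LineBundle n k)
    (T : TwoTensor n k) (y : V) : V →L[ℝ] V →L[ℝ] ℝ :=
  let D : V →L[ℝ] Cn n := mfderiv 𝓘(ℝ, V) 𝓘(ℝ, Cn n) F y
  let S : Cn n →L[ℝ] Cn n →L[ℝ] ℝ := T (F y)
  S.bilinearComp D D

/-- Multiplication by `i` on `ℂⁿ`, as a real linear map. -/
def mulI (n : ℕ) : Cn n →L[ℝ] Cn n := (Complex.I • ContinuousLinearMap.id ℂ (Cn n)).restrictScalars ℝ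

/-- The standard complex structure of `𝒪(-k)`. Each tangent space is identified with `ℂⁿ` by a
standard chart; as the coordinate changes are holomorphic, the choice of the chart is irrelevant. -/
def stdJ (x : LineBundle n k) : Tan x →L[ℝ] Tan x := mulI n

/-- The two-form `T` is closed: its exterior derivative vanishes in each of the standard charts. -/
def IsClosedForm (T : TwoTensor n k) : Prop :=
  ∀ (j : Fin n) (a x y z : Cn n),
    fderiv ℝ (pullback (param j) T) a x y z + fderiv ℝ (pullback (param j) T) a y z x
      + fderiv ℝ (pullback (param j) T) a z x y = 0

/-- `J` is a (smooth, integrable) complex structure: an almost complex structure which admits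
holomorphic coordinates, inducing the given smooth structure, near every point. -/
structure IsComplexStructure (J : EndField n k) : Prop where
  sq : ∀ x, (J x).comp (J x) = -ContinuousLinearMap.id ℝ (Tan x)
  integrable : ∀ p, ∃ (U : Set (LineBundle n k)) (ψ : LineBundle n k → Cn n), IsOpen U ∧ p ∈ U ∧
    ContMDiffOn 𝓘(ℝ, Cn n) 𝓘(ℝ, Cn n) ∞ ψ U ∧
    ∀ x ∈ U, Function.Bijective (mfderiv 𝓘(ℝ, Cn n) 𝓘(ℝ, Cn n) ψ x) ∧
      ∀ w : Tan x, mfderiv 𝓘(ℝ, Cn n) 𝓘(ℝ, Cn n) ψ x (J x w)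
        = mulI n (mfderiv 𝓘(ℝ, Cn n) 𝓘(ℝ, Cn n) ψ x w)

/-- The conformal metric `u² g`. -/
def conformal (g : RiemMetric n k) (u : LineBundle n k → ℝ) : TwoTensor n k :=
  fun x => (u x) ^ 2 • g.inner x

/-- The fundamental form `(v, w) ↦ h (J v, w)`. -/
def fundamentalForm (h : TwoTensor n k) (J : EndField n k) : TwoTensor n k :=
  fun x => (h x).comp (J x)

/-- The Riemannian distance of `g`. -/
def gdist (g : RiemMetric n k) (x y : LineBundle n k) : ENNReal :=
  letI : Bundle.RiemannianBundle (fun x : LineBundle n k => Tan x) := ⟨g.toRiemannianMetric⟩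
  Manifold.riemannianEDist 𝓘(ℝ, Cn n) x y

/-! ### `U(n)`-invariant Kähler ALE metrics -/

/-- The metric on `ℂⁿ ∖ {0}` whose Kähler form is `i ∂ ∂̄ φ(|z|²)`, so that in coordinates it is
`2 Re ∑ ∂²φ/∂z_i∂z̄_j dz_i dz̄_j`. In terms of the real Hessian `H` of `z ↦ φ(|z|²)` this is
`(H(v, w) + H(iv, iw)) / 2`. -/
def potentialMetric (φ : ℝ → ℝ) (z : Cn n) : Cn n →L[ℝ] Cn n →L[ℝ] ℝ :=
  let H : Cn n →L[ℝ] Cn n →L[ℝ] ℝ := fderiv ℝ (fderiv ℝ (fun y : Cn n => φ (‖y‖ ^ 2))) z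
  (1 / 2 : ℝ) • (H + H.bilinearComp (mulI n) (mulI n))

/-- Completeness: Cauchy sequences for the Riemannian distance converge. -/
def IsCompleteMetric (g : RiemMetric n k) : Prop :=
  ∀ s : ℕ → LineBundle n k,
    (∀ ε : ENNReal, 0 < ε → ∃ N, ∀ i ≥ N, ∀ j ≥ N, gdist g (s i) (s j) < ε) →
    ∃ x, Filter.Tendsto (fun i => gdist g x (s i)) Filter.atTop (𝓝 0)

/-- Real Euclidean space of dimension `2n`. -/
abbrev R2n (n : ℕ) : Type := EuclideanSpace ℝ (Fin (2 * n))

/-- `g` is asymptotically locally Euclidean of order `τ`: for a finite `Γ ⊂ SO(2n)` acting freely on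
`ℝ²ⁿ ∖ {0}` and a compact `K` there is a diffeomorphism `(ℝ²ⁿ ∖ B(0, R)) / Γ → X ∖ K` in which `g` is
Euclidean up to `O(r^{-τ})`, with corresponding decay of all derivatives. The diffeomorphism is given
by its composite `Ψ` with the quotient map, that is, by a local diffeomorphism from `ℝ²ⁿ ∖ B(0, R)`
onto `X ∖ K` whose fibres are exactly the `Γ`-orbits. -/
def IsALE (g : RiemMetric n k) (τ : ℝ) : Prop :=
  ∃ (Γ : Subgroup (R2n n ≃ₗᵢ[ℝ] R2n n)) (K : Set (LineBundle n k)) (R : ℝ)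
    (Ψ : R2n n → LineBundle n k),
    Finite Γ ∧ (∀ γ ∈ Γ, LinearMap.det (γ.toLinearEquiv : R2n n →ₗ[ℝ] R2n n) = 1) ∧
    (∀ γ ∈ Γ, γ ≠ 1 → ∀ y, y ≠ 0 → γ y ≠ y) ∧
    IsCompact K ∧ 0 < R ∧
    ContMDiffOn 𝓘(ℝ, R2n n) 𝓘(ℝ, Cn n) ∞ Ψ {y | R < ‖y‖} ∧
    (∀ y, R < ‖y‖ → Function.Bijective (mfderiv 𝓘(ℝ, R2n n) 𝓘(ℝ, Cn n) Ψ y)) ∧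
    Ψ '' {y | R < ‖y‖} = Kᶜ ∧
    (∀ y y', R < ‖y‖ → R < ‖y'‖ → (Ψ y = Ψ y' ↔ ∃ γ ∈ Γ, γ y = y')) ∧
    ∀ (i j : Fin (2 * n)) (m : ℕ), ∃ C R' : ℝ, R ≤ R' ∧ ∀ y : R2n n, R' < ‖y‖ →
      ‖iteratedFDeriv ℝ m (fun y' => pullback Ψ g.inner y' (EuclideanSpace.single i 1)
          (EuclideanSpace.single j 1) - if i = j then 1 else 0) y‖ ≤ C * ‖y‖ ^ (-τ - m)

/-- `g` is a `U(n)`-invariant Kähler ALE metric of order `τ` on the total space of `𝒪(-k)` arising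
from the Kähler potential `φ(𝐳)`, `𝐳 = |z|²`, on `ℂⁿ ∖ {0}`. -/
structure IsInvariantKahlerALE [NeZero n] (g : RiemMetric n k) (φ : ℝ → ℝ) (τ : ℝ) : Prop where
  smooth_potential : ContDiffOn ℝ ∞ φ (Set.Ioi 0)
  metric_eq : ∀ z : Cn n, z ≠ 0 → pullback ofVec g.inner z = potentialMetric φ z
  complete : IsCompleteMetric g
  ale : IsALE g τ

/-- The conformal factor `u²`, with `u` smooth, positive, `U(n)`-invariant and `u = O(r⁻²)`, `r` being
the distance from a base point, makes `u² g` Kähler for the `U(n)`-invariant complex structure `J`. -/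
structure IsInvariantKahlerFactor (g : RiemMetric n k) (u : LineBundle n k → ℝ) (J : EndField n k) :
    Prop where
  smooth : ContMDiff 𝓘(ℝ, Cn n) 𝓘(ℝ, ℝ) ∞ u
  pos : ∀ x, 0 < u x
  invariant : ∀ A x, u (act A x) = u x
  decay : ∀ p, ∃ C R : ℝ, ∀ x, ENNReal.ofReal R ≤ gdist g p x → u x ≤ C / (gdist g p x).toReal ^ 2
  complex : IsComplexStructure J
  complex_invariant : ∀ (A : Cn n ≃ₗᵢ[ℂ] Cn n) (x : LineBundle n k) (w : Tan x),
    mfderiv 𝓘(ℝ, Cn n) 𝓘(ℝ, Cn n) (act A) x (J x w)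
      = J (act A x) (mfderiv 𝓘(ℝ, Cn n) 𝓘(ℝ, Cn n) (act A) x w)
  hermitian : ∀ x (v w : Tan x), conformal g u x (J x v) (J x w) = conformal g u x v w
  closed : IsClosedForm (fundamentalForm (conformal g u) J)

/-! ### The weighted projective space -/

/-- The relation `(v, w) ∼ (c v, c ^ k w)`, `c ∈ ℂ^*`, on `ℂⁿ⁺¹ ∖ {0} = (ℂⁿ × ℂ) ∖ {0}`. -/
def weightedSetoid (n k : ℕ) : Setoid {p : Cn n × ℂ // p ≠ 0} where
  r p q := ∃ c : ℂ, c ≠ 0 ∧ q.1.1 = c • p.1.1 ∧ q.1.2 = c ^ k * p.1.2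
  iseqv :=
    { refl := fun p => ⟨1, one_ne_zero, by simp, by simp⟩
      symm := by
        rintro p q ⟨c, hc, h1, h2⟩
        refine ⟨c⁻¹, inv_ne_zero hc, ?_, ?_⟩
        · rw [h1, smul_smul, inv_mul_cancel₀ hc, one_smul]
        · rw [h2, ← mul_assoc, ← mul_pow, inv_mul_cancel₀ hc, one_pow, one_mul]
      trans := by
        rintro p q r ⟨c, hc, h1, h2⟩ ⟨d, hd, h3, h4⟩
        refine ⟨d * c, mul_ne_zero hd hc, ?_, ?_⟩
        · rw [h3, h1, smul_smul]
        · rw [h4, h2, mul_pow]; ring }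

/-- The weighted projective space `ℂℙⁿ_{(1, …, 1, k)}` (with `n` weights equal to `1`). -/
def WeightedProj (n k : ℕ) : Type := Quotient (weightedSetoid n k)

namespace WeightedProj

instance : TopologicalSpace (WeightedProj n k) :=
  inferInstanceAs (TopologicalSpace (Quotient (weightedSetoid n k)))

/-- The point `[v : w]`. -/
def mk (v : Cn n) (w : ℂ) (h : (v, w) ≠ 0) : WeightedProj n k :=
  Quotient.mk (weightedSetoid n k) ⟨(v, w), h⟩

/-- The point `[0 : 1]`. -/
def infty : WeightedProj n k := mk 0 1 (by simp)

/-- The action of `U(n)`, `A · [v : w] = [A v : w]`. -/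
def act (A : Cn n ≃ₗᵢ[ℂ] Cn n) : WeightedProj n k → WeightedProj n k :=
  Quotient.map (sa := weightedSetoid n k) (sb := weightedSetoid n k)
    (fun p => ⟨(A p.1.1, p.1.2), fun h => p.2 (by
      have h1 := congrArg Prod.fst h
      have h2 := congrArg Prod.snd h
      exact Prod.ext (A.map_eq_zero_iff.1 h1) h2)⟩)
    (by
      rintro p q ⟨c, hc, h1, h2⟩
      exact ⟨c, hc, by simp [h1], h2⟩)

/-- The open set `v_j ≠ 0`. -/
def dom (j : Fin n) : Set (WeightedProj n k) := {y | ∃ v w h, v j ≠ 0 ∧ y = mk v w h}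

/-- The holomorphic coordinates on the open set `v_j ≠ 0` of smooth points: `v_i / v_j` for `i ≠ j`,
and `w / v_j ^ k` in the `j`-th slot. -/
def coord (j : Fin n) : WeightedProj n k → Cn n :=
  Quotient.lift
    (fun p : {p : Cn n × ℂ // p ≠ 0} => (WithLp.toLp 2
      (fun i => if i = j then p.1.2 / p.1.1 j ^ k else p.1.1 i / p.1.1 j) : Cn n))
    (by
      rintro p q ⟨c, hc, h1, h2⟩
      ext i
      have e1 : ∀ m, q.1.1 m = c * p.1.1 m := fun m => by rw [h1]; rfl
      simp only [e1, h2]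
      split_ifs
      · rw [mul_pow, mul_div_mul_left _ _ (pow_ne_zero k hc)]
      · rw [mul_div_mul_left _ _ hc])

/-- The uniformizing orbifold chart `ξ ↦ [ξ : 1]` around the point `[0 : 1]`. -/
def orbChart (ξ : Cn n) : WeightedProj n k := mk ξ 1 (by simp)

/-- The orbifold chart is the quotient by the group `ℤ_k` of `k`-th roots of unity. -/
lemma orbChart_eq_iff (ξ ξ' : Cn n) :
    (orbChart ξ : WeightedProj n k) = orbChart ξ' ↔ ∃ c : ℂ, c ^ k = 1 ∧ c ≠ 0 ∧ ξ' = c • ξ := by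
  constructor
  · intro h
    obtain ⟨c, hc, h1, h2⟩ := Quotient.exact h
    exact ⟨c, by simpa using h2.symm, hc, h1⟩
  · rintro ⟨c, h1, hc, h2⟩
    exact Quotient.sound ⟨c, hc, h2, by simp [h1]⟩

end WeightedProj

/-- `e` identifies `(𝒪(-k), J)`, with the metric `u² g`, with the complement of the point `∞ = [0 : 1]`
in the compact complex orbifold `ℂℙⁿ_{(1, …, 1, k)}`, in such a way that `u² g` extends to an orbifold
metric. The fields say: the weighted projective space is a compactification by one point; `e` is
`U(n)`-equivariant; `e` is a biholomorphism onto the complement of `∞`; and, in the uniformizing chart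
`ξ ↦ [ξ : 1]` around `∞` (`s` being its restriction to `ξ ≠ 0`, seen in `𝒪(-k)`), `s` is holomorphic
and `u² g` extends to a continuous positive definite tensor `h` over `ξ = 0`, which is of class
`C^{1,α}` for some `α > 0` if the order `τ` of `g` exceeds `1`. -/
structure IsOrbifoldCompactification (g : RiemMetric n k) (τ : ℝ) (u : LineBundle n k → ℝ)
    (J : EndField n k) (e : LineBundle n k → WeightedProj n k) : Prop where
  compact : CompactSpace (WeightedProj n k)
  hausdorff : T2Space (WeightedProj n k)
  openEmbedding : Topology.IsOpenEmbedding e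
  range_eq : Set.range e = {WeightedProj.infty}ᶜ
  equivariant : ∀ A x, e (act A x) = WeightedProj.act A (e x)
  biholomorphic : ∀ (j : Fin n) (x : LineBundle n k), e x ∈ WeightedProj.dom j →
    ContMDiffAt 𝓘(ℝ, Cn n) 𝓘(ℝ, Cn n) ∞ (fun y => WeightedProj.coord j (e y)) x ∧
    Function.Bijective (mfderiv 𝓘(ℝ, Cn n) 𝓘(ℝ, Cn n) (fun y => WeightedProj.coord j (e y)) x) ∧
    ∀ w : Tan x, mfderiv 𝓘(ℝ, Cn n) 𝓘(ℝ, Cn n) (fun y => WeightedProj.coord j (e y)) x (J x w)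
      = mulI n (mfderiv 𝓘(ℝ, Cn n) 𝓘(ℝ, Cn n) (fun y => WeightedProj.coord j (e y)) x w)
  orbifold_point : ∃ (s : Cn n → LineBundle n k) (h : Cn n → Cn n →L[ℝ] Cn n →L[ℝ] ℝ),
    (∀ ξ, ξ ≠ 0 → e (s ξ) = WeightedProj.orbChart ξ) ∧
    ContMDiffOn 𝓘(ℝ, Cn n) 𝓘(ℝ, Cn n) ∞ s {0}ᶜ ∧
    (∀ ξ, ξ ≠ 0 → Function.Bijective (mfderiv 𝓘(ℝ, Cn n) 𝓘(ℝ, Cn n) s ξ) ∧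
      ∀ w : Cn n, mfderiv 𝓘(ℝ, Cn n) 𝓘(ℝ, Cn n) s ξ (mulI n w)
        = J (s ξ) (mfderiv 𝓘(ℝ, Cn n) 𝓘(ℝ, Cn n) s ξ w)) ∧
    (∀ ξ, ξ ≠ 0 → h ξ = pullback s (conformal g u) ξ) ∧
    Continuous h ∧ (∀ w, w ≠ 0 → 0 < h 0 w w) ∧
    (1 < τ → ContDiff ℝ 1 h ∧ ∃ α C δ : ℝ, 0 < α ∧ 0 < δ ∧
      ∀ ξ ∈ Metric.ball (0 : Cn n) δ, ∀ ξ' ∈ Metric.ball (0 : Cn n) δ, ∀ a b c : Cn n,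
        |fderiv ℝ h ξ a b c - fderiv ℝ h ξ' a b c| ≤ C * ‖ξ - ξ'‖ ^ α * (‖a‖ * ‖b‖ * ‖c‖))

end KahlerALE
end

/-!
Off the zero section the metric is, in the coordinate `z`, the radial Hermitian metric
`radialMetric p` with profile `p = φ'`. The function `𝐳 φ'(𝐳)` is positive: it is the squared length
of horizontal vectors, which makes it a smooth function `momentum` on the whole total space, and the
conformal factor `u` is its reciprocal.

**The second complex structure.** The map `compactify`, `w · v^{⊗k} ↦ [v : w̄ |v|^{2k}]`, identifies the
total space with the complement of `[0 : ⋯ : 0 : 1]` in the weighted projective space. Off the zero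
section it is `z ↦ [z / |z|² : 1]`, so that the complex structure `conjFiberJ` transported by it is the
standard one on horizontal vectors and its opposite on vertical ones. In the uniformizing chart
`inftyChart`, `ξ ↦ ξ / |ξ|²`, around the added point the metric `u² g` is again radial, now with
profile `q(ρ) = 1 / p(1 / ρ)` (`IsRadial.pullback_inftyChart`). The fundamental form of a radial metric
is closed (`extD_smul_radial`), hence `u² g` is Kähler for `conjFiberJ` off the zero section, and
everywhere by density.

**Asymptotics.** The asymptotic condition on `g` refers to unknown coordinates at infinity. It is used
through its invariant consequence that the curvature is `O(r^{-τ-2})` (`exists_curvature_decay`,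
`sectional_pullback`). The holomorphic sectional curvatures of a radial metric in horizontal and
vertical directions are explicit (`sectional_radial_horizontal`, `sectional_radial_vertical`); the
horizontal one bounds the gradient of `√momentum` along a ray of the end, and a Gronwall argument
shows that the moment map grows at most quadratically (`IsEnd.exists_momentum_le`). The curvature
bounds then become differential inequalities for the profile in the variable `log 𝐳` with a right-hand
side that decays in terms of the moment map itself (`IsEnd.asymptotics`), and a bootstrap gives
convergence at the full rate (`exists_asymptotics`): `q - c`, `ρ q'`, `ρ² q''` and `ρ³ q'''` are
`O(ρ^{τ/2})` with `c > 0` (`IsRadial.exists_invProfile_asymptotics`). Since `ρ = |ξ|²`, this is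
continuity at the orbifold point, and `C^{1,α}` when `τ > 1` (`extendedMetric_regularity`). It also
bounds the length of radial paths, so that the distance to a base point is at most a multiple of
`√momentum` (`IsRadial.exists_gdist_le`), which is the decay of `u`.

**Uniqueness.** An invariant complex structure orthogonal for `g` commutes at `z` with the unitary maps
fixing `z`, in particular with the reflections in complex lines through `z` and orthogonal to `z`;
hence it acts as `± i` on `ℂ z` and as `± i` on its complement, with signs that do not depend on `z`
(`IsInvariantKahlerFactor.exists_constant_signs`). So it is, up to sign, the standard structure or
`conjFiberJ`. For `n ≥ 2` the product of a closed fundamental form with a function is closed only if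
the function is constant (`fderiv_eq_zero_of_extD_smul_eq_zero`). In the second case this determines
the factor up to scale. In the first case the factor is constant, which contradicts its decay because
the distance is unbounded: `√momentum` is an unbounded Lipschitz function (`IsRadial.exists_le_gdist`).
-/

noncomputable section

set_option maxSynthPendingDepth 3

namespace KahlerALE

/-! ### Radial Hermitian metrics -/

section Radial

variable {V : Type*} [NormedAddCommGroup V] [InnerProductSpace ℝ V] {I : V →L[ℝ] V}

/-- The real part `Re (⟨v, z⟩ ⟨z, w⟩)` of the rank one Hermitian form attached to `z`. -/
def rankOne (I : V →L[ℝ] V) (z v w : V) : ℝ :=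
  inner ℝ z v * inner ℝ z w + inner ℝ z (I v) * inner ℝ z (I w)

/-- The polarization in `z` of `rankOne I z`, which is twice `rankOne I` on the diagonal. -/
def rankOneBil (I : V →L[ℝ] V) (z z' v w : V) : ℝ :=
  inner ℝ z v * inner ℝ z' w + inner ℝ z' v * inner ℝ z w
    + inner ℝ z (I v) * inner ℝ z' (I w) + inner ℝ z' (I v) * inner ℝ z (I w)

/-- `rankOne I z` as a continuous bilinear map. -/
def rankOneCLM (I : V →L[ℝ] V) (z : V) : V →L[ℝ] V →L[ℝ] ℝ :=
  (innerSL ℝ z).smulRight (innerSL ℝ z)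
    + ((innerSL ℝ z).comp I).smulRight ((innerSL ℝ z).comp I)

@[simp] lemma rankOneCLM_apply (z v w : V) : rankOneCLM I z v w = rankOne I z v w := by
  simp [rankOneCLM, rankOne]

/-- The Euclidean inner product as a real bilinear map. -/
def euclid (V : Type*) [NormedAddCommGroup V] [InnerProductSpace ℝ V] : V →L[ℝ] V →L[ℝ] ℝ := innerSL ℝ

@[simp] lemma euclid_apply (v w : V) : euclid V v w = inner ℝ v w := rfl

/-- The Hermitian metric `2 Re ∑ (p δ_ij + p' z̄_i z_j) dz_i dz̄_j` with `p = p(|z|²)`; it is the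
Kähler metric with potential `φ(|z|²)` when `p = φ'`. -/
def radialMetric (I : V →L[ℝ] V) (p : ℝ → ℝ) (z : V) : V →L[ℝ] V →L[ℝ] ℝ :=
  (2 * p (‖z‖ ^ 2)) • euclid V + (2 * deriv p (‖z‖ ^ 2)) • rankOneCLM I z

lemma radialMetric_apply (p : ℝ → ℝ) (z v w : V) :
    radialMetric I p z v w
      = 2 * p (‖z‖ ^ 2) * inner ℝ v w + 2 * deriv p (‖z‖ ^ 2) * rankOne I z v w := by
  simp [radialMetric]

lemma hasFDerivAt_comp_norm_sq {p : ℝ → ℝ} {p' : ℝ} {z : V} (h : HasDerivAt p p' (‖z‖ ^ 2)) :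
    HasFDerivAt (fun y : V => p (‖y‖ ^ 2)) ((2 * p') • innerSL ℝ z) z := by
  have h1 : HasFDerivAt (fun y : V => ‖y‖ ^ 2) (2 • innerSL ℝ z) z :=
    (hasStrictFDerivAt_norm_sq z).hasFDerivAt
  refine (h.comp_hasFDerivAt z h1).congr_fderiv ?_
  ext v
  simp
  ring

lemma hasFDerivAt_rankOne (I : V →L[ℝ] V) (z v w : V) :
    HasFDerivAt (fun y : V => rankOne I y v w)
      (inner ℝ z v • innerSL ℝ w + inner ℝ z w • innerSL ℝ v
        + inner ℝ z (I v) • innerSL ℝ (I w)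
        + inner ℝ z (I w) • innerSL ℝ (I v)) z := by
  have hi : ∀ c : V, HasFDerivAt (fun y : V => inner ℝ y c) (innerSL ℝ c) z := by
    intro c
    have : (fun y : V => inner ℝ y c) = innerSL ℝ c := by
      ext y; simp [real_inner_comm]
    rw [this]
    exact (innerSL ℝ c).hasFDerivAt
  unfold rankOne
  refine (((hi v).mul (hi w)).add ((hi _).mul (hi _))).congr_fderiv ?_
  ext e
  simp
  ring

lemma fderiv_rankOne_apply (I : V →L[ℝ] V) (z v w e : V) :
    fderiv ℝ (fun y : V => rankOne I y v w) z e = rankOneBil I z e v w := by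
  rw [(hasFDerivAt_rankOne I z v w).fderiv]
  simp [rankOneBil, real_inner_comm]
  ring

lemma contDiff_rankOneCLM : ContDiff ℝ ∞ ((rankOneCLM I) : V → V →L[ℝ] V →L[ℝ] ℝ) := by
  unfold rankOneCLM
  have h1 : ContDiff ℝ ∞ (fun z : V => innerSL ℝ z) := (euclid V).contDiff
  have h2 : ContDiff ℝ ∞ (fun z : V => (innerSL ℝ z).comp I) :=
    h1.clm_comp contDiff_const
  exact (h1.smulRight h1).add (h2.smulRight h2)

lemma contDiffAt_deriv {p : ℝ → ℝ} {r : ℝ} (hp : ContDiffAt ℝ ∞ p r) :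
    ContDiffAt ℝ ∞ (deriv p) r := by
  have h : ContDiffAt ℝ ∞ (fun x => fderiv ℝ p x 1) r :=
    (hp.fderiv_right (m := ∞) le_rfl).clm_apply contDiffAt_const
  simpa using h

lemma hasDerivAt_of_contDiffAt {p : ℝ → ℝ} {r : ℝ} (hp : ContDiffAt ℝ ∞ p r) :
    HasDerivAt p (deriv p r) r := (hp.differentiableAt (by simp)).hasDerivAt

lemma contDiffAt_radialMetric {p : ℝ → ℝ} {z : V} (hp : ContDiffAt ℝ ∞ p (‖z‖ ^ 2)) :
    ContDiffAt ℝ ∞ (radialMetric I p : V → V →L[ℝ] V →L[ℝ] ℝ) z := by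
  have hn : ContDiffAt ℝ ∞ (fun y : V => ‖y‖ ^ 2) z := (contDiff_norm_sq ℝ).contDiffAt
  have h1 : ContDiffAt ℝ ∞ (fun y : V => p (‖y‖ ^ 2)) z := hp.comp z hn
  have h2 : ContDiffAt ℝ ∞ (fun y : V => deriv p (‖y‖ ^ 2)) z :=
    ContDiffAt.comp (g := deriv p) z (contDiffAt_deriv hp) hn
  exact ContDiffAt.add ((contDiffAt_const.mul h1).smul contDiffAt_const)
    ((contDiffAt_const.mul h2).smul contDiff_rankOneCLM.contDiffAt)

/-- Differentiation commutes with evaluation of a field of bilinear maps. -/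
lemma fderiv_eval₂ {U V W F : Type*} [NormedAddCommGroup U] [NormedSpace ℝ U]
    [NormedAddCommGroup V] [NormedSpace ℝ V] [NormedAddCommGroup W] [NormedSpace ℝ W]
    [NormedAddCommGroup F] [NormedSpace ℝ F]
    {T : U → V →L[ℝ] W →L[ℝ] F} {y : U} (h : DifferentiableAt ℝ T y) (e : U) (v : V) (w : W) :
    fderiv ℝ (fun y' => T y' v w) y e = fderiv ℝ T y e v w := by
  have h1 := (h.hasFDerivAt.clm_apply (hasFDerivAt_const v y)).clm_apply (hasFDerivAt_const w y)
  rw [h1.fderiv]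
  simp

/-- Differentiation commutes with evaluation of a field of trilinear maps. -/
lemma fderiv_eval₃ {U V W X F : Type*} [NormedAddCommGroup U] [NormedSpace ℝ U]
    [NormedAddCommGroup V] [NormedSpace ℝ V] [NormedAddCommGroup W] [NormedSpace ℝ W]
    [NormedAddCommGroup X] [NormedSpace ℝ X] [NormedAddCommGroup F] [NormedSpace ℝ F]
    {T : U → V →L[ℝ] W →L[ℝ] X →L[ℝ] F} {y : U} (h : DifferentiableAt ℝ T y)
    (e : U) (v : V) (w : W) (x : X) :
    fderiv ℝ (fun y' => T y' v w x) y e = fderiv ℝ T y e v w x := by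
  have h1 : HasFDerivAt (fun y' => T y' v) ((fderiv ℝ T y).flip v) y := by
    refine (h.hasFDerivAt.clm_apply (hasFDerivAt_const v y)).congr_fderiv ?_
    ext1 e
    simp
  have h2 := fderiv_eval₂ h1.differentiableAt e w x
  rw [h1.fderiv] at h2
  simpa using h2

/-- The first derivatives of a radial metric. -/
lemma fderiv_radialMetric {p : ℝ → ℝ} {z : V} (hp : ContDiffAt ℝ ∞ p (‖z‖ ^ 2))
    (e v w : V) :
    fderiv ℝ (radialMetric I p) z e v w
      = 4 * deriv p (‖z‖ ^ 2) * inner ℝ z e * inner ℝ v w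
        + 4 * deriv (deriv p) (‖z‖ ^ 2) * inner ℝ z e * rankOne I z v w
        + 2 * deriv p (‖z‖ ^ 2) * rankOneBil I z e v w := by
  rw [← fderiv_eval₂ ((contDiffAt_radialMetric hp).differentiableAt (by simp))]
  simp only [radialMetric_apply]
  have h1 := hasFDerivAt_comp_norm_sq (hasDerivAt_of_contDiffAt hp)
  have h2 := hasFDerivAt_comp_norm_sq (hasDerivAt_of_contDiffAt (contDiffAt_deriv hp))
  have h3 := ((h1.const_mul 2).mul_const (inner ℝ v w)).add
    ((h2.const_mul 2).mul (hasFDerivAt_rankOne I z v w))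
  refine (congrArg (fun L : V →L[ℝ] ℝ => L _) (HasFDerivAt.fderiv h3)).trans ?_
  have h4 := fderiv_rankOne_apply I z v w e
  rw [(hasFDerivAt_rankOne I z v w).fderiv] at h4
  simp only [add_apply, smul_apply, smul_eq_mul] at h4 ⊢
  rw [h4]
  simp only [innerSL_apply_apply]
  ring

lemma hasFDerivAt_rankOneBil (I : V →L[ℝ] V) (z e v w : V) :
    HasFDerivAt (fun y : V => rankOneBil I y e v w)
      ((inner ℝ e w) • innerSL ℝ v + (inner ℝ e v) • innerSL ℝ w
        + (inner ℝ e (I w)) • innerSL ℝ (I v)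
        + (inner ℝ e (I v)) • innerSL ℝ (I w)) z := by
  have : (fun y : V => rankOneBil I y e v w) =
      ((inner ℝ e w) • innerSL ℝ v + (inner ℝ e v) • innerSL ℝ w
        + (inner ℝ e (I w)) • innerSL ℝ (I v)
        + (inner ℝ e (I v)) • innerSL ℝ (I w) : V →L[ℝ] ℝ) := by
    ext y
    simp [rankOneBil, real_inner_comm]
    ring
  rw [this]
  exact ContinuousLinearMap.hasFDerivAt _

/-- The second derivatives of a radial metric. -/
lemma fderiv_fderiv_radialMetric {p : ℝ → ℝ} {z : V} (hev : ∀ᶠ r in 𝓝 (‖z‖ ^ 2), ContDiffAt ℝ ∞ p r)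
    (f e v w : V) :
    fderiv ℝ (fderiv ℝ (radialMetric I p)) z f e v w
      = 8 * deriv (deriv p) (‖z‖ ^ 2) * inner ℝ z f * inner ℝ z e * inner ℝ v w
        + 4 * deriv p (‖z‖ ^ 2) * inner ℝ f e * inner ℝ v w
        + 8 * deriv (deriv (deriv p)) (‖z‖ ^ 2) * inner ℝ z f * inner ℝ z e * rankOne I z v w
        + 4 * deriv (deriv p) (‖z‖ ^ 2) * inner ℝ f e * rankOne I z v w
        + 4 * deriv (deriv p) (‖z‖ ^ 2) * inner ℝ z e * rankOneBil I z f v w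
        + 4 * deriv (deriv p) (‖z‖ ^ 2) * inner ℝ z f * rankOneBil I z e v w
        + 2 * deriv p (‖z‖ ^ 2) * rankOneBil I f e v w := by
  have hp : ContDiffAt ℝ ∞ p (‖z‖ ^ 2) := hev.self_of_nhds
  have hG := contDiffAt_radialMetric (I := I) hp
  rw [← fderiv_eval₃ ((hG.fderiv_right (m := ∞) le_rfl).differentiableAt (by simp))]
  replace hev : ∀ᶠ y in 𝓝 z, ContDiffAt ℝ ∞ p (‖y‖ ^ 2) := by
    have hc : ContinuousAt (fun y : V => ‖y‖ ^ 2) z := by fun_prop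
    exact hc.eventually hev
  have hev' : (fun y => fderiv ℝ (radialMetric I p) y e v w) =ᶠ[𝓝 z] fun y =>
      4 * deriv p (‖y‖ ^ 2) * inner ℝ y e * inner ℝ v w
        + 4 * deriv (deriv p) (‖y‖ ^ 2) * inner ℝ y e * rankOne I y v w
        + 2 * deriv p (‖y‖ ^ 2) * rankOneBil I y e v w :=
    hev.mono fun y hy => fderiv_radialMetric hy e v w
  rw [hev'.fderiv_eq]
  have hp1 := contDiffAt_deriv hp
  have h1 := hasFDerivAt_comp_norm_sq (hasDerivAt_of_contDiffAt hp1)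
  have h2 := hasFDerivAt_comp_norm_sq (hasDerivAt_of_contDiffAt (contDiffAt_deriv hp1))
  have hi : HasFDerivAt (fun y : V => inner ℝ y e) (innerSL ℝ e) z := by
    have : (fun y : V => inner ℝ y e) = innerSL ℝ e := by
      ext y; simp [real_inner_comm]
    rw [this]
    exact (innerSL ℝ e).hasFDerivAt
  have h3 := ((((h1.const_mul 4).mul hi).mul_const (inner ℝ v w)).add
    (((h2.const_mul 4).mul hi).mul (hasFDerivAt_rankOne I z v w))).add
    ((h1.const_mul 2).mul (hasFDerivAt_rankOneBil I z e v w))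
  refine (congrArg (fun L : V →L[ℝ] ℝ => L _) (HasFDerivAt.fderiv h3)).trans ?_
  have h4 := fderiv_rankOne_apply I z v w f
  rw [(hasFDerivAt_rankOne I z v w).fderiv] at h4
  simp only [add_apply, smul_apply, smul_eq_mul] at h4 ⊢
  rw [h4]
  simp only [innerSL_apply_apply, rankOneBil, real_inner_comm, Pi.mul_apply]
  ring

end Radial

/-! ### Sectional curvature of a metric on an open subset of a vector space -/

section Curvature

variable {V W : Type*} [NormedAddCommGroup V] [NormedSpace ℝ V] [NormedAddCommGroup W]
  [NormedSpace ℝ W]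

/-- The Christoffel symbol of the first kind `⟨∇_a b, c⟩` of the metric `G` at `p`. -/
def christoffelForm (G : V → V →L[ℝ] V →L[ℝ] ℝ) (p a b c : V) : ℝ :=
  (fderiv ℝ G p a b c + fderiv ℝ G p b a c - fderiv ℝ G p c a b) / 2

/-- The vector `u` is the covariant derivative `∇_a b` at `p` of the constant field `b`. -/
def IsChristoffel (G : V → V →L[ℝ] V →L[ℝ] ℝ) (p a b u : V) : Prop :=
  ∀ c, G p u c = christoffelForm G p a b c

/-- The unnormalized sectional curvature `⟨R(a, b) b, a⟩` of `G` at `p`, where `u`, `v`, `w` stand for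
`∇_a a`, `∇_a b`, `∇_b b`. -/
def sectional (G : V → V →L[ℝ] V →L[ℝ] ℝ) (p a b u v w : V) : ℝ :=
  fderiv ℝ (fderiv ℝ G) p a b a b - fderiv ℝ (fderiv ℝ G) p a a b b / 2
    - fderiv ℝ (fderiv ℝ G) p b b a a / 2 - G p u w + G p v v

/-- The first derivatives of a pulled back metric. -/
lemma fderiv_bilinearComp {G : W → W →L[ℝ] W →L[ℝ] ℝ} {F : V → W} {G' : V → V →L[ℝ] V →L[ℝ] ℝ}
    {y : V} (hG : ContDiffAt ℝ ∞ G (F y)) (hF : ContDiffAt ℝ ∞ F y)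
    (hG' : G' =ᶠ[𝓝 y] fun y' => (G (F y')).bilinearComp (fderiv ℝ F y') (fderiv ℝ F y'))
    (e c d : V) :
    fderiv ℝ G' y e c d
      = fderiv ℝ G (F y) (fderiv ℝ F y e) (fderiv ℝ F y c) (fderiv ℝ F y d)
        + G (F y) (fderiv ℝ (fderiv ℝ F) y e c) (fderiv ℝ F y d)
        + G (F y) (fderiv ℝ F y c) (fderiv ℝ (fderiv ℝ F) y e d) := by
  have hF1 : ContDiffAt ℝ ∞ (fderiv ℝ F) y := hF.fderiv_right (m := ∞) le_rfl
  have hGF : ContDiffAt ℝ ∞ (fun y' => G (F y')) y := hG.comp y hF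
  have hsm : ContDiffAt ℝ ∞
      (fun y' => (G (F y')).bilinearComp (fderiv ℝ F y') (fderiv ℝ F y')) y := by
    have h1 : ContDiffAt ℝ ∞ (fun y' => ((G (F y')).comp (fderiv ℝ F y')).flip) y :=
      (ContinuousLinearMap.flipₗᵢ ℝ V W ℝ).contDiff.contDiffAt.comp y (hGF.clm_comp hF1)
    exact (ContinuousLinearMap.flipₗᵢ ℝ V V ℝ).contDiff.contDiffAt.comp y (h1.clm_comp hF1)
  rw [hG'.fderiv_eq, ← fderiv_eval₂ (hsm.differentiableAt (by simp))]
  have d0 : HasFDerivAt F (fderiv ℝ F y) y := (hF.differentiableAt (by simp)).hasFDerivAt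
  have d1 := (hF1.differentiableAt (by simp)).hasFDerivAt
  have dG := ((hG.differentiableAt (by simp)).hasFDerivAt).comp y d0
  have h := (dG.clm_apply (d1.clm_apply (hasFDerivAt_const c y))).clm_apply
    (d1.clm_apply (hasFDerivAt_const d y))
  refine (congrArg (fun L : V →L[ℝ] ℝ => L _) (HasFDerivAt.fderiv h)).trans ?_
  simp
  ring

lemma contDiffAt_bilinearComp {G : W → W →L[ℝ] W →L[ℝ] ℝ} {F : V → W} {A : V → V →L[ℝ] W}
    {y : V} (hG : ContDiffAt ℝ ∞ G (F y)) (hF : ContDiffAt ℝ ∞ F y) (hA : ContDiffAt ℝ ∞ A y) :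
    ContDiffAt ℝ ∞ (fun y' => (G (F y')).bilinearComp (A y') (A y')) y := by
  have hGF : ContDiffAt ℝ ∞ (fun y' => G (F y')) y := hG.comp y hF
  have h1 : ContDiffAt ℝ ∞ (fun y' => ((G (F y')).comp (A y')).flip) y :=
    (ContinuousLinearMap.flipₗᵢ ℝ V W ℝ).contDiff.contDiffAt.comp y (hGF.clm_comp hA)
  exact (ContinuousLinearMap.flipₗᵢ ℝ V V ℝ).contDiff.contDiffAt.comp y (h1.clm_comp hA)

/-- The second derivatives of a pulled back metric. -/
lemma fderiv_fderiv_bilinearComp {G : W → W →L[ℝ] W →L[ℝ] ℝ} {F : V → W}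
    {G' : V → V →L[ℝ] V →L[ℝ] ℝ}
    {y : V} (hGev : ∀ᶠ q in 𝓝 (F y), ContDiffAt ℝ ∞ G q)
    (hFev : ∀ᶠ y in 𝓝 y, ContDiffAt ℝ ∞ F y)
    (hG' : G' =ᶠ[𝓝 y] fun y' => (G (F y')).bilinearComp (fderiv ℝ F y') (fderiv ℝ F y'))
    (f e c d : V) :
    fderiv ℝ (fderiv ℝ G') y f e c d
      = fderiv ℝ (fderiv ℝ G) (F y) (fderiv ℝ F y f) (fderiv ℝ F y e) (fderiv ℝ F y c)
            (fderiv ℝ F y d)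
        + fderiv ℝ G (F y) (fderiv ℝ (fderiv ℝ F) y f e) (fderiv ℝ F y c) (fderiv ℝ F y d)
        + fderiv ℝ G (F y) (fderiv ℝ F y e) (fderiv ℝ (fderiv ℝ F) y f c) (fderiv ℝ F y d)
        + fderiv ℝ G (F y) (fderiv ℝ F y e) (fderiv ℝ F y c) (fderiv ℝ (fderiv ℝ F) y f d)
        + fderiv ℝ G (F y) (fderiv ℝ F y f) (fderiv ℝ (fderiv ℝ F) y e c) (fderiv ℝ F y d)
        + G (F y) (fderiv ℝ (fderiv ℝ (fderiv ℝ F)) y f e c) (fderiv ℝ F y d)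
        + G (F y) (fderiv ℝ (fderiv ℝ F) y e c) (fderiv ℝ (fderiv ℝ F) y f d)
        + fderiv ℝ G (F y) (fderiv ℝ F y f) (fderiv ℝ F y c) (fderiv ℝ (fderiv ℝ F) y e d)
        + G (F y) (fderiv ℝ (fderiv ℝ F) y f c) (fderiv ℝ (fderiv ℝ F) y e d)
        + G (F y) (fderiv ℝ F y c) (fderiv ℝ (fderiv ℝ (fderiv ℝ F)) y f e d) := by
  have hG := hGev.self_of_nhds
  have hF := hFev.self_of_nhds
  have hF1 : ContDiffAt ℝ ∞ (fderiv ℝ F) y := hF.fderiv_right (m := ∞) le_rfl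
  have hF2 : ContDiffAt ℝ ∞ (fderiv ℝ (fderiv ℝ F)) y := hF1.fderiv_right (m := ∞) le_rfl
  have hG1 : ContDiffAt ℝ ∞ (fderiv ℝ G) (F y) := hG.fderiv_right (m := ∞) le_rfl
  have hsm : ContDiffAt ℝ ∞ G' y := (contDiffAt_bilinearComp hG hF hF1).congr_of_eventuallyEq hG'
  have hsm1 : ContDiffAt ℝ ∞ (fderiv ℝ G') y := hsm.fderiv_right (m := ∞) le_rfl
  rw [← fderiv_eval₃ (hsm1.differentiableAt (by simp))]
  have hev : (fun y' => fderiv ℝ G' y' e c d) =ᶠ[𝓝 y] fun y' =>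
      fderiv ℝ G (F y') (fderiv ℝ F y' e) (fderiv ℝ F y' c) (fderiv ℝ F y' d)
        + G (F y') (fderiv ℝ (fderiv ℝ F) y' e c) (fderiv ℝ F y' d)
        + G (F y') (fderiv ℝ F y' c) (fderiv ℝ (fderiv ℝ F) y' e d) := by
    filter_upwards [hG'.eventuallyEq_nhds, hFev,
      hF.continuousAt.eventually hGev] with y' h1 h2 h3
    exact fderiv_bilinearComp h3 h2 h1 e c d
  rw [hev.fderiv_eq]
  have d0 : HasFDerivAt F (fderiv ℝ F y) y := (hF.differentiableAt (by simp)).hasFDerivAt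
  have d1 := (hF1.differentiableAt (by simp)).hasFDerivAt
  have d2 := (hF2.differentiableAt (by simp)).hasFDerivAt
  have dG := ((hG.differentiableAt (by simp)).hasFDerivAt).comp y d0
  have dG1 := ((hG1.differentiableAt (by simp)).hasFDerivAt).comp y d0
  have k : ∀ x : V, HasFDerivAt (fun y' => fderiv ℝ F y' x) _ y :=
    fun x => d1.clm_apply (hasFDerivAt_const x y)
  have k2 : ∀ x x' : V, HasFDerivAt (fun y' => fderiv ℝ (fderiv ℝ F) y' x x') _ y :=
    fun x x' => (d2.clm_apply (hasFDerivAt_const x y)).clm_apply (hasFDerivAt_const x' y)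
  have h := ((((dG1.clm_apply (k e)).clm_apply (k c)).clm_apply (k d)).add
    ((dG.clm_apply (k2 e c)).clm_apply (k d))).add ((dG.clm_apply (k c)).clm_apply (k2 e d))
  refine (congrArg (fun L : V →L[ℝ] ℝ => L _) (HasFDerivAt.fderiv h)).trans ?_
  simp
  ring

lemma fderiv_fderiv_symm {F : V → W} {y : V} (hF : ContDiffAt ℝ ∞ F y) (e f : V) :
    fderiv ℝ (fderiv ℝ F) y e f = fderiv ℝ (fderiv ℝ F) y f e :=
  (hF.isSymmSndFDerivAt (by
    rw [minSmoothness_of_isRCLikeNormedField]; exact WithTop.coe_le_coe.2 (le_top : (2 : ℕ∞) ≤ ⊤))) e f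

/-- The covariant derivative of constant fields transforms like a connection. -/
lemma fderiv_christoffel {G : W → W →L[ℝ] W →L[ℝ] ℝ} {F : V → W} {G' : V → V →L[ℝ] V →L[ℝ] ℝ}
    {y : V} (hG : ContDiffAt ℝ ∞ G (F y)) (hF : ContDiffAt ℝ ∞ F y)
    (hG' : G' =ᶠ[𝓝 y] fun y' => (G (F y')).bilinearComp (fderiv ℝ F y') (fderiv ℝ F y'))
    (hsymm : ∀ a b, G (F y) a b = G (F y) b a)
    (hnd : ∀ u, (∀ c, G (F y) u c = 0) → u = 0) (hsurj : Function.Surjective (fderiv ℝ F y))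
    {a b u' : V} {u : W} (hu' : IsChristoffel G' y a b u')
    (hu : IsChristoffel G (F y) (fderiv ℝ F y a) (fderiv ℝ F y b) u) :
    fderiv ℝ F y u' = fderiv ℝ (fderiv ℝ F) y a b + u := by
  rw [← sub_eq_zero]
  refine hnd _ fun c => ?_
  obtain ⟨c, rfl⟩ := hsurj c
  have h1 := hu' c
  have h2 := hu (fderiv ℝ F y c)
  have hs : ∀ e f, fderiv ℝ (fderiv ℝ F) y e f = fderiv ℝ (fderiv ℝ F) y f e := fun e f =>
    fderiv_fderiv_symm hF e f
  rw [hG'.self_of_nhds] at h1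
  simp only [christoffelForm, fderiv_bilinearComp hG hF hG'] at h1 h2
  simp only [ContinuousLinearMap.bilinearComp_apply] at h1
  simp only [map_sub, map_add, sub_apply, add_apply]
  rw [hs b a, hs c a, hs c b, hsymm _ (fderiv ℝ (fderiv ℝ F) y a c),
    hsymm (fderiv ℝ (fderiv ℝ F) y a c)] at h1
  rw [hsymm (fderiv ℝ F y a)] at h1
  linarith

set_option maxHeartbeats 1000000 in
/-- **Naturality of the curvature**: the sectional curvature is invariant under isometries. -/
lemma sectional_pullback {G : W → W →L[ℝ] W →L[ℝ] ℝ} {F : V → W}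
    {G' : V → V →L[ℝ] V →L[ℝ] ℝ} {y : V} (hGev : ∀ᶠ q in 𝓝 (F y), ContDiffAt ℝ ∞ G q)
    (hFev : ∀ᶠ y in 𝓝 y, ContDiffAt ℝ ∞ F y)
    (hG' : G' =ᶠ[𝓝 y] fun y' => (G (F y')).bilinearComp (fderiv ℝ F y') (fderiv ℝ F y'))
    (hsymm : ∀ q a b, G q a b = G q b a)
    (hnd : ∀ u, (∀ c, G (F y) u c = 0) → u = 0) (hsurj : Function.Surjective (fderiv ℝ F y))
    {a b u' v' w' : V} {u v w : W} (hu' : IsChristoffel G' y a a u')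
    (hv' : IsChristoffel G' y a b v') (hw' : IsChristoffel G' y b b w')
    (hu : IsChristoffel G (F y) (fderiv ℝ F y a) (fderiv ℝ F y a) u)
    (hv : IsChristoffel G (F y) (fderiv ℝ F y a) (fderiv ℝ F y b) v)
    (hw : IsChristoffel G (F y) (fderiv ℝ F y b) (fderiv ℝ F y b) w) :
    sectional G' y a b u' v' w'
      = sectional G (F y) (fderiv ℝ F y a) (fderiv ℝ F y b) u v w := by
  have hG := hGev.self_of_nhds
  have hF := hFev.self_of_nhds
  have hF1 : ContDiffAt ℝ ∞ (fderiv ℝ F) y := hF.fderiv_right (m := ∞) le_rfl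
  have hs : ∀ e f, fderiv ℝ (fderiv ℝ F) y e f = fderiv ℝ (fderiv ℝ F) y f e := fun e f =>
    fderiv_fderiv_symm hF e f
  have hs3 : ∀ e f x, fderiv ℝ (fderiv ℝ (fderiv ℝ F)) y e f x
      = fderiv ℝ (fderiv ℝ (fderiv ℝ F)) y f e x := fun e f x => by
    exact congrArg (fun L : V →L[ℝ] W => L x) (fderiv_fderiv_symm hF1 e f)
  have hs3' : ∀ e f x, fderiv ℝ (fderiv ℝ (fderiv ℝ F)) y e f x
      = fderiv ℝ (fderiv ℝ (fderiv ℝ F)) y e x f := fun e f x => by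
    have hd := (hF1.fderiv_right (m := ∞) le_rfl).differentiableAt (by simp)
    rw [← fderiv_eval₂ hd, ← fderiv_eval₂ hd]
    refine congrArg (fun L : V →L[ℝ] W => L e) (Filter.EventuallyEq.fderiv_eq ?_)
    filter_upwards [hFev] with y' hy'
    exact fderiv_fderiv_symm hy' f x
  have hds : ∀ e a b, fderiv ℝ G (F y) e a b = fderiv ℝ G (F y) e b a := fun e a b => by
    have hd := hG.differentiableAt (by simp)
    rw [← fderiv_eval₂ hd, ← fderiv_eval₂ hd]
    simp only [hsymm _ a b]
  have hu0 := fderiv_christoffel hG hF hG' (hsymm _) hnd hsurj hu' hu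
  have hv0 := fderiv_christoffel hG hF hG' (hsymm _) hnd hsurj hv' hv
  have hw0 := fderiv_christoffel hG hF hG' (hsymm _) hnd hsurj hw' hw
  have k1 := hu (fderiv ℝ (fderiv ℝ F) y b b)
  have k2 := hv (fderiv ℝ (fderiv ℝ F) y a b)
  have k3 := hw (fderiv ℝ (fderiv ℝ F) y a a)
  simp only [christoffelForm] at k1 k2 k3
  rw [sectional, sectional, fderiv_fderiv_bilinearComp hGev hFev hG',
    fderiv_fderiv_bilinearComp hGev hFev hG', fderiv_fderiv_bilinearComp hGev hFev hG',
    hG'.self_of_nhds]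
  simp only [ContinuousLinearMap.bilinearComp_apply, hu0, hv0, hw0, map_add, add_apply]
  generalize fderiv ℝ F y a = A at *
  generalize fderiv ℝ F y b = B at *
  rw [hs b a]
  rw [hs3' a a b]
  rw [hs3' b b a, hs3 b a b]
  generalize fderiv ℝ (fderiv ℝ F) y a a = Qaa at *
  generalize fderiv ℝ (fderiv ℝ F) y a b = Qab at *
  generalize fderiv ℝ (fderiv ℝ F) y b b = Qbb at *
  generalize fderiv ℝ (fderiv ℝ (fderiv ℝ F)) y a b b = Tabb at *
  generalize fderiv ℝ (fderiv ℝ (fderiv ℝ F)) y a b a = Taab at *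
  linarith [hsymm (F y) A Tabb, hsymm (F y) B Taab, hsymm (F y) Qaa w, hsymm (F y) Qab v,
    hds B Qaa B, hds B A Qab, hds A Qab B, hds Qab A B]

end Curvature

/-! ### Closed two-forms -/

section Closed

variable {V W : Type*} [NormedAddCommGroup V] [NormedSpace ℝ V] [NormedAddCommGroup W]
  [NormedSpace ℝ W]

/-- The exterior derivative of the two-form `T`, evaluated at `p` on three constant fields. -/
def extD (T : V → V →L[ℝ] V →L[ℝ] ℝ) (p a b c : V) : ℝ :=
  fderiv ℝ T p a b c + fderiv ℝ T p b c a + fderiv ℝ T p c a b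

/-- The exterior derivative commutes with pull-backs. -/
lemma extD_pullback {T : W → W →L[ℝ] W →L[ℝ] ℝ} {F : V → W} {T' : V → V →L[ℝ] V →L[ℝ] ℝ}
    {y : V} (hT : ContDiffAt ℝ ∞ T (F y)) (hF : ContDiffAt ℝ ∞ F y)
    (hT' : T' =ᶠ[𝓝 y] fun y' => (T (F y')).bilinearComp (fderiv ℝ F y') (fderiv ℝ F y'))
    (hasymm : ∀ a b, T (F y) a b = -T (F y) b a) (a b c : V) :
    extD T' y a b c = extD T (F y) (fderiv ℝ F y a) (fderiv ℝ F y b) (fderiv ℝ F y c) := by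
  simp only [extD, fderiv_bilinearComp hT hF hT']
  rw [fderiv_fderiv_symm hF b a, fderiv_fderiv_symm hF c a, fderiv_fderiv_symm hF c b]
  linarith [hasymm (fderiv ℝ F y b) (fderiv ℝ (fderiv ℝ F) y a c),
    hasymm (fderiv ℝ F y c) (fderiv ℝ (fderiv ℝ F) y a b),
    hasymm (fderiv ℝ F y a) (fderiv ℝ (fderiv ℝ F) y b c)]

end Closed

/-! ### Fundamental forms and sectional curvatures of radial metrics -/

section RadialForms

variable {V : Type*} [NormedAddCommGroup V] [InnerProductSpace ℝ V] {I : V →L[ℝ] V}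

lemma rankOne_symm (z v w : V) : rankOne I z v w = rankOne I z w v := by
  simp only [rankOne]; ring

lemma radialMetric_symm (p : ℝ → ℝ) (z v w : V) :
    radialMetric I p z v w = radialMetric I p z w v := by
  rw [radialMetric_apply, radialMetric_apply, rankOne_symm, real_inner_comm]

variable (hI2 : ∀ v, I (I v) = -v) (hIs : ∀ v w, inner ℝ (I v) w = -inner ℝ v (I w))
include hI2 hIs

omit hI2 in
lemma inner_self_apply_eq_zero (v : V) : inner ℝ v (I v) = 0 := by
  have h := hIs v v
  rw [real_inner_comm] at h
  linarith

lemma radialMetric_hermitian (p : ℝ → ℝ) (z v w : V) :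
    radialMetric I p z (I v) w = -radialMetric I p z v (I w) := by
  simp only [radialMetric_apply, rankOne, hI2, hIs, inner_neg_right]
  ring

/-- Multiples `m(|z|²) ω` of the fundamental form of a radial metric. -/
lemma extD_smul_radial {p : ℝ → ℝ} {z : V} (hp : ContDiffAt ℝ ∞ p (‖z‖ ^ 2)) {m : ℝ → ℝ}
    (hm : DifferentiableAt ℝ m (‖z‖ ^ 2)) (a b c : V) :
    extD (fun y => m (‖y‖ ^ 2) • (radialMetric I p y).comp I) z a b c
      = 2 * deriv m (‖z‖ ^ 2) * (inner ℝ z a * radialMetric I p z (I b) c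
          + inner ℝ z b * radialMetric I p z (I c) a
          + inner ℝ z c * radialMetric I p z (I a) b) := by
  have hG := ((contDiffAt_radialMetric (I := I) hp).differentiableAt (by simp))
  have hmd := hasFDerivAt_comp_norm_sq hm.hasDerivAt
  have key : ∀ e v w, fderiv ℝ (fun y => m (‖y‖ ^ 2) • (radialMetric I p y).comp I) z e v w
      = 2 * deriv m (‖z‖ ^ 2) * inner ℝ z e * radialMetric I p z (I v) w
        + m (‖z‖ ^ 2) * fderiv ℝ (radialMetric I p) z e (I v) w := by
    intro e v w
    have h := hmd.smul (hG.hasFDerivAt.clm_comp (hasFDerivAt_const I z))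
    have h' := congrArg (fun L : V →L[ℝ] V →L[ℝ] V →L[ℝ] ℝ => L e v w) (HasFDerivAt.fderiv h)
    refine h'.trans ?_
    simp
    ring
  simp only [extD, key, fderiv_radialMetric hp, rankOne, rankOneBil, hI2, inner_neg_right]
  have e1 : inner ℝ (I a) b = -inner ℝ a (I b) := hIs a b
  have e2 : inner ℝ (I b) c = -inner ℝ b (I c) := hIs b c
  have e3 : inner ℝ (I c) a = -inner ℝ c (I a) := hIs c a
  have f1 : inner ℝ b (I a) = -inner ℝ a (I b) := by rw [real_inner_comm]; exact hIs a b
  have f2 : inner ℝ c (I b) = -inner ℝ b (I c) := by rw [real_inner_comm]; exact hIs b c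
  have f3 : inner ℝ a (I c) = -inner ℝ c (I a) := by rw [real_inner_comm]; exact hIs c a
  rw [e1, e2, e3, f1, f2, f3, real_inner_comm a b, real_inner_comm b c, real_inner_comm c a]
  ring

/-- The sectional curvature of a radial metric along a complex line orthogonal to `z`. -/
lemma sectional_radial_horizontal {p : ℝ → ℝ} {z w : V}
    (hp : ∀ᶠ r in 𝓝 (‖z‖ ^ 2), ContDiffAt ℝ ∞ p r)
    (h1 : inner ℝ z w = 0) (h2 : inner ℝ z (I w) = 0) :
    IsChristoffel (radialMetric I p) z w w 0 ∧ IsChristoffel (radialMetric I p) z w (I w) 0 ∧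
    IsChristoffel (radialMetric I p) z (I w) (I w) 0 ∧
    sectional (radialMetric I p) z w (I w) 0 0 0 = -8 * deriv p (‖z‖ ^ 2) * ‖w‖ ^ 4 := by
  have h3 := inner_self_apply_eq_zero hIs w
  have h3' : inner ℝ (I w) w = 0 := by rw [hIs, h3, neg_zero]
  have h4 : inner ℝ (I w) (I w) = ‖w‖ ^ 2 := by
    rw [hIs, hI2, inner_neg_right, neg_neg, real_inner_self_eq_norm_sq]
  refine ⟨fun c => ?_, fun c => ?_, fun c => ?_, ?_⟩
  · simp only [christoffelForm, fderiv_radialMetric hp.self_of_nhds, rankOne, rankOneBil, map_zero,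
      zero_apply, h1, h2, h3, hI2, inner_neg_right, hIs,
      real_inner_self_eq_norm_sq]
    ring
  · simp only [christoffelForm, fderiv_radialMetric hp.self_of_nhds, rankOne, rankOneBil, map_zero,
      zero_apply, h1, h2, h3, hI2, inner_neg_right, hIs,
      real_inner_self_eq_norm_sq]
    ring
  · simp only [christoffelForm, fderiv_radialMetric hp.self_of_nhds, rankOne, rankOneBil, map_zero,
      zero_apply, h1, h2, h3, hI2, inner_neg_right, hIs, map_neg,
      real_inner_self_eq_norm_sq]
    ring
  · simp only [sectional, fderiv_fderiv_radialMetric hp, rankOne, rankOneBil, map_zero,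
      zero_apply, h1, h2, h3, h3', h4, hI2, inner_neg_right,
      real_inner_self_eq_norm_sq]
    ring

/-- The sectional curvature of a radial metric along the complex line spanned by `z`, in terms of
`f' = p + r p'`, the derivative of `f(r) = r p(r)`. -/
lemma sectional_radial_vertical {p : ℝ → ℝ} {z : V} {r f1 f2 f3 : ℝ} (hr : r = ‖z‖ ^ 2)
    (hp : ∀ᶠ r in 𝓝 (‖z‖ ^ 2), ContDiffAt ℝ ∞ p r)
    (hf1 : f1 = p r + r * deriv p r) (hf2 : f2 = 2 * deriv p r + r * deriv (deriv p) r)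
    (hf3 : f3 = 3 * deriv (deriv p) r + r * deriv (deriv (deriv p)) r) (hf : f1 ≠ 0) :
    IsChristoffel (radialMetric I p) z z z ((r * f2 / f1) • z) ∧
    IsChristoffel (radialMetric I p) z z (I z) ((r * f2 / f1) • I z) ∧
    IsChristoffel (radialMetric I p) z (I z) (I z) (-((r * f2 / f1) • z)) ∧
    sectional (radialMetric I p) z z (I z) ((r * f2 / f1) • z) ((r * f2 / f1) • I z)
      (-((r * f2 / f1) • z)) = -4 * r ^ 2 * f2 - 4 * r ^ 3 * f3 + 4 * r ^ 3 * f2 ^ 2 / f1 := by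
  have h3 := inner_self_apply_eq_zero hIs z
  have h3' : inner ℝ (I z) z = 0 := by rw [hIs, h3, neg_zero]
  have h4 : inner ℝ (I z) (I z) = r := by
    rw [hIs, hI2, inner_neg_right, neg_neg, real_inner_self_eq_norm_sq, hr]
  have h5 : inner ℝ z z = r := by rw [real_inner_self_eq_norm_sq, hr]
  have hk : r * f2 / f1 * (p r + r * deriv p r) = r * f2 := by rw [← hf1]; field_simp
  generalize hκ : r * f2 / f1 = κ at *
  refine ⟨fun c => ?_, fun c => ?_, fun c => ?_, ?_⟩
  · simp only [christoffelForm, fderiv_radialMetric hp.self_of_nhds, rankOne, rankOneBil, map_smul,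
      smul_apply, smul_eq_mul, radialMetric_apply, h3, h5, hI2, inner_neg_right, hIs, ← hr]
    subst hf2
    linear_combination 2 * inner ℝ z c * hk + 2 * deriv p r * r * real_inner_comm z c
  · simp only [christoffelForm, fderiv_radialMetric hp.self_of_nhds, rankOne, rankOneBil, map_smul,
      smul_apply, smul_eq_mul, radialMetric_apply, h3, h5, hI2, inner_neg_right, hIs, ← hr]
    subst hf2
    linear_combination (-2) * inner ℝ z (I c) * hk
  · simp only [christoffelForm, fderiv_radialMetric hp.self_of_nhds, rankOne, rankOneBil, map_smul,
      smul_apply, smul_eq_mul, radialMetric_apply, h3, h5, hI2, inner_neg_right, hIs, ← hr, map_neg,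
      neg_apply]
    subst hf2
    linear_combination (-2) * inner ℝ z c * hk + 2 * deriv p r * r * real_inner_comm z c
  · have hk2 : 4 * r ^ 3 * f2 ^ 2 / f1 = 4 * r * κ ^ 2 * (p r + r * deriv p r) := by
      rw [← hκ, ← hf1]; field_simp
    rw [hk2]
    simp only [sectional, fderiv_fderiv_radialMetric hp, rankOne, rankOneBil, map_smul,
      smul_apply, smul_eq_mul, radialMetric_apply, h3, h3', h4, h5, hI2, inner_neg_right, ← hr,
      map_neg]
    subst hf2 hf3
    ring

end RadialForms

/-! ### Curvature decay of asymptotically Euclidean metrics -/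

section Decay

variable {N : ℕ}

lemma abs_apply_le_of_basis {T : EuclideanSpace ℝ (Fin N) →L[ℝ] EuclideanSpace ℝ (Fin N) →L[ℝ] ℝ}
    {B : Fin N → Fin N → ℝ}
    (h : ∀ i j, |T (EuclideanSpace.single i 1) (EuclideanSpace.single j 1)| ≤ B i j)
    (c d : EuclideanSpace ℝ (Fin N)) : |T c d| ≤ (∑ i, ∑ j, B i j) * (‖c‖ * ‖d‖) := by
  have hc : ∀ x : EuclideanSpace ℝ (Fin N), x = ∑ i, x i • EuclideanSpace.single i (1 : ℝ) := by
    intro x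
    have := (EuclideanSpace.basisFun (Fin N) ℝ).sum_repr x
    simpa using this.symm
  have hT : T c d
      = ∑ i, ∑ j, c i * d j * T (EuclideanSpace.single i 1) (EuclideanSpace.single j 1) := by
    conv_lhs => rw [hc c, hc d]
    simp only [map_sum, map_smul, sum_apply, smul_apply, smul_eq_mul,
      Finset.mul_sum]
    rw [Finset.sum_comm]
    exact Finset.sum_congr rfl fun i _ => Finset.sum_congr rfl fun j _ => by ring
  rw [hT, Finset.sum_mul]
  refine (Finset.abs_sum_le_sum_abs _ _).trans (Finset.sum_le_sum fun i _ => ?_)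
  rw [Finset.sum_mul]
  refine (Finset.abs_sum_le_sum_abs _ _).trans (Finset.sum_le_sum fun j _ => ?_)
  rw [abs_mul, abs_mul, mul_comm]
  have h1 : |c i| ≤ ‖c‖ := by simpa using PiLp.norm_apply_le c i
  have h2 : |d j| ≤ ‖d‖ := by simpa using PiLp.norm_apply_le d j
  exact mul_le_mul (h i j) (mul_le_mul h1 h2 (abs_nonneg _) (norm_nonneg _))
    (by positivity) ((abs_nonneg _).trans (h i j))

set_option maxHeartbeats 400000 in
/-- The decay of the components of a metric and of their derivatives, in invariant form. -/
lemma exists_decay {G : EuclideanSpace ℝ (Fin N) →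
      EuclideanSpace ℝ (Fin N) →L[ℝ] EuclideanSpace ℝ (Fin N) →L[ℝ] ℝ} {R τ : ℝ}
    (hG : ∀ y, R < ‖y‖ → ContDiffAt ℝ ∞ G y)
    (h : ∀ (i j : Fin N) (m : ℕ), ∃ C R' : ℝ, R ≤ R' ∧ ∀ y, R' < ‖y‖ →
      ‖iteratedFDeriv ℝ m (fun y' => G y' (EuclideanSpace.single i 1)
          (EuclideanSpace.single j 1) - if i = j then 1 else 0) y‖ ≤ C * ‖y‖ ^ (-τ - m)) :
    ∃ C R' : ℝ, 0 ≤ C ∧ R ≤ R' ∧ ∀ y, R' < ‖y‖ →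
      (∀ c d, |G y c d - inner ℝ c d| ≤ C * ‖y‖ ^ (-τ) * (‖c‖ * ‖d‖)) ∧
      (∀ e c d, |fderiv ℝ G y e c d| ≤ C * ‖y‖ ^ (-τ - 1) * ‖e‖ * (‖c‖ * ‖d‖)) ∧
      (∀ f e c d, |fderiv ℝ (fderiv ℝ G) y f e c d|
        ≤ C * ‖y‖ ^ (-τ - 2) * (‖f‖ * ‖e‖) * (‖c‖ * ‖d‖)) := by
  choose C R' hR hC using h
  let S : ℕ → ℝ := fun m => ∑ i, ∑ j, |C i j m|
  have hS : ∀ m, 0 ≤ S m := fun m => by positivity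
  let Q : ℝ := |R| + ∑ i, ∑ j, ∑ m ∈ Finset.range 3, |R' i j m|
  have hQ : ∀ i j, ∀ m ∈ Finset.range 3, R' i j m ≤ Q := by
    intro i j m hm
    have h1 : |R' i j m| ≤ ∑ m ∈ Finset.range 3, |R' i j m| :=
      Finset.single_le_sum (f := fun m => |R' i j m|) (fun _ _ => abs_nonneg _) hm
    have h2 : ∑ m ∈ Finset.range 3, |R' i j m| ≤ ∑ j, ∑ m ∈ Finset.range 3, |R' i j m| :=
      Finset.single_le_sum (f := fun j => ∑ m ∈ Finset.range 3, |R' i j m|)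
        (fun _ _ => by positivity) (Finset.mem_univ j)
    have h3 : ∑ j, ∑ m ∈ Finset.range 3, |R' i j m|
        ≤ ∑ i, ∑ j, ∑ m ∈ Finset.range 3, |R' i j m| :=
      Finset.single_le_sum (f := fun i => ∑ j, ∑ m ∈ Finset.range 3, |R' i j m|)
        (fun _ _ => by positivity) (Finset.mem_univ i)
    linarith [le_abs_self (R' i j m), abs_nonneg R]
  have hRQ : R ≤ Q := by
    have : 0 ≤ ∑ i, ∑ j, ∑ m ∈ Finset.range 3, |R' i j m| := by positivity
    linarith [le_abs_self R]
  refine ⟨S 0 + S 1 + S 2, Q, by linarith [hS 0, hS 1, hS 2], hRQ, fun y hy => ?_⟩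
  have hyR : R < ‖y‖ := lt_of_le_of_lt hRQ hy
  have hb : ∀ i j, ∀ m ∈ Finset.range 3, ‖iteratedFDeriv ℝ m (fun y' =>
      G y' (EuclideanSpace.single i 1) (EuclideanSpace.single j 1) - if i = j then 1 else 0) y‖
        ≤ |C i j m| * ‖y‖ ^ (-τ - m) := fun i j m hm =>
    (hC i j m y ((hQ i j m hm).trans_lt hy)).trans
      (mul_le_mul_of_nonneg_right (le_abs_self _) (by positivity))
  have hGy := hG y hyR
  have hev : ∀ᶠ y' in 𝓝 y, ContDiffAt ℝ ∞ G y' := by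
    filter_upwards [(isOpen_lt continuous_const continuous_norm).mem_nhds hyR] with y' hy'
      using hG y' hy'
  have hsm : ∀ m (q : ℝ), 0 ≤ q → S m ≤ S 0 + S 1 + S 2 →
      ∀ r : ℝ, 0 ≤ r → S m * r * q ≤ (S 0 + S 1 + S 2) * r * q := fun m q hq hm r hr =>
    mul_le_mul_of_nonneg_right (mul_le_mul_of_nonneg_right hm hr) hq
  have hf1 : ∀ i j y', ContDiffAt ℝ ∞ G y' → ∀ e, fderiv ℝ (fun y' => G y'
      (EuclideanSpace.single i 1) (EuclideanSpace.single j 1) - if i = j then 1 else 0) y' e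
        = fderiv ℝ G y' e (EuclideanSpace.single i 1) (EuclideanSpace.single j 1) := by
    intro i j y' hy' e
    rw [fderiv_sub_const, fderiv_eval₂ (hy'.differentiableAt (by simp))]
  refine ⟨fun c d => ?_, fun e c d => ?_, fun f e c d => ?_⟩
  · have := abs_apply_le_of_basis (T := G y - euclid (EuclideanSpace ℝ (Fin N)))
      (B := fun i j => |C i j 0| * ‖y‖ ^ (-τ)) (fun i j => by
        have := hb i j 0 (by simp)
        rw [norm_iteratedFDeriv_zero, Real.norm_eq_abs] at this
        simp only [Nat.cast_zero, sub_zero] at this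
        refine le_trans (le_of_eq ?_) this
        simp only [sub_apply, euclid_apply]
        congr 2
        rw [EuclideanSpace.inner_single_left]
        simp [Pi.single_apply, eq_comm]) c d
    simp only [sub_apply, euclid_apply, ← Finset.sum_mul] at this
    exact this.trans (hsm 0 _ (by positivity) (by linarith [hS 1, hS 2]) _ (by positivity))
  · have := abs_apply_le_of_basis (T := fderiv ℝ G y e)
      (B := fun i j => |C i j 1| * (‖y‖ ^ (-τ - 1) * ‖e‖)) (fun i j => by
        have := hb i j 1 (by simp)
        rw [norm_iteratedFDeriv_one] at this
        rw [← hf1 i j y hGy e, ← Real.norm_eq_abs]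
        refine (ContinuousLinearMap.le_opNorm _ e).trans ?_
        rw [← mul_assoc]
        exact mul_le_mul_of_nonneg_right (by simpa using this) (norm_nonneg _)) c d
    simp only [← Finset.sum_mul] at this
    rw [mul_assoc _ (‖y‖ ^ (-τ - 1)) ‖e‖]
    exact this.trans (hsm 1 _ (by positivity) (by linarith [hS 0, hS 2]) _ (by positivity))
  · have := abs_apply_le_of_basis (T := fderiv ℝ (fderiv ℝ G) y f e)
      (B := fun i j => |C i j 2| * (‖y‖ ^ (-τ - 2) * (‖f‖ * ‖e‖))) (fun i j => by
        have := hb i j 2 (by simp)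
        have h2 : fderiv ℝ (fderiv ℝ G) y f e (EuclideanSpace.single i 1)
            (EuclideanSpace.single j 1) = iteratedFDeriv ℝ 2 (fun y' => G y'
              (EuclideanSpace.single i 1) (EuclideanSpace.single j 1) - if i = j then 1 else 0) y
              ![f, e] := by
          rw [iteratedFDeriv_two_apply]
          have hd := (hGy.fderiv_right (m := ∞) le_rfl).differentiableAt (by simp)
          have hE : fderiv ℝ (fun y' => G y'
              (EuclideanSpace.single i 1) (EuclideanSpace.single j 1) - if i = j then 1 else 0)
              =ᶠ[𝓝 y] fun y' => ((ContinuousLinearMap.apply ℝ ℝ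
                  (EuclideanSpace.single j (1 : ℝ))).comp (ContinuousLinearMap.apply ℝ
                  (EuclideanSpace ℝ (Fin N) →L[ℝ] ℝ) (EuclideanSpace.single i (1 : ℝ)))).comp
                    (fderiv ℝ G y') := by
            filter_upwards [hev] with y' hy'
            ext e'
            simp only [hf1 i j y' hy' e', ContinuousLinearMap.comp_apply,
              ContinuousLinearMap.apply_apply]
          rw [hE.fderiv_eq]
          have hL := (hasFDerivAt_const (((ContinuousLinearMap.apply ℝ ℝ
                  (EuclideanSpace.single j (1 : ℝ))).comp (ContinuousLinearMap.apply ℝ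
                  (EuclideanSpace ℝ (Fin N) →L[ℝ] ℝ) (EuclideanSpace.single i (1 : ℝ))))) y).clm_comp
                  hd.hasFDerivAt
          rw [hL.fderiv]
          simp
        rw [h2, ← Real.norm_eq_abs]
        refine (ContinuousMultilinearMap.le_opNorm _ _).trans ?_
        have hprod : ∏ l, ‖(![f, e] : Fin 2 → EuclideanSpace ℝ (Fin N)) l‖ = ‖f‖ * ‖e‖ := by
          rw [Fin.prod_univ_two]; rfl
        simp only [Nat.cast_ofNat] at this
        rw [hprod, ← mul_assoc (|C i j 2|)]
        exact mul_le_mul_of_nonneg_right this (mul_nonneg (norm_nonneg f) (norm_nonneg e))) c d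
    simp only [← Finset.sum_mul] at this
    rw [mul_assoc _ (‖y‖ ^ (-τ - 2)) (‖f‖ * ‖e‖)]
    exact this.trans (hsm 2 _ (by positivity) (by linarith [hS 0, hS 1]) _ (by positivity))

/-- An asymptotically Euclidean metric is uniformly equivalent to the Euclidean one, and its
curvature decays two orders faster than its deviation from the Euclidean metric. -/
lemma exists_curvature_decay {G : EuclideanSpace ℝ (Fin N) →
      EuclideanSpace ℝ (Fin N) →L[ℝ] EuclideanSpace ℝ (Fin N) →L[ℝ] ℝ} {R τ : ℝ} (hτ : 0 < τ)
    (hG : ∀ y, R < ‖y‖ → ContDiffAt ℝ ∞ G y)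
    (h : ∀ (i j : Fin N) (m : ℕ), ∃ C R' : ℝ, R ≤ R' ∧ ∀ y, R' < ‖y‖ →
      ‖iteratedFDeriv ℝ m (fun y' => G y' (EuclideanSpace.single i 1)
          (EuclideanSpace.single j 1) - if i = j then 1 else 0) y‖ ≤ C * ‖y‖ ^ (-τ - m)) :
    ∃ C R' : ℝ, 0 ≤ C ∧ R ≤ R' ∧ 1 ≤ R' ∧ ∀ y, R' < ‖y‖ →
      (∀ a, ‖a‖ ^ 2 ≤ 2 * G y a a ∧ G y a a ≤ 2 * ‖a‖ ^ 2) ∧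
      ∀ a b u v w, IsChristoffel G y a a u → IsChristoffel G y a b v → IsChristoffel G y b b w →
        |sectional G y a b u v w| ≤ C * ‖y‖ ^ (-τ - 2) * (‖a‖ ^ 2 * ‖b‖ ^ 2) := by
  obtain ⟨C, R₁, hC, hR₁, hb⟩ := exists_decay hG h
  have hlim : Filter.Tendsto (fun r : ℝ => C * r ^ (-τ)) Filter.atTop (𝓝 (C * 0)) :=
    (tendsto_rpow_neg_atTop hτ).const_mul C
  obtain ⟨R₂, hR₂⟩ := Filter.eventually_atTop.1
    (hlim.eventually (gt_mem_nhds (show C * 0 < 1 / 2 by norm_num)))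
  refine ⟨2 * C + 9 * C ^ 2, max R₁ (max R₂ 1), by positivity,
    hR₁.trans (le_max_left _ _), (le_max_right _ _).trans (le_max_right _ _), fun y hy => ?_⟩
  have hy1 : R₁ < ‖y‖ := (le_max_left _ _).trans_lt hy
  have hy2 : R₂ < ‖y‖ := ((le_max_left _ _).trans (le_max_right _ _)).trans_lt hy
  have hy3 : 1 < ‖y‖ := ((le_max_right _ _).trans (le_max_right _ _)).trans_lt hy
  obtain ⟨b0, b1, b2⟩ := hb y hy1
  have hsmall := hR₂ ‖y‖ hy2.le
  have hGb : ∀ a, ‖a‖ ^ 2 ≤ 2 * G y a a ∧ G y a a ≤ 2 * ‖a‖ ^ 2 := by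
    intro a
    have h0 := b0 a a
    rw [real_inner_self_eq_norm_sq, ← sq] at h0
    have h1 : C * ‖y‖ ^ (-τ) * ‖a‖ ^ 2 ≤ 1 / 2 * ‖a‖ ^ 2 :=
      mul_le_mul_of_nonneg_right hsmall.le (by positivity)
    have h2 := abs_le.1 (h0.trans h1)
    constructor <;> linarith [h2.1, h2.2, sq_nonneg ‖a‖]
  refine ⟨hGb, fun a b u v w hu hv hw => ?_⟩
  have hy0 : 0 < ‖y‖ := by linarith
  have hpow : (‖y‖ ^ (-τ - 1)) ^ 2 ≤ ‖y‖ ^ (-τ - 2) := by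
    rw [← Real.rpow_natCast, ← Real.rpow_mul hy0.le]
    exact Real.rpow_le_rpow_of_exponent_le hy3.le (by push_cast; linarith)
  set e1 := ‖y‖ ^ (-τ - 1)
  set e2 := ‖y‖ ^ (-τ - 2)
  have he1 : 0 ≤ e1 := by positivity
  have he2 : 0 ≤ e2 := by positivity
  have hch : ∀ a b c, |christoffelForm G y a b c| ≤ 3 / 2 * (C * e1) * (‖a‖ * ‖b‖ * ‖c‖) := by
    intro a b c
    have k1 := abs_le.1 (b1 a b c)
    have k2 := abs_le.1 (b1 b a c)
    have k3 := abs_le.1 (b1 c a b)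
    unfold christoffelForm
    rw [abs_le]
    constructor <;> linarith [k1.1, k1.2, k2.1, k2.2, k3.1, k3.2]
  have hΓ : ∀ a b u, IsChristoffel G y a b u → ‖u‖ ≤ 3 * (C * e1) * (‖a‖ * ‖b‖) := by
    intro a b u hu
    have k1 := (hGb u).1
    rw [hu u] at k1
    have k2 := (le_abs_self _).trans (hch a b u)
    rcases (norm_nonneg u).eq_or_lt with h0 | h0
    · rw [← h0]; positivity
    · have : ‖u‖ * ‖u‖ ≤ 3 * (C * e1) * (‖a‖ * ‖b‖) * ‖u‖ := by linarith
      exact le_of_mul_le_mul_right this h0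
  have hGG : ∀ a b c d u w, IsChristoffel G y a b u → IsChristoffel G y c d w →
      |G y u w| ≤ 9 / 2 * (C ^ 2 * e2) * (‖a‖ * ‖b‖ * (‖c‖ * ‖d‖)) := by
    intro a b c d u w hu hw
    rw [hu w]
    refine (hch a b w).trans ?_
    have k := hΓ c d w hw
    calc 3 / 2 * (C * e1) * (‖a‖ * ‖b‖ * ‖w‖)
        ≤ 3 / 2 * (C * e1) * (‖a‖ * ‖b‖ * (3 * (C * e1) * (‖c‖ * ‖d‖))) := by gcongr
      _ = 9 / 2 * (C ^ 2 * e1 ^ 2) * (‖a‖ * ‖b‖ * (‖c‖ * ‖d‖)) := by ring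
      _ ≤ _ := by gcongr
  have g1 := abs_le.1 (hGG a a b b u w hu hw)
  have g2 := abs_le.1 (hGG a b a b v v hv hv)
  have d1 := abs_le.1 (b2 a b a b)
  have d2 := abs_le.1 (b2 a a b b)
  have d3 := abs_le.1 (b2 b b a a)
  unfold sectional
  rw [abs_le]
  constructor <;> linarith [g1.1, g1.2, g2.1, g2.2, d1.1, d1.2, d2.1, d2.2, d3.1, d3.2]

end Decay

/-! ### Differential calculus on the total space in the standard charts -/

section Charts

open LineBundle

variable {n k : ℕ} {V W : Type*} [NormedAddCommGroup V] [NormedSpace ℝ V] [NormedAddCommGroup W]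
  [NormedSpace ℝ W]

lemma mulI_apply (v : Cn n) : mulI n v = Complex.I • v := rfl

lemma mulI_mulI (v : Cn n) : mulI n (mulI n v) = -v := by
  rw [mulI_apply, mulI_apply, smul_smul, Complex.I_mul_I, neg_one_smul]

lemma norm_mulI (v : Cn n) : ‖mulI n v‖ = ‖v‖ := by
  rw [mulI_apply, norm_smul]; simp

lemma inner_eq_re (v w : Cn n) : inner ℝ v w = (inner ℂ v w).re := by
  simp [PiLp.inner_apply]

lemma inner_mulI_left (v w : Cn n) : inner ℝ (mulI n v) w = -inner ℝ v (mulI n w) := by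
  simp only [inner_eq_re, mulI_apply, inner_smul_left, inner_smul_right, Complex.conj_I, neg_mul,
    Complex.neg_re]

/-- The derivative of a map from a vector space to the total space. -/
def dInto (F : V → LineBundle n k) (y : V) : V →L[ℝ] Cn n := mfderiv 𝓘(ℝ, V) 𝓘(ℝ, Cn n) F y

/-- The derivative of a map from the total space to a vector space. -/
def dOut (ψ : LineBundle n k → W) (x : LineBundle n k) : Cn n →L[ℝ] W :=
  mfderiv 𝓘(ℝ, Cn n) 𝓘(ℝ, W) ψ x

/-- A two-tensor at a point, as a bilinear form on the model space. -/
def tensorAt (T : TwoTensor n k) (x : LineBundle n k) : Cn n →L[ℝ] Cn n →L[ℝ] ℝ := T x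

lemma pullback_eq (F : V → LineBundle n k) (T : TwoTensor n k) (y : V) :
    pullback F T y = (tensorAt T (F y)).bilinearComp (dInto F y) (dInto F y) := rfl

lemma chart_mem_maximalAtlas (j : Fin n) :
    (chart j : OpenPartialHomeomorph (LineBundle n k) (Cn n)) ∈
      IsManifold.maximalAtlas 𝓘(ℝ, Cn n) ∞ (LineBundle n k) :=
  IsManifold.subset_maximalAtlas ⟨j, rfl⟩

lemma contMDiff_param (j : Fin n) :
    ContMDiff 𝓘(ℝ, Cn n) 𝓘(ℝ, Cn n) ∞ (param j : Cn n → LineBundle n k) :=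
  contMDiffOn_univ.1 (contMDiffOn_symm_of_mem_maximalAtlas (chart_mem_maximalAtlas (k := k) j))

lemma contMDiffOn_coord (j : Fin n) :
    ContMDiffOn 𝓘(ℝ, Cn n) 𝓘(ℝ, Cn n) ∞ (coord j : LineBundle n k → Cn n) (dom j) :=
  contMDiffOn_of_mem_maximalAtlas (chart_mem_maximalAtlas (k := k) j)

lemma param_mem_dom (j : Fin n) (a : Cn n) : (param j a : LineBundle n k) ∈ dom j := ⟨a, rfl⟩

lemma param_coord {j : Fin n} {x : LineBundle n k} (hx : x ∈ dom j) : param j (coord j x) = x := by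
  obtain ⟨a, rfl⟩ := hx
  rw [coord_param]

lemma contMDiffAt_coord {j : Fin n} {x : LineBundle n k} (hx : x ∈ dom j) :
    ContMDiffAt 𝓘(ℝ, Cn n) 𝓘(ℝ, Cn n) ∞ (coord j : LineBundle n k → Cn n) x :=
  (contMDiffOn_coord j).contMDiffAt ((isOpen_dom j).mem_nhds hx)

lemma mdiffAt {M N : Type*} [TopologicalSpace M] [TopologicalSpace N]
    [ChartedSpace V M] [ChartedSpace W N] {f : M → N} {x : M}
    (h : ContMDiffAt 𝓘(ℝ, V) 𝓘(ℝ, W) ∞ f x) : MDifferentiableAt 𝓘(ℝ, V) 𝓘(ℝ, W) f x :=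
  h.mdifferentiableAt (by simp)

/-- Chain rule for a map into the total space followed by a map to a vector space. -/
lemma fderiv_comp_dInto {ψ : LineBundle n k → W} {F : V → LineBundle n k} {y : V}
    (hψ : MDifferentiableAt 𝓘(ℝ, Cn n) 𝓘(ℝ, W) ψ (F y))
    (hF : MDifferentiableAt 𝓘(ℝ, V) 𝓘(ℝ, Cn n) F y) :
    fderiv ℝ (fun y' => ψ (F y')) y = (dOut ψ (F y)).comp (dInto F y) := by
  rw [← mfderiv_eq_fderiv]
  exact mfderiv_comp y hψ hF

/-- Chain rule for a map between vector spaces followed by a map into the total space. -/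
lemma dInto_comp {F : W → LineBundle n k} {f : V → W} {y : V}
    (hF : MDifferentiableAt 𝓘(ℝ, W) 𝓘(ℝ, Cn n) F (f y)) (hf : DifferentiableAt ℝ f y) :
    dInto (fun y' => F (f y')) y = (dInto F (f y)).comp (fderiv ℝ f y) := by
  rw [← mfderiv_eq_fderiv]
  exact mfderiv_comp y hF hf.mdifferentiableAt

lemma dInto_congr {F F' : V → LineBundle n k} {y : V} (h : F =ᶠ[𝓝 y] F') :
    dInto F y = dInto F' y := h.mfderiv_eq

lemma dOut_congr {ψ ψ' : LineBundle n k → W} {x : LineBundle n k} (h : ψ =ᶠ[𝓝 x] ψ') :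
    dOut ψ x = dOut ψ' x := h.mfderiv_eq

lemma dOut_coord_comp_dInto_param (j : Fin n) (a : Cn n) :
    (dOut (coord j) (param j a : LineBundle n k)).comp (dInto (param (k := k) j) a)
      = ContinuousLinearMap.id ℝ (Cn n) := by
  rw [← fderiv_comp_dInto (mdiffAt (contMDiffAt_coord (param_mem_dom j a)))
    (mdiffAt (contMDiff_param j a))]
  simp only [coord_param]
  exact fderiv_id

lemma dInto_param_injective (j : Fin n) (a : Cn n) :
    Function.Injective (dInto (param j : Cn n → LineBundle n k) a) := by
  have h := dOut_coord_comp_dInto_param (k := k) j a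
  intro v w hvw
  have h1 := congrArg (fun L : Cn n →L[ℝ] Cn n => L v) h
  have h2 := congrArg (fun L : Cn n →L[ℝ] Cn n => L w) h
  simp only [ContinuousLinearMap.comp_apply, ContinuousLinearMap.id_apply] at h1 h2
  rw [← h1, ← h2, hvw]

lemma bijective_of_injective {L : Cn n →L[ℝ] Cn n} (h : Function.Injective L) :
    Function.Bijective L :=
  ⟨h, LinearMap.injective_iff_surjective (f := (L : Cn n →ₗ[ℝ] Cn n)).1 h⟩

lemma dInto_param_bijective (j : Fin n) (a : Cn n) :
    Function.Bijective (dInto (param j : Cn n → LineBundle n k) a) :=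
  bijective_of_injective (dInto_param_injective j a)

lemma contMDiffAt_of_eventuallyEq_param {F : V → LineBundle n k} {f : V → Cn n} {j : Fin n} {y : V}
    (h : F =ᶠ[𝓝 y] fun y' => param j (f y')) (hf : ContDiffAt ℝ ∞ f y) :
    ContMDiffAt 𝓘(ℝ, V) 𝓘(ℝ, Cn n) ∞ F y :=
  ((contMDiff_param j (f y)).comp y hf.contMDiffAt).congr_of_eventuallyEq h

lemma contDiffAt_coord_comp {F : V → LineBundle n k} {j : Fin n} {y : V}
    (hF : ContMDiffAt 𝓘(ℝ, V) 𝓘(ℝ, Cn n) ∞ F y) (hj : F y ∈ dom j) :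
    ContDiffAt ℝ ∞ (fun y' => coord j (F y')) y :=
  ((contMDiffAt_coord hj).comp y hF).contDiffAt

omit [NormedSpace ℝ V] in
lemma eventuallyEq_param_coord {F : V → LineBundle n k} {j : Fin n} {y : V}
    (hF : ContinuousAt F y) (hj : F y ∈ dom j) :
    F =ᶠ[𝓝 y] fun y' => param j (coord j (F y')) := by
  filter_upwards [hF ((isOpen_dom j).mem_nhds hj)] with y' hy'
  exact (param_coord hy').symm

/-- Pull-backs computed through a standard chart. -/
lemma pullback_eq_chart {F : V → LineBundle n k} {f : V → Cn n} {j : Fin n} {y : V}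
    (h : F =ᶠ[𝓝 y] fun y' => param j (f y')) (hf : DifferentiableAt ℝ f y) (T : TwoTensor n k) :
    pullback F T y = (pullback (param j) T (f y)).bilinearComp (fderiv ℝ f y) (fderiv ℝ f y) := by
  rw [pullback_eq, pullback_eq, dInto_congr h, dInto_comp (mdiffAt (contMDiff_param j (f y))) hf,
    h.self_of_nhds]
  rfl

lemma dInto_eq_chart {F : V → LineBundle n k} {f : V → Cn n} {j : Fin n} {y : V}
    (h : F =ᶠ[𝓝 y] fun y' => param j (f y')) (hf : DifferentiableAt ℝ f y) :
    dInto F y = (dInto (param (k := k) j) (f y)).comp (fderiv ℝ f y) := by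
  rw [dInto_congr h, dInto_comp (mdiffAt (contMDiff_param j (f y))) hf]

lemma contDiff_pullback_param (g : RiemMetric n k) (j : Fin n) :
    ContDiff ℝ ∞ (pullback (param j) g.inner) := by
  have hV : ∀ v : Cn n, ContMDiff 𝓘(ℝ, Cn n) (𝓘(ℝ, Cn n).prod 𝓘(ℝ, Cn n)) ∞
      (fun a => (⟨param j a, mfderiv 𝓘(ℝ, Cn n) 𝓘(ℝ, Cn n) (param j) a v⟩ :
        TangentBundle 𝓘(ℝ, Cn n) (LineBundle n k))) := by
    intro v
    have h1 : ContMDiff 𝓘(ℝ, Cn n) (𝓘(ℝ, Cn n).prod 𝓘(ℝ, Cn n)) ∞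
        (fun a : Cn n => (⟨a, v⟩ : TangentBundle 𝓘(ℝ, Cn n) (Cn n))) :=
      contMDiff_vectorSpace_iff_contDiff.2 (contDiff_const (c := v))
    exact ((contMDiff_param j).contMDiff_tangentMap (m := ∞) le_rfl).comp h1
  have key : ∀ v w : Cn n, ContDiff ℝ ∞ (fun a => pullback (param j) g.inner a v w) := by
    intro v w
    rw [← contMDiff_iff_contDiff]
    intro a
    have := ContMDiffAt.clm_bundle_apply₂ (F₁ := Cn n) (F₂ := Cn n) (F₃ := ℝ)
      (E₃ := Bundle.Trivial (LineBundle n k) ℝ)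
      (g.contMDiff.contMDiffAt.comp a (contMDiff_param j a)) (hV v a) (hV w a)
    rw [Bundle.contMDiffAt_totalSpace] at this
    exact this.2
  refine contDiff_clm_apply_iff.2 fun v => contDiff_clm_apply_iff.2 fun w => key v w

lemma pullback_symm (g : RiemMetric n k) (F : V → LineBundle n k) (y v w : V) :
    pullback F g.inner y v w = pullback F g.inner y w v :=
  g.symm _ _ _

lemma pullback_pos (g : RiemMetric n k) {F : V → LineBundle n k} {y v : V}
    (hF : Function.Injective (dInto F y)) (hv : v ≠ 0) : 0 < pullback F g.inner y v v :=
  g.pos _ _ fun h => hv (hF (h.trans (map_zero (dInto F y)).symm))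

/-- A positive definite metric has a connection. -/
lemma exists_isChristoffel [FiniteDimensional ℝ V] {G : V → V →L[ℝ] V →L[ℝ] ℝ} {p : V}
    (hpos : ∀ v, v ≠ 0 → 0 < G p v v) (a b : V) : ∃ u, IsChristoffel G p a b u := by
  let L : V →ₗ[ℝ] (V →L[ℝ] ℝ) := (G p : V →ₗ[ℝ] (V →L[ℝ] ℝ))
  let L' : V →ₗ[ℝ] (Module.Dual ℝ V) :=
    (LinearMap.toContinuousLinearMap (𝕜 := ℝ) (E := V) (F' := ℝ)).symm.toLinearMap ∘ₗ L
  have hinj : Function.Injective L' := by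
    rw [← LinearMap.ker_eq_bot, LinearMap.ker_eq_bot']
    intro v hv
    by_contra hne
    have h1 := hpos v hne
    have h2 : G p v v = 0 := congrArg (fun l : Module.Dual ℝ V => l v) hv
    linarith
  have hsurj : Function.Surjective L' :=
    (LinearMap.injective_iff_surjective_of_finrank_eq_finrank
      (Subspace.dual_finrank_eq (K := ℝ) (V := V)).symm).1 hinj
  let ℓ : V →L[ℝ] ℝ := (2⁻¹ : ℝ) • (fderiv ℝ G p a b + fderiv ℝ G p b a
    - ((fderiv ℝ G p).flip a).flip b)
  obtain ⟨u, hu⟩ := hsurj (ℓ : V →ₗ[ℝ] ℝ)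
  refine ⟨u, fun c => ?_⟩
  have h2 : G p u c = ℓ c := congrArg (fun l : Module.Dual ℝ V => l c) hu
  rw [h2]
  simp [ℓ, christoffelForm]
  ring

end Charts

/-! ### The topology of the weighted projective space and the one-point compactification -/

section Compactification

variable {n k : ℕ}

lemma WeightedProj.mk_eq_mk_iff {v v' : Cn n} {w w' : ℂ} {h : (v, w) ≠ 0} {h' : (v', w') ≠ 0} :
    (WeightedProj.mk v w h : WeightedProj n k) = WeightedProj.mk v' w' h'
      ↔ ∃ c : ℂ, c ≠ 0 ∧ v' = c • v ∧ w' = c ^ k * w :=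
  ⟨fun e => Quotient.exact e, fun e => Quotient.sound e⟩

lemma LineBundle.mk_eq_mk_iff {v v' : Cn n} {w w' : ℂ} {h : v ≠ 0} {h' : v' ≠ 0} :
    (LineBundle.mk v h w : LineBundle n k) = LineBundle.mk v' h' w'
      ↔ ∃ c : ℂ, c ≠ 0 ∧ v' = c • v ∧ w = c ^ k * w' :=
  ⟨fun e => Quotient.exact e, fun e => Quotient.sound e⟩

lemma WeightedProj.isOpenQuotientMap :
    IsOpenQuotientMap (Quotient.mk (weightedSetoid n k)) := by
  refine ⟨Quotient.mk_surjective, continuous_quot_mk, fun O hO => ?_⟩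
  refine (isQuotientMap_quot_mk (r := weightedSetoid n k)).isOpen_preimage.1 ?_
  let m : {c : ℂ // c ≠ 0} → {p : Cn n × ℂ // p ≠ 0} → {p : Cn n × ℂ // p ≠ 0} := fun c p =>
    ⟨(c.1 • p.1.1, c.1 ^ k * p.1.2), fun h => p.2 (by
      have h1 := congrArg Prod.fst h
      have h2 := congrArg Prod.snd h
      simp only [Prod.fst_zero, Prod.snd_zero, smul_eq_zero, mul_eq_zero, pow_eq_zero_iff',
        c.2, false_or, false_and] at h1 h2
      exact Prod.ext h1 h2)⟩
  have : Quot.mk (weightedSetoid n k) ⁻¹' (Quotient.mk (weightedSetoid n k) '' O)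
      = ⋃ c, m c ⁻¹' O := by
    ext q
    simp only [Set.mem_preimage, Set.mem_iUnion]
    constructor
    · rintro ⟨p, hp, hpq⟩
      obtain ⟨c, hc, h1, h2⟩ := Quotient.exact hpq.symm
      exact ⟨⟨c, hc⟩, by rwa [show m ⟨c, hc⟩ q = p from Subtype.ext (Prod.ext h1.symm h2.symm)]⟩
    · rintro ⟨c, hc⟩
      refine ⟨_, hc, Eq.symm (Quotient.sound ?_)⟩
      exact ⟨c.1, c.2, rfl, rfl⟩
  refine (congrArg IsOpen this).mpr ?_
  refine isOpen_iUnion fun c => hO.preimage ?_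
  exact Continuous.subtype_mk (by fun_prop) _

lemma exists_pow_eq (hk : 1 ≤ k) (w : ℂ) : ∃ c : ℂ, c ^ k = w :=
  IsAlgClosed.exists_pow_nat_eq w (by omega)

/-- The equations which describe the orbits of the weighted action. -/
lemma weighted_rel_iff (hk : 1 ≤ k) (p q : {p : Cn n × ℂ // p ≠ 0}) :
    (weightedSetoid n k) p q ↔ (∀ i j, p.1.1 i * q.1.1 j = p.1.1 j * q.1.1 i) ∧
      ∀ i, p.1.2 * q.1.1 i ^ k = q.1.2 * p.1.1 i ^ k := by
  constructor
  · rintro ⟨c, hc, h1, h2⟩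
    refine ⟨fun i j => ?_, fun i => ?_⟩
    · simp only [h1, PiLp.smul_apply, smul_eq_mul]; ring
    · simp only [h1, h2, PiLp.smul_apply, smul_eq_mul]; ring
  · rintro ⟨h1, h2⟩
    obtain ⟨⟨v, w⟩, hp⟩ := p
    obtain ⟨⟨v', w'⟩, hq⟩ := q
    simp only at h1 h2
    by_cases hv : v = 0
    · subst hv
      have hw : w ≠ 0 := fun h => hp (by rw [h]; rfl)
      have hv' : v' = 0 := by
        ext i
        have := h2 i
        simp only [PiLp.zero_apply, zero_pow (by omega : k ≠ 0), mul_zero, mul_eq_zero, hw,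
          false_or] at this
        simpa using pow_eq_zero_iff (by omega : k ≠ 0) |>.1 this
      subst hv'
      have hw' : w' ≠ 0 := fun h => hq (by rw [h]; rfl)
      obtain ⟨c, hc⟩ := exists_pow_eq hk (w' / w)
      refine ⟨c, ?_, by simp, ?_⟩
      · rintro rfl
        rw [zero_pow (by omega)] at hc
        exact div_ne_zero hw' hw hc.symm
      · change w' = c ^ k * w
        rw [hc, div_mul_cancel₀ _ hw]
    · obtain ⟨j, hj⟩ : ∃ j, v j ≠ 0 := by
        by_contra! h
        exact hv (by ext i; simpa using h i)
      have hv' : v' = (v' j / v j) • v := by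
        ext i
        simp only [PiLp.smul_apply, smul_eq_mul]
        field_simp
        linear_combination h1 j i
      have hw' : w' = (v' j / v j) ^ k * w := by
        rw [div_pow]
        field_simp
        linear_combination -(h2 j)
      refine ⟨v' j / v j, fun h => hq ?_, hv', hw'⟩
      rw [h, zero_smul] at hv'
      rw [h, zero_pow (by omega), zero_mul] at hw'
      rw [hv', hw']; rfl

/-- The orbit relation is closed, being given by equations. -/
lemma WeightedProj.t2Space (hk : 1 ≤ k) : T2Space (WeightedProj n k) := by
  refine (t2Space_iff_of_isOpenQuotientMap (WeightedProj.isOpenQuotientMap (n := n) (k := k))).2 ?_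
  have : {q : {p : Cn n × ℂ // p ≠ 0} × {p : Cn n × ℂ // p ≠ 0} |
      (Quotient.mk (weightedSetoid n k) q.1) = Quotient.mk (weightedSetoid n k) q.2} =
      {q | (∀ i j, q.1.1.1 i * q.2.1.1 j = q.1.1.1 j * q.2.1.1 i) ∧
      ∀ i, q.1.1.2 * q.2.1.1 i ^ k = q.2.1.2 * q.1.1.1 i ^ k} := by
    ext q
    exact Quotient.eq.trans (weighted_rel_iff hk q.1 q.2)
  rw [this]
  simp only [Set.ofPred_and, Set.ofPred_forall]
  refine IsClosed.inter (isClosed_iInter fun i => isClosed_iInter fun j =>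
    isClosed_eq (by fun_prop) (by fun_prop))
    (isClosed_iInter fun i => isClosed_eq (by fun_prop) (by fun_prop))

lemma WeightedProj.compactSpace (hk : 1 ≤ k) : CompactSpace (WeightedProj n k) := by
  -- either `w` can be scaled to `1` with `|v| ≤ 1`, or `|v|` can be scaled to `1` with `|w| ≤ 1`
  let A : Set (Cn n × ℂ) := Metric.closedBall 0 1 ×ˢ {1}
  let B : Set (Cn n × ℂ) := Metric.sphere 0 1 ×ˢ Metric.closedBall 0 1
  have hAB : IsCompact (A ∪ B) :=
    ((isCompact_closedBall 0 1).prod isCompact_singleton).union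
      ((isCompact_sphere 0 1).prod (isCompact_closedBall 0 1))
  have hne : A ∪ B ⊆ {p | p ≠ 0} := by
    rintro ⟨v, w⟩ (⟨-, h⟩ | ⟨h, -⟩) h0
    · simp only [Prod.mk_eq_zero] at h0
      rw [h0.2] at h
      exact zero_ne_one h
    · simp only [Prod.mk_eq_zero] at h0
      rw [h0.1] at h
      simp at h
  have hAB' : IsCompact ((Subtype.val : {p : Cn n × ℂ // p ≠ 0} → _) ⁻¹' (A ∪ B)) :=
    Topology.IsInducing.subtypeVal.isCompact_preimage' hAB
      (fun x hx => ⟨⟨x, hne hx⟩, rfl⟩)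
  refine ⟨?_⟩
  have himg : (Set.univ : Set (WeightedProj n k)) = Quotient.mk (weightedSetoid n k) ''
      ((Subtype.val : {p : Cn n × ℂ // p ≠ 0} → _) ⁻¹' (A ∪ B)) := by
    refine (Set.eq_univ_of_forall fun x => ?_).symm
    induction x using Quotient.inductionOn with
    | h p =>
    obtain ⟨⟨v, w⟩, hp⟩ := p
    have scale : v ≠ 0 → ‖w‖ ≤ ‖v‖ ^ k → ∃ q ∈ (Subtype.val : {p : Cn n × ℂ // p ≠ 0} → _) ⁻¹'
        (A ∪ B), Quotient.mk (weightedSetoid n k) q = Quotient.mk (weightedSetoid n k)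
          ⟨(v, w), hp⟩ := by
      intro hv hw
      have hv0 : 0 < ‖v‖ := norm_pos_iff.2 hv
      have hmem : (((‖v‖⁻¹ : ℝ) : ℂ) • v, ((‖v‖⁻¹ : ℝ) : ℂ) ^ k * w) ∈ A ∪ B := by
        refine Or.inr ⟨?_, ?_⟩
        · simp [norm_smul, hv0.ne']
        · simp only [mem_closedBall_zero_iff, norm_mul, norm_pow, Complex.norm_real, norm_inv,
            norm_norm, inv_pow]
          rw [inv_mul_le_iff₀ (by positivity), mul_one]
          exact hw
      refine ⟨⟨_, hne hmem⟩, hmem, ?_⟩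
      refine Eq.symm (Quotient.sound ?_)
      exact ⟨((‖v‖⁻¹ : ℝ) : ℂ), by simpa using hv, rfl, rfl⟩
    by_cases hw : w = 0
    · have hv : v ≠ 0 := fun h => hp (by rw [h, hw]; rfl)
      exact scale hv (by rw [hw, norm_zero]; positivity)
    · obtain ⟨c, hc⟩ := exists_pow_eq hk w⁻¹
      have hc0 : c ≠ 0 := by
        rintro rfl
        rw [zero_pow (by omega)] at hc
        exact inv_ne_zero hw hc.symm
      by_cases hcv : ‖c • v‖ ≤ 1
      · have hmem : (c • v, c ^ k * w) ∈ A ∪ B :=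
          Or.inl ⟨by simpa using hcv, by simp [hc, hw]⟩
        refine ⟨⟨_, hne hmem⟩, hmem, ?_⟩
        refine Eq.symm (Quotient.sound ?_)
        exact ⟨c, hc0, rfl, rfl⟩
      · push Not at hcv
        refine scale (fun h => ?_) ?_
        · rw [h, smul_zero, norm_zero] at hcv
          linarith
        · have h1 : 1 ≤ ‖c • v‖ ^ k := one_le_pow₀ hcv.le
          rw [norm_smul, mul_pow, ← norm_pow, hc, norm_inv] at h1
          have h2 : 0 < ‖w‖ := norm_pos_iff.2 hw
          rw [inv_mul_eq_div, le_div_iff₀ h2] at h1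
          linarith
  rw [himg]
  exact hAB'.image continuous_quot_mk

/-- The map `w · v^{⊗k} ↦ [v : w̄ |v|^{2k}]`. On the complement of the zero section it is
`z ↦ [z / |z|² : 1]`, so that it turns the complex structure of the fibres around. -/
def compactify : LineBundle n k → WeightedProj n k :=
  Quotient.map (sa := bundleSetoid n k) (sb := weightedSetoid n k)
    (fun p => ⟨(p.1.1, (starRingEnd ℂ) p.1.2 * ((‖p.1.1‖ ^ (2 * k) : ℝ) : ℂ)), fun h =>
      p.2 (congrArg Prod.fst h)⟩)
    (by
      rintro p q ⟨c, hc, h1, h2⟩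
      refine ⟨c, hc, h1, ?_⟩
      simp only [h1, h2, norm_smul, map_mul, map_pow, mul_pow, pow_mul, Complex.ofReal_mul,
        Complex.ofReal_pow]
      rw [← Complex.mul_conj', mul_pow]
      ring)

lemma compactify_mk (v : Cn n) (hv : v ≠ 0) (w : ℂ) :
    compactify (LineBundle.mk v hv w : LineBundle n k)
      = WeightedProj.mk v ((starRingEnd ℂ) w * ((‖v‖ ^ (2 * k) : ℝ) : ℂ))
        (fun h => hv (congrArg Prod.fst h)) := rfl

lemma compactify_injective : Function.Injective (compactify : LineBundle n k → _) := by
  intro x y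
  induction x using Quotient.inductionOn with
  | h p =>
  induction y using Quotient.inductionOn with
  | h q =>
  intro h
  obtain ⟨c, hc, h1, h2⟩ := Quotient.exact h
  refine Quotient.sound ⟨c, hc, h1, ?_⟩
  have hv : ((‖p.1.1‖ ^ (2 * k) : ℝ) : ℂ) ≠ 0 := by
    have := p.2
    exact_mod_cast (pow_pos (norm_pos_iff.2 this) _).ne'
  simp only at h1 h2
  rw [h1, norm_smul, mul_pow, Complex.ofReal_mul, ← mul_assoc, ← mul_assoc] at h2
  have h3 := mul_right_cancel₀ hv h2
  rw [pow_mul, Complex.ofReal_pow, Complex.ofReal_pow, ← Complex.mul_conj', mul_pow] at h3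
  have h4 : (starRingEnd ℂ) q.1.2 * (starRingEnd ℂ) c ^ k = (starRingEnd ℂ) p.1.2 := by
    have hck : c ^ k ≠ 0 := pow_ne_zero _ hc
    apply mul_left_cancel₀ hck
    linear_combination h3
  have h5 := congrArg (starRingEnd ℂ) h4
  simp only [map_mul, map_pow, Complex.conj_conj] at h5
  rw [← h5]; ring

lemma continuous_compactify : Continuous (compactify : LineBundle n k → _) := by
  refine continuous_quot_lift _ ?_
  refine continuous_quot_mk.comp (Continuous.subtype_mk ?_ _)
  refine Continuous.prodMk (by fun_prop) (Continuous.mul ?_ ?_)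
  · exact Complex.continuous_conj.comp (by fun_prop)
  · exact Complex.continuous_ofReal.comp (by fun_prop)

/-- The map is open because it lifts to a homeomorphism of `{v ≠ 0}`. -/
lemma isOpenEmbedding_compactify :
    Topology.IsOpenEmbedding (compactify : LineBundle n k → _) := by
  refine .of_continuous_injective_isOpenMap continuous_compactify compactify_injective ?_
  intro U hU
  -- lift to the vector spaces, where the map is a homeomorphism of `{v ≠ 0}`
  obtain ⟨O, hO, hOU⟩ := isOpen_induced_iff.1
    (hU.preimage (continuous_quot_mk : Continuous (Quot.mk (bundleSetoid n k))))
  let m : Cn n × ℂ → Cn n × ℂ := fun p =>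
    (p.1, (starRingEnd ℂ) p.2 / ((‖p.1‖ ^ (2 * k) : ℝ) : ℂ))
  have hm : ContinuousOn m {p | p.1 ≠ 0} := by
    refine ContinuousOn.prodMk (by fun_prop) (ContinuousOn.div ?_ ?_ ?_)
    · exact (Complex.continuous_conj.comp continuous_snd).continuousOn
    · exact (Complex.continuous_ofReal.comp (by fun_prop)).continuousOn
    · intro p hp
      exact_mod_cast (pow_pos (norm_pos_iff.2 hp) _).ne'
  have hop : IsOpen ({p : Cn n × ℂ | p.1 ≠ 0} ∩ m ⁻¹' O) :=
    hm.isOpen_inter_preimage (isOpen_ne_fun continuous_fst continuous_const) hO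
  have hmm : ∀ (v : Cn n) (w : ℂ), v ≠ 0 →
      m (v, (starRingEnd ℂ) w * ((‖v‖ ^ (2 * k) : ℝ) : ℂ)) = (v, w) := by
    intro v w hv
    have h0 : ((‖v‖ ^ (2 * k) : ℝ) : ℂ) ≠ 0 := by
      exact_mod_cast (pow_pos (norm_pos_iff.2 hv) _).ne'
    simp only [m, map_mul, Complex.conj_conj, Complex.conj_ofReal]
    rw [mul_div_cancel_right₀ _ h0]
  have himg : compactify '' U = Quotient.mk (weightedSetoid n k) ''
      (Subtype.val ⁻¹' ({p : Cn n × ℂ | p.1 ≠ 0} ∩ m ⁻¹' O)) := by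
    ext y
    constructor
    · rintro ⟨x, hx, rfl⟩
      induction x using Quotient.inductionOn with
      | h p =>
      refine ⟨⟨(p.1.1, (starRingEnd ℂ) p.1.2 * ((‖p.1.1‖ ^ (2 * k) : ℝ) : ℂ)), fun h =>
        p.2 (congrArg Prod.fst h)⟩, ⟨p.2, ?_⟩, rfl⟩
      have : p ∈ Subtype.val ⁻¹' O := by rw [hOU]; exact hx
      simp only [Set.mem_preimage]
      rw [hmm _ _ p.2]
      exact this
    · rintro ⟨p, ⟨hp1, hp2⟩, rfl⟩
      have h0 : ((‖p.1.1‖ ^ (2 * k) : ℝ) : ℂ) ≠ 0 := by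
        exact_mod_cast (pow_pos (norm_pos_iff.2 hp1) _).ne'
      refine ⟨LineBundle.mk (m p.1).1 hp1 (m p.1).2, ?_, ?_⟩
      · have : (⟨m p.1, hp1⟩ : {p : Cn n × ℂ // p.1 ≠ 0}) ∈ Subtype.val ⁻¹' O := hp2
        rw [hOU] at this
        exact this
      · rw [compactify_mk]
        refine congrArg (Quotient.mk _) (Subtype.ext (Prod.ext rfl ?_))
        simp only [m, map_div₀, Complex.conj_conj, Complex.conj_ofReal]
        rw [div_mul_cancel₀ _ h0]
  rw [himg]
  exact WeightedProj.isOpenQuotientMap.isOpenMap _ (hop.preimage continuous_subtype_val)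

lemma range_compactify (hk : 1 ≤ k) :
    Set.range (compactify : LineBundle n k → _) = {WeightedProj.infty}ᶜ := by
  ext y
  simp only [Set.mem_range, Set.mem_compl_iff, Set.mem_singleton_iff]
  constructor
  · rintro ⟨x, rfl⟩ h
    induction x using Quotient.inductionOn with
    | h p =>
    obtain ⟨c, hc, h1, -⟩ := Quotient.exact h
    exact p.2 (by simpa [hc] using h1.symm)
  · induction y using Quotient.inductionOn with
    | h p =>
    intro hy
    have hv : p.1.1 ≠ 0 := by
      intro hv
      have hw : p.1.2 ≠ 0 := fun h => p.2 (Prod.ext hv h)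
      obtain ⟨c, hc⟩ := exists_pow_eq hk p.1.2⁻¹
      refine hy (Quotient.sound ⟨c, ?_, by simp [hv], by simp [hc, hw]⟩)
      rintro rfl
      rw [zero_pow (by omega)] at hc
      exact inv_ne_zero hw hc.symm
    have h0 : ((‖p.1.1‖ ^ (2 * k) : ℝ) : ℂ) ≠ 0 := by
      exact_mod_cast (pow_pos (norm_pos_iff.2 hv) _).ne'
    refine ⟨LineBundle.mk p.1.1 hv ((starRingEnd ℂ) p.1.2 / ((‖p.1.1‖ ^ (2 * k) : ℝ) : ℂ)), ?_⟩
    rw [compactify_mk]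
    refine congrArg (Quotient.mk _) (Subtype.ext (Prod.ext rfl ?_))
    simp only [map_div₀, Complex.conj_conj, Complex.conj_ofReal]
    rw [div_mul_cancel₀ _ h0]

lemma compactify_act (A : Cn n ≃ₗᵢ[ℂ] Cn n) (x : LineBundle n k) :
    compactify (LineBundle.act A x) = WeightedProj.act A (compactify x) := by
  induction x using Quotient.inductionOn with
  | h p =>
  refine congrArg (Quotient.mk _) (Subtype.ext (Prod.ext rfl ?_))
  simp

lemma LineBundle.t2Space (hk : 1 ≤ k) : T2Space (LineBundle n k) :=
  haveI := WeightedProj.t2Space (n := n) hk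
  isOpenEmbedding_compactify.isEmbedding.t2Space

end Compactification

/-! ### The metric away from the zero section and its moment map -/

section Momentum

open LineBundle

variable {n k : ℕ}

lemma hasFDerivAt_coordinate (i : Fin n) (z : Cn n) :
    HasFDerivAt (fun y : Cn n => y i) ((EuclideanSpace.proj i : Cn n →L[ℂ] ℂ).restrictScalars ℝ) z :=
  ((EuclideanSpace.proj i : Cn n →L[ℂ] ℂ).restrictScalars ℝ).hasFDerivAt

/-- The coordinates of the point `z^{⊗k}` in the `j`-th standard chart. -/
def vecCoord (k : ℕ) (j : Fin n) (z : Cn n) : Cn n :=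
  WithLp.toLp 2 (fun i => if i = j then z j ^ k else z i / z j)

lemma vecCoord_apply (k : ℕ) (j i : Fin n) (z : Cn n) :
    vecCoord k j z i = if i = j then z j ^ k else z i / z j := rfl

lemma ne_zero_of_apply {j : Fin n} {z : Cn n} (hz : z j ≠ 0) : z ≠ 0 := by
  rintro rfl; exact hz rfl

lemma exists_apply_ne_zero {z : Cn n} (hz : z ≠ 0) : ∃ j, z j ≠ 0 := by
  by_contra! h
  exact hz (by ext i; simpa using h i)

lemma contDiffAt_vecCoord {j : Fin n} {z : Cn n} (hz : z j ≠ 0) :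
    ContDiffAt ℝ ∞ (vecCoord k j) z := by
  refine contDiffAt_piLp (p := 2) |>.2 fun i => ?_
  simp only [vecCoord_apply]
  have h : ∀ m, ContDiffAt ℝ ∞ (fun y : Cn n => y m) z := fun m => by fun_prop
  split_ifs
  · exact (h j).pow k
  · simp only [div_eq_mul_inv]
    exact (h i).mul ((h j).inv hz)

lemma eventually_apply_ne_zero {j : Fin n} {z : Cn n} (hz : z j ≠ 0) : ∀ᶠ y in 𝓝 z, y j ≠ 0 := by
  have : Continuous fun y : Cn n => y j := by fun_prop
  exact this.continuousAt.eventually_ne hz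

/-- The derivative of `vecCoord`, with the quotient `y i / y j` differentiated in the form
`y i = (y i / y j) · y j`. -/
lemma fderiv_vecCoord_apply {j : Fin n} {z : Cn n} (hz : z j ≠ 0) (v : Cn n) :
    (∀ i, i ≠ j → v i = (fderiv ℝ (vecCoord k j) z v) i * z j + z i / z j * v j) ∧
      (fderiv ℝ (vecCoord k j) z v) j = k * z j ^ (k - 1) * v j := by
  have hd := ((contDiffAt_vecCoord (k := k) hz).differentiableAt (by simp)).hasFDerivAt
  have hi : ∀ i, HasFDerivAt (fun y : Cn n => vecCoord k j y i)
      (((EuclideanSpace.proj i : Cn n →L[ℂ] ℂ).restrictScalars ℝ).comp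
        (fderiv ℝ (vecCoord k j) z)) z := fun i =>
    (hasFDerivAt_coordinate i _).comp z hd
  constructor
  · intro i hij
    have h1 := (hi i).mul (hasFDerivAt_coordinate j z)
    have h2 : (fun y : Cn n => vecCoord k j y i * y j) =ᶠ[𝓝 z] fun y => y i := by
      filter_upwards [eventually_apply_ne_zero hz] with y hy
      rw [vecCoord_apply, if_neg hij, div_mul_cancel₀ _ hy]
    have h3 := h1.unique ((hasFDerivAt_coordinate i z).congr_of_eventuallyEq h2)
    have h4 := congrArg (fun L : Cn n →L[ℝ] ℂ => L v) h3
    simp [vecCoord_apply, hij] at h4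
    linear_combination -h4
  · have h1 := (hasFDerivAt_coordinate j z).pow k
    have h2 : (fun y : Cn n => vecCoord k j y j) =ᶠ[𝓝 z] fun y => y j ^ k := by
      filter_upwards with y
      rw [vecCoord_apply, if_pos rfl]
    have h3 := (hi j).unique (h1.congr_of_eventuallyEq h2)
    have h4 := congrArg (fun L : Cn n →L[ℝ] ℂ => L v) h3
    simpa using h4

lemma fderiv_vecCoord_injective (hk : 1 ≤ k) {j : Fin n} {z : Cn n} (hz : z j ≠ 0) :
    Function.Injective (fderiv ℝ (vecCoord k j) z) := by
  refine (injective_iff_map_eq_zero _).2 fun v hv => ?_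
  obtain ⟨h1, h2⟩ := fderiv_vecCoord_apply (k := k) hz v
  have hj : v j = 0 := by
    rw [hv] at h2
    have h3 : (k : ℂ) * z j ^ (k - 1) ≠ 0 :=
      mul_ne_zero (by exact_mod_cast (by omega : k ≠ 0)) (pow_ne_zero _ hz)
    simpa [h3] using h2.symm
  ext i
  by_cases hij : i = j
  · subst hij; simpa using hj
  · have := h1 i hij
    rw [hv, hj] at this
    simpa using this

lemma fderiv_vecCoord_bijective (hk : 1 ≤ k) {j : Fin n} {z : Cn n} (hz : z j ≠ 0) :
    Function.Bijective (fderiv ℝ (vecCoord k j) z) :=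
  bijective_of_injective (fderiv_vecCoord_injective hk hz)

variable [NeZero n]

lemma ofVec_eq_mk {z : Cn n} (hz : z ≠ 0) : (ofVec z : LineBundle n k) = mk z hz 1 := by
  rw [ofVec, dif_pos hz]

lemma coord_ofVec {j : Fin n} {z : Cn n} (hz : z ≠ 0) :
    coord j (ofVec z : LineBundle n k) = vecCoord k j z := by
  rw [ofVec_eq_mk hz]
  ext i
  rw [coord_mk, vecCoord_apply, one_mul]

lemma ofVec_mem_dom {j : Fin n} {z : Cn n} (hz : z ≠ 0) :
    (ofVec z : LineBundle n k) ∈ dom j ↔ z j ≠ 0 := by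
  rw [ofVec_eq_mk hz, mk_mem_dom]

lemma ofVec_eq_param {j : Fin n} {z : Cn n} (hz : z j ≠ 0) :
    (ofVec z : LineBundle n k) = param j (vecCoord k j z) := by
  have h0 := ne_zero_of_apply hz
  rw [← coord_ofVec h0, param_coord ((ofVec_mem_dom h0).2 hz)]

lemma ofVec_eventuallyEq_param {j : Fin n} {z : Cn n} (hz : z j ≠ 0) :
    (ofVec : Cn n → LineBundle n k) =ᶠ[𝓝 z] fun y => param j (vecCoord k j y) := by
  filter_upwards [eventually_apply_ne_zero hz] with y hy using ofVec_eq_param hy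

lemma contMDiffAt_ofVec {z : Cn n} (hz : z ≠ 0) :
    ContMDiffAt 𝓘(ℝ, Cn n) 𝓘(ℝ, Cn n) ∞ (ofVec : Cn n → LineBundle n k) z := by
  obtain ⟨j, hj⟩ := exists_apply_ne_zero hz
  exact contMDiffAt_of_eventuallyEq_param (ofVec_eventuallyEq_param hj) (contDiffAt_vecCoord hj)

lemma dInto_ofVec {j : Fin n} {z : Cn n} (hz : z j ≠ 0) :
    dInto (ofVec : Cn n → LineBundle n k) z
      = (dInto (param (k := k) j) (vecCoord k j z)).comp (fderiv ℝ (vecCoord k j) z) :=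
  dInto_eq_chart (ofVec_eventuallyEq_param hz)
    ((contDiffAt_vecCoord hz).differentiableAt (by simp))

lemma dInto_ofVec_bijective (hk : 1 ≤ k) {z : Cn n} (hz : z ≠ 0) :
    Function.Bijective (dInto (ofVec : Cn n → LineBundle n k) z) := by
  obtain ⟨j, hj⟩ := exists_apply_ne_zero hz
  rw [dInto_ofVec hj]
  exact (dInto_param_bijective j _).comp (fderiv_vecCoord_bijective hk hj)

lemma pullback_ofVec_eq {j : Fin n} {z : Cn n} (hz : z j ≠ 0) (T : TwoTensor n k) :
    pullback ofVec T z = (pullback (param j) T (vecCoord k j z)).bilinearComp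
      (fderiv ℝ (vecCoord k j) z) (fderiv ℝ (vecCoord k j) z) :=
  pullback_eq_chart (ofVec_eventuallyEq_param hz)
    ((contDiffAt_vecCoord hz).differentiableAt (by simp)) T

/-- The Hermitian norm `|w| |v|^k` of `w · v^{⊗k}`. -/
def fiberNorm : LineBundle n k → ℝ :=
  Quotient.lift (fun p : {p : Cn n × ℂ // p.1 ≠ 0} => ‖p.1.2‖ * ‖p.1.1‖ ^ k)
    (by
      rintro p q ⟨c, hc, h1, h2⟩
      simp only [h1, h2, norm_smul, norm_mul, norm_pow, mul_pow]
      ring)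

omit [NeZero n] in
lemma fiberNorm_mk (v : Cn n) (hv : v ≠ 0) (w : ℂ) :
    fiberNorm (mk v hv w : LineBundle n k) = ‖w‖ * ‖v‖ ^ k := rfl

omit [NeZero n] in
lemma fiberNorm_param (j : Fin n) (a : Cn n) :
    fiberNorm (param j a : LineBundle n k) = ‖a j‖ * ‖dehom j a‖ ^ k := rfl

lemma fiberNorm_ofVec {z : Cn n} (hz : z ≠ 0) : fiberNorm (ofVec z : LineBundle n k) = ‖z‖ ^ k := by
  rw [ofVec_eq_mk hz, fiberNorm_mk, norm_one, one_mul]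

omit [NeZero n] in
lemma continuous_fiberNorm : Continuous (fiberNorm : LineBundle n k → ℝ) :=
  continuous_quot_lift _ (by fun_prop)

omit [NeZero n] in
lemma fiberNorm_act (A : Cn n ≃ₗᵢ[ℂ] Cn n) (x : LineBundle n k) :
    fiberNorm (act A x) = fiberNorm x := by
  induction x using Quotient.inductionOn with
  | h p =>
    change ‖p.1.2‖ * ‖A p.1.1‖ ^ k = ‖p.1.2‖ * ‖p.1.1‖ ^ k
    rw [LinearIsometryEquiv.norm_map]

lemma exists_eq_ofVec (hk : 1 ≤ k) {x : LineBundle n k} (hx : fiberNorm x ≠ 0) :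
    ∃ z, z ≠ 0 ∧ x = ofVec z := by
  induction x using Quotient.inductionOn with
  | h p =>
    obtain ⟨⟨v, w⟩, hv⟩ := p
    obtain ⟨c, hc⟩ := exists_pow_eq hk w
    have hc0 : c ≠ 0 := by
      rintro rfl
      apply hx
      change ‖w‖ * ‖v‖ ^ k = 0
      rw [← hc, zero_pow (by omega), norm_zero, zero_mul]
    refine ⟨c • v, smul_ne_zero hc0 hv, ?_⟩
    rw [ofVec_eq_mk (smul_ne_zero hc0 hv)]
    exact LineBundle.mk_eq_mk_iff.2 ⟨c, hc0, rfl, by rw [hc, mul_one]⟩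

lemma exists_param_eq_ofVec (hk : 1 ≤ k) {j : Fin n} {a : Cn n} (ha : a j ≠ 0) :
    ∃ z : Cn n, z j ≠ 0 ∧ a = vecCoord k j z := by
  have h : fiberNorm (param j a : LineBundle n k) ≠ 0 := by
    rw [fiberNorm_param]
    exact mul_ne_zero (norm_ne_zero_iff.2 ha) (pow_ne_zero _ (norm_ne_zero_iff.2 (dehom_ne_zero j a)))
  obtain ⟨z, hz, hz'⟩ := exists_eq_ofVec hk h
  have hzj : z j ≠ 0 := (ofVec_mem_dom (k := k) hz).1 (hz' ▸ param_mem_dom j a)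
  refine ⟨z, hzj, ?_⟩
  rw [← coord_ofVec (k := k) hz, ← hz', coord_param]

omit [NeZero n] in
/-- The disc bundle is the image of the compact set `{|v| = 1, |w| ≤ T}`. -/
lemma isCompact_fiberNorm_le (T : ℝ) : IsCompact {x : LineBundle n k | fiberNorm x ≤ T} := by
  have h1 : IsCompact ((Metric.sphere (0 : Cn n) 1) ×ˢ (Metric.closedBall (0 : ℂ) T)) :=
    (isCompact_sphere 0 1).prod (isCompact_closedBall 0 T)
  have h2 : IsCompact ((Subtype.val : {p : Cn n × ℂ // p.1 ≠ 0} → _) ⁻¹'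
      ((Metric.sphere (0 : Cn n) 1) ×ˢ (Metric.closedBall (0 : ℂ) T))) := by
    refine Topology.IsInducing.subtypeVal.isCompact_preimage' h1 fun x hx => ⟨⟨x, ?_⟩, rfl⟩
    intro h0
    have := hx.1
    rw [h0] at this
    simp at this
  have h3 := h2.image (continuous_quot_mk : Continuous (Quot.mk (bundleSetoid n k)))
  refine h3.of_isClosed_subset (isClosed_le continuous_fiberNorm continuous_const) ?_
  intro x hx
  induction x using Quotient.inductionOn with
  | h p =>
    obtain ⟨⟨v, w⟩, hv⟩ := p
    have hv0 : 0 < ‖v‖ := norm_pos_iff.2 hv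
    have hne : (((‖v‖⁻¹ : ℝ) : ℂ)) ≠ 0 := by simpa using hv
    refine ⟨⟨(((‖v‖⁻¹ : ℝ) : ℂ) • v, ((‖v‖ : ℝ) : ℂ) ^ k * w), smul_ne_zero hne hv⟩, ⟨?_, ?_⟩, ?_⟩
    · simp [norm_smul, hv0.ne']
    · have : ‖w‖ * ‖v‖ ^ k ≤ T := hx
      simpa [mul_comm] using this
    · refine Eq.symm (Quotient.sound ⟨((‖v‖⁻¹ : ℝ) : ℂ), hne, rfl, ?_⟩)
      have : (((‖v‖ : ℝ) : ℂ)) ≠ 0 := by simpa using hv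
      simp only [Complex.ofReal_inv]
      rw [← mul_assoc, ← mul_pow, inv_mul_cancel₀ this, one_pow, one_mul]

omit [NeZero n] in
lemma dense_apply_ne_zero (j : Fin n) : Dense {a : Cn n | a j ≠ 0} := by
  have h : IsOpenMap (fun a : Cn n => a j) :=
    (EuclideanSpace.proj j : Cn n →L[ℂ] ℂ).isOpenMap (fun w => ⟨EuclideanSpace.single j w, by simp⟩)
  exact (dense_compl_singleton (0 : ℂ)).preimage h

omit [NeZero n] in
lemma inner_eq_zero_of_mulI {z w : Cn n} (h : inner ℂ z w = 0) :
    inner ℝ z w = 0 ∧ inner ℝ z (mulI n w) = 0 := by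
  simp [inner_eq_re, mulI_apply, h]

/-- The metric `g` is given off the zero section by `radialMetric p`; if `g` has the Kähler potential
`φ(|z|²)`, then `p = φ'`. -/
structure IsRadial (g : RiemMetric n k) (p : ℝ → ℝ) : Prop where
  smooth : ContDiffOn ℝ ∞ p (Set.Ioi 0)
  metric_eq : ∀ z : Cn n, z ≠ 0 → pullback ofVec g.inner z = radialMetric (mulI n) p z

omit [NeZero n] in
lemma potentialMetric_eq {φ : ℝ → ℝ} {z : Cn n} (hφ : ContDiffOn ℝ ∞ φ (Set.Ioi 0)) (hz : z ≠ 0) :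
    potentialMetric φ z = radialMetric (mulI n) (deriv φ) z := by
  have hat : ∀ r > 0, ContDiffAt ℝ ∞ φ r := fun r hr => hφ.contDiffAt (Ioi_mem_nhds hr)
  have hev : (fderiv ℝ (fun y : Cn n => φ (‖y‖ ^ 2)))
      =ᶠ[𝓝 z] fun y => (2 * deriv φ (‖y‖ ^ 2)) • euclid (Cn n) y := by
    filter_upwards [isOpen_ne.mem_nhds hz] with y hy
    exact (hasFDerivAt_comp_norm_sq (hasDerivAt_of_contDiffAt
      (hat _ (pow_pos (norm_pos_iff.2 hy) 2)))).fderiv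
  have h1 := hasFDerivAt_comp_norm_sq (z := z) (hasDerivAt_of_contDiffAt
    (contDiffAt_deriv (hat _ (pow_pos (norm_pos_iff.2 hz) 2))))
  have h2 : HasFDerivAt (fun y : Cn n => (2 * deriv φ (‖y‖ ^ 2)) • euclid (Cn n) y) _ z :=
    (h1.const_mul 2).smul (euclid (Cn n)).hasFDerivAt
  ext v w
  simp only [potentialMetric, hev.fderiv_eq, h2.fderiv]
  simp [radialMetric_apply, rankOne]
  have h3 : inner ℝ (mulI n v) (mulI n w) = inner ℝ v w := by
    rw [inner_mulI_left, mulI_mulI, inner_neg_right, neg_neg]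
  rw [h3]
  ring

lemma IsInvariantKahlerALE.isRadial {g : RiemMetric n k} {φ : ℝ → ℝ} {τ : ℝ}
    (h : IsInvariantKahlerALE g φ τ) : IsRadial g (deriv φ) where
  smooth := fun r hr =>
    (contDiffAt_deriv (h.smooth_potential.contDiffAt (Ioi_mem_nhds hr))).contDiffWithinAt
  metric_eq z hz := by rw [h.metric_eq z hz, potentialMetric_eq h.smooth_potential hz]

namespace IsRadial

variable {g : RiemMetric n k} {p : ℝ → ℝ} (h : IsRadial g p)
include h

lemma contDiffAt {r : ℝ} (hr : 0 < r) : ContDiffAt ℝ ∞ p r := h.smooth.contDiffAt (Ioi_mem_nhds hr)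

lemma pos (hk : 1 ≤ k) {z v : Cn n} (hz : z ≠ 0) (hv : v ≠ 0) :
    0 < radialMetric (mulI n) p z v v := by
  rw [← h.metric_eq z hz]
  exact pullback_pos g (dInto_ofVec_bijective hk hz).1 hv

/-- The metric is positive on horizontal vectors, where its value is a multiple of `p r`, and on
vertical ones, where it is a multiple of `p r + r p'(r)`. -/
lemma p_pos (hn : 2 ≤ n) (hk : 1 ≤ k) {r : ℝ} (hr : 0 < r) : 0 < p r ∧ 0 < p r + r * deriv p r := by
  let i : Fin n := ⟨0, by omega⟩
  let j : Fin n := ⟨1, by omega⟩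
  have hij : i ≠ j := by simp [i, j]
  have hs : (0 : ℝ) < √r := Real.sqrt_pos.2 hr
  let z : Cn n := EuclideanSpace.single j ((√r : ℝ) : ℂ)
  have hzn : ‖z‖ ^ 2 = r := by
    simp only [z, PiLp.norm_single, Complex.norm_real, Real.norm_eq_abs, sq_abs,
      Real.sq_sqrt hr.le]
  have hz : z ≠ 0 := by
    intro h0
    rw [h0] at hzn
    simp at hzn
    exact hr.ne hzn
  have hw : (EuclideanSpace.single i 1 : Cn n) ≠ 0 := by
    intro h0
    simpa using congrArg (fun v : Cn n => v i) h0
  have horth : inner ℂ z (EuclideanSpace.single i 1 : Cn n) = 0 := by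
    simp [z, EuclideanSpace.inner_single_left, hij.symm]
  obtain ⟨o1, o2⟩ := inner_eq_zero_of_mulI horth
  have h1 := h.pos hk hz hw
  have h2 := h.pos hk hz hz
  have h3 : inner ℝ z (mulI n z) = 0 := inner_self_apply_eq_zero (I := mulI n) inner_mulI_left z
  simp only [radialMetric_apply, hzn, rankOne, o1, o2, h3] at h1 h2
  simp only [real_inner_self_eq_norm_sq, hzn] at h2
  constructor
  · simpa using h1
  · have : 0 < (2 * r) * (p r + r * deriv p r) := by linarith
    exact (pos_iff_pos_of_mul_pos this).1 (by positivity)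

end IsRadial

/-- The squared length of the unit horizontal vector `∂_i` along the fibre over the `j`-th coordinate
line, as a function of the fibre coordinate. -/
def fiberProfile (g : RiemMetric n k) (i j : Fin n) (w : ℂ) : ℝ :=
  pullback (param j) g.inner (EuclideanSpace.single j w) (EuclideanSpace.single i 1)
    (EuclideanSpace.single i 1) / 2

/-- The moment map `𝐳 φ'(𝐳)` of the circle action on the fibres, which extends smoothly over the zero
section, as a function of the norm of a point of the line bundle. The indices are any two different
ones. -/
def momentum (g : RiemMetric n k) (i j : Fin n) (x : LineBundle n k) : ℝ :=
  fiberProfile g i j (fiberNorm x)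

section

variable {g : RiemMetric n k} {p : ℝ → ℝ} {i j : Fin n}

omit [NeZero n] in
lemma contDiff_fiberProfile : ContDiff ℝ ∞ (fiberProfile g i j) := by
  have h1 : ContDiff ℝ ∞ (fun w : ℂ => (EuclideanSpace.single j w : Cn n)) := by
    refine contDiff_piLp (p := 2) |>.2 fun m => ?_
    by_cases hm : m = j
    · subst hm; simpa using contDiff_fun_id
    · simpa [hm] using contDiff_const
  exact ((((contDiff_pullback_param g j).comp h1).clm_apply contDiff_const).clm_apply
    contDiff_const).div_const 2

omit [NeZero n] in
lemma fiberProfile_pos (w : ℂ) : 0 < fiberProfile g i j w := by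
  refine div_pos (pullback_pos g (dInto_param_injective j _) fun h0 => ?_) two_pos
  simpa using congrArg (fun v : Cn n => v i) h0

lemma IsRadial.fiberProfile_pow (h : IsRadial g p) (hij : i ≠ j) {c : ℂ} (hc : c ≠ 0) :
    fiberProfile g i j (c ^ k) = ‖c‖ ^ 2 * p (‖c‖ ^ 2) := by
  let z : Cn n := EuclideanSpace.single j c
  have hzj : z j ≠ 0 := by simpa [z] using hc
  have hz : z ≠ 0 := ne_zero_of_apply hzj
  have hco : vecCoord k j z = EuclideanSpace.single j (c ^ k) := by
    ext m
    by_cases hm : m = j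
    · subst hm; simp [vecCoord_apply, z]
    · simp [vecCoord_apply, z, hm]
  have hD : fderiv ℝ (vecCoord k j) z (EuclideanSpace.single i c) = EuclideanSpace.single i 1 := by
    obtain ⟨h1, h2⟩ := fderiv_vecCoord_apply (k := k) hzj (EuclideanSpace.single i c)
    ext m
    by_cases hm : m = j
    · subst hm; rw [h2]; simp [hij, hij.symm]
    · have h3 := h1 m hm
      apply mul_right_cancel₀ hzj
      by_cases hmi : m = i
      · subst hmi; simp [z, hm] at h3 ⊢; exact h3.symm
      · simp [z, hm, hmi, hc] at h3 ⊢; exact h3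
  have h1 := h.metric_eq z hz
  rw [pullback_ofVec_eq hzj] at h1
  have h2 := congrArg (fun L : Cn n →L[ℝ] Cn n →L[ℝ] ℝ =>
    L (EuclideanSpace.single i c) (EuclideanSpace.single i c)) h1
  simp only [ContinuousLinearMap.bilinearComp_apply, hD, hco] at h2
  have horth : inner ℂ z (EuclideanSpace.single i c : Cn n) = 0 := by
    simp [z, EuclideanSpace.inner_single_left, hij.symm]
  obtain ⟨o1, o2⟩ := inner_eq_zero_of_mulI horth
  rw [fiberProfile, h2, radialMetric_apply, rankOne, o1, o2, real_inner_self_eq_norm_sq]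
  simp only [z, PiLp.norm_single]
  ring

lemma IsRadial.fiberProfile_norm (h : IsRadial g p) (hk : 1 ≤ k) (hij : i ≠ j) (w : ℂ) :
    fiberProfile g i j (‖w‖ : ℂ) = fiberProfile g i j w := by
  by_cases hw : w = 0
  · simp [hw]
  obtain ⟨c, rfl⟩ := exists_pow_eq hk w
  have hc : c ≠ 0 := by
    rintro rfl
    exact hw (zero_pow (by omega))
  rw [h.fiberProfile_pow hij hc, norm_pow, Complex.ofReal_pow,
    h.fiberProfile_pow hij (by simpa using hc)]
  simp

/-- Off the zero section the moment map is `𝐳 p(𝐳)`. -/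
lemma IsRadial.momentum_ofVec (h : IsRadial g p) (hij : i ≠ j) {z : Cn n} (hz : z ≠ 0) :
    momentum g i j (ofVec z) = ‖z‖ ^ 2 * p (‖z‖ ^ 2) := by
  rw [momentum, fiberNorm_ofVec hz, Complex.ofReal_pow,
    h.fiberProfile_pow hij (by simpa using hz)]
  simp

omit [NeZero n] in
lemma momentum_pos (x : LineBundle n k) : 0 < momentum g i j x := fiberProfile_pos _

omit [NeZero n] in
lemma momentum_act (A : Cn n ≃ₗᵢ[ℂ] Cn n) (x : LineBundle n k) :
    momentum g i j (act A x) = momentum g i j x := by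
  rw [momentum, momentum, fiberNorm_act]

omit [NeZero n] in
lemma contDiff_dehom (l : Fin n) : ContDiff ℝ ∞ (dehom l : Cn n → Cn n) := by
  refine contDiff_piLp (p := 2) |>.2 fun m => ?_
  simp only [dehom]
  split_ifs <;> fun_prop

/-- The moment map is smooth over the zero section: the profile `fiberProfile` is smooth and depends
only on the modulus of the fibre coordinate, so that in a chart the norm `|w| |v|^k` may be replaced by
the smooth function `a j * ‖dehom j a‖ ^ k`. -/
lemma IsRadial.contMDiff_momentum (h : IsRadial g p) (hk : 1 ≤ k) (hij : i ≠ j) :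
    ContMDiff 𝓘(ℝ, Cn n) 𝓘(ℝ, ℝ) ∞ (momentum g i j) := by
  intro x
  obtain ⟨l, hl⟩ := exists_mem_dom x
  have h1 : ∀ a : Cn n, momentum g i j (param l a)
      = fiberProfile g i j (a l * ((‖dehom l a‖ ^ k : ℝ) : ℂ)) := by
    intro a
    rw [momentum, ← h.fiberProfile_norm hk hij (a l * _), fiberNorm_param]
    simp
  have h2 : ContDiff ℝ ∞ (fun a : Cn n => fiberProfile g i j (a l * ((‖dehom l a‖ ^ k : ℝ) : ℂ))) := by
    refine contDiff_fiberProfile.comp (ContDiff.mul (by fun_prop) ?_)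
    refine Complex.ofRealCLM.contDiff.comp (ContDiff.pow ?_ k)
    exact (contDiff_dehom l).norm ℝ (dehom_ne_zero l)
  refine (h2.contMDiff.contMDiffAt.comp x (contMDiffAt_coord hl)).congr_of_eventuallyEq ?_
  filter_upwards [(isOpen_dom l).mem_nhds hl] with y hy
  change _ = fiberProfile g i j (coord l y l * ((‖dehom l (coord l y)‖ ^ k : ℝ) : ℂ))
  rw [← h1, param_coord hy]

end

end Momentum

/-! ### The second complex structure -/

section SecondStructure

open LineBundle

variable {n k : ℕ}

/-- The real derivative of a holomorphic map commutes with multiplication by `i`. -/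
lemma fderiv_mulI {f : Cn n → Cn n} {b : Cn n} (hf : DifferentiableAt ℂ f b) (v : Cn n) :
    fderiv ℝ f b (mulI n v) = mulI n (fderiv ℝ f b v) := by
  rw [(hf.hasFDerivAt.restrictScalars ℝ).fderiv]
  simp [mulI_apply]

/-- The `l`-th homogeneous coordinate of `A v`, and the fibre coordinate `w`, in the `j`-th affine
coordinates `b` of `[v : w]`. -/
def projTransition (k : ℕ) (A : Cn n ≃ₗᵢ[ℂ] Cn n) (j l : Fin n) (b : Cn n) : Cn n :=
  WithLp.toLp 2 (fun i => if i = l then b j / A (dehom j b) l ^ k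
    else A (dehom j b) i / A (dehom j b) l)

lemma differentiable_dehom_apply (A : Cn n ≃ₗᵢ[ℂ] Cn n) (j i : Fin n) :
    Differentiable ℂ (fun b : Cn n => A (dehom j b) i) := by
  have h1 : Differentiable ℂ (dehom j : Cn n → Cn n) := by
    refine differentiable_euclidean.2 fun m => ?_
    simp only [dehom]
    split_ifs <;> fun_prop
  have h2 : Differentiable ℂ (fun b : Cn n => A (dehom j b)) :=
    A.toContinuousLinearEquiv.differentiable.comp h1
  exact differentiable_euclidean.1 h2 i

lemma differentiableAt_projTransition {A : Cn n ≃ₗᵢ[ℂ] Cn n} {j l : Fin n} {b : Cn n}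
    (hb : A (dehom j b) l ≠ 0) : DifferentiableAt ℂ (projTransition k A j l) b := by
  refine differentiableAt_euclidean.2 fun i => ?_
  simp only [projTransition]
  have h := fun i => differentiable_dehom_apply A j i b
  split_ifs
  · simp only [div_eq_mul_inv]
    exact DifferentiableAt.mul (by fun_prop) (((h l).fun_pow k).fun_inv (pow_ne_zero _ hb))
  · simp only [div_eq_mul_inv]
    exact (h i).mul ((h l).fun_inv hb)

/-- The affine coordinates on the weighted projective space, pulled back by `compactify`. -/
def projCoord (j : Fin n) (x : LineBundle n k) : Cn n := WeightedProj.coord j (compactify x)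

/-- The map `compactify` in the `j`-th affine coordinates. -/
def compactifyChart (k : ℕ) (j : Fin n) (a : Cn n) : Cn n :=
  WithLp.toLp 2 (fun i => if i = j then (starRingEnd ℂ) (a j) * (((‖dehom j a‖ ^ (2 * k) : ℝ) : ℂ))
    else a i)

/-- The inverse of `compactifyChart`. -/
def compactifyChartInv (k : ℕ) (j : Fin n) (a : Cn n) : Cn n :=
  WithLp.toLp 2 (fun i => if i = j then (starRingEnd ℂ) (a j) / (((‖dehom j a‖ ^ (2 * k) : ℝ) : ℂ))
    else a i)

lemma dehom_congr {j : Fin n} {a b : Cn n} (h : ∀ i, i ≠ j → a i = b i) : dehom j a = dehom j b := by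
  ext i
  by_cases hi : i = j
  · subst hi; simp [dehom]
  · simp [dehom, hi, h i hi]

lemma norm_dehom_pow_ne_zero (m : ℕ) (j : Fin n) (a : Cn n) : ((‖dehom j a‖ ^ m : ℝ) : ℂ) ≠ 0 := by
  exact_mod_cast (pow_pos (norm_pos_iff.2 (dehom_ne_zero j a)) m).ne'

lemma compactifyChartInv_compactifyChart (j : Fin n) (a : Cn n) :
    compactifyChartInv k j (compactifyChart k j a) = a := by
  have hd : dehom j (compactifyChart k j a) = dehom j a :=
    dehom_congr fun i hi => by simp [compactifyChart, hi]
  ext i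
  by_cases hi : i = j
  · subst hi
    have h := norm_dehom_pow_ne_zero (2 * k) i a
    simp only [compactifyChartInv, if_pos, hd]
    simp only [compactifyChart, if_pos, map_mul, Complex.conj_conj, Complex.conj_ofReal]
    exact mul_div_cancel_right₀ _ h
  · simp [compactifyChartInv, compactifyChart, hi]

lemma contDiff_conj_apply (j : Fin n) : ContDiff ℝ ∞ (fun a : Cn n => (starRingEnd ℂ) (a j)) :=
  Complex.conjCLE.contDiff.comp
    ((EuclideanSpace.proj j : Cn n →L[ℂ] ℂ).restrictScalars ℝ).contDiff

lemma contDiff_norm_dehom_pow (m : ℕ) (j : Fin n) :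
    ContDiff ℝ ∞ (fun a : Cn n => ((‖dehom j a‖ ^ m : ℝ) : ℂ)) :=
  Complex.ofRealCLM.contDiff.comp (((contDiff_dehom j).norm ℝ (dehom_ne_zero j)).pow m)

lemma contDiff_compactifyChart (j : Fin n) : ContDiff ℝ ∞ (compactifyChart k j) := by
  refine contDiff_piLp (p := 2) |>.2 fun i => ?_
  simp only [compactifyChart]
  split_ifs
  · exact (contDiff_conj_apply j).mul (contDiff_norm_dehom_pow (2 * k) j)
  · fun_prop

lemma contDiff_compactifyChartInv (j : Fin n) : ContDiff ℝ ∞ (compactifyChartInv k j) := by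
  refine contDiff_piLp (p := 2) |>.2 fun i => ?_
  simp only [compactifyChartInv]
  split_ifs
  · simp only [div_eq_mul_inv]
    exact (contDiff_conj_apply j).mul
      ((contDiff_norm_dehom_pow (2 * k) j).inv fun a => norm_dehom_pow_ne_zero _ j a)
  · fun_prop

/-- A differentiable map with a differentiable left inverse has an injective derivative. -/
lemma fderiv_injective_of_leftInverse {V W : Type*} [NormedAddCommGroup V] [NormedSpace ℝ V]
    [NormedAddCommGroup W] [NormedSpace ℝ W] {f : V → W} {f' : W → V} {a : V}
    (hf : DifferentiableAt ℝ f a) (hf' : DifferentiableAt ℝ f' (f a))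
    (h : (fun x => f' (f x)) =ᶠ[𝓝 a] fun x => x) : Function.Injective (fderiv ℝ f a) := by
  have h1 : fderiv ℝ (fun x => f' (f x)) a = ContinuousLinearMap.id ℝ V :=
    h.fderiv_eq.trans fderiv_fun_id
  have h2 : fderiv ℝ (fun x => f' (f x)) a = (fderiv ℝ f' (f a)).comp (fderiv ℝ f a) :=
    fderiv_comp a hf' hf
  rw [h2] at h1
  intro v w hvw
  have e1 := congrArg (fun L : V →L[ℝ] V => L v) h1
  have e2 := congrArg (fun L : V →L[ℝ] V => L w) h1
  simp only [ContinuousLinearMap.comp_apply, ContinuousLinearMap.id_apply] at e1 e2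
  rw [← e1, ← e2, hvw]

lemma fderiv_compactifyChart_bijective (j : Fin n) (a : Cn n) :
    Function.Bijective (fderiv ℝ (compactifyChart k j) a) :=
  bijective_of_injective (fderiv_injective_of_leftInverse
    ((contDiff_compactifyChart j).differentiable (by simp) _)
    ((contDiff_compactifyChartInv j).differentiable (by simp) _)
    (Filter.Eventually.of_forall (compactifyChartInv_compactifyChart j)))

lemma projCoord_mk (j i : Fin n) (v : Cn n) (hv : v ≠ 0) (w : ℂ) :
    projCoord j (mk v hv w : LineBundle n k) i
      = if i = j then (starRingEnd ℂ) w * ((‖v‖ ^ (2 * k) : ℝ) : ℂ) / v j ^ k else v i / v j := rfl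

lemma projCoord_param (j : Fin n) (a : Cn n) :
    projCoord j (param j a : LineBundle n k) = compactifyChart k j a := by
  ext i
  rw [param, projCoord_mk]
  by_cases hi : i = j
  · subst hi; simp [compactifyChart, dehom]
  · simp [compactifyChart, dehom, hi]

lemma projCoord_eventuallyEq {j : Fin n} {x : LineBundle n k} (hx : x ∈ dom j) :
    (projCoord j : LineBundle n k → Cn n) =ᶠ[𝓝 x] fun y => compactifyChart k j (coord j y) := by
  filter_upwards [(isOpen_dom j).mem_nhds hx] with y hy
  rw [← projCoord_param, param_coord hy]

lemma contMDiffAt_projCoord {j : Fin n} {x : LineBundle n k} (hx : x ∈ dom j) :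
    ContMDiffAt 𝓘(ℝ, Cn n) 𝓘(ℝ, Cn n) ∞ (projCoord j : LineBundle n k → Cn n) x :=
  ((contDiff_compactifyChart j).contMDiff.contMDiffAt.comp x
    (contMDiffAt_coord hx)).congr_of_eventuallyEq (projCoord_eventuallyEq hx)

/-- Chain rule for maps out of the total space. -/
lemma dOut_comp {V W : Type*} [NormedAddCommGroup V] [NormedSpace ℝ V] [NormedAddCommGroup W]
    [NormedSpace ℝ W] {ψ : LineBundle n k → V} {f : V → W} {x : LineBundle n k}
    (hf : DifferentiableAt ℝ f (ψ x)) (hψ : MDifferentiableAt 𝓘(ℝ, Cn n) 𝓘(ℝ, V) ψ x) :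
    dOut (fun y => f (ψ y)) x = (fderiv ℝ f (ψ x)).comp (dOut ψ x) := by
  rw [← mfderiv_eq_fderiv]
  exact mfderiv_comp x hf.mdifferentiableAt hψ

lemma dOut_coord_bijective {j : Fin n} {x : LineBundle n k} (hx : x ∈ dom j) :
    Function.Bijective (dOut (coord j) x) := by
  obtain ⟨a, rfl⟩ := hx
  have h := dOut_coord_comp_dInto_param (k := k) j a
  have hs : Function.Surjective (dOut (coord j) (param j a : LineBundle n k)) := fun v =>
    ⟨dInto (param (k := k) j) a v, congrArg (fun L : Cn n →L[ℝ] Cn n => L v) h⟩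
  exact ⟨LinearMap.injective_iff_surjective
    (f := (dOut (coord j) (param j a : LineBundle n k) : Cn n →ₗ[ℝ] Cn n)).2 hs, hs⟩

lemma dOut_projCoord {j : Fin n} {x : LineBundle n k} (hx : x ∈ dom j) :
    dOut (projCoord j) x
      = (fderiv ℝ (compactifyChart k j) (coord j x)).comp (dOut (coord j) x) := by
  rw [dOut_congr (projCoord_eventuallyEq hx)]
  exact dOut_comp ((contDiff_compactifyChart j).differentiable (by simp) _)
    (mdiffAt (contMDiffAt_coord hx))

lemma dOut_projCoord_bijective {j : Fin n} {x : LineBundle n k} (hx : x ∈ dom j) :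
    Function.Bijective (dOut (projCoord j) x) := by
  rw [dOut_projCoord hx]
  exact (fderiv_compactifyChart_bijective j _).comp (dOut_coord_bijective hx)

lemma projCoord_act (A : Cn n ≃ₗᵢ[ℂ] Cn n) {j l : Fin n} {y : LineBundle n k} (hy : y ∈ dom j) :
    projCoord l (act A y) = projTransition k A j l (projCoord j y) := by
  obtain ⟨a, rfl⟩ := hy
  have hd : dehom j (compactifyChart k j a) = dehom j a :=
    dehom_congr fun i hi => by simp [compactifyChart, hi]
  rw [projCoord_param]
  change projCoord l (mk (A (dehom j a)) _ (a j)) = _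
  ext i
  rw [projCoord_mk]
  simp only [projTransition, hd]
  split_ifs with h
  · simp [compactifyChart]
  · rfl

lemma act_mem_dom {A : Cn n ≃ₗᵢ[ℂ] Cn n} {j l : Fin n} {a : Cn n} :
    act A (param j a : LineBundle n k) ∈ dom l ↔ A (dehom j a) l ≠ 0 := by
  change (mk (A (dehom j a)) _ (a j) : LineBundle n k) ∈ dom l ↔ _
  rw [mk_mem_dom]

lemma continuous_act (A : Cn n ≃ₗᵢ[ℂ] Cn n) : Continuous (act A : LineBundle n k → _) := by
  refine continuous_quot_lift _ (continuous_quot_mk.comp (Continuous.subtype_mk ?_ _))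
  exact (A.continuous.comp (by fun_prop)).prodMk (by fun_prop)

/-- The map `act A` between two standard charts. -/
def actChart (k : ℕ) (A : Cn n ≃ₗᵢ[ℂ] Cn n) (j l : Fin n) (a : Cn n) : Cn n :=
  WithLp.toLp 2 (fun i => if i = l then a j * A (dehom j a) l ^ k
    else A (dehom j a) i / A (dehom j a) l)

lemma contDiffAt_actChart {A : Cn n ≃ₗᵢ[ℂ] Cn n} {j l : Fin n} {a : Cn n}
    (ha : A (dehom j a) l ≠ 0) : ContDiffAt ℝ ∞ (actChart k A j l) a := by
  have h : ∀ i, ContDiff ℝ ∞ (fun b : Cn n => A (dehom j b) i) := fun i =>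
    ((EuclideanSpace.proj i : Cn n →L[ℂ] ℂ).restrictScalars ℝ).contDiff.comp
      ((A.toContinuousLinearEquiv.contDiff.restrict_scalars ℝ).comp (contDiff_dehom j))
  refine contDiffAt_piLp (p := 2) |>.2 fun i => ?_
  simp only [actChart]
  split_ifs
  · exact ContDiffAt.mul (by fun_prop) ((h l).contDiffAt.pow k)
  · simp only [div_eq_mul_inv]
    exact (h i).contDiffAt.mul ((h l).contDiffAt.inv ha)

lemma contMDiff_act (A : Cn n ≃ₗᵢ[ℂ] Cn n) :
    ContMDiff 𝓘(ℝ, Cn n) 𝓘(ℝ, Cn n) ∞ (act A : LineBundle n k → LineBundle n k) := by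
  intro x
  obtain ⟨j, hj⟩ := exists_mem_dom x
  obtain ⟨l, hl⟩ := exists_mem_dom (act A x)
  have hne : A (dehom j (coord j x)) l ≠ 0 := by
    rw [← act_mem_dom (k := k), param_coord hj]; exact hl
  have h1 := (contDiffAt_actChart (k := k) hne).contMDiffAt.comp x (contMDiffAt_coord hj)
  refine ((contMDiff_param l _).comp x h1).congr_of_eventuallyEq ?_
  filter_upwards [(isOpen_dom j).mem_nhds hj,
    (continuous_act A).continuousAt.preimage_mem_nhds ((isOpen_dom l).mem_nhds hl)] with y hy hy'
  obtain ⟨a, rfl⟩ := hy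
  change _ = param l (actChart k A j l (coord j (param j a : LineBundle n k)))
  rw [coord_param, ← param_coord (x := act A (param j a)) hy']
  congr 1

lemma act_refl (x : LineBundle n k) : act (LinearIsometryEquiv.refl ℂ (Cn n)) x = x := by
  induction x using Quotient.inductionOn with
  | h p => rfl

/-- The derivatives of the holomorphic coordinates of `A · x`. -/
lemma dOut_projCoord_act (A : Cn n ≃ₗᵢ[ℂ] Cn n) {j l : Fin n} {x : LineBundle n k} (hj : x ∈ dom j)
    (hl : act A x ∈ dom l) :
    (dOut (projCoord l) (act A x)).comp (mfderiv 𝓘(ℝ, Cn n) 𝓘(ℝ, Cn n) (act A) x)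
      = (fderiv ℝ (projTransition k A j l) (projCoord j x)).comp (dOut (projCoord j) x) ∧
    DifferentiableAt ℂ (projTransition k A j l) (projCoord j x) := by
  have hd : DifferentiableAt ℂ (projTransition k A j l) (projCoord j x) := by
    apply differentiableAt_projTransition
    obtain ⟨a, rfl⟩ := hj
    have hd : dehom j (compactifyChart k j a) = dehom j a :=
      dehom_congr fun i hi => by simp [compactifyChart, hi]
    rw [projCoord_param, hd, ← act_mem_dom (k := k)]
    exact hl
  refine ⟨?_, hd⟩
  have h1 : dOut (fun y => projCoord l (act A y)) x
      = (dOut (projCoord l) (act A x)).comp (mfderiv 𝓘(ℝ, Cn n) 𝓘(ℝ, Cn n) (act A) x) :=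
    mfderiv_comp x (mdiffAt (contMDiffAt_projCoord hl)) (mdiffAt (contMDiff_act A x))
  rw [← h1, ← dOut_comp (hd.restrictScalars ℝ) (mdiffAt (contMDiffAt_projCoord hj))]
  refine dOut_congr ?_
  filter_upwards [(isOpen_dom j).mem_nhds hj] with y hy using projCoord_act A hy

/-- A field of endomorphisms at a point, as an endomorphism of the model space. -/
def endAt (J : EndField n k) (x : LineBundle n k) : Cn n →L[ℝ] Cn n := J x

/-- The complex structure pulled back from the weighted projective space by `compactify`. -/
def conjFiberJ : EndField n k := fun x =>
  let D : Cn n →L[ℝ] Cn n := dOut (projCoord (exists_mem_dom x).choose) x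
  (D.inverse.comp ((mulI n).comp D) : Cn n →L[ℝ] Cn n)

lemma inverse_apply_of_bijective {D : Cn n →L[ℝ] Cn n} (hD : Function.Bijective D) (v : Cn n) :
    D (D.inverse v) = v ∧ D.inverse (D v) = v := by
  let e : Cn n ≃L[ℝ] Cn n := ContinuousLinearEquiv.ofBijective D
    (LinearMap.ker_eq_bot.2 hD.1) (LinearMap.range_eq_top.2 hD.2)
  have he : (e : Cn n →L[ℝ] Cn n) = D := ContinuousLinearEquiv.coe_ofBijective D _ _
  rw [← he, ContinuousLinearMap.inverse_equiv]
  exact ⟨e.apply_symm_apply v, e.symm_apply_apply v⟩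

/-- The coordinates `projCoord` are holomorphic for `conjFiberJ`. -/
lemma dOut_projCoord_conjFiberJ {j : Fin n} {x : LineBundle n k} (hj : x ∈ dom j) (w : Cn n) :
    dOut (projCoord j) x (endAt conjFiberJ x w) = mulI n (dOut (projCoord j) x w) := by
  have hl := (exists_mem_dom x).choose_spec
  set l := (exists_mem_dom x).choose
  obtain ⟨h1, h2⟩ := dOut_projCoord_act (LinearIsometryEquiv.refl ℂ (Cn n)) (j := l) (l := j) hl
    (by rw [act_refl]; exact hj)
  have hid : (act (LinearIsometryEquiv.refl ℂ (Cn n)) : LineBundle n k → _) = id :=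
    funext act_refl
  have h3 : dOut (projCoord j) x = (fderiv ℝ (projTransition k (LinearIsometryEquiv.refl ℂ (Cn n))
      l j) (projCoord l x)).comp (dOut (projCoord l) x) := by
    rw [← h1, hid, mfderiv_id]
    rfl
  rw [h3]
  simp only [ContinuousLinearMap.comp_apply]
  rw [← fderiv_mulI h2]
  exact congrArg _ (inverse_apply_of_bijective (dOut_projCoord_bijective hl) _).1

/-- The affine coordinates `projCoord` are holomorphic charts for `conjFiberJ`. -/
lemma isComplexStructure_conjFiberJ : IsComplexStructure (conjFiberJ : EndField n k) where
  sq x := by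
    obtain ⟨j, hj⟩ := exists_mem_dom x
    refine ContinuousLinearMap.ext fun (w : Cn n) => ?_
    apply (dOut_projCoord_bijective hj).1
    change dOut (projCoord j) x (endAt conjFiberJ x (endAt conjFiberJ x w)) = dOut (projCoord j) x (-w)
    rw [dOut_projCoord_conjFiberJ hj, dOut_projCoord_conjFiberJ hj, mulI_mulI, map_neg]
  integrable x := by
    obtain ⟨j, hj⟩ := exists_mem_dom x
    exact ⟨dom j, projCoord j, isOpen_dom j, hj,
      fun y hy => (contMDiffAt_projCoord hy).contMDiffWithinAt,
      fun y hy => ⟨dOut_projCoord_bijective hy, dOut_projCoord_conjFiberJ hy⟩⟩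

lemma conjFiberJ_act (A : Cn n ≃ₗᵢ[ℂ] Cn n) (x : LineBundle n k) (w : Tan x) :
    mfderiv 𝓘(ℝ, Cn n) 𝓘(ℝ, Cn n) (act A) x (conjFiberJ x w)
      = conjFiberJ (act A x) (mfderiv 𝓘(ℝ, Cn n) 𝓘(ℝ, Cn n) (act A) x w) := by
  obtain ⟨j, hj⟩ := exists_mem_dom x
  obtain ⟨l, hl⟩ := exists_mem_dom (act A x)
  obtain ⟨h1, h2⟩ := dOut_projCoord_act A hj hl
  have h3 : ∀ w : Cn n, dOut (projCoord l) (act A x) (mfderiv 𝓘(ℝ, Cn n) 𝓘(ℝ, Cn n) (act A) x w)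
      = fderiv ℝ (projTransition k A j l) (projCoord j x) (dOut (projCoord j) x w) := fun w =>
    congrArg (fun L : Cn n →L[ℝ] Cn n => L w) h1
  apply (dOut_projCoord_bijective hl).1
  refine (h3 _).trans ?_
  refine Eq.trans ?_ (dOut_projCoord_conjFiberJ hl _).symm
  refine Eq.trans (congrArg _ (dOut_projCoord_conjFiberJ hj w)) ?_
  rw [fderiv_mulI h2]
  exact congrArg (mulI n) (h3 w).symm

/-- The standard charts are holomorphic for the standard complex structure. -/
lemma dOut_coord_stdJ {j : Fin n} {x : LineBundle n k} (hj : x ∈ dom j) (w : Cn n) :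
    dOut (coord j) x (endAt stdJ x w) = mulI n (dOut (coord j) x w) := by
  have hl := (exists_mem_dom x).choose_spec
  set l := (exists_mem_dom x).choose with hl_def
  have hD : dOut (coord j) x = fderiv ℝ (fun a => coord j (param l a : LineBundle n k))
      (coord l x) := by
    have h1 := mdiffAt (contMDiffAt_coord hj)
    unfold dOut
    rw [h1.mfderiv]
    change fderivWithin ℝ (fun a => coord j (param l a : LineBundle n k)) (Set.range id)
      (coord l x) = _
    rw [Set.range_id, fderivWithin_univ]
  have hne : dehom l (coord l x) j ≠ 0 := by
    rw [← mk_mem_dom (k := k) j _ (dehom_ne_zero l _) (coord l x l)]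
    change param l (coord l x) ∈ dom j
    rw [param_coord hl]; exact hj
  have hd : DifferentiableAt ℂ (fun a => coord j (param l a : LineBundle n k)) (coord l x) := by
    have hop : IsOpen {a : Cn n | dehom l a j ≠ 0} :=
      isOpen_ne_fun ((EuclideanSpace.proj j : Cn n →L[ℂ] ℂ).continuous.comp
        (continuous_dehom (n := n) l)) continuous_const
    exact ((contDiffOn_transition (k := k) l j).contDiffAt (hop.mem_nhds hne)).differentiableAt
      (by simp)
  rw [hD]
  exact fderiv_mulI hd w

/-- The fibre direction at `a`. -/
lemma fderiv_compactifyChart_fiber (j : Fin n) (a : Cn n) (c : ℂ) :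
    fderiv ℝ (compactifyChart k j) a (EuclideanSpace.single j c) j
      = (starRingEnd ℂ) c * ((‖dehom j a‖ ^ (2 * k) : ℝ) : ℂ) := by
  have h1 := ((contDiff_compactifyChart (k := k) j).differentiable (by simp) a).hasFDerivAt
  have h2 := (hasFDerivAt_coordinate j _).comp a h1
  have h3 : HasDerivAt (fun t : ℝ => a + t • (EuclideanSpace.single j c : Cn n))
      (EuclideanSpace.single j c) 0 := by
    simpa using ((hasDerivAt_id (0 : ℝ)).smul_const (EuclideanSpace.single j c : Cn n)).const_add a
  have h4 := HasFDerivAt.comp_hasDerivAt (x := (0 : ℝ)) (f := fun t : ℝ =>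
    a + t • (EuclideanSpace.single j c : Cn n)) (l := fun y => compactifyChart k j y j)
    (by rw [zero_smul, add_zero]; exact h2) h3
  have h5 : ((fun y => compactifyChart k j y j) ∘ fun t : ℝ =>
      a + t • (EuclideanSpace.single j c : Cn n)) = fun t : ℝ =>
        ((starRingEnd ℂ) (a j) + (t : ℂ) * (starRingEnd ℂ) c)
          * ((‖dehom j a‖ ^ (2 * k) : ℝ) : ℂ) := by
    funext t
    have hd : dehom j (a + t • (EuclideanSpace.single j c : Cn n)) = dehom j a :=
      dehom_congr fun i hi => by simp [hi]
    simp [compactifyChart, hd]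
  have h6 : HasDerivAt (fun t : ℝ => ((starRingEnd ℂ) (a j) + (t : ℂ) * (starRingEnd ℂ) c)
          * ((‖dehom j a‖ ^ (2 * k) : ℝ) : ℂ))
      ((starRingEnd ℂ) c * ((‖dehom j a‖ ^ (2 * k) : ℝ) : ℂ)) 0 := by
    have := ((Complex.ofRealCLM.hasDerivAt (x := (0 : ℝ))).mul_const
      ((starRingEnd ℂ) c)).const_add ((starRingEnd ℂ) (a j))
    simpa using this.mul_const ((‖dehom j a‖ ^ (2 * k) : ℝ) : ℂ)
  rw [h5] at h4
  exact h4.unique h6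

lemma fderiv_compactifyChart_base {j i : Fin n} (hi : i ≠ j) (a v : Cn n) :
    fderiv ℝ (compactifyChart k j) a v i = v i := by
  have h1 := ((contDiff_compactifyChart (k := k) j).differentiable (by simp) a).hasFDerivAt
  have h2 := (hasFDerivAt_coordinate i _).comp a h1
  have h3 : (fun y : Cn n => y i) ∘ compactifyChart k j = fun y => y i := by
    funext y; simp [compactifyChart, hi]
  rw [h3] at h2
  exact congrArg (fun L : Cn n →L[ℝ] ℂ => L v) (h2.unique (hasFDerivAt_coordinate i a))

/-- On vertical vectors the second structure is the opposite of the standard one, on the quotient by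
the vertical vectors the two agree. -/
lemma conjFiberJ_ne (hn : 2 ≤ n) (x : LineBundle n k) :
    conjFiberJ x ≠ stdJ x ∧ conjFiberJ x ≠ -stdJ x := by
  obtain ⟨j, hj⟩ := exists_mem_dom x
  obtain ⟨i, hi⟩ : ∃ i : Fin n, i ≠ j := by
    have : Nontrivial (Fin n) := Fin.nontrivial_iff_two_le.2 hn
    exact exists_ne j
  set a := coord j x
  -- both structures in the standard chart
  have key : ∀ ε : ℝ, (∀ w : Cn n, endAt conjFiberJ x w = ε • endAt stdJ x w) → ∀ v : Cn n,
      ε • fderiv ℝ (compactifyChart k j) a (mulI n v)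
        = mulI n (fderiv ℝ (compactifyChart k j) a v) := by
    intro ε hε v
    obtain ⟨w, rfl⟩ := (dOut_coord_bijective hj).2 v
    have h1 := dOut_projCoord_conjFiberJ hj w
    rw [hε w, map_smul, dOut_projCoord hj] at h1
    simp only [ContinuousLinearMap.comp_apply] at h1
    rw [dOut_coord_stdJ hj] at h1
    exact h1
  constructor
  · intro h
    have h1 := congrArg (fun u : Cn n => u j) (key 1 (fun w => by rw [endAt, h, one_smul]; rfl)
      (EuclideanSpace.single j 1))
    have h2 : mulI n (EuclideanSpace.single j 1) = EuclideanSpace.single j Complex.I := by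
      ext m
      by_cases hm : m = j
      · subst hm; simp [mulI_apply]
      · simp [mulI_apply, hm]
    simp only [one_smul, h2, mulI_apply, PiLp.smul_apply, fderiv_compactifyChart_fiber, smul_eq_mul,
      Complex.conj_I, map_one, one_mul] at h1
    have h3 := mul_right_cancel₀ (norm_dehom_pow_ne_zero (2 * k) j a) h1
    have := congrArg Complex.im h3
    norm_num at this
  · intro h
    have h1 := congrArg (fun u : Cn n => u i) (key (-1) (fun w => by
      rw [endAt, h, neg_smul, one_smul]; rfl) (EuclideanSpace.single i 1))
    simp only [PiLp.smul_apply, mulI_apply, fderiv_compactifyChart_base hi] at h1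
    have := congrArg Complex.im h1
    norm_num at this

end SecondStructure

/-! ### Fundamental forms in charts -/

section FundamentalForms

open LineBundle

variable {n k : ℕ}

/-- A field of endomorphisms in the `j`-th standard chart. -/
def chartEnd (J : EndField n k) (j : Fin n) (a : Cn n) : Cn n →L[ℝ] Cn n :=
  (dInto (param (k := k) j) a).inverse.comp
    ((endAt J (param j a)).comp (dInto (param (k := k) j) a))

lemma dInto_chartEnd (J : EndField n k) (j : Fin n) (a v : Cn n) :
    dInto (param (k := k) j) a (chartEnd J j a v)
      = endAt J (param j a) (dInto (param (k := k) j) a v) :=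
  (inverse_apply_of_bijective (dInto_param_bijective j a) _).1

lemma IsComplexStructure.contDiff_chartEnd {J : EndField n k} (hJ : IsComplexStructure J)
    (j : Fin n) : ContDiff ℝ ∞ (chartEnd J j) := by
  refine contDiff_iff_contDiffAt.2 fun a => ?_
  obtain ⟨U, ψ, hU, ha, hψ, hD⟩ := hJ.integrable (param j a)
  have hat : ∀ x ∈ U, ContMDiffAt 𝓘(ℝ, Cn n) 𝓘(ℝ, Cn n) ∞ ψ x := fun x hx =>
    hψ.contMDiffAt (hU.mem_nhds hx)
  let f : Cn n → Cn n := fun b => ψ (param j b)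
  have hf : ∀ b, param j b ∈ U → ContDiffAt ℝ ∞ f b := fun b hb =>
    ((hat _ hb).comp b (contMDiff_param j b)).contDiffAt
  have hfd : ∀ b, param j b ∈ U →
      fderiv ℝ f b = (dOut ψ (param j b)).comp (dInto (param (k := k) j) b) := fun b hb =>
    fderiv_comp_dInto (mdiffAt (hat _ hb)) (mdiffAt (contMDiff_param j b))
  have hbij : ∀ b, param j b ∈ U → Function.Bijective (fderiv ℝ f b) := by
    intro b hb
    rw [hfd b hb]
    have h1 : Function.Bijective (dOut ψ (param j b)) := (hD _ hb).1
    exact h1.comp (dInto_param_bijective j b)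
  have hev : chartEnd J j =ᶠ[𝓝 a]
      fun b => (fderiv ℝ f b).inverse.comp ((mulI n).comp (fderiv ℝ f b)) := by
    filter_upwards [((contMDiff_param j).continuous.continuousAt (x := a)).preimage_mem_nhds
      (hU.mem_nhds ha)] with b hb
    refine ContinuousLinearMap.ext fun v => (hbij b hb).1 ?_
    refine Eq.trans ?_ (inverse_apply_of_bijective (hbij b hb) _).1.symm
    rw [hfd b hb]
    simp only [ContinuousLinearMap.comp_apply]
    rw [dInto_chartEnd]
    exact (hD _ hb).2 _
  have h1 : ContDiffAt ℝ ∞ (fderiv ℝ f) a := (hf a ha).fderiv_right (m := ∞) le_rfl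
  have h2 : ContDiffAt ℝ ∞ (fun b => (fderiv ℝ f b).inverse) a := by
    let e : Cn n ≃L[ℝ] Cn n := ContinuousLinearEquiv.ofBijective (fderiv ℝ f a)
      (LinearMap.ker_eq_bot.2 (hbij a ha).1) (LinearMap.range_eq_top.2 (hbij a ha).2)
    have he : (e : Cn n →L[ℝ] Cn n) = fderiv ℝ f a := ContinuousLinearEquiv.coe_ofBijective _ _ _
    have h3 := contDiffAt_map_inverse (𝕜 := ℝ) (n := ∞) e
    rw [he] at h3
    exact h3.comp a h1
  exact (h2.clm_comp (contDiffAt_const.clm_comp h1)).congr_of_eventuallyEq hev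

/-- The data of a smooth conformal factor and a compatible complex structure. -/
structure IsHermitianPair (g : RiemMetric n k) (u : LineBundle n k → ℝ) (J : EndField n k) :
    Prop where
  smooth : ContMDiff 𝓘(ℝ, Cn n) 𝓘(ℝ, ℝ) ∞ u
  complex : IsComplexStructure J
  hermitian : ∀ x (v w : Tan x), conformal g u x (J x v) (J x w) = conformal g u x v w

lemma endAt_endAt {J : EndField n k} (hJ : IsComplexStructure J) (x : LineBundle n k) (v : Cn n) :
    endAt J x (endAt J x v) = -v :=
  congrArg (fun L : Cn n →L[ℝ] Cn n => L v) (hJ.sq x)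

/-- The fundamental form pulled back by a map along which the complex structure lifts to `K`. -/
lemma pullback_fundamentalForm {V : Type*} [NormedAddCommGroup V] [NormedSpace ℝ V]
    (g : RiemMetric n k) (u : LineBundle n k → ℝ) (J : EndField n k) {F : V → LineBundle n k} {y : V}
    {K : V →L[ℝ] V} (hK : ∀ v, endAt J (F y) (dInto F y v) = dInto F y (K v)) :
    pullback F (fundamentalForm (conformal g u) J) y
      = (u (F y)) ^ 2 • (pullback F g.inner y).comp K := by
  ext v w
  change u (F y) ^ 2 * tensorAt g.inner (F y) (endAt J (F y) (dInto F y v)) (dInto F y w) = _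
  rw [hK v]
  rfl

namespace IsHermitianPair

variable {g : RiemMetric n k} {u : LineBundle n k → ℝ} {J : EndField n k}
  (h : IsHermitianPair g u J)
include h

lemma contDiff_pullback_param (j : Fin n) :
    ContDiff ℝ ∞ (pullback (param j) (fundamentalForm (conformal g u) J)) := by
  have h1 : pullback (param j) (fundamentalForm (conformal g u) J) = fun a =>
      (u (param j a)) ^ 2 • (pullback (param j) g.inner a).comp (chartEnd J j a) :=
    funext fun a => pullback_fundamentalForm g u J fun v => (dInto_chartEnd J j a v).symm
  rw [h1]
  have h2 : ContDiff ℝ ∞ (fun a : Cn n => u (param j a)) :=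
    (h.smooth.comp (contMDiff_param j)).contDiff
  exact (h2.pow 2).smul ((KahlerALE.contDiff_pullback_param g j).clm_comp
    (h.complex.contDiff_chartEnd j))

lemma antisymm (x : LineBundle n k) (v w : Cn n) :
    tensorAt (fundamentalForm (conformal g u) J) x v w
      = -tensorAt (fundamentalForm (conformal g u) J) x w v := by
  change u x ^ 2 * tensorAt g.inner x (endAt J x v) w
    = -(u x ^ 2 * tensorAt g.inner x (endAt J x w) v)
  have h1 : u x ^ 2 * tensorAt g.inner x (endAt J x (endAt J x v)) (endAt J x w)
    = u x ^ 2 * tensorAt g.inner x (endAt J x v) w := h.hermitian x (endAt J x v) w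
  rw [endAt_endAt h.complex, map_neg] at h1
  have h2 : tensorAt g.inner x v (endAt J x w) = tensorAt g.inner x (endAt J x w) v :=
    g.symm x v (endAt J x w)
  rw [← h1, ← h2]
  simp

/-- The exterior derivative of the fundamental form pulled back by a map from `ℂⁿ`. -/
lemma extD_pullback {F : Cn n → LineBundle n k} {j : Fin n} {y : Cn n}
    (hF : ∀ᶠ y' in 𝓝 y, ContMDiffAt 𝓘(ℝ, Cn n) 𝓘(ℝ, Cn n) ∞ F y') (hj : F y ∈ dom j)
    (a b c : Cn n) :
    extD (pullback F (fundamentalForm (conformal g u) J)) y a b c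
      = extD (pullback (param j) (fundamentalForm (conformal g u) J)) (coord j (F y))
        (fderiv ℝ (fun y' => coord j (F y')) y a) (fderiv ℝ (fun y' => coord j (F y')) y b)
        (fderiv ℝ (fun y' => coord j (F y')) y c) := by
  have hFj : ∀ᶠ y' in 𝓝 y, F y' ∈ dom j :=
    hF.self_of_nhds.continuousAt.preimage_mem_nhds ((isOpen_dom j).mem_nhds hj)
  refine KahlerALE.extD_pullback (F := fun y' => coord j (F y'))
    (h.contDiff_pullback_param j).contDiffAt (contDiffAt_coord_comp hF.self_of_nhds hj) ?_ ?_ a b c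
  · filter_upwards [hF, hFj] with y' h1 h2
    exact pullback_eq_chart (eventuallyEq_param_coord h1.continuousAt h2)
      ((contDiffAt_coord_comp h1 h2).differentiableAt (by simp)) _
  · intro v w
    exact h.antisymm _ _ _

end IsHermitianPair

variable {g : RiemMetric n k} {u : LineBundle n k → ℝ} {J : EndField n k}

/-- Vanishing of the exterior derivative of a fundamental form may be tested after pulling back by a
local diffeomorphism. -/
lemma IsHermitianPair.extD_pullback_eq_zero (h : IsHermitianPair g u J)
    (hc : IsClosedForm (fundamentalForm (conformal g u) J)) {F : Cn n → LineBundle n k} {y : Cn n}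
    (hF : ∀ᶠ y' in 𝓝 y, ContMDiffAt 𝓘(ℝ, Cn n) 𝓘(ℝ, Cn n) ∞ F y') (a b c : Cn n) :
    extD (pullback F (fundamentalForm (conformal g u) J)) y a b c = 0 := by
  obtain ⟨j, hj⟩ := exists_mem_dom (F y)
  rw [h.extD_pullback hF hj]
  exact hc j _ _ _ _

/-- A fundamental form is closed if it pulls back to a closed form under a local diffeomorphism onto
the complement of the zero section. -/
lemma IsHermitianPair.isClosedForm [NeZero n] (hk : 1 ≤ k) (h : IsHermitianPair g u J)
    {F : Cn n → LineBundle n k}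
    (hF : ∀ y, y ≠ 0 → ContMDiffAt 𝓘(ℝ, Cn n) 𝓘(ℝ, Cn n) ∞ F y)
    (hF' : ∀ y, y ≠ 0 → Function.Bijective (dInto F y))
    (hsurj : ∀ z, z ≠ 0 → ∃ y, y ≠ 0 ∧ F y = ofVec z)
    (hc : ∀ y, y ≠ 0 → ∀ a b c, extD (pullback F (fundamentalForm (conformal g u) J)) y a b c = 0) :
    IsClosedForm (fundamentalForm (conformal g u) J) := by
  intro j a₀ v₁ v₂ v₃
  have hcd : ContDiff ℝ ∞ (fderiv ℝ (pullback (param j) (fundamentalForm (conformal g u) J))) :=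
    (h.contDiff_pullback_param j).fderiv_right (m := ∞) le_rfl
  have hcont : Continuous fun a : Cn n =>
      extD (pullback (param j) (fundamentalForm (conformal g u) J)) a v₁ v₂ v₃ := by
    have h1 := hcd.continuous
    unfold extD
    fun_prop
  have hzero : ∀ a ∈ {a : Cn n | a j ≠ 0},
      extD (pullback (param j) (fundamentalForm (conformal g u) J)) a v₁ v₂ v₃ = 0 := by
    intro a ha
    obtain ⟨z, hzj, rfl⟩ := exists_param_eq_ofVec hk ha
    have hz := ne_zero_of_apply hzj
    obtain ⟨y, hy, hyz⟩ := hsurj z hz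
    have hyj : F y ∈ dom j := by rw [hyz]; exact (ofVec_mem_dom hz).2 hzj
    have hev : ∀ᶠ y' in 𝓝 y, ContMDiffAt 𝓘(ℝ, Cn n) 𝓘(ℝ, Cn n) ∞ F y' := by
      filter_upwards [isOpen_ne.mem_nhds hy] with y' hy' using hF y' hy'
    have hbij : Function.Bijective (fderiv ℝ (fun y' => coord j (F y')) y) := by
      rw [fderiv_comp_dInto (mdiffAt (contMDiffAt_coord hyj)) (mdiffAt (hF y hy))]
      exact (dOut_coord_bijective hyj).comp (hF' y hy)
    obtain ⟨w₁, rfl⟩ := hbij.2 v₁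
    obtain ⟨w₂, rfl⟩ := hbij.2 v₂
    obtain ⟨w₃, rfl⟩ := hbij.2 v₃
    have h1 := h.extD_pullback hev hyj w₁ w₂ w₃
    rw [hc y hy, hyz, coord_ofVec hz] at h1
    exact h1.symm
  have := hcont.ext_on (dense_apply_ne_zero j) continuous_const hzero
  exact congrFun this a₀

end FundamentalForms

/-! ### The chart at infinity -/

section ChartAtInfinity

open LineBundle

variable {n k : ℕ}

/-- The inversion `ξ ↦ ξ / |ξ|²`. -/
def invVec (ξ : Cn n) : Cn n := (‖ξ‖ ^ 2)⁻¹ • ξ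

lemma invVec_ne_zero {ξ : Cn n} (h : ξ ≠ 0) : invVec ξ ≠ 0 :=
  smul_ne_zero (inv_ne_zero (pow_ne_zero _ (norm_ne_zero_iff.2 h))) h

lemma norm_sq_invVec (ξ : Cn n) : ‖invVec ξ‖ ^ 2 = (‖ξ‖ ^ 2)⁻¹ := by
  by_cases h : ξ = 0
  · simp [h, invVec]
  have := norm_pos_iff.2 h
  rw [invVec, norm_smul, mul_pow, norm_inv, norm_pow, norm_norm]
  field_simp

lemma invVec_invVec (ξ : Cn n) : invVec (invVec ξ) = ξ := by
  by_cases h : ξ = 0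
  · simp [h, invVec]
  have := norm_pos_iff.2 h
  have h1 := norm_sq_invVec ξ
  rw [invVec, h1, inv_inv, invVec, smul_smul, mul_inv_cancel₀ (by positivity), one_smul]

lemma hasFDerivAt_invVec {ξ : Cn n} (h : ξ ≠ 0) :
    HasFDerivAt (invVec : Cn n → Cn n) ((‖ξ‖ ^ 2)⁻¹ • ContinuousLinearMap.id ℝ (Cn n)
      - (2 * ((‖ξ‖ ^ 2)⁻¹) ^ 2) • (euclid (Cn n) ξ).smulRight ξ) ξ := by
  have h0 : ‖ξ‖ ^ 2 ≠ 0 := pow_ne_zero _ (norm_ne_zero_iff.2 h)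
  have h1 := hasFDerivAt_comp_norm_sq (p := fun r => r⁻¹) (z := ξ) (hasDerivAt_inv h0)
  refine (h1.smul (hasFDerivAt_id ξ)).congr_fderiv ?_
  ext1 v
  simp only [add_apply, smul_apply, sub_apply,
    ContinuousLinearMap.smulRight_apply, euclid_apply, ContinuousLinearMap.id_apply, id_eq,
    innerSL_apply_apply, smul_smul, smul_eq_mul, sub_eq_add_neg, ← neg_smul]
  congr 2
  field_simp

lemma contDiffAt_invVec {ξ : Cn n} (h : ξ ≠ 0) : ContDiffAt ℝ ∞ (invVec : Cn n → Cn n) ξ :=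
  (((contDiff_norm_sq ℝ).contDiffAt).inv (pow_ne_zero _ (norm_ne_zero_iff.2 h))).smul contDiffAt_id

lemma fderiv_invVec_bijective {ξ : Cn n} (h : ξ ≠ 0) :
    Function.Bijective (fderiv ℝ (invVec : Cn n → Cn n) ξ) :=
  bijective_of_injective (fderiv_injective_of_leftInverse (f' := invVec)
    (hasFDerivAt_invVec h).differentiableAt
    (hasFDerivAt_invVec (invVec_ne_zero h)).differentiableAt
    (Filter.Eventually.of_forall invVec_invVec))

variable [NeZero n]

/-- The uniformizing chart around the point at infinity, off the origin, seen in the total space. -/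
def inftyChart (ξ : Cn n) : LineBundle n k := ofVec (invVec ξ)

lemma contMDiffAt_inftyChart {ξ : Cn n} (h : ξ ≠ 0) :
    ContMDiffAt 𝓘(ℝ, Cn n) 𝓘(ℝ, Cn n) ∞ (inftyChart : Cn n → LineBundle n k) ξ :=
  (contMDiffAt_ofVec (invVec_ne_zero h)).comp ξ (contDiffAt_invVec h).contMDiffAt

lemma dInto_inftyChart {ξ : Cn n} (h : ξ ≠ 0) :
    dInto (inftyChart : Cn n → LineBundle n k) ξ
      = (dInto (ofVec : Cn n → LineBundle n k) (invVec ξ)).comp (fderiv ℝ invVec ξ) :=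
  dInto_comp (mdiffAt (contMDiffAt_ofVec (invVec_ne_zero h)))
    (hasFDerivAt_invVec h).differentiableAt

lemma dInto_inftyChart_bijective (hk : 1 ≤ k) {ξ : Cn n} (h : ξ ≠ 0) :
    Function.Bijective (dInto (inftyChart : Cn n → LineBundle n k) ξ) := by
  rw [dInto_inftyChart h]
  exact (dInto_ofVec_bijective hk (invVec_ne_zero h)).comp (fderiv_invVec_bijective h)

lemma compactify_inftyChart {ξ : Cn n} (h : ξ ≠ 0) :
    compactify (inftyChart ξ : LineBundle n k) = WeightedProj.orbChart ξ := by
  have h0 : ‖ξ‖ ^ 2 ≠ 0 := pow_ne_zero _ (norm_ne_zero_iff.2 h)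
  rw [inftyChart, ofVec_eq_mk (invVec_ne_zero h), compactify_mk]
  refine WeightedProj.mk_eq_mk_iff.2 ⟨((‖ξ‖ ^ 2 : ℝ) : ℂ), by exact_mod_cast h0, ?_, ?_⟩
  · ext i
    simp only [invVec, PiLp.smul_apply, Complex.real_smul, smul_eq_mul, ← mul_assoc,
      ← Complex.ofReal_mul, mul_inv_cancel₀ h0, Complex.ofReal_one, one_mul]
  · rw [pow_mul, norm_sq_invVec, map_one, one_mul, ← Complex.ofReal_pow, ← Complex.ofReal_mul,
      ← mul_pow, mul_inv_cancel₀ h0, one_pow, Complex.ofReal_one]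

/-- The chart at infinity is holomorphic for the second complex structure. -/
lemma conjFiberJ_dInto_inftyChart {ξ : Cn n} (h : ξ ≠ 0) (w : Cn n) :
    endAt conjFiberJ (inftyChart ξ : LineBundle n k) (dInto (inftyChart (k := k)) ξ w)
      = dInto (inftyChart (k := k)) ξ (mulI n w) := by
  obtain ⟨j, hj⟩ := exists_apply_ne_zero h
  have h0 : ‖ξ‖ ^ 2 ≠ 0 := pow_ne_zero _ (norm_ne_zero_iff.2 h)
  have hdom : (inftyChart ξ : LineBundle n k) ∈ dom j := by
    rw [inftyChart, ofVec_mem_dom (invVec_ne_zero h), invVec]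
    simp only [PiLp.smul_apply, Complex.real_smul]
    exact mul_ne_zero (by exact_mod_cast inv_ne_zero h0) hj
  let S : Cn n → Cn n := fun ξ => WithLp.toLp 2 fun i => if i = j then 1 / ξ j ^ k else ξ i / ξ j
  have hS : DifferentiableAt ℂ S ξ := by
    refine differentiableAt_euclidean.2 fun i => ?_
    simp only [S, div_eq_mul_inv]
    have h1 : ∀ m, DifferentiableAt ℂ (fun y : Cn n => y m) ξ := fun m => by fun_prop
    split_ifs
    · exact DifferentiableAt.mul (by fun_prop) (((h1 j).fun_pow k).fun_inv (pow_ne_zero _ hj))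
    · exact (h1 i).mul ((h1 j).fun_inv hj)
  have hcomp : (fun y => projCoord j (inftyChart y : LineBundle n k)) =ᶠ[𝓝 ξ] S := by
    filter_upwards [isOpen_ne.mem_nhds h] with y hy
    rw [projCoord, compactify_inftyChart hy]
    rfl
  have hder : ∀ v, dOut (projCoord j) (inftyChart ξ : LineBundle n k)
      (dInto (inftyChart (k := k)) ξ v) = fderiv ℝ S ξ v := by
    intro v
    rw [← hcomp.fderiv_eq, fderiv_comp_dInto (mdiffAt (contMDiffAt_projCoord hdom))
      (mdiffAt (contMDiffAt_inftyChart h))]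
    rfl
  apply (dOut_projCoord_bijective hdom).1
  rw [dOut_projCoord_conjFiberJ hdom, hder, hder, fderiv_mulI hS]

variable {g : RiemMetric n k} {p : ℝ → ℝ}

/-- The radial profile of the rescaled metric in the chart at infinity. -/
def invProfile (p : ℝ → ℝ) (ρ : ℝ) : ℝ := (p ρ⁻¹)⁻¹

lemma IsRadial.contDiffAt_invProfile (h : IsRadial g p) (hn : 2 ≤ n) (hk : 1 ≤ k) {ρ : ℝ}
    (hρ : 0 < ρ) : ContDiffAt ℝ ∞ (invProfile p) ρ :=
  ((h.contDiffAt (inv_pos.2 hρ)).comp ρ (contDiffAt_inv ℝ hρ.ne')).inv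
    (h.p_pos hn hk (inv_pos.2 hρ)).1.ne'

lemma IsRadial.deriv_invProfile (h : IsRadial g p) (hn : 2 ≤ n) (hk : 1 ≤ k) {ρ : ℝ}
    (hρ : 0 < ρ) : deriv (invProfile p) ρ = deriv p ρ⁻¹ / (ρ ^ 2 * p ρ⁻¹ ^ 2) := by
  have h1 := hasDerivAt_of_contDiffAt (h.contDiffAt (inv_pos.2 hρ))
  have h2 := (h1.comp ρ (hasDerivAt_inv hρ.ne')).inv (h.p_pos hn hk (inv_pos.2 hρ)).1.ne'
  have h3 : deriv (invProfile p) ρ = _ := h2.deriv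
  rw [h3]
  simp only [Function.comp_apply]
  have := (h.p_pos hn hk (inv_pos.2 hρ)).1
  field_simp

/-- In the chart at infinity the metric is a multiple of a radial metric. -/
lemma IsRadial.pullback_inftyChart (h : IsRadial g p) (hn : 2 ≤ n) (hk : 1 ≤ k) {ξ : Cn n}
    (hξ : ξ ≠ 0) :
    pullback inftyChart g.inner ξ
      = (((‖ξ‖ ^ 2)⁻¹ * p (‖ξ‖ ^ 2)⁻¹) ^ 2) • radialMetric (mulI n) (invProfile p) ξ := by
  have h0 : 0 < ‖ξ‖ ^ 2 := pow_pos (norm_pos_iff.2 hξ) 2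
  have hp := (h.p_pos hn hk (inv_pos.2 h0)).1
  have h1 : pullback inftyChart g.inner ξ = (pullback ofVec g.inner (invVec ξ)).bilinearComp
      (fderiv ℝ invVec ξ) (fderiv ℝ invVec ξ) := by
    rw [pullback_eq, dInto_inftyChart hξ]
    rfl
  rw [h1, h.metric_eq _ (invVec_ne_zero hξ)]
  ext v w
  simp only [ContinuousLinearMap.bilinearComp_apply, smul_apply, radialMetric_apply,
    norm_sq_invVec, h.deriv_invProfile hn hk h0, (hasFDerivAt_invVec hξ).fderiv, invProfile, rankOne,
    smul_eq_mul]
  simp only [sub_apply, smul_apply, ContinuousLinearMap.smulRight_apply, euclid_apply,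
    ContinuousLinearMap.id_apply, map_sub, map_smul, inner_sub_left, inner_sub_right,
    real_inner_smul_left, real_inner_smul_right, invVec]
  have e1 : inner ℝ ξ (mulI n ξ) = 0 := inner_self_apply_eq_zero (I := mulI n) inner_mulI_left ξ
  rw [e1, real_inner_self_eq_norm_sq, real_inner_comm ξ v]
  generalize inner ℝ v w = α
  generalize inner ℝ ξ v = β
  generalize inner ℝ ξ w = γ
  generalize inner ℝ ξ (mulI n v) = β'
  generalize inner ℝ ξ (mulI n w) = γ'
  generalize deriv p (‖ξ‖ ^ 2)⁻¹ = p' at *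
  generalize p (‖ξ‖ ^ 2)⁻¹ = p₀ at *
  generalize ‖ξ‖ ^ 2 = ρ at *
  field_simp
  ring

end ChartAtInfinity

/-! ### The end of an asymptotically locally Euclidean metric -/

section Ends

open LineBundle

variable {n k : ℕ} {V : Type*} [NormedAddCommGroup V] [NormedSpace ℝ V]

lemma contDiffAt_pullback (g : RiemMetric n k) {F : V → LineBundle n k} {y : V}
    (hF : ∀ᶠ y' in 𝓝 y, ContMDiffAt 𝓘(ℝ, V) 𝓘(ℝ, Cn n) ∞ F y') :
    ContDiffAt ℝ ∞ (pullback F g.inner) y := by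
  obtain ⟨j, hj⟩ := exists_mem_dom (F y)
  have hFj : ∀ᶠ y' in 𝓝 y, F y' ∈ dom j :=
    hF.self_of_nhds.continuousAt.preimage_mem_nhds ((isOpen_dom j).mem_nhds hj)
  have hf := contDiffAt_coord_comp hF.self_of_nhds hj
  refine (contDiffAt_bilinearComp (F := fun y' => coord j (F y'))
    (contDiff_pullback_param g j).contDiffAt hf
    (hf.fderiv_right (m := ∞) le_rfl)).congr_of_eventuallyEq ?_
  filter_upwards [hF, hFj] with y' h1 h2
  exact pullback_eq_chart (eventuallyEq_param_coord h1.continuousAt h2)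
    ((contDiffAt_coord_comp h1 h2).differentiableAt (by simp)) _

/-- The sectional curvature of a pulled back metric, in a standard chart. -/
lemma sectional_chart (g : RiemMetric n k) {F : V → LineBundle n k} {y : V} {j : Fin n}
    {G : V → V →L[ℝ] V →L[ℝ] ℝ} (hG : G =ᶠ[𝓝 y] pullback F g.inner)
    (hF : ∀ᶠ y' in 𝓝 y, ContMDiffAt 𝓘(ℝ, V) 𝓘(ℝ, Cn n) ∞ F y') (hj : F y ∈ dom j)
    (hs : Function.Surjective (dInto F y)) {a b u v w : V} (hu : IsChristoffel G y a a u)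
    (hv : IsChristoffel G y a b v) (hw : IsChristoffel G y b b w) {A B u' v' w' : Cn n}
    (hA : A = dOut (coord j) (F y) (dInto F y a)) (hB : B = dOut (coord j) (F y) (dInto F y b))
    (hu' : IsChristoffel (pullback (param j) g.inner) (coord j (F y)) A A u')
    (hv' : IsChristoffel (pullback (param j) g.inner) (coord j (F y)) A B v')
    (hw' : IsChristoffel (pullback (param j) g.inner) (coord j (F y)) B B w') :
    sectional G y a b u v w
      = sectional (pullback (param j) g.inner) (coord j (F y)) A B u' v' w' := by
  have hFj : ∀ᶠ y' in 𝓝 y, F y' ∈ dom j :=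
    hF.self_of_nhds.continuousAt.preimage_mem_nhds ((isOpen_dom j).mem_nhds hj)
  have hD : fderiv ℝ (fun y' => coord j (F y')) y = (dOut (coord j) (F y)).comp (dInto F y) :=
    fderiv_comp_dInto (mdiffAt (contMDiffAt_coord hj)) (mdiffAt hF.self_of_nhds)
  have hA' : A = fderiv ℝ (fun y' => coord j (F y')) y a := by rw [hA, hD]; rfl
  have hB' : B = fderiv ℝ (fun y' => coord j (F y')) y b := by rw [hB, hD]; rfl
  rw [hA'] at hu' hv' ⊢
  rw [hB'] at hv' hw' ⊢
  refine sectional_pullback (F := fun y' => coord j (F y'))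
    (Filter.Eventually.of_forall fun q => (contDiff_pullback_param g j).contDiffAt) ?_ ?_
    (fun q a b => pullback_symm g _ q a b) ?_ ?_ hu hv hw hu' hv' hw'
  · filter_upwards [hF, hFj] with y' h1 h2 using contDiffAt_coord_comp h1 h2
  · filter_upwards [hG, hF, hFj] with y' h0 h1 h2
    rw [h0]
    exact pullback_eq_chart (eventuallyEq_param_coord h1.continuousAt h2)
      ((contDiffAt_coord_comp h1 h2).differentiableAt (by simp)) _
  · intro u h0
    by_contra hne
    exact (pullback_pos g (dInto_param_injective j _) hne).ne' (h0 u)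
  · rw [hD]
    exact (dOut_coord_bijective hj).2.comp hs

/-- Sectional curvatures at a point of the image of two local diffeomorphisms agree. -/
lemma sectional_eq_of_eq (g : RiemMetric n k) {W : Type*} [NormedAddCommGroup W] [NormedSpace ℝ W]
    {F : V → LineBundle n k} {F' : W → LineBundle n k} {y : V} {y' : W} (hyy : F y = F' y')
    {G : V → V →L[ℝ] V →L[ℝ] ℝ} (hG : G =ᶠ[𝓝 y] pullback F g.inner)
    {G' : W → W →L[ℝ] W →L[ℝ] ℝ} (hG' : G' =ᶠ[𝓝 y'] pullback F' g.inner)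
    (hF : ∀ᶠ y' in 𝓝 y, ContMDiffAt 𝓘(ℝ, V) 𝓘(ℝ, Cn n) ∞ F y')
    (hF' : ∀ᶠ y' in 𝓝 y', ContMDiffAt 𝓘(ℝ, W) 𝓘(ℝ, Cn n) ∞ F' y')
    (hs : Function.Surjective (dInto F y)) (hs' : Function.Surjective (dInto F' y'))
    {a b u v w : V} (hu : IsChristoffel G y a a u)
    (hv : IsChristoffel G y a b v) (hw : IsChristoffel G y b b w)
    {a' b' u' v' w' : W} (hu' : IsChristoffel G' y' a' a' u')
    (hv' : IsChristoffel G' y' a' b' v') (hw' : IsChristoffel G' y' b' b' w')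
    (ha : dInto F y a = dInto F' y' a') (hb : dInto F y b = dInto F' y' b') :
    sectional G y a b u v w = sectional G' y' a' b' u' v' w' := by
  obtain ⟨j, hj⟩ := exists_mem_dom (F y)
  have hpos : ∀ v, v ≠ 0 → 0 < pullback (param j) g.inner (coord j (F y)) v v := fun v hv =>
    pullback_pos g (dInto_param_injective j _) hv
  obtain ⟨u₀, hu₀⟩ := exists_isChristoffel hpos (dOut (coord j) (F y) (dInto F y a))
    (dOut (coord j) (F y) (dInto F y a))
  obtain ⟨v₀, hv₀⟩ := exists_isChristoffel hpos (dOut (coord j) (F y) (dInto F y a))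
    (dOut (coord j) (F y) (dInto F y b))
  obtain ⟨w₀, hw₀⟩ := exists_isChristoffel hpos (dOut (coord j) (F y) (dInto F y b))
    (dOut (coord j) (F y) (dInto F y b))
  rw [sectional_chart g hG hF hj hs hu hv hw rfl rfl hu₀ hv₀ hw₀]
  rw [hyy] at hj hu₀ hv₀ hw₀ ⊢
  rw [ha] at hu₀ hv₀ ⊢
  rw [hb] at hv₀ hw₀ ⊢
  exact (sectional_chart g hG' hF' hj hs' hu' hv' hw' rfl rfl hu₀ hv₀ hw₀).symm

/-- A local diffeomorphism from the complement of a ball in `ℝ²ⁿ`, proper at infinity modulo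
isometries, for which the metric is uniformly Euclidean and has curvature `O(r^{-τ-2})`. -/
structure IsEnd (g : RiemMetric n k) (τ R C : ℝ) (Ψ : R2n n → LineBundle n k) : Prop where
  one_le : 1 ≤ R
  nonneg : 0 ≤ C
  smooth : ∀ y, R < ‖y‖ → ContMDiffAt 𝓘(ℝ, R2n n) 𝓘(ℝ, Cn n) ∞ Ψ y
  bijective : ∀ y, R < ‖y‖ → Function.Bijective (dInto Ψ y)
  norm_eq : ∀ y y', R < ‖y‖ → R < ‖y'‖ → Ψ y = Ψ y' → ‖y‖ = ‖y'‖
  bounds : ∀ y, R < ‖y‖ → ∀ a, ‖a‖ ^ 2 ≤ 2 * pullback Ψ g.inner y a a ∧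
    pullback Ψ g.inner y a a ≤ 2 * ‖a‖ ^ 2
  curvature : ∀ y, R < ‖y‖ → ∀ a b u v w, IsChristoffel (pullback Ψ g.inner) y a a u →
    IsChristoffel (pullback Ψ g.inner) y a b v → IsChristoffel (pullback Ψ g.inner) y b b w →
      |sectional (pullback Ψ g.inner) y a b u v w| ≤ C * ‖y‖ ^ (-τ - 2) * (‖a‖ ^ 2 * ‖b‖ ^ 2)

lemma eventually_lt_norm {E : Type*} [NormedAddCommGroup E] {R : ℝ} {y : E} (hy : R < ‖y‖) :
    ∀ᶠ y' in 𝓝 y, R < ‖y'‖ := continuous_norm.continuousAt.eventually (lt_mem_nhds hy)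

/-- The group `Γ` acts by isometries, so that the radius is well defined on the end. -/
lemma IsALE.exists_isEnd {g : RiemMetric n k} {τ : ℝ} (hτ : 0 < τ) (h : IsALE g τ) :
    ∃ R C Ψ, IsEnd g τ R C Ψ := by
  obtain ⟨Γ, K, R, Ψ, -, -, -, -, -, hΨ, hbij, -, horb, hdec⟩ := h
  have hop : IsOpen {y : R2n n | R < ‖y‖} := isOpen_lt continuous_const continuous_norm
  have hsm : ∀ y, R < ‖y‖ → ContMDiffAt 𝓘(ℝ, R2n n) 𝓘(ℝ, Cn n) ∞ Ψ y := fun y hy =>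
    hΨ.contMDiffAt (hop.mem_nhds hy)
  have hG : ∀ y, R < ‖y‖ → ContDiffAt ℝ ∞ (pullback Ψ g.inner) y := fun y hy =>
    contDiffAt_pullback g ((eventually_lt_norm hy).mono hsm)
  obtain ⟨C, R', hC, hR, hR1, hb⟩ := exists_curvature_decay hτ hG hdec
  refine ⟨R', C, Ψ, hR1, hC, fun y hy => hsm y (hR.trans_lt hy),
    fun y hy => hbij y (hR.trans_lt hy), ?_, fun y hy => (hb y hy).1, fun y hy => (hb y hy).2⟩
  intro y y' hy hy' he
  obtain ⟨γ, -, rfl⟩ := (horb y y' (hR.trans_lt hy) (hR.trans_lt hy')).1 he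
  exact (γ.norm_map y).symm

namespace IsEnd

variable {g : RiemMetric n k} {τ R C : ℝ} {Ψ : R2n n → LineBundle n k} (h : IsEnd g τ R C Ψ)
include h

/-- Short paths in a standard chart lift to the end, along which the radius changes slowly. -/
lemma exists_lift [T2Space (LineBundle n k)] {j : Fin n} {a b : Cn n} {ℓ : ℝ} (hℓ : 0 < ℓ)
    (hlen : ∀ t ∈ Set.Icc (0 : ℝ) 1,
      pullback (param j) g.inner (a + t • (b - a)) (b - a) (b - a) ≤ ℓ ^ 2)
    {y₀ : R2n n} (hy₀ : R + 2 * ℓ < ‖y₀‖) (ha : Ψ y₀ = param j a) :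
    ∃ y, R < ‖y‖ ∧ ‖y‖ ≤ ‖y₀‖ + 2 * ℓ ∧ Ψ y = param j b := by
  let γ : ℝ → Cn n := fun t => a + t • (b - a)
  have hγ : ∀ t, HasDerivAt γ (b - a) t := fun t => by
    simpa [γ] using ((hasDerivAt_id t).smul_const (b - a)).const_add a
  have hγc : Continuous γ := continuous_iff_continuousAt.2 fun t => (hγ t).continuousAt
  let S : Set ℝ := {t | ∃ y, |‖y‖ - ‖y₀‖| ≤ 2 * ℓ * t ∧ Ψ y = param j (γ t)}
  have hbig : ∀ (y : R2n n) (t : ℝ), t ∈ Set.Icc (0 : ℝ) 1 →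
      |‖y‖ - ‖y₀‖| ≤ 2 * ℓ * t → R < ‖y‖ := by
    intro y t ht hy
    have := (abs_le.1 hy).1
    nlinarith [ht.2]
  have hsub : Set.Icc (0 : ℝ) 1 ⊆ S := by
    refine IsClosed.Icc_subset_of_forall_exists_gt ?_ ?_ ?_
    · refine isSeqClosed_iff_isClosed.1 fun t t₀ ht htt => ?_
      have ht01 : t₀ ∈ Set.Icc (0 : ℝ) 1 := isClosed_Icc.isSeqClosed (fun m => (ht m).2) htt
      refine ⟨?_, ht01⟩
      choose y hy hyΨ using fun m => (ht m).1
      have hbd : ∀ m, y m ∈ Metric.closedBall (0 : R2n n) (‖y₀‖ + 2 * ℓ) := by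
        intro m
        rw [mem_closedBall_zero_iff]
        have := (abs_le.1 (hy m)).2
        nlinarith [(ht m).2.2]
      obtain ⟨y', -, φ, hφ, hlim⟩ := (isCompact_closedBall (0 : R2n n) _).tendsto_subseq hbd
      have htφ := htt.comp hφ.tendsto_atTop
      have hle : |‖y'‖ - ‖y₀‖| ≤ 2 * ℓ * t₀ :=
        le_of_tendsto_of_tendsto' ((hlim.norm.sub_const _).abs) (htφ.const_mul (2 * ℓ))
          (fun m => hy (φ m))
      refine ⟨y', hle, ?_⟩
      have h1 := ((h.smooth y' (hbig y' t₀ ht01 hle)).continuousAt.tendsto).comp hlim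
      have h2 := (((contMDiff_param (k := k) j).continuous.comp hγc).tendsto t₀).comp htφ
      refine tendsto_nhds_unique h1 (h2.congr fun m => ?_)
      exact (hyΨ (φ m)).symm
    · exact ⟨y₀, by simp, by simpa [γ] using ha⟩
    · rintro t ⟨⟨y, hy, hyΨ⟩, ht⟩ t' ht'
      have htI : t ∈ Set.Icc (0 : ℝ) 1 := Set.Ico_subset_Icc_self ht
      have hyR := hbig y t htI hy
      have hdom : Ψ y ∈ dom j := by rw [hyΨ]; exact param_mem_dom j _
      have hf := contDiffAt_coord_comp (h.smooth y hyR) hdom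
      set f : R2n n → Cn n := fun y' => coord j (Ψ y')
      have hfy : f y = γ t := by simp only [f, hyΨ, coord_param]
      have hfd : fderiv ℝ f y = (dOut (coord j) (Ψ y)).comp (dInto Ψ y) :=
        fderiv_comp_dInto (mdiffAt (contMDiffAt_coord hdom)) (mdiffAt (h.smooth y hyR))
      have hbij : Function.Bijective (fderiv ℝ f y) := by
        rw [hfd]; exact (dOut_coord_bijective hdom).comp (h.bijective y hyR)
      let e : R2n n ≃L[ℝ] Cn n := ContinuousLinearEquiv.ofBijective (fderiv ℝ f y)
        (LinearMap.ker_eq_bot.2 hbij.1) (LinearMap.range_eq_top.2 hbij.2)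
      have he : (e : R2n n →L[ℝ] Cn n) = fderiv ℝ f y := ContinuousLinearEquiv.coe_ofBijective _ _ _
      have hstrict : HasStrictFDerivAt f (e : R2n n →L[ℝ] Cn n) y := by
        rw [he]; exact hf.hasStrictFDerivAt (by simp)
      -- the lifted curve, and its velocity `c` at `t`
      let η : ℝ → R2n n := fun s => hstrict.localInverse f e y (γ s)
      have hη0 : η t = y := by
        simp only [η, ← hfy]
        exact hstrict.localInverse_apply_image
      let c : R2n n := e.symm (b - a)
      have hηd : HasDerivAt η c t := by
        have h1 := hstrict.to_localInverse.hasFDerivAt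
        rw [hfy] at h1
        exact h1.comp_hasDerivAt t (hγ t)
      have hηΨ : ∀ᶠ s in 𝓝 t, Ψ (η s) = param j (γ s) := by
        have h1 := hstrict.eventually_right_inverse
        rw [hfy] at h1
        have h2 := (hγ t).continuousAt.eventually h1
        have h3 : ∀ᶠ s in 𝓝 t, Ψ (η s) ∈ dom j := by
          have h4 : ContinuousAt Ψ (η t) := by rw [hη0]; exact (h.smooth y hyR).continuousAt
          refine (ContinuousAt.comp h4 hηd.continuousAt).preimage_mem_nhds
            ((isOpen_dom j).mem_nhds ?_)
          change Ψ (η t) ∈ dom j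
          rw [hη0]; exact hdom
        filter_upwards [h2, h3] with s hs hs'
        rw [← param_coord hs']
        exact congrArg _ hs
      have hc : ‖c‖ < 2 * ℓ := by
        have h1 := (h.bounds y hyR c).1
        have h2 : pullback Ψ g.inner y c c
            = pullback (param j) g.inner (γ t) (b - a) (b - a) := by
          have h3 := pullback_eq_chart (eventuallyEq_param_coord (h.smooth y hyR).continuousAt hdom)
            (hf.differentiableAt (by simp)) g.inner
          rw [h3, ← hfy]
          have h4 : fderiv ℝ f y c = b - a := by
            rw [← he]; exact e.apply_symm_apply _
          change pullback (param j) g.inner (f y) (fderiv ℝ f y c) (fderiv ℝ f y c) = _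
          rw [h4]
        have h3 := hlen t htI
        rw [h2] at h1
        have h4 : ‖c‖ ^ 2 < (2 * ℓ) ^ 2 := by nlinarith
        exact lt_of_pow_lt_pow_left₀ 2 (by positivity) h4
      have hslope : ∀ᶠ s in 𝓝[>] t, ‖η s - η t‖ < 2 * ℓ * (s - t) := by
        have h1 := (hasDerivAt_iff_tendsto_slope.1 hηd).norm.eventually (gt_mem_nhds hc)
        have h2 : 𝓝[>] t ≤ 𝓝[≠] t := nhdsWithin_mono _ fun s hs => ne_of_gt hs
        filter_upwards [h2 h1, self_mem_nhdsWithin] with s hs hst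
        have hst' : 0 < s - t := sub_pos.2 hst
        rw [slope_def_module, norm_smul, norm_inv, Real.norm_of_nonneg hst'.le,
          inv_mul_lt_iff₀ hst'] at hs
        linarith
      obtain ⟨s, hs1, hs2, hs3⟩ := (hslope.and ((hηΨ.filter_mono nhdsWithin_le_nhds).and
        (Ioc_mem_nhdsGT (Set.mem_Ioi.1 ht')))).exists
      refine ⟨s, ⟨η s, ?_, hs2⟩, hs3⟩
      have h1 := abs_norm_sub_norm_le (η s) (η t)
      rw [hη0] at h1 hs1
      have h2 : |‖η s‖ - ‖y₀‖| ≤ |‖η s‖ - ‖y‖| + |‖y‖ - ‖y₀‖| := by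
        have := abs_add_le (‖η s‖ - ‖y‖) (‖y‖ - ‖y₀‖)
        simpa using this
      linarith
  obtain ⟨y, hy, hyΨ⟩ := hsub (Set.right_mem_Icc.2 zero_le_one)
  refine ⟨y, hbig y 1 (Set.right_mem_Icc.2 zero_le_one) hy, ?_, ?_⟩
  · have := (abs_le.1 hy).2; linarith
  · simpa [γ] using hyΨ

/-- The end leaves every compact set. Otherwise two of its points with very different radii would lie
in a small ball of a chart; the segment joining them lifts to the end, and its length bounds the
difference of the radii. -/
lemma exists_forall_notMem [T2Space (LineBundle n k)] {K : Set (LineBundle n k)} (hK : IsCompact K) :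
    ∃ R', ∀ y, R' < ‖y‖ → Ψ y ∉ K := by
  by_contra! hcon
  choose y hy hyK using hcon
  obtain ⟨x, hx, hcl⟩ := hK.exists_mapClusterPt (f := Filter.atTop) (u := fun m : ℕ => Ψ (y m))
    (Filter.tendsto_principal.2 (Filter.Eventually.of_forall fun m => hyK m))
  obtain ⟨j, a, rfl⟩ := exists_mem_dom x
  -- a ball in the chart in which all segments are short
  have hG : ContinuousAt (pullback (param j) g.inner) a :=
    (contDiff_pullback_param g j).continuous.continuousAt
  obtain ⟨ε₀, hε₀, hball⟩ := Metric.eventually_nhds_iff_ball.1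
    (hG.norm.eventually (gt_mem_nhds (lt_add_one _)))
  set B : ℝ := ‖pullback (param j) g.inner a‖ + 1
  have hB : 0 < B := by positivity
  let ε : ℝ := min ε₀ (1 / (2 * (B + 1)))
  have hε : 0 < ε := lt_min hε₀ (by positivity)
  have hshort : ∀ b ∈ Metric.ball a ε, ∀ b' ∈ Metric.ball a ε, ∀ t ∈ Set.Icc (0 : ℝ) 1,
      pullback (param j) g.inner (b + t • (b' - b)) (b' - b) (b' - b) ≤ 1 ^ 2 := by
    intro b hb b' hb' t ht
    have h1 : b + t • (b' - b) ∈ Metric.ball a ε := (convex_ball a ε).add_smul_sub_mem hb hb' ht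
    have h2 := hball _ (Metric.ball_subset_ball (min_le_left _ _) h1)
    have h3 : ‖b' - b‖ ≤ 1 / (B + 1) := by
      rw [← dist_eq_norm]
      have e1 := dist_triangle_right b' b a
      rw [Metric.mem_ball] at hb hb'
      have e2 : ε ≤ 1 / (2 * (B + 1)) := min_le_right _ _
      have e3 : 1 / (2 * (B + 1)) = 1 / (B + 1) / 2 := by field_simp
      linarith
    have h4 := (pullback (param j) g.inner (b + t • (b' - b))).le_opNorm₂ (b' - b) (b' - b)
    have h5 := (le_abs_self _).trans h4
    have h6 : ‖b' - b‖ * ‖b' - b‖ ≤ 1 / (B + 1) * (1 / (B + 1)) := by gcongr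
    have h7 : B * (1 / (B + 1) * (1 / (B + 1))) ≤ 1 := by
      rw [show B * (1 / (B + 1) * (1 / (B + 1))) = B / ((B + 1) * (B + 1)) by field_simp,
        div_le_one (by positivity)]
      nlinarith
    calc _ ≤ _ := h5
      _ = ‖pullback (param j) g.inner (b + t • (b' - b))‖ * (‖b' - b‖ * ‖b' - b‖) := by ring
      _ ≤ B * (1 / (B + 1) * (1 / (B + 1))) := by gcongr
      _ ≤ 1 ^ 2 := by linarith
  have hU : param j '' Metric.ball a ε ∈ 𝓝 (param j a : LineBundle n k) := by
    refine IsOpen.mem_nhds ?_ ⟨a, Metric.mem_ball_self hε, rfl⟩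
    exact (chart (k := k) j).symm.isOpen_image_of_subset_source Metric.isOpen_ball
      (Set.subset_univ _)
  have hfreq := mapClusterPt_iff_frequently.1 hcl _ hU
  obtain ⟨m, hm, b, hb, hbm⟩ := Filter.frequently_atTop.1 hfreq (⌈R + 2⌉₊)
  obtain ⟨m', hm', b', hb', hbm'⟩ := Filter.frequently_atTop.1 hfreq (⌈‖y m‖ + 2 + R⌉₊)
  have h1 : R + 2 * 1 < ‖y m‖ := by
    have := (Nat.le_ceil (R + 2)).trans (Nat.cast_le.2 hm)
    linarith [hy m]
  obtain ⟨y', hy'R, hy'le, hy'Ψ⟩ := h.exists_lift one_pos (hshort b hb b' hb') h1 hbm.symm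
  have h2 : ‖y m‖ + 2 + R < ‖y m'‖ := by
    have := (Nat.le_ceil (‖y m‖ + 2 + R)).trans (Nat.cast_le.2 hm')
    linarith [hy m']
  have h3 := h.norm_eq y' (y m') hy'R (by linarith [norm_nonneg (y m)]) (hy'Ψ.trans hbm')
  linarith [h.one_le]

end IsEnd

end Ends

/-! ### Growth of the moment map and decay of the curvature -/

section Growth

open LineBundle

variable {n k : ℕ} [NeZero n] {g : RiemMetric n k} {p : ℝ → ℝ}

lemma IsRadial.eventually_contDiffAt (hr : IsRadial g p) {r : ℝ} (h : 0 < r) :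
    ∀ᶠ r' in 𝓝 r, ContDiffAt ℝ ∞ p r' := by
  filter_upwards [Ioi_mem_nhds h] with r' hr' using hr.contDiffAt hr'

omit [NeZero n] in
lemma tensorAt_dInto {V : Type*} [NormedAddCommGroup V] [NormedSpace ℝ V] {F : V → LineBundle n k}
    (T : TwoTensor n k) (y a b : V) :
    tensorAt T (F y) (dInto F y a) (dInto F y b) = pullback F T y a b := rfl

/-- The curvature bound at infinity in the coordinates `z`. -/
lemma IsEnd.radial_curvature {τ R C : ℝ} {Ψ : R2n n → LineBundle n k} (h : IsEnd g τ R C Ψ)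
    (hr : IsRadial g p) (hk : 1 ≤ k) {y : R2n n} (hy : R < ‖y‖) {z : Cn n} (hz : z ≠ 0)
    (hyz : Ψ y = ofVec z) {a b u v w : Cn n} (hu : IsChristoffel (radialMetric (mulI n) p) z a a u)
    (hv : IsChristoffel (radialMetric (mulI n) p) z a b v)
    (hw : IsChristoffel (radialMetric (mulI n) p) z b b w) :
    |sectional (radialMetric (mulI n) p) z a b u v w| ≤ 4 * C * ‖y‖ ^ (-τ - 2) *
      (radialMetric (mulI n) p z a a * radialMetric (mulI n) p z b b) := by
  obtain ⟨a', ha'⟩ := (h.bijective y hy).2 (dInto ofVec z a)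
  obtain ⟨b', hb'⟩ := (h.bijective y hy).2 (dInto ofVec z b)
  have hpos : ∀ v, v ≠ 0 → 0 < pullback Ψ g.inner y v v := fun v hv =>
    pullback_pos g (h.bijective y hy).1 hv
  obtain ⟨u', hu'⟩ := exists_isChristoffel hpos a' a'
  obtain ⟨v', hv'⟩ := exists_isChristoffel hpos a' b'
  obtain ⟨w', hw'⟩ := exists_isChristoffel hpos b' b'
  have hG : radialMetric (mulI n) p =ᶠ[𝓝 z] pullback ofVec g.inner := by
    filter_upwards [isOpen_ne.mem_nhds hz] with z' hz' using (hr.metric_eq z' hz').symm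
  rw [sectional_eq_of_eq g hyz.symm hG (Filter.EventuallyEq.refl _ _)
    (by filter_upwards [isOpen_ne.mem_nhds hz] with z' hz' using contMDiffAt_ofVec hz')
    ((eventually_lt_norm hy).mono h.smooth) (dInto_ofVec_bijective hk hz).2 (h.bijective y hy).2
    hu hv hw hu' hv' hw' ha'.symm hb'.symm]
  refine (h.curvature y hy a' b' u' v' w' hu' hv' hw').trans ?_
  have e1 : pullback Ψ g.inner y a' a' = radialMetric (mulI n) p z a a := by
    rw [← hr.metric_eq z hz, ← tensorAt_dInto, ← tensorAt_dInto, ha', hyz]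
  have e2 : pullback Ψ g.inner y b' b' = radialMetric (mulI n) p z b b := by
    rw [← hr.metric_eq z hz, ← tensorAt_dInto, ← tensorAt_dInto, hb', hyz]
  have b1 := (h.bounds y hy a').1
  have b2 := (h.bounds y hy b').1
  rw [e1] at b1
  rw [e2] at b2
  have b3 := mul_le_mul b1 b2 (sq_nonneg _) ((sq_nonneg ‖a'‖).trans b1)
  have hs : 0 ≤ C * ‖y‖ ^ (-τ - 2) := mul_nonneg h.nonneg (Real.rpow_nonneg (norm_nonneg _) _)
  calc _ ≤ C * ‖y‖ ^ (-τ - 2) * (2 * radialMetric (mulI n) p z a a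
        * (2 * radialMetric (mulI n) p z b b)) := mul_le_mul_of_nonneg_left b3 hs
    _ = _ := by ring

omit [NeZero n] in
lemma exists_orthogonal (hn : 2 ≤ n) (z : Cn n) : ∃ w : Cn n, w ≠ 0 ∧ inner ℂ z w = 0 := by
  have h1 : 0 < Module.finrank ℂ ((Submodule.span ℂ {z})ᗮ : Submodule ℂ (Cn n)) := by
    have h2 := Submodule.finrank_add_finrank_orthogonal (𝕜 := ℂ) (Submodule.span ℂ {z})
    have h3 := finrank_span_le_card (R := ℂ) ({z} : Set (Cn n))
    simp at h2 h3
    omega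
  obtain ⟨w, hw⟩ := (Module.finrank_pos_iff_exists_ne_zero (R := ℂ)).1 h1
  exact ⟨w, fun h => hw (Subtype.ext h), Submodule.mem_orthogonal_singleton_iff_inner_right.1 w.2⟩

/-- The horizontal holomorphic sectional curvature bounds `p'`. -/
lemma IsEnd.horizontal {τ R C : ℝ} {Ψ : R2n n → LineBundle n k} (h : IsEnd g τ R C Ψ)
    (hr : IsRadial g p) (hn : 2 ≤ n) (hk : 1 ≤ k) {y : R2n n} (hy : R < ‖y‖) {z : Cn n} (hz : z ≠ 0)
    (hyz : Ψ y = ofVec z) :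
    |deriv p (‖z‖ ^ 2)| ≤ 2 * C * ‖y‖ ^ (-τ - 2) * p (‖z‖ ^ 2) ^ 2 := by
  obtain ⟨w, hw, horth⟩ := exists_orthogonal hn z
  obtain ⟨o1, o2⟩ := inner_eq_zero_of_mulI horth
  have hev := hr.eventually_contDiffAt (pow_pos (norm_pos_iff.2 hz) 2)
  obtain ⟨c1, c2, c3, hs⟩ := sectional_radial_horizontal (I := mulI n) mulI_mulI inner_mulI_left
    hev o1 o2
  have h1 := h.radial_curvature hr hk hy hz hyz c1 c2 c3
  have hw0 : 0 < ‖w‖ ^ 4 := pow_pos (norm_pos_iff.2 hw) 4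
  rw [hs, radialMetric_apply, radialMetric_apply, rankOne, rankOne, mulI_mulI, inner_neg_right, o1,
    o2, real_inner_self_eq_norm_sq, real_inner_self_eq_norm_sq, norm_mulI, abs_mul, abs_mul,
    abs_of_pos hw0] at h1
  norm_num at h1
  refine le_of_mul_le_mul_right (a := 8 * ‖w‖ ^ 4) ?_ (by positivity)
  linarith

/-- The vertical holomorphic sectional curvature bounds the third order quantity
`(log (r f'(r)))''`, where the primes on the left are derivatives in `log r`. -/
lemma IsEnd.vertical {τ R C : ℝ} {Ψ : R2n n → LineBundle n k} (h : IsEnd g τ R C Ψ)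
    (hr : IsRadial g p) (hn : 2 ≤ n) (hk : 1 ≤ k) {y : R2n n} (hy : R < ‖y‖) {z : Cn n} (hz : z ≠ 0)
    (hyz : Ψ y = ofVec z) {r f1 f2 f3 : ℝ} (hrz : r = ‖z‖ ^ 2) (hf1 : f1 = p r + r * deriv p r)
    (hf2 : f2 = 2 * deriv p r + r * deriv (deriv p) r)
    (hf3 : f3 = 3 * deriv (deriv p) r + r * deriv (deriv (deriv p)) r) :
    |(r * f2 + r ^ 2 * f3 - r ^ 2 * f2 ^ 2 / f1) / f1| ≤ 4 * C * ‖y‖ ^ (-τ - 2) * (r * f1) := by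
  have hr0 : 0 < r := hrz ▸ pow_pos (norm_pos_iff.2 hz) 2
  have hf10 : 0 < f1 := hf1 ▸ (hr.p_pos hn hk hr0).2
  have hev := hr.eventually_contDiffAt (pow_pos (norm_pos_iff.2 hz) 2)
  obtain ⟨c1, c2, c3, hs⟩ := sectional_radial_vertical (I := mulI n) mulI_mulI inner_mulI_left
    hrz hev hf1 hf2 hf3 hf10.ne'
  have h1 := h.radial_curvature hr hk hy hz hyz c1 c2 c3
  have e0 : inner ℝ z (mulI n z) = 0 := inner_self_apply_eq_zero (I := mulI n) inner_mulI_left z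
  have e1 : radialMetric (mulI n) p z z z = 2 * (r * f1) := by
    rw [radialMetric_apply, rankOne, e0, real_inner_self_eq_norm_sq, ← hrz, hf1]; ring
  have e2 : radialMetric (mulI n) p z (mulI n z) (mulI n z) = 2 * (r * f1) := by
    rw [radialMetric_apply, rankOne, e0, mulI_mulI, inner_neg_right, real_inner_self_eq_norm_sq,
      real_inner_self_eq_norm_sq, norm_mulI, ← hrz, hf1]; ring
  rw [hs, e1, e2] at h1
  have e3 : -4 * r ^ 2 * f2 - 4 * r ^ 3 * f3 + 4 * r ^ 3 * f2 ^ 2 / f1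
      = -((4 * (r * f1)) * ((r * f2 + r ^ 2 * f3 - r ^ 2 * f2 ^ 2 / f1) / f1)) := by
    field_simp
    ring
  have hrf : 0 < 4 * (r * f1) := by positivity
  rw [e3, abs_neg, abs_mul, abs_of_pos hrf] at h1
  refine le_of_mul_le_mul_left (a := 4 * (r * f1)) ?_ hrf
  linarith

omit [NeZero n] in
lemma inner_sq_add_inner_mulI_sq_le (z v : Cn n) :
    inner ℝ z v ^ 2 + inner ℝ z (mulI n v) ^ 2 ≤ ‖z‖ ^ 2 * ‖v‖ ^ 2 := by
  have h1 := norm_inner_le_norm (𝕜 := ℂ) z v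
  have h2 : inner ℝ z v ^ 2 + inner ℝ z (mulI n v) ^ 2 = ‖inner ℂ z v‖ ^ 2 := by
    rw [inner_eq_re, inner_eq_re, mulI_apply, inner_smul_right, ← Complex.normSq_eq_norm_sq,
      Complex.normSq_apply]
    simp
    ring
  rw [h2, ← mul_pow]
  gcongr

lemma IsRadial.fderiv_momentum_ofVec (hr : IsRadial g p) {i j : Fin n} (hij : i ≠ j)
    {z : Cn n} (hz : z ≠ 0) (w : Cn n) :
    fderiv ℝ (fun y => momentum g i j (ofVec y)) z w
      = 2 * (p (‖z‖ ^ 2) + ‖z‖ ^ 2 * deriv p (‖z‖ ^ 2)) * inner ℝ z w := by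
  have h0 : 0 < ‖z‖ ^ 2 := pow_pos (norm_pos_iff.2 hz) 2
  have hev : (fun y => momentum g i j (ofVec y)) =ᶠ[𝓝 z] fun y => ‖y‖ ^ 2 * p (‖y‖ ^ 2) := by
    filter_upwards [isOpen_ne.mem_nhds hz] with y hy using hr.momentum_ofVec hij hy
  have h1 := (hasDerivAt_id (‖z‖ ^ 2)).mul (hasDerivAt_of_contDiffAt (hr.contDiffAt h0))
  have h2 : HasFDerivAt (fun y : Cn n => ‖y‖ ^ 2 * p (‖y‖ ^ 2)) _ z := hasFDerivAt_comp_norm_sq h1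
  rw [hev.fderiv_eq, h2.fderiv]
  simp

/-- The gradient of the moment map, by the Cauchy-Schwarz inequality in the direction of `z`. -/
lemma IsRadial.dOut_momentum_sq_le (hr : IsRadial g p) (hn : 2 ≤ n) (hk : 1 ≤ k) {i j : Fin n}
    (hij : i ≠ j) {z : Cn n} (hz : z ≠ 0) (v : Cn n) :
    dOut (momentum g i j) (ofVec z) v ^ 2
      ≤ 2 * (‖z‖ ^ 2 * (p (‖z‖ ^ 2) + ‖z‖ ^ 2 * deriv p (‖z‖ ^ 2)))
        * tensorAt g.inner (ofVec z) v v := by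
  obtain ⟨w, rfl⟩ := (dInto_ofVec_bijective hk hz).2 v
  have h0 : 0 < ‖z‖ ^ 2 := pow_pos (norm_pos_iff.2 hz) 2
  have h1 : dOut (momentum g i j) (ofVec z) (dInto (ofVec (k := k)) z w)
      = fderiv ℝ (fun y => momentum g i j (ofVec y)) z w := by
    rw [fderiv_comp_dInto (mdiffAt (hr.contMDiff_momentum hk hij _)) (mdiffAt (contMDiffAt_ofVec hz))]
    rfl
  obtain ⟨hp, hf⟩ := hr.p_pos hn hk h0
  rw [h1, hr.fderiv_momentum_ofVec hij hz, tensorAt_dInto, hr.metric_eq z hz, radialMetric_apply,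
    rankOne, real_inner_self_eq_norm_sq]
  have h2 := inner_sq_add_inner_mulI_sq_le z w
  generalize inner ℝ z w = α at *
  generalize inner ℝ z (mulI n w) = β at *
  generalize deriv p (‖z‖ ^ 2) = p' at *
  generalize p (‖z‖ ^ 2) = p₀ at *
  generalize ‖z‖ ^ 2 = r at *
  have h3 : 0 ≤ (p₀ + r * p') * (p₀ * (r * ‖w‖ ^ 2 - (α ^ 2 + β ^ 2)) + (p₀ + r * p') * β ^ 2) :=
    mul_nonneg hf.le (add_nonneg (mul_nonneg hp.le (sub_nonneg.2 h2)) (by positivity))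
  nlinarith [h3]

/-- A linear Gronwall estimate with an integrable coefficient. -/
lemma le_mul_of_deriv_le {σ σ' : ℝ → ℝ} {S K δ : ℝ} (hS : 1 ≤ S) (hK : 0 ≤ K) (hδ : 0 < δ)
    (hσ : ∀ s, S ≤ s → HasDerivAt σ (σ' s) s) (hσ0 : ∀ s, S ≤ s → 0 ≤ σ s)
    (hle : ∀ s, S ≤ s → σ' s ≤ 1 + K * s ^ (-1 - δ) * σ s) :
    ∃ A, 0 < A ∧ ∀ s, S ≤ s → σ s ≤ A * s := by
  let E : ℝ → ℝ := fun s => K / δ * s ^ (-δ)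
  have hE : ∀ s, S ≤ s → HasDerivAt E (-(K * s ^ (-1 - δ))) s := by
    intro s hs
    have h1 := (Real.hasDerivAt_rpow_const (x := s) (p := -δ) (Or.inl (by linarith))).const_mul
      (K / δ)
    refine h1.congr_deriv ?_
    rw [show -δ - 1 = -1 - δ by ring]
    field_simp
  have hE0 : ∀ s, S ≤ s → 0 ≤ E s := fun s hs =>
    mul_nonneg (by positivity) (Real.rpow_nonneg (by linarith) _)
  have hEle : ∀ s, S ≤ s → E s ≤ E S := fun s hs =>
    mul_le_mul_of_nonneg_left (Real.rpow_le_rpow_of_nonpos (by linarith) hs (by linarith))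
      (by positivity)
  let f : ℝ → ℝ := fun s => σ s * Real.exp (E s) - Real.exp (E S) * s
  have hf : ∀ s, S ≤ s → HasDerivAt f (σ' s * Real.exp (E s)
      + σ s * (Real.exp (E s) * -(K * s ^ (-1 - δ))) - Real.exp (E S) * 1) s := fun s hs =>
    ((hσ s hs).mul (hE s hs).exp).sub ((hasDerivAt_id s).const_mul _)
  have hanti : AntitoneOn f (Set.Ici S) := by
    refine antitoneOn_of_deriv_nonpos (convex_Ici S)
      (fun s hs => (hf s hs).continuousAt.continuousWithinAt)
      (fun s hs => (hf s (interior_subset hs)).differentiableAt.differentiableWithinAt) ?_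
    intro s hs
    have hs' : S ≤ s := interior_subset hs
    rw [(hf s hs').deriv]
    have h1 := mul_le_mul_of_nonneg_right (hle s hs') (Real.exp_pos (E s)).le
    have h2 := Real.exp_le_exp.2 (hEle s hs')
    nlinarith
  refine ⟨Real.exp (E S) * (1 + σ S), mul_pos (Real.exp_pos _) (by linarith [hσ0 S le_rfl]),
    fun s hs => ?_⟩
  have h1 := hanti (Set.mem_Ici.2 le_rfl) (Set.mem_Ici.2 hs) hs
  simp only [f] at h1
  have h2 : σ s ≤ σ s * Real.exp (E s) :=
    le_mul_of_one_le_right (hσ0 s hs) (Real.one_le_exp (hE0 s hs))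
  have h3 : σ S * Real.exp (E S) ≤ σ S * Real.exp (E S) * s :=
    le_mul_of_one_le_right (mul_nonneg (hσ0 S le_rfl) (Real.exp_pos _).le) (by linarith)
  have h4 : 0 < Real.exp (E S) * S := mul_pos (Real.exp_pos _) (by linarith)
  nlinarith

/-- Along a ray of the end the moment map `M` grows at most quadratically. The gradient of `√M` is
bounded by `1 + O(s^{-1-τ/2}) √M`, because the horizontal curvature controls `p'`. -/
lemma IsEnd.exists_momentum_le {τ R C : ℝ} {Ψ : R2n n → LineBundle n k} (h : IsEnd g τ R C Ψ)
    (hτ : 0 < τ) (hr : IsRadial g p) (hn : 2 ≤ n) (hk : 1 ≤ k) {i j : Fin n} (hij : i ≠ j)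
    {θ : R2n n} (hθ : ‖θ‖ = 1) :
    ∃ A S, 0 < A ∧ R < S ∧ ∀ s, S ≤ s → fiberNorm (Ψ (s • θ)) ≠ 0 ∧
      momentum g i j (Ψ (s • θ)) ≤ A * s ^ 2 := by
  have := LineBundle.t2Space (n := n) hk
  obtain ⟨R', hR'⟩ := h.exists_forall_notMem (isCompact_fiberNorm_le (n := n) (k := k) 0)
  let S : ℝ := max R R' + 1
  have hRS : R < S := (le_max_left _ _).trans_lt (lt_add_one _)
  have hS1 : 1 ≤ S := h.one_le.trans hRS.le
  have hnorm : ∀ s, S ≤ s → ‖s • θ‖ = s := fun s hs => by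
    rw [norm_smul, hθ, mul_one, Real.norm_of_nonneg (by linarith)]
  have hgt : ∀ s, S ≤ s → R < ‖s • θ‖ := fun s hs => by rw [hnorm s hs]; linarith
  have hN : ∀ s, S ≤ s → fiberNorm (Ψ (s • θ)) ≠ 0 := by
    intro s hs h0
    refine hR' (s • θ) ?_ h0.le
    rw [hnorm s hs]
    exact ((le_max_right _ _).trans_lt (lt_add_one _)).trans_le hs
  let M : ℝ → ℝ := fun s => momentum g i j (Ψ (s • θ))
  have hM0 : ∀ s, 0 < M s := fun s => momentum_pos _
  let M' : ℝ → ℝ := fun s => dOut (momentum g i j) (Ψ (s • θ)) (dInto Ψ (s • θ) θ)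
  have hM : ∀ s, S ≤ s → HasDerivAt M (M' s) s := by
    intro s hs
    have h1 := mdiffAt (hr.contMDiff_momentum hk hij (Ψ (s • θ)))
    have h2 := mdiffAt (h.smooth _ (hgt s hs))
    have h3 : DifferentiableAt ℝ (fun y => momentum g i j (Ψ y)) (s • θ) :=
      (h1.comp (s • θ) h2).differentiableAt
    have h4 := h3.hasFDerivAt
    rw [fderiv_comp_dInto h1 h2] at h4
    have h5 : HasDerivAt (fun t : ℝ => t • θ) θ s := by
      simpa using (hasDerivAt_id s).smul_const θ
    exact h4.comp_hasDerivAt s h5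
  have hbound : ∀ s, S ≤ s → M' s ^ 2 ≤ 4 * (M s + 2 * C * s ^ (-τ - 2) * M s ^ 2) := by
    intro s hs
    obtain ⟨z, hz, hzs⟩ := exists_eq_ofVec hk (hN s hs)
    have h0 : 0 < ‖z‖ ^ 2 := pow_pos (norm_pos_iff.2 hz) 2
    have h1 := hr.dOut_momentum_sq_le hn hk hij hz (dInto Ψ (s • θ) θ)
    have h2 := h.horizontal hr hn hk (hgt s hs) hz hzs
    have h3 := (h.bounds _ (hgt s hs) θ).2
    have h4 : M s = ‖z‖ ^ 2 * p (‖z‖ ^ 2) := by simp only [M, hzs, hr.momentum_ofVec hij hz]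
    rw [← hzs, tensorAt_dInto] at h1
    rw [hθ] at h3
    rw [hnorm s hs] at h2
    obtain ⟨hp, hf⟩ := hr.p_pos hn hk h0
    have h5 := (abs_le.1 h2).2
    generalize deriv p (‖z‖ ^ 2) = p' at *
    generalize p (‖z‖ ^ 2) = p₀ at *
    generalize ‖z‖ ^ 2 = r at *
    calc M' s ^ 2 ≤ _ := h1
      _ ≤ 2 * (r * (p₀ + r * p')) * (2 * 1 ^ 2) := mul_le_mul_of_nonneg_left h3 (by positivity)
      _ = 4 * (r * p₀ + r ^ 2 * p') := by ring
      _ ≤ 4 * (r * p₀ + r ^ 2 * (2 * C * s ^ (-τ - 2) * p₀ ^ 2)) := by gcongr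
      _ = _ := by rw [h4]; ring
  have hder : ∀ s, S ≤ s → M' s / (2 * √(M s))
      ≤ 1 + √(2 * C) * s ^ (-1 - τ / 2) * √(M s) := by
    intro s hs
    have hs0 : 0 < s := by linarith
    have hq : 0 < √(M s) := Real.sqrt_pos.2 (hM0 s)
    rw [div_le_iff₀ (by positivity)]
    set q := √(M s)
    have hqM : M s = q ^ 2 := (Real.sq_sqrt (hM0 s).le).symm
    set κ := √(2 * C) * s ^ (-1 - τ / 2)
    have hκ0 : 0 ≤ κ := by positivity
    have hκ : κ ^ 2 = 2 * C * s ^ (-τ - 2) := by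
      simp only [κ]
      rw [mul_pow, Real.sq_sqrt (by linarith [h.nonneg]), ← Real.rpow_natCast (s ^ _),
        ← Real.rpow_mul hs0.le]
      congr 2
      push_cast
      ring
    have h1 := hbound s hs
    rw [← hκ, hqM] at h1
    refine le_of_abs_le (abs_le_of_sq_le_sq ?_ (by positivity))
    nlinarith [mul_nonneg hκ0 hq.le, mul_nonneg (mul_nonneg hκ0 hq.le) (sq_nonneg q)]
  obtain ⟨A, hA, hle⟩ := le_mul_of_deriv_le (σ := fun s => √(M s))
    (σ' := fun s => M' s / (2 * √(M s))) (K := √(2 * C)) (δ := τ / 2) hS1 (Real.sqrt_nonneg _)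
    (by linarith) (fun s hs => (hM s hs).sqrt (hM0 s).ne') (fun s _ => Real.sqrt_nonneg _) hder
  refine ⟨A ^ 2, S, by positivity, hRS, fun s hs => ⟨hN s hs, ?_⟩⟩
  have h1 := pow_le_pow_left₀ (Real.sqrt_nonneg _) (hle s hs) 2
  rwa [Real.sq_sqrt (hM0 s).le, mul_pow] at h1

/-- The asymptotic inequalities for the radial profile of an asymptotically locally Euclidean
metric. All level sets `|z|² = r` far out meet a fixed ray of the end, so that it suffices to evaluate
the curvature bounds along this ray. -/
lemma IsEnd.asymptotics {τ R C : ℝ} {Ψ : R2n n → LineBundle n k} (h : IsEnd g τ R C Ψ)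
    (hτ : 0 < τ) (hr : IsRadial g p) (hn : 2 ≤ n) (hk : 1 ≤ k) :
    ∃ K r₀, 0 < K ∧ 0 < r₀ ∧ ∀ r, r₀ ≤ r →
      |r ^ 2 * deriv p r| ≤ r * p r / 2 ∧
      |r ^ 2 * deriv p r| ≤ K * (r * p r) ^ (-(τ / 2)) * (r * p r) ∧
      ∀ f1 f2 f3, f1 = p r + r * deriv p r → f2 = 2 * deriv p r + r * deriv (deriv p) r →
        f3 = 3 * deriv (deriv p) r + r * deriv (deriv (deriv p)) r →
        |(r * f2 + r ^ 2 * f3 - r ^ 2 * f2 ^ 2 / f1) / f1| ≤ K * (r * p r) ^ (-(τ / 2)) := by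
  have := LineBundle.t2Space (n := n) hk
  let i : Fin n := ⟨0, by omega⟩
  let j : Fin n := ⟨1, by omega⟩
  have hij : i ≠ j := by simp [i, j]
  let θ : R2n n := EuclideanSpace.single ⟨0, by omega⟩ 1
  have hθ : ‖θ‖ = 1 := by simp [θ]
  obtain ⟨A, S, hA, hRS, hS⟩ := h.exists_momentum_le hτ hr hn hk hij hθ
  have hS1 : 1 < S := h.one_le.trans_lt hRS
  -- far out on the ray, the first bound holds
  have hlim : Filter.Tendsto (fun s : ℝ => 2 * C * A * s ^ (-τ)) Filter.atTop (𝓝 (2 * C * A * 0)) :=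
    (tendsto_rpow_neg_atTop hτ).const_mul _
  obtain ⟨S₁, hS₁⟩ := Filter.eventually_atTop.1
    (hlim.eventually (gt_mem_nhds (show 2 * C * A * 0 < 1 / 2 by norm_num)))
  let s₁ : ℝ := max S S₁
  have hcont : ContinuousOn (fun s : ℝ => fiberNorm (Ψ (s • θ))) (Set.Ici S) := by
    intro s hs
    have hn' : R < ‖s • θ‖ := by
      rw [norm_smul, hθ, mul_one, Real.norm_of_nonneg (by linarith [Set.mem_Ici.1 hs])]
      exact hRS.trans_le hs
    refine ContinuousAt.continuousWithinAt ?_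
    exact continuous_fiberNorm.continuousAt.comp
      (ContinuousAt.comp (f := fun s : ℝ => s • θ) (h.smooth _ hn').continuousAt (by fun_prop))
  let T₁ := fiberNorm (Ψ (s₁ • θ))
  let K := (6 * C + 1) * A⁻¹ ^ (-(τ / 2) - 1)
  have hC := h.nonneg
  refine ⟨K, max 1 (T₁ ^ 2), by positivity, lt_max_of_lt_left one_pos, fun r hr₀ => ?_⟩
  have hr1 : 1 ≤ r := (le_max_left _ _).trans hr₀
  have hr0 : 0 < r := by linarith
  have hsq1 : 1 ≤ √r := Real.one_le_sqrt.2 hr1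
  have hT : T₁ ≤ √r ^ k := by
    have h1 : T₁ ≤ √r := Real.le_sqrt_of_sq_le ((le_max_right _ _).trans hr₀)
    exact h1.trans (le_self_pow₀ hsq1 (by omega))
  -- a point of the ray on the level set
  obtain ⟨s, hss, hsN⟩ : ∃ s, s₁ ≤ s ∧ fiberNorm (Ψ (s • θ)) = √r ^ k := by
    obtain ⟨R', hR'⟩ := h.exists_forall_notMem (isCompact_fiberNorm_le (n := n) (k := k) (√r ^ k))
    let s₂ := max s₁ (|R'| + 1)
    have h12 : s₁ ≤ s₂ := le_max_left _ _
    have h2 : √r ^ k ≤ fiberNorm (Ψ (s₂ • θ)) := by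
      refine (not_le.1 (hR' (s₂ • θ) ?_)).le
      rw [norm_smul, hθ, mul_one]
      have := le_abs_self R'
      exact (by linarith : R' < |R'| + 1).trans_le ((le_max_right _ _).trans (le_abs_self s₂))
    obtain ⟨s, hs, hs'⟩ := intermediate_value_Icc h12
      (hcont.mono fun s hs => (le_max_left S S₁).trans hs.1) ⟨hT, h2⟩
    exact ⟨s, hs.1, hs'⟩
  have hSs : S ≤ s := (le_max_left _ _).trans hss
  have hs0 : 0 < s := by linarith
  have hnorm : ‖s • θ‖ = s := by rw [norm_smul, hθ, mul_one, Real.norm_of_nonneg hs0.le]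
  have hRs : R < ‖s • θ‖ := by rw [hnorm]; linarith
  obtain ⟨hN, hM⟩ := hS s hSs
  obtain ⟨z, hz, hzs⟩ := exists_eq_ofVec hk hN
  have hzr : r = ‖z‖ ^ 2 := by
    rw [hzs, fiberNorm_ofVec hz] at hsN
    rw [(pow_left_inj₀ (norm_nonneg z) (Real.sqrt_nonneg r) (by omega)).1 hsN, Real.sq_sqrt hr0.le]
  rw [hzs, hr.momentum_ofVec hij hz, ← hzr] at hM
  have hH := h.horizontal hr hn hk hRs hz hzs
  rw [← hzr, hnorm] at hH
  obtain ⟨hp, hf⟩ := hr.p_pos hn hk hr0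
  have hx : 0 < r * p r := mul_pos hr0 hp
  set x := r * p r with hx_def
  have hH' : |r ^ 2 * deriv p r| ≤ 2 * C * s ^ (-τ - 2) * x ^ 2 := by
    rw [abs_mul, abs_of_pos (by positivity : 0 < r ^ 2)]
    calc _ ≤ r ^ 2 * (2 * C * s ^ (-τ - 2) * p r ^ 2) := by gcongr
      _ = _ := by rw [hx_def]; ring
  have hspow : s ^ (-τ - 2) * s ^ 2 = s ^ (-τ) := by
    rw [← Real.rpow_natCast s 2, ← Real.rpow_add hs0]
    congr 1
    push_cast; ring
  -- the radius is bounded below in terms of the moment map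
  have hsx : s ^ (-τ - 2) * x ≤ A⁻¹ ^ (-(τ / 2) - 1) * x ^ (-(τ / 2)) := by
    have h1 : s ^ (-τ - 2) = (s ^ 2) ^ (-(τ / 2) - 1) := by
      rw [← Real.rpow_natCast s 2, ← Real.rpow_mul hs0.le]
      congr 1
      push_cast; ring
    have h2 : A⁻¹ * x ≤ s ^ 2 := by rwa [inv_mul_le_iff₀ hA]
    have h3 : (s ^ 2) ^ (-(τ / 2) - 1) ≤ (A⁻¹ * x) ^ (-(τ / 2) - 1) :=
      Real.rpow_le_rpow_of_nonpos (by positivity) h2 (by linarith)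
    rw [Real.mul_rpow (by positivity) hx.le] at h3
    have h4 : x ^ (-(τ / 2)) = x ^ (-(τ / 2) - 1) * x := by
      rw [← Real.rpow_add_one hx.ne']; congr 1; ring
    rw [h1, h4, ← mul_assoc (A⁻¹ ^ _)]
    exact mul_le_mul_of_nonneg_right h3 hx.le
  have hsp : 0 ≤ s ^ (-τ - 2) := Real.rpow_nonneg hs0.le _
  have hfirst : |r ^ 2 * deriv p r| ≤ x / 2 := by
    have h1 := hS₁ s ((le_max_right _ _).trans hss)
    calc _ ≤ 2 * C * s ^ (-τ - 2) * x ^ 2 := hH'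
      _ = 2 * C * s ^ (-τ - 2) * x * x := by ring
      _ ≤ 2 * C * s ^ (-τ - 2) * (A * s ^ 2) * x := by gcongr
      _ = 2 * C * A * (s ^ (-τ - 2) * s ^ 2) * x := by ring
      _ ≤ 1 / 2 * x := by rw [hspow]; gcongr
      _ = x / 2 := by ring
  have hAx : 0 ≤ A⁻¹ ^ (-(τ / 2) - 1) * x ^ (-(τ / 2)) := by positivity
  refine ⟨hfirst, ?_, fun f1 f2 f3 e1 e2 e3 => ?_⟩
  · calc _ ≤ 2 * C * s ^ (-τ - 2) * x ^ 2 := hH'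
      _ = 2 * C * (s ^ (-τ - 2) * x) * x := by ring
      _ ≤ (6 * C + 1) * (A⁻¹ ^ (-(τ / 2) - 1) * x ^ (-(τ / 2))) * x := by
        gcongr
        linarith
      _ = _ := by simp only [K]; ring
  · have hV := h.vertical hr hn hk hRs hz hzs hzr e1 e2 e3
    rw [hnorm] at hV
    have h2 : r * f1 ≤ 3 / 2 * x := by
      have := (abs_le.1 hfirst).2
      rw [e1]
      nlinarith
    calc _ ≤ 4 * C * s ^ (-τ - 2) * (r * f1) := hV
      _ ≤ 4 * C * s ^ (-τ - 2) * (3 / 2 * x) := by gcongr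
      _ = 6 * C * (s ^ (-τ - 2) * x) := by ring
      _ ≤ (6 * C + 1) * (A⁻¹ ^ (-(τ / 2) - 1) * x ^ (-(τ / 2))) := by
        gcongr
        linarith
      _ = _ := by simp only [K]; ring

end Growth

/-! ### Asymptotics of the radial profile -/

section Asymptotics

open Filter Asymptotics

/-- A function with exponentially small derivative converges exponentially fast. -/
lemma exists_abs_sub_le_exp {h h' : ℝ → ℝ} {T K δ : ℝ} (hδ : 0 < δ)
    (hh : ∀ t, T ≤ t → HasDerivAt h (h' t) t) (hb : ∀ t, T ≤ t → |h' t| ≤ K * Real.exp (-δ * t)) :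
    ∃ ℓ, ∀ t, T ≤ t → |h t - ℓ| ≤ K / δ * Real.exp (-δ * t) := by
  let ε : ℝ → ℝ := fun t => K / δ * Real.exp (-δ * t)
  have hK : 0 ≤ K := by
    have := (abs_nonneg _).trans (hb T le_rfl)
    exact nonneg_of_mul_nonneg_left this (Real.exp_pos _)
  have hε0 : ∀ t, 0 ≤ ε t := fun t => by positivity
  have hε : ∀ t, HasDerivAt ε (-(K * Real.exp (-δ * t))) t := by
    intro t
    refine (((hasDerivAt_id t).const_mul (-δ)).exp.const_mul (K / δ)).congr_deriv ?_
    simp only [id]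
    field_simp
  have hanti : AntitoneOn (fun t => h t + ε t) (Set.Ici T) := by
    refine antitoneOn_of_deriv_nonpos (convex_Ici T)
      (fun t ht => ((hh t ht).add (hε t)).continuousAt.continuousWithinAt)
      (fun t ht => ((hh t (interior_subset ht)).add (hε t)).differentiableAt.differentiableWithinAt)
      fun t ht => ?_
    have ht' : T ≤ t := interior_subset ht
    rw [((hh t ht').fun_add (hε t)).deriv]
    linarith [(abs_le.1 (hb t ht')).2]
  have hmono : MonotoneOn (fun t => h t - ε t) (Set.Ici T) := by
    refine monotoneOn_of_deriv_nonneg (convex_Ici T)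
      (fun t ht => ((hh t ht).sub (hε t)).continuousAt.continuousWithinAt)
      (fun t ht => ((hh t (interior_subset ht)).sub (hε t)).differentiableAt.differentiableWithinAt)
      fun t ht => ?_
    have ht' : T ≤ t := interior_subset ht
    rw [((hh t ht').fun_sub (hε t)).deriv]
    linarith [(abs_le.1 (hb t ht')).1]
  -- the limit is the infimum of the antitone function
  let S : Set ℝ := (fun t => h t + ε t) '' Set.Ici T
  have hlow : ∀ t, T ≤ t → ∀ s, T ≤ s → h t - ε t ≤ h s + ε s := by
    intro t ht s hs
    rcases le_total t s with h1 | h1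
    · have := hmono ht hs h1
      simp only at this
      linarith [hε0 s]
    · have := hanti hs ht h1
      simp only at this
      linarith [hε0 t]
  have hbdd : BddBelow S := ⟨h T - ε T, by
    rintro _ ⟨s, hs, rfl⟩
    exact hlow T le_rfl s hs⟩
  refine ⟨sInf S, fun t ht => abs_le.2 ⟨?_, ?_⟩⟩
  · have := csInf_le hbdd (Set.mem_image_of_mem _ ht)
    simp only [ε] at this
    linarith
  · have : h t - ε t ≤ sInf S := by
      refine le_csInf ⟨_, Set.mem_image_of_mem _ (Set.mem_Ici.2 le_rfl)⟩ ?_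
      rintro _ ⟨s, hs, rfl⟩
      exact hlow t ht s hs
    simp only [ε] at this
    linarith

/-- The asymptotic behaviour of solutions of `x' = x y`, `y' = y (M + 1 - y)` for which `y - 1` and
`M'` are bounded by a negative power of `x`. -/
lemma exists_asymptotics {x y M M' : ℝ → ℝ} {T K δ : ℝ} (hδ : 0 < δ) (hT : 0 ≤ T)
    (hx0 : ∀ t, 0 < x t) (hx : ∀ t, HasDerivAt x (x t * y t) t)
    (hy : ∀ t, HasDerivAt y (y t * (M t + 1 - y t)) t) (hM : ∀ t, HasDerivAt M (M' t) t)
    (h1 : ∀ t, T ≤ t → |y t - 1| ≤ 1 / 2) (h2 : ∀ t, T ≤ t → |y t - 1| ≤ K * x t ^ (-δ))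
    (h3 : ∀ t, T ≤ t → |M' t| ≤ K * x t ^ (-δ)) :
    ∃ c B, 0 < c ∧ ∀ t, T ≤ t → |Real.exp t / x t - c| ≤ B * Real.exp (-δ * t) ∧
      |y t - 1| ≤ B * Real.exp (-δ * t) ∧ |M t| ≤ B * Real.exp (-δ * t) ∧
      |M' t| ≤ B * Real.exp (-δ * t) := by
  have hK : 0 ≤ K := by
    have := (abs_nonneg _).trans (h2 T le_rfl)
    exact nonneg_of_mul_nonneg_left this (Real.rpow_pos_of_pos (hx0 T) _)
  -- exponential growth at half the expected rate
  have hhalf : ∀ t, T ≤ t → x T * Real.exp (-(T / 2)) * Real.exp (t / 2) ≤ x t := by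
    have hd : ∀ t, HasDerivAt (fun t => x t * Real.exp (-(t / 2)))
        (x t * y t * Real.exp (-(t / 2)) + x t * (Real.exp (-(t / 2)) * -(1 / 2))) t := fun t =>
      (hx t).mul (((hasDerivAt_id t).div_const 2).neg.exp)
    have hmono : MonotoneOn (fun t => x t * Real.exp (-(t / 2))) (Set.Ici T) := by
      refine monotoneOn_of_deriv_nonneg (convex_Ici T)
        (fun t ht => (hd t).continuousAt.continuousWithinAt)
        (fun t ht => (hd t).differentiableAt.differentiableWithinAt) fun t ht => ?_
      have h4 := (abs_le.1 (h1 t (interior_subset ht))).1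
      rw [(hd t).deriv, show x t * y t * Real.exp (-(t / 2))
        + x t * (Real.exp (-(t / 2)) * -(1 / 2))
        = x t * Real.exp (-(t / 2)) * (y t - 1 / 2) by ring]
      exact mul_nonneg (mul_pos (hx0 t) (Real.exp_pos _)).le (by linarith)
    intro t ht
    have h4 := hmono (Set.mem_Ici.2 le_rfl) (Set.mem_Ici.2 ht) ht
    calc _ ≤ x t * Real.exp (-(t / 2)) * Real.exp (t / 2) := by gcongr
      _ = x t := by rw [mul_assoc, ← Real.exp_add]; simp
  have hpow : ∀ b κ : ℝ, 0 < b → ∀ t, b * Real.exp (κ * t) ≤ x t →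
      x t ^ (-δ) ≤ b ^ (-δ) * Real.exp (-(δ * κ) * t) := by
    intro b κ hb t ht
    have h4 := Real.rpow_le_rpow_of_nonpos (by positivity) ht (by linarith : -δ ≤ 0)
    rw [Real.mul_rpow hb.le (Real.exp_pos _).le, ← Real.exp_mul] at h4
    rwa [show κ * t * -δ = -(δ * κ) * t by ring] at h4
  let G : ℝ → ℝ := fun t => t - Real.log (x t)
  have hG : ∀ t, HasDerivAt G (1 - y t) t := by
    intro t
    refine ((hasDerivAt_id t).sub ((hx t).log (hx0 t).ne')).congr_deriv ?_
    rw [mul_div_cancel_left₀ _ (hx0 t).ne']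
  have hGx : ∀ t, Real.exp (G t) = Real.exp t / x t := fun t => by
    rw [Real.exp_sub, Real.exp_log (hx0 t)]
  -- convergence of `log x - t` with half of the expected rate, and the expected growth
  let b := x T * Real.exp (-(T / 2))
  have hb : 0 < b := mul_pos (hx0 T) (Real.exp_pos _)
  obtain ⟨γ₀, hγ₀⟩ := exists_abs_sub_le_exp (h := G) (h' := fun t => 1 - y t) (T := T)
    (K := K * b ^ (-δ)) (δ := δ * (1 / 2)) (by positivity) (fun t _ => hG t) (fun t ht => by
      rw [abs_sub_comm, mul_assoc]
      refine (h2 t ht).trans (mul_le_mul_of_nonneg_left (hpow b (1 / 2) hb t ?_) hK)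
      have := hhalf t ht
      rwa [show t / 2 = 1 / 2 * t by ring] at this)
  let B₀ := K * b ^ (-δ) / (δ * (1 / 2))
  have hB₀ : 0 ≤ B₀ := by positivity
  have hlin : ∀ t, T ≤ t → Real.exp (-(γ₀ + B₀)) * Real.exp (1 * t) ≤ x t := by
    intro t ht
    have h4 := (abs_le.1 (hγ₀ t ht)).2
    have h5 : Real.exp (-(δ * (1 / 2)) * t) ≤ 1 :=
      Real.exp_le_one_iff.2 (by nlinarith)
    have h6 : B₀ * Real.exp (-(δ * (1 / 2)) * t) ≤ B₀ := mul_le_of_le_one_right hB₀ h5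
    have h7 : t - Real.log (x t) ≤ γ₀ + B₀ := by
      simp only [G, B₀] at h4 h6 ⊢
      linarith
    rw [← Real.exp_add, ← Real.le_log_iff_exp_le (hx0 t)]
    linarith
  let K₁ := K * Real.exp (-(γ₀ + B₀)) ^ (-δ)
  have hK₁ : 0 ≤ K₁ := by positivity
  have hfin : ∀ t, T ≤ t → K * x t ^ (-δ) ≤ K₁ * Real.exp (-δ * t) := by
    intro t ht
    have := hpow _ 1 (Real.exp_pos _) t (hlin t ht)
    rw [mul_one] at this
    calc _ ≤ K * (_ * Real.exp (-δ * t)) := mul_le_mul_of_nonneg_left this hK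
      _ = _ := by simp only [K₁]; ring
  have hy1 : ∀ t, T ≤ t → |y t - 1| ≤ K₁ * Real.exp (-δ * t) := fun t ht =>
    (h2 t ht).trans (hfin t ht)
  have hM1 : ∀ t, T ≤ t → |M' t| ≤ K₁ * Real.exp (-δ * t) := fun t ht =>
    (h3 t ht).trans (hfin t ht)
  have hexp1 : ∀ t, T ≤ t → Real.exp (-δ * t) ≤ 1 := fun t ht =>
    Real.exp_le_one_iff.2 (by nlinarith)
  obtain ⟨γ, hγ⟩ := exists_abs_sub_le_exp (h := G) (h' := fun t => 1 - y t) (T := T)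
    (K := K₁) hδ (fun t _ => hG t) (fun t ht => by rw [abs_sub_comm]; exact hy1 t ht)
  obtain ⟨m, hm⟩ := exists_abs_sub_le_exp (h := M) (h' := M') (T := T)
    (K := K₁) hδ (fun t _ => hM t) hM1
  have hypos : ∀ t, T ≤ t → 1 / 2 ≤ y t := fun t ht => by linarith [(abs_le.1 (h1 t ht)).1]
  -- the limit of `M` vanishes, because `log y` stays bounded
  have hm0 : m = 0 := by
    by_contra hm0
    have hw : ∀ t, T ≤ t → HasDerivAt (fun t => Real.log (y t) - m * t)
        (M t + 1 - y t - m) t := by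
      intro t ht
      have h4 : y t ≠ 0 := by linarith [hypos t ht]
      refine (((hy t).log h4).sub ((hasDerivAt_id t).const_mul m)).congr_deriv ?_
      rw [mul_div_cancel_left₀ _ h4, mul_one]
    obtain ⟨ℓ, hℓ⟩ := exists_abs_sub_le_exp (K := K₁ / δ + K₁) hδ hw (fun t ht => by
      have h4 := hm t ht
      have h5 := hy1 t ht
      have h6 : M t + 1 - y t - m = (M t - m) - (y t - 1) := by ring
      rw [h6, add_mul]
      exact (abs_sub _ _).trans (add_le_add h4 h5))
    let B₁ := (K₁ / δ + K₁) / δ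
    have hB₁ : 0 ≤ B₁ := by positivity
    have hbd : ∀ t, T ≤ t → |m| * t ≤ 1 + |ℓ| + B₁ := by
      intro t ht
      have h4 : |Real.log (y t) - m * t - ℓ| ≤ B₁ :=
        (hℓ t ht).trans (mul_le_of_le_one_right hB₁ (hexp1 t ht))
      have hyp : 0 < y t := by linarith [hypos t ht]
      have h5 : |Real.log (y t)| ≤ 1 := by
        rw [abs_le]
        constructor
        · have h6 := Real.one_sub_inv_le_log_of_pos hyp
          have h7 : (y t)⁻¹ ≤ (1 / 2)⁻¹ := inv_anti₀ (by norm_num) (hypos t ht)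
          norm_num at h7
          linarith
        · linarith [Real.log_le_sub_one_of_pos hyp, (abs_le.1 (h1 t ht)).2]
      have h8 : |m| * t = |m * t| := by rw [abs_mul, abs_of_nonneg (hT.trans ht)]
      rw [h8, show m * t = Real.log (y t) + (-ℓ) - (Real.log (y t) - m * t - ℓ) by ring]
      refine (abs_sub _ _).trans (add_le_add ((abs_add_le _ _).trans ?_) h4)
      rw [abs_neg]
      linarith
    have hmpos : 0 < |m| := abs_pos.2 hm0
    let t := max T ((1 + |ℓ| + B₁ + 1) / |m|)
    have h9 := hbd t (le_max_left _ _)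
    have h10 : (1 + |ℓ| + B₁ + 1) / |m| ≤ t := le_max_right _ _
    rw [div_le_iff₀ hmpos] at h10
    linarith
  subst hm0
  simp only [sub_zero] at hm
  let B₂ := Real.exp (γ + K₁ / δ) * (K₁ / δ)
  have hB₂ : 0 ≤ B₂ := by positivity
  have hK₁δ : 0 ≤ K₁ / δ := by positivity
  refine ⟨Real.exp γ, B₂ + K₁ + K₁ / δ, Real.exp_pos γ, fun t ht => ?_⟩
  have hexp := Real.exp_pos (-δ * t)
  have hle : ∀ {a b : ℝ}, a ≤ b * Real.exp (-δ * t) → b ≤ B₂ + K₁ + K₁ / δ →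
      a ≤ (B₂ + K₁ + K₁ / δ) * Real.exp (-δ * t) := fun h4 h5 =>
    h4.trans (mul_le_mul_of_nonneg_right h5 hexp.le)
  refine ⟨hle (b := B₂) ?_ (by linarith), hle (hy1 t ht) (by linarith),
    hle (hm t ht) (by linarith), hle (hM1 t ht) (by linarith)⟩
  rw [← hGx]
  have h4 := hγ t ht
  have h5 : |G t - γ| ≤ K₁ / δ := h4.trans (mul_le_of_le_one_right (by positivity) (hexp1 t ht))
  have h6 : |Real.exp (G t) - Real.exp γ| ≤ Real.exp (γ + K₁ / δ) * |G t - γ| := by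
    have e1 : Real.exp (G t) ≤ Real.exp (γ + K₁ / δ) :=
      Real.exp_le_exp.2 (by linarith [(abs_le.1 h5).2])
    have e2 : Real.exp γ ≤ Real.exp (γ + K₁ / δ) := Real.exp_le_exp.2 (by linarith)
    have e3 : Real.exp (G t) - Real.exp γ ≤ Real.exp (G t) * (G t - γ) := by
      have h7 := mul_le_mul_of_nonneg_left (Real.add_one_le_exp (γ - G t)) (Real.exp_pos (G t)).le
      rw [← Real.exp_add] at h7
      rw [show G t + (γ - G t) = γ by ring] at h7
      linarith
    have e4 : Real.exp γ - Real.exp (G t) ≤ Real.exp γ * (γ - G t) := by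
      have h7 := mul_le_mul_of_nonneg_left (Real.add_one_le_exp (G t - γ)) (Real.exp_pos γ).le
      rw [← Real.exp_add] at h7
      rw [show γ + (G t - γ) = G t by ring] at h7
      linarith
    rw [abs_le]
    constructor
    · have h8 : Real.exp γ * (γ - G t) ≤ Real.exp (γ + K₁ / δ) * |G t - γ| := by
        rw [abs_sub_comm]
        rcases le_total 0 (γ - G t) with h9 | h9
        · exact mul_le_mul e2 (le_abs_self _) h9 (Real.exp_pos _).le
        · exact (mul_nonpos_of_nonneg_of_nonpos (Real.exp_pos _).le h9).trans (by positivity)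
      linarith
    · have h8 : Real.exp (G t) * (G t - γ) ≤ Real.exp (γ + K₁ / δ) * |G t - γ| := by
        rcases le_total 0 (G t - γ) with h9 | h9
        · exact mul_le_mul e1 (le_abs_self _) h9 (Real.exp_pos _).le
        · exact (mul_nonpos_of_nonneg_of_nonpos (Real.exp_pos _).le h9).trans (by positivity)
      linarith
  calc _ ≤ _ := h6
    _ ≤ Real.exp (γ + K₁ / δ) * (K₁ / δ * Real.exp (-δ * t)) := by gcongr
    _ = _ := by simp only [B₂]; ring

end Asymptotics

/-! ### The profile in the chart at infinity -/

section Profile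

open Filter Asymptotics LineBundle

/-- Derivatives of a function of `-log ρ`. -/
lemma deriv_comp_neg_log {q Q Q₁ Q₂ Q₃ : ℝ → ℝ} (hq : ∀ ρ, 0 < ρ → q ρ = Q (-Real.log ρ))
    (h1 : ∀ t, HasDerivAt Q (Q₁ t) t) (h2 : ∀ t, HasDerivAt Q₁ (Q₂ t) t)
    (h3 : ∀ t, HasDerivAt Q₂ (Q₃ t) t) {ρ : ℝ} (hρ : 0 < ρ) :
    ρ * deriv q ρ = -Q₁ (-Real.log ρ) ∧
    ρ ^ 2 * deriv (deriv q) ρ = Q₂ (-Real.log ρ) + Q₁ (-Real.log ρ) ∧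
    ρ ^ 3 * deriv (deriv (deriv q)) ρ
      = -(Q₃ (-Real.log ρ) + 3 * Q₂ (-Real.log ρ) + 2 * Q₁ (-Real.log ρ)) := by
  have hlog : ∀ ρ : ℝ, 0 < ρ → HasDerivAt (fun ρ => -Real.log ρ) (-ρ⁻¹) ρ := fun ρ hρ =>
    (Real.hasDerivAt_log hρ.ne').neg
  have d1 : ∀ ρ, 0 < ρ → deriv q ρ = -Q₁ (-Real.log ρ) * ρ⁻¹ := by
    intro ρ hρ
    have hev : q =ᶠ[𝓝 ρ] fun ρ => Q (-Real.log ρ) := by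
      filter_upwards [Ioi_mem_nhds hρ] with ρ' hρ' using hq ρ' hρ'
    have e1 : HasDerivAt (fun ρ => Q (-Real.log ρ)) _ ρ := (h1 _).comp ρ (hlog ρ hρ)
    rw [hev.deriv_eq, e1.deriv]
    ring
  have d2 : ∀ ρ, 0 < ρ → deriv (deriv q) ρ
      = (Q₂ (-Real.log ρ) + Q₁ (-Real.log ρ)) * (ρ⁻¹) ^ 2 := by
    intro ρ hρ
    have hev : deriv q =ᶠ[𝓝 ρ] fun ρ => -Q₁ (-Real.log ρ) * ρ⁻¹ := by
      filter_upwards [Ioi_mem_nhds hρ] with ρ' hρ' using d1 ρ' hρ'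
    have e1 : HasDerivAt (fun ρ => Q₁ (-Real.log ρ)) _ ρ := (h2 _).comp ρ (hlog ρ hρ)
    rw [hev.deriv_eq, (e1.fun_neg.fun_mul (hasDerivAt_inv hρ.ne')).deriv]
    field_simp
  have d3 : deriv (deriv (deriv q)) ρ
      = -(Q₃ (-Real.log ρ) + 3 * Q₂ (-Real.log ρ) + 2 * Q₁ (-Real.log ρ)) * (ρ⁻¹) ^ 3 := by
    have hev : deriv (deriv q) =ᶠ[𝓝 ρ]
        fun ρ => (Q₂ (-Real.log ρ) + Q₁ (-Real.log ρ)) * (ρ⁻¹) ^ 2 := by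
      filter_upwards [Ioi_mem_nhds hρ] with ρ' hρ' using d2 ρ' hρ'
    have e1 : HasDerivAt (fun ρ => Q₂ (-Real.log ρ) + Q₁ (-Real.log ρ)) _ ρ :=
      ((h3 _).comp ρ (hlog ρ hρ)).fun_add ((h2 _).comp ρ (hlog ρ hρ))
    rw [hev.deriv_eq, (e1.fun_mul ((hasDerivAt_inv hρ.ne').fun_pow 2)).deriv]
    push_cast
    field_simp
    ring
  refine ⟨?_, ?_, ?_⟩
  · rw [d1 ρ hρ]; field_simp
  · rw [d2 ρ hρ]; field_simp
  · rw [d3]; field_simp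

variable {n k : ℕ} [NeZero n] {g : RiemMetric n k} {p : ℝ → ℝ}

/-- In the chart at infinity, the radial profile of the rescaled metric has a positive limit, which is
approached with all derivatives up to order three at the rate `ρ^{τ/2}`. -/
lemma IsRadial.exists_invProfile_asymptotics (hr : IsRadial g p) (hn : 2 ≤ n) (hk : 1 ≤ k) {τ : ℝ}
    (hτ : 0 < τ) (h : IsALE g τ) :
    ∃ c, 0 < c ∧
      (fun ρ => invProfile p ρ - c) =O[𝓝[>] 0] (fun ρ : ℝ => ρ ^ (τ / 2)) ∧
      (fun ρ => ρ * deriv (invProfile p) ρ) =O[𝓝[>] 0] (fun ρ : ℝ => ρ ^ (τ / 2)) ∧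
      (fun ρ => ρ ^ 2 * deriv (deriv (invProfile p)) ρ) =O[𝓝[>] 0] (fun ρ : ℝ => ρ ^ (τ / 2)) ∧
      (fun ρ => ρ ^ 3 * deriv (deriv (deriv (invProfile p))) ρ)
        =O[𝓝[>] 0] (fun ρ : ℝ => ρ ^ (τ / 2)) := by
  obtain ⟨R, C, Ψ, hΨ⟩ := h.exists_isEnd hτ
  obtain ⟨K, r₀, hK, hr₀, hasy⟩ := hΨ.asymptotics hτ hr hn hk
  -- the profile in the logarithmic variable
  let p1 := deriv p
  let p2 := deriv p1
  let p3 := deriv p2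
  have hd0 : ∀ r, 0 < r → HasDerivAt p (p1 r) r := fun r h0 =>
    hasDerivAt_of_contDiffAt (hr.contDiffAt h0)
  have hd1 : ∀ r, 0 < r → HasDerivAt p1 (p2 r) r := fun r h0 =>
    hasDerivAt_of_contDiffAt (contDiffAt_deriv (hr.contDiffAt h0))
  have hd2 : ∀ r, 0 < r → HasDerivAt p2 (p3 r) r := fun r h0 =>
    hasDerivAt_of_contDiffAt (contDiffAt_deriv (contDiffAt_deriv (hr.contDiffAt h0)))
  let f1 : ℝ → ℝ := fun r => p r + r * p1 r
  let f2 : ℝ → ℝ := fun r => 2 * p1 r + r * p2 r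
  let f3 : ℝ → ℝ := fun r => 3 * p2 r + r * p3 r
  have hf1 : ∀ r, 0 < r → HasDerivAt f1 (f2 r) r := fun r h0 =>
    ((hd0 r h0).add ((hasDerivAt_id r).mul (hd1 r h0))).congr_deriv (by simp [f2]; ring)
  have hf2 : ∀ r, 0 < r → HasDerivAt f2 (f3 r) r := fun r h0 =>
    (((hd1 r h0).const_mul 2).add ((hasDerivAt_id r).mul (hd2 r h0))).congr_deriv
      (by simp [f3]; ring)
  have hp0 : ∀ r, 0 < r → 0 < p r := fun r h0 => (hr.p_pos hn hk h0).1
  have hf0 : ∀ r, 0 < r → 0 < f1 r := fun r h0 => (hr.p_pos hn hk h0).2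
  have he : ∀ t : ℝ, HasDerivAt Real.exp (Real.exp t) t := Real.hasDerivAt_exp
  have hep : ∀ t : ℝ, 0 < Real.exp t := Real.exp_pos
  let x : ℝ → ℝ := fun t => Real.exp t * p (Real.exp t)
  let y : ℝ → ℝ := fun t => f1 (Real.exp t) / p (Real.exp t)
  let M : ℝ → ℝ := fun t => Real.exp t * f2 (Real.exp t) / f1 (Real.exp t)
  let M' : ℝ → ℝ := fun t => (Real.exp t * f2 (Real.exp t) + Real.exp t ^ 2 * f3 (Real.exp t)
    - Real.exp t ^ 2 * f2 (Real.exp t) ^ 2 / f1 (Real.exp t)) / f1 (Real.exp t)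
  have hx0 : ∀ t, 0 < x t := fun t => mul_pos (hep t) (hp0 _ (hep t))
  have hpne : ∀ t, p (Real.exp t) ≠ 0 := fun t => (hp0 _ (hep t)).ne'
  have hfne : ∀ t, f1 (Real.exp t) ≠ 0 := fun t => (hf0 _ (hep t)).ne'
  have hx : ∀ t, HasDerivAt x (x t * y t) t := by
    intro t
    refine ((he t).mul ((hd0 _ (hep t)).comp t (he t))).congr_deriv ?_
    have := hpne t
    simp only [x, y, f1, Function.comp_apply]
    field_simp
  have hy : ∀ t, HasDerivAt y (y t * (M t + 1 - y t)) t := by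
    intro t
    refine (((hf1 _ (hep t)).comp t (he t)).div ((hd0 _ (hep t)).comp t (he t))
      (hpne t)).congr_deriv ?_
    have h1 := hpne t
    have h2 := hfne t
    simp only [y, M, Function.comp_apply]
    field_simp
    simp only [f1]
    ring
  have hM : ∀ t, HasDerivAt M (M' t) t := by
    intro t
    refine (((he t).mul ((hf2 _ (hep t)).comp t (he t))).div ((hf1 _ (hep t)).comp t (he t))
      (hfne t)).congr_deriv ?_
    have h2 := hfne t
    simp only [M', Function.comp_apply, Pi.mul_apply]
    field_simp
  have hyx : ∀ t, y t - 1 = Real.exp t ^ 2 * p1 (Real.exp t) / x t := by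
    intro t
    have h1 := hpne t
    have h2 := (hep t).ne'
    simp only [y, x, f1]
    field_simp
    ring
  let T := max 0 (Real.log r₀)
  have hTr : ∀ t, T ≤ t → r₀ ≤ Real.exp t := fun t ht =>
    (Real.log_le_iff_le_exp hr₀).1 ((le_max_right _ _).trans ht)
  obtain ⟨c, B, hc, hB⟩ := exists_asymptotics (T := T) (K := K) (δ := τ / 2) (by linarith)
    (le_max_left _ _) hx0 hx hy hM
    (fun t ht => by
      rw [hyx, abs_div, abs_of_pos (hx0 t), div_le_iff₀ (hx0 t)]
      have := (hasy _ (hTr t ht)).1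
      simp only [x]
      linarith)
    (fun t ht => by
      rw [hyx, abs_div, abs_of_pos (hx0 t), div_le_iff₀ (hx0 t)]
      exact (hasy _ (hTr t ht)).2.1)
    (fun t ht => (hasy _ (hTr t ht)).2.2 _ _ _ rfl rfl rfl)
  -- the derivatives of the reciprocal profile
  let Q : ℝ → ℝ := fun t => Real.exp t / x t
  let a : ℝ → ℝ := fun t => 1 - y t
  let a' : ℝ → ℝ := fun t => -(y t * (M t + a t))
  let Q₁ : ℝ → ℝ := fun t => a t * Q t
  let Q₂ : ℝ → ℝ := fun t => (a t ^ 2 + a' t) * Q t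
  let Q₃ : ℝ → ℝ := fun t => (2 * (a t * a' t)
    - (y t * (M t + a t) * (M t + a t) + y t * (M' t + a' t))) * Q t + (a t ^ 2 + a' t) * Q₁ t
  have hQ : ∀ t, HasDerivAt Q (Q₁ t) t := fun t =>
    ((he t).div (hx t) (hx0 t).ne').congr_deriv (by
      have := (hx0 t).ne'
      simp only [Q₁, Q, a]
      field_simp)
  have ha : ∀ t, HasDerivAt a (a' t) t := fun t =>
    ((hy t).const_sub 1).congr_deriv (by simp only [a', a]; ring)
  have ha' : ∀ t, HasDerivAt a' (-(y t * (M t + a t) * (M t + a t) + y t * (M' t + a' t))) t :=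
    fun t => ((hy t).mul ((hM t).add (ha t))).neg.congr_deriv (by
      simp only [a', a, Pi.add_apply]; ring)
  have hQ₁ : ∀ t, HasDerivAt Q₁ (Q₂ t) t := fun t =>
    ((ha t).mul (hQ t)).congr_deriv (by simp only [Q₂, Q₁]; ring)
  have hQ₂ : ∀ t, HasDerivAt Q₂ (Q₃ t) t := fun t =>
    ((((ha t).pow 2).add (ha' t)).mul (hQ t)).congr_deriv (by
      simp only [Q₃, Pi.add_apply, Pi.pow_apply]; push_cast; ring)
  -- the estimates in the logarithmic variable
  let e : ℝ → ℝ := fun t => Real.exp (-(τ / 2) * t)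
  have hO : ∀ {F : ℝ → ℝ}, (∀ t, T ≤ t → |F t| ≤ B * Real.exp (-(τ / 2) * t)) → F =O[atTop] e := by
    intro F hF
    refine IsBigO.of_bound B ?_
    filter_upwards [eventually_ge_atTop T] with t ht
    rw [Real.norm_eq_abs, Real.norm_eq_abs, abs_of_pos (Real.exp_pos _)]
    exact hF t ht
  have he1 : e =O[atTop] (fun _ => (1 : ℝ)) := by
    refine IsBigO.of_bound 1 ?_
    filter_upwards [eventually_ge_atTop 0] with t ht
    rw [Real.norm_eq_abs, abs_of_pos (Real.exp_pos _), norm_one, mul_one]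
    exact Real.exp_le_one_iff.2 (by nlinarith)
  have oQc : (fun t => Q t - c) =O[atTop] e := hO fun t ht => (hB t ht).1
  have oa : a =O[atTop] e := hO fun t ht => by rw [abs_sub_comm]; exact (hB t ht).2.1
  have oM : M =O[atTop] e := hO fun t ht => (hB t ht).2.2.1
  have oM' : M' =O[atTop] e := hO fun t ht => (hB t ht).2.2.2
  have oQ : Q =O[atTop] (fun _ => (1 : ℝ)) :=
    ((oQc.trans he1).add (isBigO_const_const c one_ne_zero _)).congr_left fun t => by ring
  have oy : y =O[atTop] (fun _ => (1 : ℝ)) :=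
    ((isBigO_const_const (1 : ℝ) one_ne_zero _).sub (oa.trans he1)).congr_left fun t => by
      simp only [a]; ring
  have om : ∀ {F G : ℝ → ℝ}, F =O[atTop] e → G =O[atTop] (fun _ => (1 : ℝ)) →
      (fun t => F t * G t) =O[atTop] e := fun hF hG => by simpa using hF.mul hG
  have om' : ∀ {F G : ℝ → ℝ}, G =O[atTop] (fun _ => (1 : ℝ)) → F =O[atTop] e →
      (fun t => G t * F t) =O[atTop] e := fun hG hF => by simpa using hG.mul hF
  have oMa : (fun t => M t + a t) =O[atTop] e := oM.add oa
  have oa' : a' =O[atTop] e := (om' oy oMa).neg_left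
  have oQ₁ : Q₁ =O[atTop] e := om oa oQ
  have o2 : (fun t => a t ^ 2 + a' t) =O[atTop] e :=
    ((om oa (oa.trans he1)).add oa').congr_left fun t => by simp only [sq]
  have oQ₂ : Q₂ =O[atTop] e := om o2 oQ
  have oQ₃ : Q₃ =O[atTop] e := by
    refine (om (((om oa (oa'.trans he1)).const_mul_left 2).sub
      ((om (om' oy oMa) (oMa.trans he1)).add (om' oy (oM'.add oa')))) oQ).add
      (om o2 (oQ₁.trans he1))
  -- back to the original variable
  have hlim : Tendsto (fun ρ : ℝ => -Real.log ρ) (𝓝[>] 0) atTop :=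
    tendsto_neg_atBot_atTop.comp Real.tendsto_log_nhdsGT_zero
  have hee : (fun ρ : ℝ => e (-Real.log ρ)) =ᶠ[𝓝[>] 0] fun ρ => ρ ^ (τ / 2) := by
    filter_upwards [self_mem_nhdsWithin] with ρ hρ
    simp only [e]
    rw [Real.rpow_def_of_pos hρ]
    congr 1; ring
  have hqQ : ∀ ρ, 0 < ρ → invProfile p ρ = Q (-Real.log ρ) := by
    intro ρ hρ
    have h1 := hpne (-Real.log ρ)
    simp only [invProfile, Q, x]
    rw [Real.exp_neg, Real.exp_log hρ] at h1 ⊢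
    have : ρ⁻¹ ≠ 0 := inv_ne_zero hρ.ne'
    rw [div_mul_eq_div_div, div_self this, one_div]
  have hback : ∀ {F G : ℝ → ℝ}, F =O[atTop] e → (∀ ρ, 0 < ρ → G ρ = F (-Real.log ρ)) →
      G =O[𝓝[>] 0] fun ρ => ρ ^ (τ / 2) := by
    intro F G hF hG
    refine (hF.comp_tendsto hlim).congr' ?_ hee
    filter_upwards [self_mem_nhdsWithin] with ρ hρ using (hG ρ hρ).symm
  have hder := fun (ρ : ℝ) (hρ : 0 < ρ) => deriv_comp_neg_log hqQ hQ hQ₁ hQ₂ hρ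
  refine ⟨c, hc, hback oQc fun ρ hρ => by rw [hqQ ρ hρ], hback oQ₁.neg_left fun ρ hρ => (hder ρ hρ).1,
    hback (oQ₂.add oQ₁) fun ρ hρ => (hder ρ hρ).2.1, ?_⟩
  exact hback ((oQ₃.add (oQ₂.const_mul_left 3)).add (oQ₁.const_mul_left 2)).neg_left
    fun ρ hρ => (hder ρ hρ).2.2

end Profile

/-! ### Regularity at the orbifold point -/

section Regularity

open Filter Asymptotics

variable {V : Type*} [NormedAddCommGroup V] [InnerProductSpace ℝ V] {I : V →L[ℝ] V}

/-- A function which is `O(|ξ|^α)`, with derivative `O(|ξ|^{α-1})`, is Hölder continuous at `0`. -/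
lemma holder_of_fderiv_le {W : Type*} [NormedAddCommGroup W] [NormedSpace ℝ W] {F : V → W}
    {α δ C : ℝ} (hα : 0 < α) (hα1 : α < 1) (hC : 0 ≤ C) (hF0 : F 0 = 0)
    (hd : ∀ ξ, ξ ≠ 0 → DifferentiableAt ℝ F ξ)
    (h1 : ∀ ξ, ξ ≠ 0 → ‖ξ‖ < δ → ‖F ξ‖ ≤ C * ‖ξ‖ ^ α)
    (h2 : ∀ ξ, ξ ≠ 0 → ‖ξ‖ < δ → ‖fderiv ℝ F ξ‖ ≤ C * ‖ξ‖ ^ (α - 1))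
    {ξ ξ' : V} (hξ : ‖ξ‖ < δ) (hξ' : ‖ξ'‖ < δ) : ‖F ξ - F ξ'‖ ≤ 4 * C * ‖ξ - ξ'‖ ^ α := by
  wlog hle : ‖ξ'‖ ≤ ‖ξ‖ generalizing ξ ξ' with H
  · rw [norm_sub_rev, norm_sub_rev ξ]
    exact H hξ' hξ (le_of_not_ge hle)
  by_cases hξ0 : ξ = 0
  · have : ξ' = 0 := by simpa [hξ0] using hle
    rw [hξ0, this]
    simp [hα.ne']
  have hpos : 0 < ‖ξ‖ := norm_pos_iff.2 hξ0
  have h1' : ∀ η, ‖η‖ < δ → ‖F η‖ ≤ C * ‖η‖ ^ α := by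
    intro η hη
    by_cases h0 : η = 0
    · rw [h0, hF0, norm_zero, norm_zero, Real.zero_rpow hα.ne', mul_zero]
    · exact h1 η h0 hη
  rcases le_or_gt (‖ξ‖ / 2) ‖ξ - ξ'‖ with hfar | hnear
  · -- both values are small
    have e1 : ‖ξ'‖ ^ α ≤ ‖ξ‖ ^ α := Real.rpow_le_rpow (norm_nonneg _) hle hα.le
    have e2 : ‖ξ‖ ^ α ≤ 2 * ‖ξ - ξ'‖ ^ α := by
      have e3 : ‖ξ‖ ^ α ≤ (2 * ‖ξ - ξ'‖) ^ α := Real.rpow_le_rpow hpos.le (by linarith) hα.le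
      rw [Real.mul_rpow two_pos.le (norm_nonneg _)] at e3
      have e4 : (2 : ℝ) ^ α ≤ 2 := by
        conv_rhs => rw [← Real.rpow_one 2]
        exact Real.rpow_le_rpow_of_exponent_le one_le_two hα1.le
      exact e3.trans (mul_le_mul_of_nonneg_right e4 (Real.rpow_nonneg (norm_nonneg _) _))
    calc _ ≤ ‖F ξ‖ + ‖F ξ'‖ := norm_sub_le _ _
      _ ≤ C * ‖ξ‖ ^ α + C * ‖ξ'‖ ^ α := add_le_add (h1' ξ hξ) (h1' ξ' hξ')
      _ ≤ C * (2 * ‖ξ - ξ'‖ ^ α) + C * (2 * ‖ξ - ξ'‖ ^ α) := by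
        gcongr
        exact e1.trans e2
      _ = _ := by ring
  · -- the segment stays away from the origin
    by_cases hne : ξ = ξ'
    · rw [hne]; simp [hα.ne']
    have hdist : 0 < ‖ξ - ξ'‖ := norm_pos_iff.2 (sub_ne_zero.2 hne)
    let s : Set V := Metric.ball 0 δ ∩ Metric.ball ξ (‖ξ‖ / 2)
    have hs : ∀ η ∈ s, η ≠ 0 ∧ ‖ξ‖ / 2 ≤ ‖η‖ ∧ ‖η‖ < δ := by
      rintro η ⟨hη1, hη2⟩
      rw [mem_ball_zero_iff] at hη1
      rw [Metric.mem_ball, dist_eq_norm, norm_sub_rev] at hη2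
      have h3 := norm_sub_norm_le ξ η
      have h4 : ‖ξ‖ / 2 ≤ ‖η‖ := by linarith
      exact ⟨norm_pos_iff.1 (by linarith), h4, hη1⟩
    have hmv := Convex.norm_image_sub_le_of_norm_fderiv_le (𝕜 := ℝ) (f := F) (s := s) (x := ξ')
      (y := ξ) (C := C * ‖ξ - ξ'‖ ^ (α - 1)) (fun η hη => hd η (hs η hη).1) (fun η hη => ?_)
      ((convex_ball _ _).inter (convex_ball _ _)) ⟨by simpa using hξ', ?_⟩
      ⟨by simpa using hξ, Metric.mem_ball_self (by positivity)⟩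
    · have e1 : ‖ξ - ξ'‖ ^ α = ‖ξ - ξ'‖ ^ (α - 1) * ‖ξ - ξ'‖ := by
        rw [← Real.rpow_add_one hdist.ne']; congr 1; ring
      have e2 : 0 ≤ C * (‖ξ - ξ'‖ ^ (α - 1) * ‖ξ - ξ'‖) := by positivity
      rw [e1]
      linarith
    · obtain ⟨h3, h4, h5⟩ := hs η hη
      refine (h2 η h3 h5).trans (mul_le_mul_of_nonneg_left ?_ hC)
      exact Real.rpow_le_rpow_of_nonpos hdist (hnear.le.trans h4) (by linarith)
    · rw [Metric.mem_ball, dist_eq_norm, norm_sub_rev]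
      exact hnear

lemma abs_inner_le (v w : V) : |inner ℝ v w| ≤ ‖v‖ * ‖w‖ := abs_real_inner_le_norm v w

lemma abs_rankOne_le (hI : ∀ v, ‖I v‖ = ‖v‖) (z v w : V) :
    |rankOne I z v w| ≤ 2 * (‖z‖ * ‖z‖ * (‖v‖ * ‖w‖)) := by
  have h1 : ∀ v w : V, |inner ℝ z v * inner ℝ z w| ≤ ‖z‖ * ‖z‖ * (‖v‖ * ‖w‖) := by
    intro v w
    rw [abs_mul]
    calc _ ≤ (‖z‖ * ‖v‖) * (‖z‖ * ‖w‖) := by gcongr <;> exact abs_inner_le _ _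
      _ = _ := by ring
  have h2 := h1 v w
  have h3 := h1 (I v) (I w)
  rw [hI, hI] at h3
  exact (abs_add_le _ _).trans (by linarith)

lemma abs_rankOneBil_le (hI : ∀ v, ‖I v‖ = ‖v‖) (z z' v w : V) :
    |rankOneBil I z z' v w| ≤ 4 * (‖z‖ * ‖z'‖ * (‖v‖ * ‖w‖)) := by
  have h1 : ∀ a b v w : V, |inner ℝ a v * inner ℝ b w| ≤ ‖a‖ * ‖b‖ * (‖v‖ * ‖w‖) := by
    intro a b v w
    rw [abs_mul]
    calc _ ≤ (‖a‖ * ‖v‖) * (‖b‖ * ‖w‖) := by gcongr <;> exact abs_inner_le _ _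
      _ = _ := by ring
  have h2 := h1 z z' v w
  have h3 := h1 z' z v w
  have h4 := h1 z z' (I v) (I w)
  have h5 := h1 z' z (I v) (I w)
  rw [hI, hI] at h4 h5
  rw [rankOneBil]
  refine (abs_add_le _ _).trans ?_
  refine (add_le_add_left (abs_add_three _ _ _) _).trans ?_
  nlinarith [mul_comm ‖z‖ ‖z'‖]

/-- Operator norms of trilinear maps. -/
lemma opNorm_le_bound₃ {T : V →L[ℝ] V →L[ℝ] V →L[ℝ] ℝ} {M : ℝ} (hM : 0 ≤ M)
    (h : ∀ e v w, |T e v w| ≤ M * (‖e‖ * (‖v‖ * ‖w‖))) : ‖T‖ ≤ M := by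
  refine ContinuousLinearMap.opNorm_le_bound _ hM fun e => ?_
  refine ContinuousLinearMap.opNorm_le_bound₂ _ (by positivity) fun v w => ?_
  rw [Real.norm_eq_abs]
  exact (h e v w).trans (by rw [mul_assoc, mul_assoc])

lemma norm_fderiv_radialMetric_le (hI : ∀ v, ‖I v‖ = ‖v‖) {q : ℝ → ℝ} {z : V}
    (hq : ContDiffAt ℝ ∞ q (‖z‖ ^ 2)) :
    ‖fderiv ℝ (radialMetric I q) z‖
      ≤ 12 * |deriv q (‖z‖ ^ 2)| * ‖z‖ + 8 * |deriv (deriv q) (‖z‖ ^ 2)| * ‖z‖ ^ 3 := by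
  refine opNorm_le_bound₃ (by positivity) fun e v w => ?_
  rw [fderiv_radialMetric hq]
  generalize deriv (deriv q) (‖z‖ ^ 2) = q2
  generalize deriv q (‖z‖ ^ 2) = q1
  have t1 : |4 * q1 * inner ℝ z e * inner ℝ v w| ≤ 4 * |q1| * (‖z‖ * ‖e‖) * (‖v‖ * ‖w‖) := by
    simp only [abs_mul, Nat.abs_ofNat]
    gcongr <;> exact abs_inner_le _ _
  have t2 : |4 * q2 * inner ℝ z e * rankOne I z v w|
      ≤ 4 * |q2| * (‖z‖ * ‖e‖) * (2 * (‖z‖ * ‖z‖ * (‖v‖ * ‖w‖))) := by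
    simp only [abs_mul, Nat.abs_ofNat]
    gcongr
    · exact abs_inner_le _ _
    · exact abs_rankOne_le hI _ _ _
  have t3 : |2 * q1 * rankOneBil I z e v w| ≤ 2 * |q1| * (4 * (‖z‖ * ‖e‖ * (‖v‖ * ‖w‖))) := by
    simp only [abs_mul, Nat.abs_ofNat]
    gcongr
    exact abs_rankOneBil_le hI _ _ _ _
  refine (abs_add_three _ _ _).trans ((add_le_add_three t1 t2 t3).trans (le_of_eq ?_))
  ring

lemma norm_fderiv_fderiv_radialMetric_le (hI : ∀ v, ‖I v‖ = ‖v‖) {q : ℝ → ℝ} {z : V}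
    (hq : ∀ᶠ r in 𝓝 (‖z‖ ^ 2), ContDiffAt ℝ ∞ q r) :
    ‖fderiv ℝ (fderiv ℝ (radialMetric I q)) z‖
      ≤ 12 * |deriv q (‖z‖ ^ 2)| + 48 * |deriv (deriv q) (‖z‖ ^ 2)| * ‖z‖ ^ 2
        + 16 * |deriv (deriv (deriv q)) (‖z‖ ^ 2)| * ‖z‖ ^ 4 := by
  refine ContinuousLinearMap.opNorm_le_bound _ (by positivity) fun f => ?_
  refine opNorm_le_bound₃ (by positivity) fun e v w => ?_
  rw [fderiv_fderiv_radialMetric hq]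
  generalize deriv (deriv (deriv q)) (‖z‖ ^ 2) = q3
  generalize deriv (deriv q) (‖z‖ ^ 2) = q2
  generalize deriv q (‖z‖ ^ 2) = q1
  have t1 : |8 * q2 * inner ℝ z f * inner ℝ z e * inner ℝ v w|
      ≤ 8 * |q2| * (‖z‖ * ‖f‖) * (‖z‖ * ‖e‖) * (‖v‖ * ‖w‖) := by
    simp only [abs_mul, Nat.abs_ofNat]
    gcongr <;> exact abs_inner_le _ _
  have t2 : |4 * q1 * inner ℝ f e * inner ℝ v w| ≤ 4 * |q1| * (‖f‖ * ‖e‖) * (‖v‖ * ‖w‖) := by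
    simp only [abs_mul, Nat.abs_ofNat]
    gcongr <;> exact abs_inner_le _ _
  have t3 : |8 * q3 * inner ℝ z f * inner ℝ z e * rankOne I z v w|
      ≤ 8 * |q3| * (‖z‖ * ‖f‖) * (‖z‖ * ‖e‖) * (2 * (‖z‖ * ‖z‖ * (‖v‖ * ‖w‖))) := by
    simp only [abs_mul, Nat.abs_ofNat]
    gcongr
    · exact abs_inner_le _ _
    · exact abs_inner_le _ _
    · exact abs_rankOne_le hI _ _ _
  have t4 : |4 * q2 * inner ℝ f e * rankOne I z v w|
      ≤ 4 * |q2| * (‖f‖ * ‖e‖) * (2 * (‖z‖ * ‖z‖ * (‖v‖ * ‖w‖))) := by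
    simp only [abs_mul, Nat.abs_ofNat]
    gcongr
    · exact abs_inner_le _ _
    · exact abs_rankOne_le hI _ _ _
  have t5 : |4 * q2 * inner ℝ z e * rankOneBil I z f v w|
      ≤ 4 * |q2| * (‖z‖ * ‖e‖) * (4 * (‖z‖ * ‖f‖ * (‖v‖ * ‖w‖))) := by
    simp only [abs_mul, Nat.abs_ofNat]
    gcongr
    · exact abs_inner_le _ _
    · exact abs_rankOneBil_le hI _ _ _ _
  have t6 : |4 * q2 * inner ℝ z f * rankOneBil I z e v w|
      ≤ 4 * |q2| * (‖z‖ * ‖f‖) * (4 * (‖z‖ * ‖e‖ * (‖v‖ * ‖w‖))) := by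
    simp only [abs_mul, Nat.abs_ofNat]
    gcongr
    · exact abs_inner_le _ _
    · exact abs_rankOneBil_le hI _ _ _ _
  have t7 : |2 * q1 * rankOneBil I f e v w| ≤ 2 * |q1| * (4 * (‖f‖ * ‖e‖ * (‖v‖ * ‖w‖))) := by
    simp only [abs_mul, Nat.abs_ofNat]
    gcongr
    exact abs_rankOneBil_le hI _ _ _ _
  refine (abs_add_le _ _).trans ((add_le_add ((abs_add_le _ _).trans (add_le_add
    ((abs_add_le _ _).trans (add_le_add ((abs_add_le _ _).trans (add_le_add
    (abs_add_three _ _ _) le_rfl)) le_rfl)) le_rfl)) le_rfl).trans ?_)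
  refine (add_le_add (add_le_add (add_le_add (add_le_add (add_le_add_three t1 t2 t3) t4) t5) t6)
    t7).trans (le_of_eq ?_)
  ring

/-- The radial metric with profile `q` off the origin, with the value prescribed by the limit `c` of
`q` at the origin. -/
def extendedMetric (I : V →L[ℝ] V) (q : ℝ → ℝ) (c : ℝ) (ξ : V) : V →L[ℝ] V →L[ℝ] ℝ :=
  open Classical in if ξ = 0 then (2 * c) • euclid V else radialMetric I q ξ

lemma extendedMetric_of_ne {q : ℝ → ℝ} {c : ℝ} {ξ : V} (h : ξ ≠ 0) :
    extendedMetric I q c ξ = radialMetric I q ξ := if_neg h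

lemma extendedMetric_zero {q : ℝ → ℝ} {c : ℝ} : extendedMetric I q c 0 = (2 * c) • euclid V :=
  if_pos rfl

lemma extendedMetric_eventuallyEq {q : ℝ → ℝ} {c : ℝ} {ξ : V} (h : ξ ≠ 0) :
    extendedMetric I q c =ᶠ[𝓝 ξ] radialMetric I q := by
  filter_upwards [isOpen_ne.mem_nhds h] with η hη using extendedMetric_of_ne hη

lemma norm_extendedMetric_sub_le (hI : ∀ v, ‖I v‖ = ‖v‖) {q : ℝ → ℝ} {c : ℝ} {z : V} (hz : z ≠ 0) :
    ‖extendedMetric I q c z - extendedMetric I q c 0‖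
      ≤ 2 * |q (‖z‖ ^ 2) - c| + 4 * |deriv q (‖z‖ ^ 2)| * ‖z‖ ^ 2 := by
  refine ContinuousLinearMap.opNorm_le_bound₂ _ (by positivity) fun v w => ?_
  rw [extendedMetric_of_ne hz, extendedMetric_zero, sub_apply, sub_apply, radialMetric_apply,
    Real.norm_eq_abs]
  simp only [smul_apply, euclid_apply, smul_eq_mul]
  generalize deriv q (‖z‖ ^ 2) = q1
  generalize q (‖z‖ ^ 2) = q0
  have t1 : |2 * (q0 - c) * inner ℝ v w| ≤ 2 * |q0 - c| * (‖v‖ * ‖w‖) := by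
    rw [abs_mul, abs_mul, Nat.abs_ofNat]
    gcongr
    exact abs_inner_le _ _
  have t2 : |2 * q1 * rankOne I z v w| ≤ 2 * |q1| * (2 * (‖z‖ * ‖z‖ * (‖v‖ * ‖w‖))) := by
    rw [abs_mul, abs_mul, Nat.abs_ofNat]
    gcongr
    exact abs_rankOne_le hI _ _ _
  rw [show 2 * q0 * inner ℝ v w + 2 * q1 * rankOne I z v w - 2 * c * inner ℝ v w
    = 2 * (q0 - c) * inner ℝ v w + 2 * q1 * rankOne I z v w by ring]
  refine (abs_add_le _ _).trans ((add_le_add t1 t2).trans (le_of_eq ?_))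
  ring

/-- A profile which converges at the rate `ρ^{τ/2}` with its derivatives defines a continuous metric,
which is of class `C^{1,α}` if `τ > 1`. -/
lemma extendedMetric_regularity (hI : ∀ v, ‖I v‖ = ‖v‖) {q : ℝ → ℝ} {c τ : ℝ} (hτ : 0 < τ)
    (hq : ∀ ρ, 0 < ρ → ContDiffAt ℝ ∞ q ρ)
    (h0 : (fun ρ => q ρ - c) =O[𝓝[>] 0] (fun ρ : ℝ => ρ ^ (τ / 2)))
    (h1 : (fun ρ => ρ * deriv q ρ) =O[𝓝[>] 0] (fun ρ : ℝ => ρ ^ (τ / 2)))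
    (h2 : (fun ρ => ρ ^ 2 * deriv (deriv q) ρ) =O[𝓝[>] 0] (fun ρ : ℝ => ρ ^ (τ / 2)))
    (h3 : (fun ρ => ρ ^ 3 * deriv (deriv (deriv q)) ρ) =O[𝓝[>] 0] (fun ρ : ℝ => ρ ^ (τ / 2))) :
    Continuous (extendedMetric I q c) ∧
    (1 < τ → ContDiff ℝ 1 (extendedMetric I q c) ∧ ∃ α C δ : ℝ, 0 < α ∧ 0 < δ ∧
      ∀ ξ ∈ Metric.ball (0 : V) δ, ∀ ξ' ∈ Metric.ball (0 : V) δ, ∀ a b c' : V,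
        |fderiv ℝ (extendedMetric I q c) ξ a b c' - fderiv ℝ (extendedMetric I q c) ξ' a b c'|
          ≤ C * ‖ξ - ξ'‖ ^ α * (‖a‖ * ‖b‖ * ‖c'‖)) := by
  -- the estimates as inequalities near the origin
  obtain ⟨K₀, hK₀, b0⟩ := h0.exists_nonneg
  obtain ⟨K₁, hK₁, b1⟩ := h1.exists_nonneg
  obtain ⟨K₂, hK₂, b2⟩ := h2.exists_nonneg
  obtain ⟨K₃, hK₃, b3⟩ := h3.exists_nonneg
  obtain ⟨ε, hε, hsub⟩ := mem_nhdsGT_iff_exists_Ioo_subset.1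
    (b0.bound.and (b1.bound.and (b2.bound.and b3.bound)))
  let δ : ℝ := min 1 (√ε)
  have hδ : 0 < δ := lt_min one_pos (Real.sqrt_pos.2 hε)
  let K := K₀ + K₁ + K₂ + K₃
  have hK : 0 ≤ K := by positivity
  have hb : ∀ z : V, z ≠ 0 → ‖z‖ < δ → |q (‖z‖ ^ 2) - c| ≤ K * ‖z‖ ^ τ ∧
      ‖z‖ ^ 2 * |deriv q (‖z‖ ^ 2)| ≤ K * ‖z‖ ^ τ ∧
      ‖z‖ ^ 4 * |deriv (deriv q) (‖z‖ ^ 2)| ≤ K * ‖z‖ ^ τ ∧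
      ‖z‖ ^ 6 * |deriv (deriv (deriv q)) (‖z‖ ^ 2)| ≤ K * ‖z‖ ^ τ := by
    intro z hz hzδ
    have hz0 : 0 < ‖z‖ := norm_pos_iff.2 hz
    have hmem : ‖z‖ ^ 2 ∈ Set.Ioo 0 ε := by
      refine ⟨by positivity, ?_⟩
      have := hzδ.trans_le (min_le_right _ _)
      rwa [Real.lt_sqrt hz0.le] at this
    obtain ⟨e0, e1, e2, e3⟩ := hsub hmem
    have hpw : (‖z‖ ^ 2) ^ (τ / 2) = ‖z‖ ^ τ := by
      rw [← Real.rpow_natCast ‖z‖ 2, ← Real.rpow_mul hz0.le]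
      congr 1; push_cast; ring
    simp only [Real.norm_eq_abs, hpw, abs_mul, abs_pow, abs_norm,
      abs_of_nonneg (Real.rpow_nonneg hz0.le τ)] at e0 e1 e2 e3
    have hzτ : 0 ≤ ‖z‖ ^ τ := Real.rpow_nonneg hz0.le τ
    refine ⟨e0.trans ?_, e1.trans ?_, ?_, ?_⟩
    · exact mul_le_mul_of_nonneg_right (by simp only [K]; linarith) hzτ
    · exact mul_le_mul_of_nonneg_right (by simp only [K]; linarith) hzτ
    · rw [← pow_mul] at e2
      exact e2.trans (mul_le_mul_of_nonneg_right (by simp only [K]; linarith) hzτ)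
    · rw [← pow_mul] at e3
      exact e3.trans (mul_le_mul_of_nonneg_right (by simp only [K]; linarith) hzτ)
  have hcd : ∀ z : V, z ≠ 0 → ContDiffAt ℝ ∞ (extendedMetric I q c) z := fun z hz =>
    (contDiffAt_radialMetric (hq _ (pow_pos (norm_pos_iff.2 hz) 2))).congr_of_eventuallyEq
      (extendedMetric_eventuallyEq hz)
  have hdiff : ∀ z : V, ‖z‖ < δ →
      ‖extendedMetric I q c z - extendedMetric I q c 0‖ ≤ 6 * K * ‖z‖ ^ τ := by
    intro z hzδ
    by_cases hz : z = 0
    · subst hz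
      rw [sub_self, norm_zero]
      positivity
    obtain ⟨e0, e1, -, -⟩ := hb z hz hzδ
    refine (norm_extendedMetric_sub_le hI hz).trans ?_
    linarith
  have hball : ∀ᶠ z : V in 𝓝 0, ‖z‖ < δ := by
    filter_upwards [Metric.ball_mem_nhds (0 : V) hδ] with z hz
    simpa using hz
  have hcont : Continuous (extendedMetric I q c) := by
    refine continuous_iff_continuousAt.2 fun z => ?_
    by_cases hz : z = 0
    · subst hz
      refine tendsto_iff_norm_sub_tendsto_zero.2 ?_
      refine squeeze_zero' (Eventually.of_forall fun _ => norm_nonneg _) (hball.mono hdiff) ?_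
      have h4 : Tendsto (fun z : V => ‖z‖ ^ τ) (𝓝 0) (𝓝 (‖(0 : V)‖ ^ τ)) :=
        (continuous_norm.tendsto 0).rpow_const (Or.inr hτ.le)
      rw [norm_zero, Real.zero_rpow hτ.ne'] at h4
      simpa using h4.const_mul (6 * K)
    · exact (hcd z hz).continuousAt
  refine ⟨hcont, fun hτ1 => ?_⟩
  -- the Hölder exponent; the loss in the exponent only keeps it below `1`
  let α : ℝ := min τ (3 / 2) - 1
  have hα : 0 < α := sub_pos.2 (lt_min hτ1 (by norm_num))
  have hα1 : α < 1 := by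
    have : min τ (3 / 2) ≤ 3 / 2 := min_le_right _ _
    simp only [α]; linarith
  have hpow : ∀ z : V, z ≠ 0 → ‖z‖ < δ → ‖z‖ ^ τ ≤ ‖z‖ ^ (α + 1) := by
    intro z hz hzδ
    refine Real.rpow_le_rpow_of_exponent_ge (norm_pos_iff.2 hz)
      (hzδ.trans_le (min_le_left _ _)).le ?_
    simp only [α, sub_add_cancel]
    exact min_le_left _ _
  have hfd : ∀ z : V, z ≠ 0 → fderiv ℝ (extendedMetric I q c) =ᶠ[𝓝 z]
      fderiv ℝ (radialMetric I q) := fun z hz =>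
    (extendedMetric_eventuallyEq hz).fderiv
  have hD1 : ∀ z : V, z ≠ 0 → ‖z‖ < δ →
      ‖fderiv ℝ (extendedMetric I q c) z‖ ≤ 80 * K * ‖z‖ ^ α := by
    intro z hz hzδ
    have hz0 : 0 < ‖z‖ := norm_pos_iff.2 hz
    obtain ⟨-, e1, e2, -⟩ := hb z hz hzδ
    have e4 := hpow z hz hzδ
    rw [(hfd z hz).self_of_nhds]
    refine (norm_fderiv_radialMetric_le hI (hq _ (pow_pos hz0 2))).trans ?_
    rw [Real.rpow_add_one hz0.ne'] at e4
    have e5 := mul_le_mul_of_nonneg_left e4 hK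
    have e6 : 0 ≤ K * ‖z‖ ^ α * ‖z‖ := by positivity
    refine le_of_mul_le_mul_right (a := ‖z‖) ?_ hz0
    linarith
  have hD2 : ∀ z : V, z ≠ 0 → ‖z‖ < δ →
      ‖fderiv ℝ (fderiv ℝ (extendedMetric I q c)) z‖ ≤ 80 * K * ‖z‖ ^ (α - 1) := by
    intro z hz hzδ
    have hz0 : 0 < ‖z‖ := norm_pos_iff.2 hz
    obtain ⟨-, e1, e2, e3⟩ := hb z hz hzδ
    have e4 := hpow z hz hzδ
    rw [(hfd z hz).fderiv_eq]
    refine (norm_fderiv_fderiv_radialMetric_le hI ?_).trans ?_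
    · filter_upwards [Ioi_mem_nhds (pow_pos hz0 2)] with r hr using hq r hr
    have e7 : ‖z‖ ^ (α + 1) = ‖z‖ ^ (α - 1) * ‖z‖ ^ 2 := by
      rw [← Real.rpow_natCast ‖z‖ 2, ← Real.rpow_add hz0]
      congr 1; push_cast; ring
    rw [e7] at e4
    have e5 := mul_le_mul_of_nonneg_left e4 hK
    have e6 : 0 ≤ K * (‖z‖ ^ (α - 1) * ‖z‖ ^ 2) := by positivity
    refine le_of_mul_le_mul_right (a := ‖z‖ ^ 2) ?_ (by positivity)
    linarith
  have hzero : HasFDerivAt (extendedMetric I q c) (0 : V →L[ℝ] V →L[ℝ] V →L[ℝ] ℝ) 0 := by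
    rw [hasFDerivAt_iff_isLittleO_nhds_zero]
    have h5 : (fun z : V => extendedMetric I q c (0 + z) - extendedMetric I q c 0
        - (0 : V →L[ℝ] V →L[ℝ] V →L[ℝ] ℝ) z) =O[𝓝 0] fun z => ‖z‖ ^ τ := by
      refine IsBigO.of_bound (6 * K) ?_
      filter_upwards [hball] with z hz
      rw [zero_add, zero_apply, sub_zero, Real.norm_of_nonneg (Real.rpow_nonneg (norm_nonneg _) _)]
      exact hdiff z hz
    refine h5.trans_isLittleO ?_
    have h6 : (fun z : V => ‖z‖ ^ (τ - 1) * ‖z‖) =o[𝓝 0] fun z : V => z := by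
      have h7 : Tendsto (fun z : V => ‖z‖ ^ (τ - 1)) (𝓝 0) (𝓝 (‖(0 : V)‖ ^ (τ - 1))) :=
        (continuous_norm.tendsto 0).rpow_const (Or.inr (by linarith))
      rw [norm_zero, Real.zero_rpow (by linarith : τ - 1 ≠ 0)] at h7
      have h8 : (fun z : V => ‖z‖ ^ (τ - 1)) =o[𝓝 0] fun _ => (1 : ℝ) :=
        (isLittleO_one_iff ℝ).2 h7
      have h9 := h8.mul_isBigO (isBigO_refl (fun z : V => ‖z‖) (𝓝 0))
      simp only [one_mul] at h9
      exact h9.trans_isBigO (isBigO_refl (fun z : V => z) _).norm_left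
    refine h6.congr_left fun z => ?_
    by_cases hz : z = 0
    · rw [hz, norm_zero, mul_zero, Real.zero_rpow hτ.ne']
    · rw [← Real.rpow_add_one (norm_ne_zero_iff.2 hz)]; congr 1; ring
  have hfcont : Continuous (fderiv ℝ (extendedMetric I q c)) := by
    refine continuous_iff_continuousAt.2 fun z => ?_
    by_cases hz : z = 0
    · subst hz
      refine tendsto_iff_norm_sub_tendsto_zero.2 ?_
      rw [hzero.fderiv]
      simp only [sub_zero]
      refine squeeze_zero' (g := fun z : V => 80 * K * ‖z‖ ^ α)
        (Eventually.of_forall fun _ => norm_nonneg _) ?_ ?_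
      · filter_upwards [hball] with z hz
        by_cases h0 : z = 0
        · rw [h0, hzero.fderiv, norm_zero]; positivity
        · exact hD1 z h0 hz
      · have h4 : Tendsto (fun z : V => ‖z‖ ^ α) (𝓝 0) (𝓝 (‖(0 : V)‖ ^ α)) :=
          (continuous_norm.tendsto 0).rpow_const (Or.inr hα.le)
        rw [norm_zero, Real.zero_rpow hα.ne'] at h4
        simpa using h4.const_mul (80 * K)
    · exact ((hcd z hz).fderiv_right (m := ∞) le_rfl).continuousAt
  refine ⟨contDiff_one_iff_fderiv.2 ⟨fun z => ?_, hfcont⟩, α, 4 * (80 * K), δ, hα, hδ,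
    fun ξ hξ ξ' hξ' a b c' => ?_⟩
  · by_cases hz : z = 0
    · rw [hz]; exact hzero.differentiableAt
    · exact (hcd z hz).differentiableAt (by simp)
  · have h6 := holder_of_fderiv_le (F := fderiv ℝ (extendedMetric I q c)) hα hα1
      (by positivity : 0 ≤ 80 * K) hzero.fderiv
      (fun z hz => ((hcd z hz).fderiv_right (m := ∞) le_rfl).differentiableAt (by simp)) hD1 hD2
      (by simpa using hξ) (by simpa using hξ')
    rw [← sub_apply, ← sub_apply, ← sub_apply, ← Real.norm_eq_abs]
    calc _ ≤ ‖fderiv ℝ (extendedMetric I q c) ξ - fderiv ℝ (extendedMetric I q c) ξ'‖ * ‖a‖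
          * ‖b‖ * ‖c'‖ := by
          refine (ContinuousLinearMap.le_opNorm₂ _ b c').trans ?_
          gcongr
          exact ContinuousLinearMap.le_opNorm _ a
      _ ≤ 4 * (80 * K) * ‖ξ - ξ'‖ ^ α * ‖a‖ * ‖b‖ * ‖c'‖ := by gcongr
      _ = _ := by ring

end Regularity

/-! ### The Riemannian distance -/

section Distance

open LineBundle

variable {n k : ℕ} {g : RiemMetric n k}

/-- The length of a tangent vector, in the normed structure of the tangent spaces which enters the
definition of the Riemannian distance. -/
lemma enorm_tangent (g : RiemMetric n k) (x : LineBundle n k) (v : Tan x) :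
    letI : Bundle.RiemannianBundle (fun x : LineBundle n k => Tan x) := ⟨g.toRiemannianMetric⟩
    ‖v‖ₑ = ENNReal.ofReal (√(tensorAt g.inner x v v)) := by
  letI : Bundle.RiemannianBundle (fun x : LineBundle n k => Tan x) := ⟨g.toRiemannianMetric⟩
  rw [← ofReal_norm, norm_eq_sqrt_real_inner]
  rfl

lemma gdist_comm (x y : LineBundle n k) : gdist g x y = gdist g y x := by
  letI : Bundle.RiemannianBundle (fun x : LineBundle n k => Tan x) := ⟨g.toRiemannianMetric⟩
  exact Manifold.riemannianEDist_comm

lemma gdist_triangle (x y z : LineBundle n k) : gdist g x z ≤ gdist g x y + gdist g y z := by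
  letI : Bundle.RiemannianBundle (fun x : LineBundle n k => Tan x) := ⟨g.toRiemannianMetric⟩
  exact Manifold.riemannianEDist_triangle

lemma eventually_gdist_lt (x : LineBundle n k) : ∀ᶠ y in 𝓝 x, gdist g x y < 1 := by
  letI : Bundle.RiemannianBundle (fun x : LineBundle n k => Tan x) := ⟨g.toRiemannianMetric⟩
  haveI : IsManifold 𝓘(ℝ, Cn n) 1 (LineBundle n k) := IsManifold.of_le (n := ∞) (by simp)
  haveI : IsContinuousRiemannianBundle (Cn n) (fun x : LineBundle n k => Tan x) :=
    ⟨g.inner, g.contMDiff.continuous, fun _ _ _ => rfl⟩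
  exact eventually_riemannianEDist_lt 𝓘(ℝ, Cn n) x one_pos

/-- A path of speed at most `L`. -/
lemma gdist_le_of_path {γ : ℝ → LineBundle n k} {a b L : ℝ} (hab : a ≤ b)
    (hγ : ∀ t ∈ Set.Icc a b, ContMDiffAt 𝓘(ℝ, ℝ) 𝓘(ℝ, Cn n) ∞ γ t)
    (hL : ∀ t ∈ Set.Icc a b, √(tensorAt g.inner (γ t) (dInto γ t 1) (dInto γ t 1)) ≤ L) :
    gdist g (γ a) (γ b) ≤ ENNReal.ofReal (L * (b - a)) := by
  letI : Bundle.RiemannianBundle (fun x : LineBundle n k => Tan x) := ⟨g.toRiemannianMetric⟩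
  refine (Manifold.riemannianEDist_le_pathELength (γ := γ)
    (fun t ht => ((hγ t ht).of_le (by simp)).contMDiffWithinAt) rfl rfl hab).trans ?_
  rw [Manifold.pathELength_eq_lintegral_mfderiv_Icc]
  calc _ ≤ ∫⁻ _ in Set.Icc a b, ENNReal.ofReal L := by
        refine MeasureTheory.setLIntegral_mono' measurableSet_Icc fun t ht => ?_
        rw [enorm_tangent]
        exact ENNReal.ofReal_le_ofReal (hL t ht)
    _ = _ := by
        rw [MeasureTheory.setLIntegral_const, Real.volume_Icc,
          ← ENNReal.ofReal_mul ((Real.sqrt_nonneg _).trans (hL a ⟨le_rfl, hab⟩))]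

/-- A function with gradient of length at most `L` is Lipschitz. -/
lemma abs_sub_le_of_gdist_lt {f : LineBundle n k → ℝ} (hf : ContMDiff 𝓘(ℝ, Cn n) 𝓘(ℝ, ℝ) ∞ f)
    {L : ℝ} (hL0 : 0 ≤ L) (hL : ∀ x (v : Cn n), |dOut f x v| ≤ L * √(tensorAt g.inner x v v))
    {x y : LineBundle n k} {r : ℝ} (hxy : gdist g x y < ENNReal.ofReal r) :
    |f y - f x| ≤ L * r := by
  letI : Bundle.RiemannianBundle (fun x : LineBundle n k => Tan x) := ⟨g.toRiemannianMetric⟩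
  have hr : 0 ≤ r := (ENNReal.ofReal_pos.1 (pos_of_gt hxy)).le
  obtain ⟨γ, rfl, rfl, hγ, hlen⟩ := Manifold.exists_lt_of_riemannianEDist_lt hxy
  have hfγ : ContDiffOn ℝ 1 (fun t => f (γ t)) (Set.Icc 0 1) :=
    contMDiffOn_iff_contDiffOn.1 ((hf.of_le (by simp)).comp_contMDiffOn hγ)
  have h1 := enorm_sub_le_lintegral_deriv_of_contDiffOn_Icc hfγ zero_le_one
  rw [← MeasureTheory.restrict_Ioo_eq_restrict_Icc] at h1
  rw [Manifold.pathELength_eq_lintegral_mfderiv_Ioo] at hlen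
  have h2 : ∫⁻ t in Set.Ioo (0 : ℝ) 1, ‖deriv (fun t => f (γ t)) t‖ₑ
      ≤ ∫⁻ t in Set.Ioo (0 : ℝ) 1, ENNReal.ofReal L * ‖mfderiv 𝓘(ℝ, ℝ) 𝓘(ℝ, Cn n) γ t 1‖ₑ := by
    refine MeasureTheory.setLIntegral_mono' measurableSet_Ioo fun t ht => ?_
    have hγt : MDifferentiableAt 𝓘(ℝ, ℝ) 𝓘(ℝ, Cn n) γ t :=
      ((hγ t ⟨ht.1.le, ht.2.le⟩).contMDiffAt (Icc_mem_nhds ht.1 ht.2)).mdifferentiableAt one_ne_zero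
    have h3 : deriv (fun t => f (γ t)) t = dOut f (γ t) (dInto γ t 1) := by
      rw [← fderiv_apply_one_eq_deriv, fderiv_comp_dInto (mdiffAt (hf _)) hγt]
      rfl
    rw [h3, enorm_tangent, ← ENNReal.ofReal_mul hL0, Real.enorm_eq_ofReal_abs]
    exact ENNReal.ofReal_le_ofReal (hL _ _)
  rw [MeasureTheory.lintegral_const_mul' _ _ ENNReal.ofReal_ne_top] at h2
  have h4 := (h1.trans h2).trans (mul_le_mul_right hlen.le _)
  rw [← ENNReal.ofReal_mul hL0, Real.enorm_eq_ofReal_abs] at h4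
  exact (ENNReal.ofReal_le_ofReal_iff (mul_nonneg hL0 hr)).1 h4

lemma isPreconnected_compl_zero (hn : 2 ≤ n) : IsPreconnected ({0}ᶜ : Set (Cn n)) := by
  have hrank : 1 < Module.rank ℝ (Cn n) := by
    rw [← Module.finrank_eq_rank, ← Module.finrank_mul_finrank ℝ ℂ (Cn n)]
    simp only [Complex.finrank_real_complex, finrank_euclideanSpace, Fintype.card_fin]
    exact_mod_cast (by omega : 1 < 2 * n)
  exact (isConnected_compl_singleton_of_one_lt_rank hrank 0).isPreconnected

/-- The total space is a quotient of the product of `ℂⁿ ∖ {0}` and `ℂ`. -/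
lemma preconnectedSpace (hn : 2 ≤ n) : PreconnectedSpace (LineBundle n k) := by
  have h2 : IsPreconnected {p : Cn n × ℂ | p.1 ≠ 0} := by
    have : {p : Cn n × ℂ | p.1 ≠ 0} = ({0}ᶜ : Set (Cn n)) ×ˢ Set.univ := by ext; simp
    rw [this]
    exact (isPreconnected_compl_zero hn).prod isPreconnected_univ
  have h3 : PreconnectedSpace {p : Cn n × ℂ // p.1 ≠ 0} := Subtype.preconnectedSpace h2
  refine ⟨?_⟩
  have h4 := isPreconnected_range
    (continuous_quot_mk : Continuous (Quot.mk (bundleSetoid n k)))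
  rw [Set.range_eq_univ.2 Quot.mk_surjective] at h4
  exact h4

lemma gdist_lt_top (hn : 2 ≤ n) (x y : LineBundle n k) : gdist g x y < ⊤ := by
  have := preconnectedSpace (k := k) hn
  have h : IsClopen {y | gdist g x y < ⊤} := by
    constructor
    · rw [← isOpen_compl_iff, isOpen_iff_mem_nhds]
      intro y hy
      filter_upwards [eventually_gdist_lt (g := g) y] with z hz hz'
      refine hy ((gdist_triangle x z y).trans_lt (ENNReal.add_lt_top.2 ⟨hz', ?_⟩))
      rw [gdist_comm]
      exact hz.trans ENNReal.one_lt_top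
    · rw [isOpen_iff_mem_nhds]
      intro y hy
      filter_upwards [eventually_gdist_lt (g := g) y] with z hz
      exact (gdist_triangle x y z).trans_lt (ENNReal.add_lt_top.2 ⟨hy, hz.trans ENNReal.one_lt_top⟩)
  have h2 := h.eq_univ ⟨x, ?_⟩
  · have h3 : y ∈ {y | gdist g x y < ⊤} := by rw [h2]; trivial
    exact h3
  · exact ((eventually_gdist_lt (g := g) x).self_of_nhds).trans ENNReal.one_lt_top

lemma exists_gdist_le_of_isCompact (hn : 2 ≤ n) (x : LineBundle n k) {K : Set (LineBundle n k)}
    (hK : IsCompact K) : ∃ B : ℝ, 0 ≤ B ∧ ∀ y ∈ K, gdist g x y ≤ ENNReal.ofReal B := by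
  refine hK.induction_on (p := fun s => ∃ B : ℝ, 0 ≤ B ∧ ∀ y ∈ s, gdist g x y ≤ ENNReal.ofReal B)
    ⟨0, le_rfl, by simp⟩ ?_ ?_ ?_
  · rintro s t hst ⟨B, hB, h⟩
    exact ⟨B, hB, fun y hy => h y (hst hy)⟩
  · rintro s t ⟨B, hB, h⟩ ⟨B', hB', h'⟩
    refine ⟨max B B', le_max_of_le_left hB, fun y hy => hy.elim (fun hy => ?_) fun hy => ?_⟩
    · exact (h y hy).trans (ENNReal.ofReal_le_ofReal (le_max_left _ _))
    · exact (h' y hy).trans (ENNReal.ofReal_le_ofReal (le_max_right _ _))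
  · intro y _
    refine ⟨_, mem_nhdsWithin_of_mem_nhds (eventually_gdist_lt (g := g) y),
      (gdist g x y).toReal + 1, by positivity, fun z hz => ?_⟩
    rw [ENNReal.ofReal_add ENNReal.toReal_nonneg zero_le_one,
      ENNReal.ofReal_toReal (gdist_lt_top hn x y).ne, ENNReal.ofReal_one]
    exact (gdist_triangle x y z).trans (add_le_add le_rfl (le_of_lt hz))

variable [NeZero n] {p : ℝ → ℝ}

/-- The profile has a positive limit at infinity, and the radial directions have bounded length. -/
lemma IsRadial.exists_profile_bounds (hr : IsRadial g p) (hn : 2 ≤ n) (hk : 1 ≤ k) {τ : ℝ}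
    (hτ : 0 < τ) (h : IsALE g τ) :
    ∃ m L r₀, 0 < m ∧ 0 < L ∧ 0 < r₀ ∧ ∀ r, r₀ ≤ r → m ^ 2 ≤ p r ∧
      p r + r * deriv p r ≤ 3 / 2 * p r ∧ 2 * (p r + r * deriv p r) ≤ L ^ 2 := by
  obtain ⟨R, C, Ψ, hΨ⟩ := h.exists_isEnd hτ
  obtain ⟨K, r₁, hK, hr₁, hasy⟩ := hΨ.asymptotics hτ hr hn hk
  obtain ⟨c, hc, h0, -⟩ := hr.exists_invProfile_asymptotics hn hk hτ h
  have hlim : Filter.Tendsto (fun ρ => invProfile p ρ - c) (𝓝[>] 0) (𝓝 0) := by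
    refine h0.trans_tendsto ?_
    have h1 : ContinuousAt (fun ρ : ℝ => ρ ^ (τ / 2)) 0 :=
      Real.continuousAt_rpow_const _ _ (Or.inr (by linarith))
    have h2 := h1.tendsto
    rw [Real.zero_rpow (by linarith)] at h2
    exact h2.mono_left nhdsWithin_le_nhds
  have hinf := hlim.comp tendsto_inv_atTop_nhdsGT_zero
  have hev : ∀ᶠ r in Filter.atTop, |invProfile p r⁻¹ - c| < c / 2 := by
    have := hinf.eventually (Metric.ball_mem_nhds (0 : ℝ) (half_pos hc))
    filter_upwards [this] with r hr'
    simpa using hr'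
  obtain ⟨r₂, hr₂⟩ := Filter.eventually_atTop.1 hev
  have hc' : 0 < 2 / (3 * c) := by positivity
  have hc2 : 0 < 6 / c := by positivity
  refine ⟨√(2 / (3 * c)), √(6 / c), max r₁ r₂, Real.sqrt_pos.2 hc', Real.sqrt_pos.2 hc2,
    lt_max_of_lt_left hr₁, fun r hrr => ?_⟩
  have hr0 : 0 < r := hr₁.trans_le ((le_max_left _ _).trans hrr)
  have h1 := hr₂ r ((le_max_right _ _).trans hrr)
  have hp := (hr.p_pos hn hk hr0).1
  simp only [invProfile, inv_inv] at h1
  obtain ⟨h2, h3⟩ := abs_lt.1 h1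
  have h4 : p r * (p r)⁻¹ = 1 := mul_inv_cancel₀ hp.ne'
  have h5 := (abs_le.1 (hasy r ((le_max_left _ _).trans hrr)).1).2
  have h6 : r * deriv p r ≤ p r / 2 := by
    refine le_of_mul_le_mul_left ?_ hr0
    linarith
  rw [Real.sq_sqrt hc'.le, Real.sq_sqrt hc2.le]
  refine ⟨?_, by linarith, ?_⟩
  · rw [div_le_iff₀ (by positivity)]
    nlinarith
  · rw [le_div_iff₀ hc]
    nlinarith

omit [NeZero n] in
lemma radialMetric_radial {z θ : Cn n} {s : ℝ} (hθ : ‖θ‖ = 1) (hz : z = s • θ) :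
    radialMetric (mulI n) p z θ θ = 2 * (p (s ^ 2) + s ^ 2 * deriv p (s ^ 2)) := by
  have h1 : inner ℝ θ (mulI n θ) = 0 := inner_self_apply_eq_zero (I := mulI n) inner_mulI_left θ
  have h2 : ‖z‖ ^ 2 = s ^ 2 := by rw [hz, norm_smul, hθ, mul_one, Real.norm_eq_abs, sq_abs]
  rw [radialMetric_apply, rankOne, h2, hz, real_inner_smul_left, real_inner_smul_left, h1,
    real_inner_self_eq_norm_sq, hθ]
  ring

/-- The distance from a base point is at most a multiple of the square root of the moment map. -/
lemma IsRadial.exists_gdist_le (hr : IsRadial g p) (hn : 2 ≤ n) (hk : 1 ≤ k) {τ : ℝ}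
    (hτ : 0 < τ) (h : IsALE g τ) {i j : Fin n} (hij : i ≠ j) (x₀ : LineBundle n k) :
    ∃ A R : ℝ, 0 < A ∧ 0 < R ∧ ∀ x, ENNReal.ofReal R ≤ gdist g x₀ x →
      (gdist g x₀ x).toReal ≤ A * √(momentum g i j x) := by
  obtain ⟨m, L, r₀, hm, hL, hr₀, hb⟩ := hr.exists_profile_bounds hn hk hτ h
  set s₀ := √r₀
  have hs₀ : 0 < s₀ := Real.sqrt_pos.2 hr₀
  have hs₀2 : s₀ ^ 2 = r₀ := Real.sq_sqrt hr₀.le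
  obtain ⟨B, hB, hBK⟩ := exists_gdist_le_of_isCompact (g := g) hn x₀
    (isCompact_fiberNorm_le (n := n) (k := k) (s₀ ^ k))
  refine ⟨(B / s₀ + L) / m, B + 1, by positivity, by positivity, fun x hx => ?_⟩
  have hfar : s₀ ^ k < fiberNorm x := by
    by_contra! hle
    have h1 := hx.trans (hBK x hle)
    rw [ENNReal.ofReal_le_ofReal_iff hB] at h1
    linarith
  obtain ⟨z, hz, rfl⟩ := exists_eq_ofVec hk ((pow_pos hs₀ k).trans hfar).ne'
  rw [fiberNorm_ofVec hz] at hfar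
  have hs : s₀ < ‖z‖ := lt_of_pow_lt_pow_left₀ k (norm_nonneg _) hfar
  have hs0 : 0 < ‖z‖ := hs₀.trans hs
  set s := ‖z‖
  let θ : Cn n := s⁻¹ • z
  have hθ : ‖θ‖ = 1 := by
    rw [norm_smul, norm_inv, norm_norm]; exact inv_mul_cancel₀ hs0.ne'
  have hne : ∀ t ∈ Set.Icc s₀ s, t • θ ≠ 0 := fun t ht =>
    smul_ne_zero (hs₀.trans_le ht.1).ne' (norm_ne_zero_iff.1 (by rw [hθ]; exact one_ne_zero))
  have hline : ∀ t : ℝ, HasFDerivAt (fun t : ℝ => t • θ)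
      ((ContinuousLinearMap.id ℝ ℝ).smulRight θ) t := fun t =>
    ((ContinuousLinearMap.id ℝ ℝ).smulRight θ).hasFDerivAt
  have hpath := gdist_le_of_path (g := g) (γ := fun t => ofVec (t • θ)) (L := L) hs.le
    (fun t ht => (contMDiffAt_ofVec (hne t ht)).comp t
      (((ContinuousLinearMap.id ℝ ℝ).smulRight θ).contDiff.contDiffAt).contMDiffAt)
    (fun t ht => by
      have e1 : dInto (fun t : ℝ => (ofVec (t • θ) : LineBundle n k)) t 1
          = dInto (ofVec (k := k)) (t • θ) θ := by
        rw [dInto_comp (F := ofVec) (f := fun t : ℝ => t • θ)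
          (mdiffAt (contMDiffAt_ofVec (hne t ht))) (hline t).differentiableAt, (hline t).fderiv]
        simp
      rw [e1, tensorAt_dInto, hr.metric_eq _ (hne t ht), radialMetric_radial hθ rfl]
      refine Real.sqrt_le_iff.2 ⟨hL.le, (hb (t ^ 2) ?_).2.2⟩
      rw [← hs₀2]
      exact pow_le_pow_left₀ hs₀.le ht.1 2)
  have hend : s • θ = z := by simp only [θ]; rw [smul_smul, mul_inv_cancel₀ hs0.ne', one_smul]
  rw [hend] at hpath
  have hstart : gdist g x₀ (ofVec (s₀ • θ)) ≤ ENNReal.ofReal B := by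
    refine hBK _ ?_
    change fiberNorm _ ≤ _
    rw [fiberNorm_ofVec (hne s₀ ⟨le_rfl, hs.le⟩), norm_smul, hθ, mul_one,
      Real.norm_of_nonneg hs₀.le]
  have htot := (gdist_triangle x₀ _ _).trans (add_le_add hstart hpath)
  rw [← ENNReal.ofReal_add hB (mul_nonneg hL.le (by linarith))] at htot
  have h2 := ENNReal.toReal_le_of_le_ofReal (add_nonneg hB (mul_nonneg hL.le (by linarith))) htot
  have h3 : m * s ≤ √(momentum g i j (ofVec z : LineBundle n k)) := by
    refine Real.le_sqrt_of_sq_le ?_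
    rw [hr.momentum_ofVec hij hz, mul_pow, mul_comm]
    refine mul_le_mul_of_nonneg_left (hb _ ?_).1 (sq_nonneg _)
    rw [← hs₀2]
    exact pow_le_pow_left₀ hs₀.le hs.le 2
  calc _ ≤ B + L * (s - s₀) := h2
    _ ≤ B / s₀ * s + L * s := by
        have : B ≤ B / s₀ * s := by
          rw [div_mul_eq_mul_div, le_div_iff₀ hs₀]
          exact mul_le_mul_of_nonneg_left hs.le hB
        nlinarith
    _ = (B / s₀ + L) / m * (m * s) := by field_simp
    _ ≤ _ := mul_le_mul_of_nonneg_left h3 (by positivity)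

/-- The decay of the conformal factor. -/
lemma IsRadial.exists_inv_momentum_le (hr : IsRadial g p) (hn : 2 ≤ n) (hk : 1 ≤ k) {τ : ℝ}
    (hτ : 0 < τ) (h : IsALE g τ) {i j : Fin n} (hij : i ≠ j) (x₀ : LineBundle n k) :
    ∃ C R : ℝ, ∀ x, ENNReal.ofReal R ≤ gdist g x₀ x →
      (momentum g i j x)⁻¹ ≤ C / (gdist g x₀ x).toReal ^ 2 := by
  obtain ⟨A, R, hA, hR, hle⟩ := hr.exists_gdist_le hn hk hτ h hij x₀
  refine ⟨A ^ 2, R, fun x hx => ?_⟩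
  have hpos : 0 < (gdist g x₀ x).toReal :=
    ENNReal.toReal_pos ((ENNReal.ofReal_pos.2 hR).trans_le hx).ne' (gdist_lt_top hn _ _).ne
  have hm : 0 < momentum g i j x := momentum_pos x
  have h1 := pow_le_pow_left₀ hpos.le (hle x hx) 2
  rw [mul_pow, Real.sq_sqrt hm.le] at h1
  rw [inv_eq_one_div, div_le_div_iff₀ hm (by positivity)]
  linarith

/-- The derivative of the moment map in the direction of the radial vector field is at most a multiple
of the moment map: far out by the asymptotics, and near the zero section by compactness, as the moment
map is there a positive smooth function of the fibre coordinate. -/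
lemma IsRadial.exists_radial_derivative_le (hr : IsRadial g p) (hn : 2 ≤ n) (hk : 1 ≤ k) {τ : ℝ}
    (hτ : 0 < τ) (h : IsALE g τ) :
    ∃ L : ℝ, 0 ≤ L ∧ ∀ r, 0 < r → r * (p r + r * deriv p r) ≤ L ^ 2 * (2 * (r * p r)) := by
  obtain ⟨m, L, r₀, hm, hL, hr₀, hb⟩ := hr.exists_profile_bounds hn hk hτ h
  let i : Fin n := ⟨0, by omega⟩
  let j : Fin n := ⟨1, by omega⟩
  have hij : i ≠ j := by simp [i, j]
  let Q : ℝ → ℝ := fun t => fiberProfile g i j (t : ℂ)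
  have hQ : ContDiff ℝ ∞ Q := contDiff_fiberProfile.comp Complex.ofRealCLM.contDiff
  have hQ0 : ∀ t, 0 < Q t := fun t => fiberProfile_pos _
  have hQ' : ∀ t, HasDerivAt Q (deriv Q t) t := fun t =>
    (hQ.differentiable (by simp) t).hasDerivAt
  have hcont : Continuous fun t => (k / 2 : ℝ) * t * deriv Q t / Q t :=
    ((continuous_const.mul continuous_id).mul (hQ.continuous_deriv (by simp))).div hQ.continuous
      fun t => (hQ0 t).ne'
  obtain ⟨B, hB⟩ := (isCompact_Icc (a := (0 : ℝ)) (b := (√r₀) ^ k)).bddAbove_image hcont.continuousOn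
  refine ⟨√(1 + max B 0), Real.sqrt_nonneg _, fun r h0 => ?_⟩
  rw [Real.sq_sqrt (by positivity)]
  have hp := (hr.p_pos hn hk h0).1
  have hrp : 0 < r * p r := mul_pos h0 hp
  have hM : 0 ≤ max B 0 := le_max_right _ _
  by_cases hle : r₀ ≤ r
  · have h1 := mul_le_mul_of_nonneg_left (hb r hle).2.1 h0.le
    nlinarith [mul_nonneg hM hrp.le]
  · push Not at hle
    set s := √r
    have hs : 0 < s := Real.sqrt_pos.2 h0
    have hs2 : s ^ 2 = r := Real.sq_sqrt h0.le
    have hev : (fun t : ℝ => Q (t ^ k)) =ᶠ[𝓝 s] fun t => t ^ 2 * p (t ^ 2) := by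
      filter_upwards [Ioi_mem_nhds hs] with t ht
      have h1 := hr.fiberProfile_pow hij (c := (t : ℂ)) (by simpa using (ne_of_gt ht))
      simp only [Complex.norm_real, Real.norm_eq_abs, sq_abs] at h1
      simpa [Q] using h1
    have hd1 : HasDerivAt (fun t : ℝ => Q (t ^ k)) (deriv Q (s ^ k) * (k * s ^ (k - 1))) s :=
      (hQ' (s ^ k)).comp s (hasDerivAt_pow k s)
    have hsq : HasDerivAt (fun t : ℝ => t ^ 2) (2 * s) s := by simpa using hasDerivAt_pow 2 s
    have hpd : HasDerivAt p (deriv p (s ^ 2)) (s ^ 2) :=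
      hasDerivAt_of_contDiffAt (hr.contDiffAt (by rw [hs2]; exact h0))
    have hd2 : HasDerivAt (fun t : ℝ => t ^ 2 * p (t ^ 2))
        (2 * s * p (s ^ 2) + s ^ 2 * (deriv p (s ^ 2) * (2 * s))) s :=
      hsq.mul (HasDerivAt.comp (h₂ := p) (h := fun t : ℝ => t ^ 2) s hpd hsq)
    have heq := hd1.unique (hd2.congr_of_eventuallyEq hev)
    rw [hs2] at heq
    have hval : Q (s ^ k) = r * p r := hev.self_of_nhds.trans (by simp only [hs2])
    have hpow : s * s ^ (k - 1) = s ^ k := by rw [← pow_succ', Nat.sub_add_cancel hk]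
    have hkey : r * (p r + r * deriv p r) = (k / 2 : ℝ) * s ^ k * deriv Q (s ^ k) := by
      generalize deriv Q (s ^ k) = q at heq ⊢
      have : r * (p r + r * deriv p r) = s / 2 * (2 * s * p r + r * (deriv p r * (2 * s))) := by
        rw [← hs2]; ring
      rw [this, ← heq, ← hpow]
      ring
    have hBs := hB ⟨s ^ k, ⟨by positivity, pow_le_pow_left₀ hs.le (Real.sqrt_le_sqrt hle.le) k⟩, rfl⟩
    simp only [] at hBs
    rw [hval, ← hkey, div_le_iff₀ hrp] at hBs
    have h1 : B * (r * p r) ≤ max B 0 * (r * p r) :=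
      mul_le_mul_of_nonneg_right (le_max_left _ _) hrp.le
    nlinarith [mul_nonneg hM hrp.le]

/-- The gradient of `√(𝐳 φ')` is bounded. -/
lemma IsRadial.exists_dOut_sqrt_momentum_le (hr : IsRadial g p) (hn : 2 ≤ n) (hk : 1 ≤ k) {τ : ℝ}
    (hτ : 0 < τ) (h : IsALE g τ) {i j : Fin n} (hij : i ≠ j) :
    ContMDiff 𝓘(ℝ, Cn n) 𝓘(ℝ, ℝ) ∞ (fun y : LineBundle n k => √(momentum g i j y)) ∧
    ∃ L : ℝ, 0 ≤ L ∧ ∀ (x : LineBundle n k) (v : Cn n),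
      |dOut (fun y => √(momentum g i j y)) x v| ≤ L * √(tensorAt g.inner x v v) := by
  have hsm : ContMDiff 𝓘(ℝ, Cn n) 𝓘(ℝ, ℝ) ∞ (fun y : LineBundle n k => √(momentum g i j y)) :=
    fun x => (Real.contDiffAt_sqrt (momentum_pos x).ne').contMDiffAt.comp x
      (hr.contMDiff_momentum hk hij x)
  refine ⟨hsm, ?_⟩
  obtain ⟨L, hL, hle⟩ := hr.exists_radial_derivative_le hn hk hτ h
  refine ⟨L, hL, ?_⟩
  have hoff : ∀ z : Cn n, z ≠ 0 → ∀ v : Cn n,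
      |dOut (fun y => √(momentum g i j y)) (ofVec z) v|
        ≤ L * √(tensorAt g.inner (ofVec z : LineBundle n k) v v) := by
    intro z hz v
    have h0 : 0 < ‖z‖ ^ 2 := pow_pos (norm_pos_iff.2 hz) 2
    have hm : 0 < momentum g i j (ofVec z : LineBundle n k) := momentum_pos _
    have h1 := hr.dOut_momentum_sq_le hn hk hij hz v
    have h2 := hle _ h0
    rw [← hr.momentum_ofVec hij hz] at h2
    have h3 : dOut (fun y => √(momentum g i j y)) (ofVec z) v
        = dOut (momentum g i j) (ofVec z) v / (2 * √(momentum g i j (ofVec z : LineBundle n k))) := by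
      have h4 := Real.hasDerivAt_sqrt hm.ne'
      rw [dOut_comp h4.differentiableAt (mdiffAt (hr.contMDiff_momentum hk hij _)),
        h4.hasFDerivAt.fderiv]
      simp [div_eq_mul_inv, mul_comm]
    have hg : 0 ≤ tensorAt g.inner (ofVec z : LineBundle n k) v v := by
      by_cases hv : v = 0
      · simp [hv]
      · exact (g.pos _ v hv).le
    refine abs_le_of_sq_le_sq' ?_ (by positivity) |> abs_le.2
    rw [h3, div_pow, mul_pow, mul_pow, Real.sq_sqrt hm.le, Real.sq_sqrt hg,
      div_le_iff₀ (by positivity)]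
    nlinarith [mul_le_mul_of_nonneg_right h2 hg]
  intro x v
  obtain ⟨l, a, rfl⟩ := exists_mem_dom x
  obtain ⟨w, rfl⟩ := (dInto_param_bijective (k := k) l a).2 v
  have hcd : ContDiff ℝ ∞ (fun b : Cn n => √(momentum g i j (param l b : LineBundle n k))) :=
    (hsm.comp (contMDiff_param l)).contDiff
  have hval : ∀ b : Cn n, dOut (fun y => √(momentum g i j y)) (param l b : LineBundle n k)
      (dInto (param (k := k) l) b w)
      = fderiv ℝ (fun b : Cn n => √(momentum g i j (param l b : LineBundle n k))) b w := fun b => by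
    rw [fderiv_comp_dInto (mdiffAt (hsm _)) (mdiffAt (contMDiff_param l b))]
    rfl
  have hclosed : IsClosed {b : Cn n |
      |fderiv ℝ (fun b : Cn n => √(momentum g i j (param l b : LineBundle n k))) b w|
        ≤ L * √(pullback (param l) g.inner b w w)} := by
    refine isClosed_le ?_ ?_
    · exact ((hcd.continuous_fderiv (by simp)).clm_apply continuous_const).abs
    · exact continuous_const.mul (((contDiff_pullback_param g l).continuous.clm_apply
        continuous_const).clm_apply continuous_const).sqrt
  have hmem : a ∈ closure {b : Cn n | b l ≠ 0} := dense_apply_ne_zero l a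
  have hsub : {b : Cn n | b l ≠ 0} ⊆ {b : Cn n |
      |fderiv ℝ (fun b : Cn n => √(momentum g i j (param l b : LineBundle n k))) b w|
        ≤ L * √(pullback (param l) g.inner b w w)} := by
    intro b hb
    obtain ⟨z, hzl, rfl⟩ := exists_param_eq_ofVec hk hb
    have h1 := hoff z (ne_zero_of_apply hzl) (dInto (param (k := k) l) (vecCoord k l z) w)
    rw [ofVec_eq_param hzl, hval, tensorAt_dInto] at h1
    exact h1
  have := closure_minimal hsub hclosed hmem
  rw [hval, tensorAt_dInto]
  exact this

/-- The distance from a base point is unbounded, because `√(𝐳 φ')` is unbounded and Lipschitz. -/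
lemma IsRadial.exists_le_gdist (hr : IsRadial g p) (hn : 2 ≤ n) (hk : 1 ≤ k) {τ : ℝ}
    (hτ : 0 < τ) (h : IsALE g τ) (x₀ : LineBundle n k) (D : ℝ) :
    ∃ x, ENNReal.ofReal D ≤ gdist g x₀ x := by
  by_contra! hcon
  obtain ⟨m, L', r₀, hm, hL', hr₀, hb⟩ := hr.exists_profile_bounds hn hk hτ h
  let i : Fin n := ⟨0, by omega⟩
  let j : Fin n := ⟨1, by omega⟩
  have hij : i ≠ j := by simp [i, j]
  obtain ⟨hsm, L, hL, hle⟩ := hr.exists_dOut_sqrt_momentum_le hn hk hτ h hij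
  set B := √(momentum g i j x₀) + L * D
  have hB : ∀ x : LineBundle n k, √(momentum g i j x) ≤ B := fun x => by
    have := (abs_le.1 (abs_sub_le_of_gdist_lt hsm hL hle (hcon x))).2
    simp only [B]
    linarith
  have hB0 : 0 ≤ B := (Real.sqrt_nonneg _).trans (hB x₀)
  let t : ℝ := √r₀ + (B + 1) / m
  have ht : 0 < t := by positivity
  let z : Cn n := EuclideanSpace.single i (t : ℂ)
  have hzt : ‖z‖ = t := by simp [z, abs_of_pos ht]
  have hz : z ≠ 0 := norm_ne_zero_iff.1 (by rw [hzt]; exact ht.ne')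
  have h1 := hB (ofVec z)
  rw [hr.momentum_ofVec hij hz, hzt] at h1
  have h2 : r₀ ≤ t ^ 2 := by
    rw [← Real.sq_sqrt hr₀.le]
    exact pow_le_pow_left₀ (Real.sqrt_nonneg _) (le_add_of_nonneg_right (by positivity)) 2
  have h3 : m * t ≤ √(t ^ 2 * p (t ^ 2)) := by
    refine Real.le_sqrt_of_sq_le ?_
    rw [mul_pow, mul_comm]
    exact mul_le_mul_of_nonneg_left (hb _ h2).1 (sq_nonneg _)
  have h4 : B + 1 ≤ m * t := by
    simp only [t]
    rw [mul_add, mul_div_cancel₀ _ hm.ne']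
    linarith [mul_nonneg hm.le (Real.sqrt_nonneg r₀)]
  linarith

end Distance

/-! ### Invariant complex structures off the zero section -/

section InvariantStructures

open LineBundle

variable {n k : ℕ}

/-- Real linear maps on `ℂⁿ` are determined by their values on a complex line and on its orthogonal
complement. -/
lemma eq_of_eq_on_line {W : Type*} [NormedAddCommGroup W] [NormedSpace ℝ W] {L L' : Cn n →L[ℝ] W}
    {z : Cn n} (hz : z ≠ 0) (h1 : L z = L' z) (h2 : L (mulI n z) = L' (mulI n z))
    (h3 : ∀ w, inner ℂ z w = 0 → L w = L' w) : L = L' := by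
  ext x
  have h0 : inner ℂ z z ≠ 0 := inner_self_ne_zero.2 hz
  set c : ℂ := inner ℂ z x / inner ℂ z z
  have h4 : inner ℂ z (x - c • z) = 0 := by
    rw [inner_sub_right, inner_smul_right, div_mul_cancel₀ _ h0, sub_self]
  have h5 : x = c.re • z + c.im • mulI n z + (x - c • z) := by
    have : c • z = c.re • z + c.im • mulI n z := by
      conv_lhs => rw [← Complex.re_add_im c, add_smul, mul_smul]
      rfl
    rw [this]; abel
  rw [h5]
  simp only [map_add, map_smul, h1, h2, h3 _ h4]

/-- An orthogonal complex structure which preserves a complex line acts on it as `± i`. -/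
lemma eq_smul_mulI_of_mem_span {B : Cn n →L[ℝ] Cn n →L[ℝ] ℝ} {K : Cn n →L[ℝ] Cn n}
    (hsymm : ∀ a b, B a b = B b a) (hI : ∀ a b, B (mulI n a) b = -B a (mulI n b))
    (hpos : ∀ a, a ≠ 0 → 0 < B a a) (hK2 : ∀ a, K (K a) = -a) (hK : ∀ a b, B (K a) (K b) = B a b)
    {x : Cn n} (hx : K x ∈ Submodule.span ℂ {x}) :
    ∃ ε : ℝ, ε ^ 2 = 1 ∧ K x = ε • mulI n x := by
  by_cases hx0 : x = 0
  · exact ⟨1, one_pow 2, by simp [hx0]⟩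
  obtain ⟨c, hc⟩ := Submodule.mem_span_singleton.1 hx
  have hc' : K x = c.re • x + c.im • mulI n x := by
    rw [← hc]
    conv_lhs => rw [← Complex.re_add_im c, add_smul, mul_smul]
    rfl
  have h1 : B (mulI n x) x = 0 := by
    have := hI x x
    rw [hsymm x] at this
    linarith
  have h2 : B (K x) x = 0 := by
    have := hK (K x) x
    rw [hK2, map_neg, neg_apply, hsymm x] at this
    linarith
  have h3 : B (mulI n x) (mulI n x) = B x x := by
    rw [hI, mulI_mulI, map_neg, neg_neg]
  have hp := hpos x hx0
  have hre : c.re = 0 := by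
    rw [hc'] at h2
    simp only [map_add, map_smul, add_apply, smul_apply, h1, smul_eq_mul, mul_zero, add_zero] at h2
    exact (mul_eq_zero.1 h2).resolve_right hp.ne'
  rw [hre, zero_smul, zero_add] at hc'
  refine ⟨c.im, ?_, hc'⟩
  have h4 := hK x x
  rw [hc'] at h4
  simp only [map_smul, smul_apply, h3, smul_eq_mul] at h4
  refine mul_right_cancel₀ hp.ne' ?_
  rw [one_mul, pow_two, mul_assoc, h4]

lemma map_mulI_of_eq_smul_mulI {K : Cn n →L[ℝ] Cn n} (hK2 : ∀ a, K (K a) = -a) {ε : ℝ}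
    (hε : ε ^ 2 = 1) {x : Cn n} (h : K x = ε • mulI n x) : K (mulI n x) = ε • mulI n (mulI n x) := by
  have h1 := hK2 x
  rw [h, map_smul] at h1
  rw [mulI_mulI, smul_neg, ← smul_neg, ← h1, smul_smul, ← pow_two, hε, one_smul]

/-- A complex structure on `ℂⁿ` which is orthogonal and commutes with the unitary maps fixing `z` acts
as `± i` on the line of `z` and on its orthogonal complement. -/
lemma exists_signs {B : Cn n →L[ℝ] Cn n →L[ℝ] ℝ} {K : Cn n →L[ℝ] Cn n}
    (hsymm : ∀ a b, B a b = B b a) (hI : ∀ a b, B (mulI n a) b = -B a (mulI n b))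
    (hpos : ∀ a, a ≠ 0 → 0 < B a a) (hK2 : ∀ a, K (K a) = -a) (hK : ∀ a b, B (K a) (K b) = B a b)
    {z : Cn n} (hA : ∀ (A : Cn n ≃ₗᵢ[ℂ] Cn n), A z = z → ∀ a, A (K a) = K (A a)) :
    ∃ ε₁ ε₂ : ℝ, ε₁ ^ 2 = 1 ∧ ε₂ ^ 2 = 1 ∧ K z = ε₁ • mulI n z ∧
      ∀ w, inner ℂ z w = 0 → K w = ε₂ • mulI n w := by
  -- the reflection in the line of `z`
  obtain ⟨ε₁, hε₁, h1⟩ := eq_smul_mulI_of_mem_span hsymm hI hpos hK2 hK (x := z) (by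
    have hfix : (Submodule.span ℂ {z}).reflection z = z :=
      Submodule.reflection_mem_subspace_eq_self (Submodule.mem_span_singleton_self z)
    have := hA _ hfix z
    rw [hfix] at this
    exact (Submodule.reflection_eq_self_iff _).1 this)
  -- the reflection in the complement of the line of `w`
  have h2 : ∀ w, inner ℂ z w = 0 → ∃ ε : ℝ, ε ^ 2 = 1 ∧ K w = ε • mulI n w := by
    intro w hw
    refine eq_smul_mulI_of_mem_span hsymm hI hpos hK2 hK ?_
    have hfix : (Submodule.span ℂ {w})ᗮ.reflection z = z :=
      Submodule.reflection_mem_subspace_eq_self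
        (Submodule.mem_orthogonal_singleton_iff_inner_left.2 hw)
    have := hA _ hfix w
    rw [Submodule.reflection_orthogonalComplement_singleton_eq_neg, map_neg,
      Submodule.reflection_orthogonal_apply, neg_inj] at this
    exact (Submodule.reflection_eq_self_iff _).1 this
  by_cases hw₀ : ∃ w₀ : Cn n, w₀ ≠ 0 ∧ inner ℂ z w₀ = 0
  · obtain ⟨w₀, hne, horth⟩ := hw₀
    obtain ⟨ε₂, hε₂, h3⟩ := h2 w₀ horth
    refine ⟨ε₁, ε₂, hε₁, hε₂, h1, fun w hw => ?_⟩
    obtain ⟨ε, hε, h4⟩ := h2 w hw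
    obtain ⟨ε', hε', h5⟩ := h2 (w₀ + w) (by rw [inner_add_right, horth, hw, add_zero])
    have h6 : mulI n ((ε₂ - ε') • w₀ + (ε - ε') • w) = 0 := by
      rw [map_add, h3, h4] at h5
      rw [← sub_eq_zero] at h5
      rw [← h5]
      rw [map_add, map_smul, map_smul, map_add, sub_smul, sub_smul, smul_add]
      abel
    have h7 : (ε₂ - ε') • w₀ + (ε - ε') • w = 0 := by
      rw [← norm_eq_zero, ← norm_mulI, h6, norm_zero]
    rcases sq_eq_sq_iff_eq_or_eq_neg.1 (hε.trans hε₂.symm) with h | h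
    · rw [h4, h]
    have hε₂0 : ε₂ ≠ 0 := by rintro rfl; norm_num at hε₂
    rcases sq_eq_sq_iff_eq_or_eq_neg.1 (hε'.trans hε₂.symm) with h' | h'
    · rw [h', h, sub_self, zero_smul, zero_add, smul_eq_zero] at h7
      rw [h7.resolve_left (by intro h0; apply hε₂0; linarith)]
      simp
    · rw [h', h, sub_self, zero_smul, add_zero, smul_eq_zero] at h7
      exact absurd (h7.resolve_left (by intro h0; apply hε₂0; linarith)) hne
  · push Not at hw₀
    refine ⟨ε₁, 1, hε₁, one_pow 2, h1, fun w hw => ?_⟩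
    have : w = 0 := by
      by_contra h
      exact hw₀ w h hw
    simp [this]

/-- A function `f` such that `f ω` is closed, `ω` being the fundamental form of a radial metric, has
vanishing derivative. Since `ω` is closed, the hypothesis is `df ∧ ω = 0`; it is tested on triples
`(a, b, i b)` with `ω(a, b) = ω(a, i b) = 0`, which exist because `n ≥ 2`. -/
lemma fderiv_eq_zero_of_extD_smul_eq_zero (hn : 2 ≤ n) {f : Cn n → ℝ} {p : ℝ → ℝ} {z : Cn n}
    (hz : z ≠ 0) (hp : ContDiffAt ℝ ∞ p (‖z‖ ^ 2)) (hpos : ∀ a, a ≠ 0 → 0 < radialMetric (mulI n) p z a a)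
    (hf : DifferentiableAt ℝ f z)
    (hc : ∀ a b c, extD (fun y => f y • (radialMetric (mulI n) p y).comp (mulI n)) z a b c = 0) :
    fderiv ℝ f z = 0 := by
  set T : Cn n → Cn n →L[ℝ] Cn n →L[ℝ] ℝ := fun y => (radialMetric (mulI n) p y).comp (mulI n)
  have hT : DifferentiableAt ℝ T z :=
    ((contDiffAt_radialMetric (I := mulI n) hp).differentiableAt (by simp)).clm_comp
      (differentiableAt_const _)
  have hT0 : ∀ a b c, extD T z a b c = 0 := by
    intro a b c
    have h1 := extD_smul_radial (I := mulI n) mulI_mulI inner_mulI_left hp (m := fun _ => 1)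
      (differentiableAt_const _) a b c
    simpa [T] using h1
  have hprod : ∀ a b c, fderiv ℝ f z a * T z b c + fderiv ℝ f z b * T z c a
      + fderiv ℝ f z c * T z a b = 0 := by
    intro a b c
    have key : ∀ e v w, fderiv ℝ (fun y => f y • T y) z e v w
        = f z * fderiv ℝ T z e v w + fderiv ℝ f z e * T z v w := by
      intro e v w
      have h1 : HasFDerivAt (fun y => f y • T y) _ z := hf.hasFDerivAt.smul hT.hasFDerivAt
      rw [HasFDerivAt.fderiv h1]
      simp
    have h1 : extD (fun y => f y • T y) z a b c = 0 := hc a b c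
    have h2 := hT0 a b c
    simp only [extD, key] at h1 h2
    linear_combination h1 - f z * h2
  have hself : ∀ a, T z a (mulI n a) = radialMetric (mulI n) p z (mulI n a) (mulI n a) := fun _ => rfl
  have hselfpos : ∀ a, a ≠ 0 → T z a (mulI n a) ≠ 0 := by
    intro a ha
    rw [hself]
    exact (hpos _ (by rw [← norm_ne_zero_iff, norm_mulI]; exact norm_ne_zero_iff.2 ha)).ne'
  have hTorth : ∀ a b, inner ℂ a b = 0 → (inner ℂ z a = 0 ∨ inner ℂ z b = 0) → T z a b = 0 := by
    intro a b hab hor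
    have e1 : inner ℝ (mulI n a) b = 0 := by
      rw [inner_mulI_left, (inner_eq_zero_of_mulI hab).2, neg_zero]
    change radialMetric (mulI n) p z (mulI n a) b = 0
    rw [radialMetric_apply, e1, rankOne, mulI_mulI, inner_neg_right]
    rcases hor with h | h
    · rw [(inner_eq_zero_of_mulI h).1, (inner_eq_zero_of_mulI h).2]; ring
    · rw [(inner_eq_zero_of_mulI h).1, (inner_eq_zero_of_mulI h).2]; ring
  have hI : ∀ a b : Cn n, inner ℂ a b = 0 → inner ℂ a (mulI n b) = 0 ∧ inner ℂ b a = 0 ∧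
      inner ℂ (mulI n a) b = 0 ∧ inner ℂ (mulI n b) a = 0 := by
    intro a b h
    have h' : inner ℂ b a = 0 := inner_eq_zero_symm.1 h
    simp [mulI_apply, inner_smul_left, inner_smul_right, h, h']
  obtain ⟨w, hw, horth⟩ := exists_orthogonal hn z
  refine eq_of_eq_on_line hz ?_ ?_ fun a ha => ?_
  -- the directions `z`, `i z` are tested against `w`, `i w`, and those orthogonal to `z` against `z`
  · have h1 := hprod z w (mulI n w)
    rw [hTorth (mulI n w) z (hI _ _ horth).2.2.2 (Or.inl (hI _ _ horth).1),
      hTorth z w horth (Or.inr horth)] at h1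
    simpa [hselfpos w hw] using h1
  · have h1 := hprod (mulI n z) w (mulI n w)
    rw [hTorth (mulI n w) (mulI n z) (hI _ _ (hI _ _ horth).2.2.2).1 (Or.inl (hI _ _ horth).1),
      hTorth (mulI n z) w (hI _ _ horth).2.2.1 (Or.inr horth)] at h1
    simpa [hselfpos w hw] using h1
  · have h1 := hprod a z (mulI n z)
    rw [hTorth a z (hI _ _ ha).2.1 (Or.inl ha),
      hTorth (mulI n z) a (hI _ _ ha).2.2.1 (Or.inr ha)] at h1
    simpa [hselfpos z hz] using h1

variable [NeZero n]

lemma act_ofVec (A : Cn n ≃ₗᵢ[ℂ] Cn n) {z : Cn n} (hz : z ≠ 0) :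
    act A (ofVec z : LineBundle n k) = ofVec (A z) := by
  rw [ofVec_eq_mk hz, ofVec_eq_mk (fun h => hz (A.map_eq_zero_iff.1 h))]
  rfl

/-- The derivative of the action. -/
def dAct (A : Cn n ≃ₗᵢ[ℂ] Cn n) (x : LineBundle n k) : Cn n →L[ℝ] Cn n :=
  mfderiv 𝓘(ℝ, Cn n) 𝓘(ℝ, Cn n) (act A) x

lemma dAct_dInto_ofVec (A : Cn n ≃ₗᵢ[ℂ] Cn n) {z : Cn n} (hz : z ≠ 0) (a : Cn n) :
    dAct A (ofVec z : LineBundle n k) (dInto (ofVec (k := k)) z a)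
      = dInto (ofVec (k := k)) (A z) (A a) := by
  have hAz : A z ≠ 0 := fun h => hz (A.map_eq_zero_iff.1 h)
  let A' : Cn n →L[ℝ] Cn n := (A.toContinuousLinearEquiv : Cn n →L[ℂ] Cn n).restrictScalars ℝ
  have h1 : dInto (fun y => act A (ofVec y : LineBundle n k)) z
      = (dAct A (ofVec z : LineBundle n k)).comp (dInto (ofVec (k := k)) z) :=
    mfderiv_comp z (mdiffAt (contMDiff_act A _)) (mdiffAt (contMDiffAt_ofVec hz))
  have h2 : dInto (fun y => (ofVec (A' y) : LineBundle n k)) z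
      = (dInto (ofVec (k := k)) (A' z)).comp (fderiv ℝ A' z) :=
    dInto_comp (F := ofVec) (f := A') (mdiffAt (contMDiffAt_ofVec hAz)) A'.differentiableAt
  have h3 : dInto (fun y => act A (ofVec y : LineBundle n k)) z
      = dInto (fun y => (ofVec (A' y) : LineBundle n k)) z := by
    refine dInto_congr ?_
    filter_upwards [isOpen_ne.mem_nhds hz] with y hy using act_ofVec A hy
  rw [h1, h2, A'.fderiv] at h3
  exact congrArg (fun L : Cn n →L[ℝ] Cn n => L a) h3

variable {g : RiemMetric n k} {p : ℝ → ℝ} {v : LineBundle n k → ℝ} {J : EndField n k}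

omit [NeZero n] in
lemma IsInvariantKahlerFactor.isHermitianPair (h : IsInvariantKahlerFactor g v J) :
    IsHermitianPair g v J := ⟨h.smooth, h.complex, h.hermitian⟩

/-- A compatible invariant complex structure at a point off the zero section. -/
lemma IsInvariantKahlerFactor.exists_signs (h : IsInvariantKahlerFactor g v J) (hr : IsRadial g p)
    (hk : 1 ≤ k) {z : Cn n} (hz : z ≠ 0) :
    ∃ ε₁ ε₂ : ℝ, ε₁ ^ 2 = 1 ∧ ε₂ ^ 2 = 1 ∧
      endAt J (ofVec z) (dInto (ofVec (k := k)) z z) = dInto (ofVec (k := k)) z (ε₁ • mulI n z) ∧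
      endAt J (ofVec z) (dInto (ofVec (k := k)) z (mulI n z))
        = dInto (ofVec (k := k)) z (ε₁ • mulI n (mulI n z)) ∧
      ∀ w, inner ℂ z w = 0 → endAt J (ofVec z) (dInto (ofVec (k := k)) z w)
        = dInto (ofVec (k := k)) z (ε₂ • mulI n w) := by
  have hbij := dInto_ofVec_bijective hk hz
  set D := dInto (ofVec (k := k)) z
  let K : Cn n →L[ℝ] Cn n := D.inverse.comp ((endAt J (ofVec z)).comp D)
  have hDK : ∀ a, D (K a) = endAt J (ofVec z) (D a) := fun a =>
    (inverse_apply_of_bijective hbij _).1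
  have hK2 : ∀ a, K (K a) = -a := by
    intro a
    apply hbij.1
    rw [hDK, hDK, endAt_endAt h.complex, map_neg]
  have hB : ∀ a b, radialMetric (mulI n) p z a b = tensorAt g.inner (ofVec z) (D a) (D b) := by
    intro a b
    rw [tensorAt_dInto, hr.metric_eq z hz]
  have hK : ∀ a b, radialMetric (mulI n) p z (K a) (K b) = radialMetric (mulI n) p z a b := by
    intro a b
    rw [hB, hB, hDK, hDK]
    have h1 : v (ofVec z) ^ 2 * tensorAt g.inner (ofVec z) (endAt J (ofVec z) (D a))
        (endAt J (ofVec z) (D b)) = v (ofVec z) ^ 2 * tensorAt g.inner (ofVec z) (D a) (D b) :=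
      h.hermitian (ofVec z) (D a) (D b)
    exact mul_left_cancel₀ (pow_ne_zero 2 (h.pos _).ne') h1
  have hA : ∀ (A : Cn n ≃ₗᵢ[ℂ] Cn n), A z = z → ∀ a, A (K a) = K (A a) := by
    intro A hAz a
    have h0 : ∀ b, dAct A (ofVec z : LineBundle n k) (D b) = D (A b) := by
      intro b
      rw [dAct_dInto_ofVec A hz, hAz]
    have h1 : dAct A (ofVec z) (endAt J (ofVec z) (D a))
        = endAt J (act A (ofVec z)) (dAct A (ofVec z) (D a)) :=
      h.complex_invariant A (ofVec z) (D a)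
    rw [act_ofVec A hz, hAz] at h1
    apply hbij.1
    rw [hDK, ← h0, hDK, h1, h0]
  obtain ⟨ε₁, ε₂, h1, h2, h3, h4⟩ := KahlerALE.exists_signs (radialMetric_symm p z)
    (radialMetric_hermitian mulI_mulI inner_mulI_left p z) (fun a ha => hr.pos hk hz ha) hK2 hK hA
  refine ⟨ε₁, ε₂, h1, h2, ?_, ?_, fun w hw => ?_⟩
  · rw [← hDK, h3]
  · rw [← hDK, map_mulI_of_eq_smul_mulI hK2 h1 h3]
  · rw [← hDK, h4 w hw]

end InvariantStructures

/-! ### Uniqueness of the conformal factor -/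

section Uniqueness

open LineBundle

variable {n k : ℕ} {g : RiemMetric n k} {p : ℝ → ℝ} {v : LineBundle n k → ℝ} {J : EndField n k}

/-- A choice of a sign at the points of `ℂⁿ ∖ {0}` which is locally constant is constant. -/
lemma exists_constant_sign (hn : 2 ≤ n) {S : ℝ → Cn n → Prop}
    (hopen : ∀ ε z, z ≠ 0 → S ε z → ∀ᶠ y in 𝓝 z, S ε y)
    (hex : ∀ z, z ≠ 0 → S 1 z ∨ S (-1) z) (hdisj : ∀ z, z ≠ 0 → S 1 z → ¬S (-1) z) :
    ∃ ε : ℝ, ε ^ 2 = 1 ∧ ∀ z, z ≠ 0 → S ε z := by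
  have hU : ∀ ε, IsOpen {z | z ≠ 0 ∧ S ε z} := by
    intro ε
    rw [isOpen_iff_mem_nhds]
    rintro z ⟨hz, hS⟩
    filter_upwards [isOpen_ne.mem_nhds hz, hopen ε z hz hS] with y h1 h2 using ⟨h1, h2⟩
  have h := isPreconnected_iff_subset_of_disjoint.1 (isPreconnected_compl_zero hn) _ _ (hU 1)
    (hU (-1)) (fun z hz => (hex z hz).imp (fun h => ⟨hz, h⟩) fun h => ⟨hz, h⟩)
    (by
      ext z
      simp only [Set.mem_inter_iff, Set.mem_ofPred_eq, Set.mem_empty_iff_false, iff_false]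
      rintro ⟨-, ⟨hz, h1⟩, -, h2⟩
      exact hdisj z hz h1 h2)
  rcases h with h | h
  · exact ⟨1, one_pow 2, fun z hz => (h hz).2⟩
  · exact ⟨-1, by norm_num, fun z hz => (h hz).2⟩

/-- If the fundamental form pulls back to a multiple of the one of a radial metric, then the
multiple is constant. -/
lemma IsHermitianPair.exists_mul_eq (hn : 2 ≤ n) (h : IsHermitianPair g v J) (hv : ∀ x, 0 < v x)
    (hclosed : IsClosedForm (fundamentalForm (conformal g v) J)) {F : Cn n → LineBundle n k}
    (hF : ∀ y, y ≠ 0 → ContMDiffAt 𝓘(ℝ, Cn n) 𝓘(ℝ, Cn n) ∞ F y)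
    (hinj : ∀ y, y ≠ 0 → Function.Injective (dInto F y)) {c : Cn n → ℝ} {q : ℝ → ℝ}
    (hc : ∀ y, y ≠ 0 → DifferentiableAt ℝ c y) (hc0 : ∀ y, y ≠ 0 → 0 < c y)
    (hq : ∀ r, 0 < r → ContDiffAt ℝ ∞ q r)
    (hm : ∀ y, y ≠ 0 → pullback F g.inner y = c y ^ 2 • radialMetric (mulI n) q y) {ε : ℝ}
    (hε : ε ^ 2 = 1)
    (hJ : ∀ y, y ≠ 0 → ∀ a, endAt J (F y) (dInto F y a) = dInto F y (ε • mulI n a)) :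
    ∃ C : ℝ, ∀ y, y ≠ 0 → v (F y) * c y = C := by
  let f : Cn n → ℝ := fun y => ε * (v (F y) * c y) ^ 2
  have hε0 : ε ≠ 0 := by rintro rfl; norm_num at hε
  have hpull : ∀ y, y ≠ 0 → pullback F (fundamentalForm (conformal g v) J) y
      = f y • (radialMetric (mulI n) q y).comp (mulI n) := by
    intro y hy
    rw [pullback_fundamentalForm g v J (K := ε • mulI n) (hJ y hy), hm y hy]
    ext a b
    simp [f]
    ring
  have hvF : ∀ y, y ≠ 0 → DifferentiableAt ℝ (fun y => v (F y)) y := fun y hy =>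
    ((mdiffAt (h.smooth _)).comp y (mdiffAt (hF y hy))).differentiableAt
  have hf : ∀ y, y ≠ 0 → DifferentiableAt ℝ f y := fun y hy =>
    (((hvF y hy).mul (hc y hy)).pow 2).const_mul ε
  have hf0 : ∀ y, y ≠ 0 → fderiv ℝ f y = 0 := by
    intro y hy
    have hy0 : 0 < ‖y‖ ^ 2 := pow_pos (norm_pos_iff.2 hy) 2
    refine fderiv_eq_zero_of_extD_smul_eq_zero hn hy (hq _ hy0) (fun a ha => ?_) (hf y hy)
      fun a b e => ?_
    · have h1 := pullback_pos g (hinj y hy) ha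
      rw [hm y hy] at h1
      exact pos_of_mul_pos_right h1 (sq_nonneg _)
    · have h1 := h.extD_pullback_eq_zero hclosed (F := F) (y := y)
        (by filter_upwards [isOpen_ne.mem_nhds hy] with y' hy' using hF y' hy') a b e
      have h2 : pullback F (fundamentalForm (conformal g v) J)
          =ᶠ[𝓝 y] fun y => f y • (radialMetric (mulI n) q y).comp (mulI n) := by
        filter_upwards [isOpen_ne.mem_nhds hy] with y' hy' using hpull y' hy'
      rw [extD, h2.fderiv_eq] at h1
      exact h1
  obtain ⟨C, hC⟩ := isOpen_compl_singleton.exists_is_const_of_fderiv_eq_zero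
    (isPreconnected_compl_zero hn) (fun y hy => (hf y hy).differentiableWithinAt)
    (fun y hy => hf0 y hy)
  refine ⟨√(ε * C), fun y hy => ?_⟩
  have h1 := hC y hy
  simp only [f] at h1
  rw [← h1, ← mul_assoc, ← pow_two, hε, one_mul, Real.sqrt_sq (mul_pos (hv _) (hc0 y hy)).le]

variable [NeZero n]

/-- A continuous function which is constant off the zero section is constant. -/
lemma eq_const_of_eq_off_zeroSection (hk : 1 ≤ k) {f : LineBundle n k → ℝ} (hf : Continuous f)
    {C : ℝ} (h : ∀ z, z ≠ 0 → f (ofVec z) = C) (x : LineBundle n k) : f x = C := by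
  obtain ⟨j, a, rfl⟩ := exists_mem_dom x
  have h1 : Set.EqOn (fun b : Cn n => f (param j b)) (fun _ => C) {b | b j ≠ 0} := by
    intro b hb
    obtain ⟨z, hzj, rfl⟩ := exists_param_eq_ofVec hk hb
    simp only []
    rw [← ofVec_eq_param hzj, h z (ne_zero_of_apply hzj)]
  exact congrFun (Continuous.ext_on (dense_apply_ne_zero j)
    (hf.comp (contMDiff_param j).continuous) continuous_const h1) a

lemma IsHermitianPair.continuousAt_pullback_ofVec (h : IsHermitianPair g v J) {z : Cn n} (hz : z ≠ 0)
    {a b : Cn n → Cn n} (ha : Continuous a) (hb : Continuous b) :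
    ContinuousAt (fun y => pullback ofVec (fundamentalForm (conformal g v) J) y (a y) (b y)) z := by
  obtain ⟨j, hj⟩ := exists_apply_ne_zero hz
  have h1 : (fun y => pullback ofVec (fundamentalForm (conformal g v) J) y (a y) (b y)) =ᶠ[𝓝 z]
      fun y => pullback (param j) (fundamentalForm (conformal g v) J) (vecCoord k j y)
        (fderiv ℝ (vecCoord k j) y (a y)) (fderiv ℝ (vecCoord k j) y (b y)) := by
    filter_upwards [eventually_apply_ne_zero hj] with y hy
    rw [pullback_ofVec_eq hy]
    rfl
  refine ContinuousAt.congr ?_ h1.symm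
  have h2 := contDiffAt_vecCoord (k := k) hj
  have h3 : ContinuousAt (fderiv ℝ (vecCoord k j)) z := (h2.fderiv_right (m := ∞) le_rfl).continuousAt
  exact (((h.contDiff_pullback_param j).continuous.continuousAt.comp h2.continuousAt).clm_apply
    (h3.clm_apply ha.continuousAt)).clm_apply (h3.clm_apply hb.continuousAt)

/-- The two signs describing an invariant compatible complex structure are constant. -/
lemma IsInvariantKahlerFactor.exists_constant_signs (h : IsInvariantKahlerFactor g v J)
    (hr : IsRadial g p) (hn : 2 ≤ n) (hk : 1 ≤ k) :
    ∃ ε₁ ε₂ : ℝ, ε₁ ^ 2 = 1 ∧ ε₂ ^ 2 = 1 ∧ ∀ z, z ≠ 0 →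
      endAt J (ofVec z) (dInto (ofVec (k := k)) z z) = dInto (ofVec (k := k)) z (ε₁ • mulI n z) ∧
      endAt J (ofVec z) (dInto (ofVec (k := k)) z (mulI n z))
        = dInto (ofVec (k := k)) z (ε₁ • mulI n (mulI n z)) ∧
      ∀ w, inner ℂ z w = 0 → endAt J (ofVec z) (dInto (ofVec (k := k)) z w)
        = dInto (ofVec (k := k)) z (ε₂ • mulI n w) := by
  set T := fundamentalForm (conformal g v) J
  have hT : ∀ z, z ≠ 0 → ∀ (ε : ℝ) w, w ≠ 0 →
      endAt J (ofVec z) (dInto (ofVec (k := k)) z w) = dInto (ofVec (k := k)) z (ε • mulI n w) →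
      ∃ c, 0 < c ∧ pullback ofVec T z w (mulI n w) = ε * c := by
    intro z hz ε w hw hJ
    have hIw : mulI n w ≠ 0 := by rw [← norm_ne_zero_iff, norm_mulI]; exact norm_ne_zero_iff.2 hw
    refine ⟨v (ofVec z) ^ 2 * radialMetric (mulI n) p z (mulI n w) (mulI n w),
      mul_pos (pow_pos (h.pos _) 2) (hr.pos hk hz hIw), ?_⟩
    change v (ofVec z) ^ 2 * tensorAt g.inner (ofVec z)
      (endAt J (ofVec z) (dInto (ofVec (k := k)) z w)) (dInto (ofVec (k := k)) z (mulI n w)) = _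
    rw [hJ, tensorAt_dInto, hr.metric_eq z hz]
    simp
    ring
  have hsign : ∀ {ε ε' c : ℝ}, ε ^ 2 = 1 → ε' ^ 2 = 1 → 0 < c → 0 < ε * (ε' * c) → ε' = ε := by
    intro ε ε' c h1 h2 hc0 h3
    rcases sq_eq_sq_iff_eq_or_eq_neg.1 (h2.trans h1.symm) with h4 | h4
    · exact h4
    · rw [h4] at h3
      nlinarith
  have hone : ∀ {ε c : ℝ}, ε ^ 2 = 1 → 0 < c → 0 < 1 * (ε * c) ∨ 0 < -1 * (ε * c) := by
    intro ε c h1 hc0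
    rcases (sq_eq_sq_iff_eq_or_eq_neg.1 (h1.trans (one_pow 2).symm)) with h4 | h4
    · left; rw [h4]; linarith
    · right; rw [h4]; linarith
  obtain ⟨ε₁, hε₁, h1⟩ := exists_constant_sign hn
    (S := fun ε z => 0 < ε * pullback ofVec T z z (mulI n z))
    (fun ε z hz hS => (continuousAt_const.mul (h.isHermitianPair.continuousAt_pullback_ofVec hz
      continuous_id (mulI n).continuous)).eventually_const_lt hS)
    (fun z hz => by
      obtain ⟨ε, -, e1, -, e2, -⟩ := h.exists_signs hr hk hz
      obtain ⟨c, hc0, hc⟩ := hT z hz ε z hz e2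
      simp only [hc]
      exact hone e1 hc0)
    (fun z hz (h1 : 0 < 1 * _) (h2 : 0 < -1 * _) => by linarith)
  obtain ⟨ε₂, hε₂, h2⟩ := exists_constant_sign hn
    (S := fun ε z => ∃ w, inner ℂ z w = 0 ∧ 0 < ε * pullback ofVec T z w (mulI n w))
    (fun ε z hz ⟨w, hw, hS⟩ => by
      -- the projection of `w` to the orthogonal complement of a nearby point
      let W : Cn n → Cn n := fun y => inner ℂ y y • w - inner ℂ y w • y
      have hW : Continuous W := by fun_prop
      have hz0 : (inner ℂ z z : ℂ) ≠ 0 := inner_self_ne_zero.2 hz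
      have hcont := (continuousAt_const (y := ε)).mul
        (h.isHermitianPair.continuousAt_pullback_ofVec hz hW ((mulI n).continuous.comp hW))
      have hpos : 0 < ε * pullback ofVec T z (W z) (mulI n (W z)) := by
        have e1 : W z = (‖z‖ ^ 2) • w := by
          simp only [W, hw, zero_smul, sub_zero]
          rw [inner_self_eq_norm_sq_to_K]
          norm_cast
        rw [e1]
        simp only [map_smul, smul_apply, smul_eq_mul]
        have : 0 < ‖z‖ ^ 2 := pow_pos (norm_pos_iff.2 hz) 2
        have h3 := mul_pos (mul_pos this this) hS
        linarith
      filter_upwards [hcont.eventually_const_lt hpos] with y hy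
      refine ⟨W y, ?_, hy⟩
      simp only [W, inner_sub_right, inner_smul_right]
      ring)
    (fun z hz => by
      obtain ⟨-, ε, -, e1, -, -, e2⟩ := h.exists_signs hr hk hz
      obtain ⟨w, hw, horth⟩ := exists_orthogonal hn z
      obtain ⟨c, hc0, hc⟩ := hT z hz ε w hw (e2 w horth)
      rcases hone e1 hc0 with h3 | h3
      · exact Or.inl ⟨w, horth, by rw [hc]; exact h3⟩
      · exact Or.inr ⟨w, horth, by rw [hc]; exact h3⟩)
    (fun z hz ⟨w, hw, h3⟩ ⟨w', hw', h4⟩ => by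
      obtain ⟨-, ε, -, e1, -, -, e2⟩ := h.exists_signs hr hk hz
      have hne : w ≠ 0 := by rintro rfl; simp at h3
      have hne' : w' ≠ 0 := by rintro rfl; simp at h4
      obtain ⟨c, hc0, hc⟩ := hT z hz ε w hne (e2 w hw)
      obtain ⟨c', hc0', hc'⟩ := hT z hz ε w' hne' (e2 w' hw')
      rw [hc] at h3
      rw [hc'] at h4
      have h5 := hsign (one_pow 2) e1 hc0 h3
      have h6 := hsign (by norm_num) e1 hc0' h4
      linarith)
  refine ⟨ε₁, ε₂, hε₁, hε₂, fun z hz => ?_⟩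
  obtain ⟨δ₁, δ₂, e1, e2, e3, e4, e5⟩ := h.exists_signs hr hk hz
  have h3 : δ₁ = ε₁ := by
    obtain ⟨c, hc0, hc⟩ := hT z hz δ₁ z hz e3
    have := h1 z hz
    rw [hc] at this
    exact hsign hε₁ e1 hc0 this
  have h4 : δ₂ = ε₂ := by
    obtain ⟨w, hw, hS⟩ := h2 z hz
    have hne : w ≠ 0 := by rintro rfl; simp at hS
    obtain ⟨c, hc0, hc⟩ := hT z hz δ₂ w hne (e5 w hw)
    rw [hc] at hS
    exact hsign hε₂ e2 hc0 hS
  rw [← h3, ← h4]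
  exact ⟨e3, e4, e5⟩

/-- In the chart at infinity the second structure becomes the standard one. -/
lemma endAt_dInto_inftyChart {ε : ℝ} (hJ : ∀ z : Cn n, z ≠ 0 →
      endAt J (ofVec z) (dInto (ofVec (k := k)) z z) = dInto (ofVec (k := k)) z (-ε • mulI n z) ∧
      endAt J (ofVec z) (dInto (ofVec (k := k)) z (mulI n z))
        = dInto (ofVec (k := k)) z (-ε • mulI n (mulI n z)) ∧
      ∀ w, inner ℂ z w = 0 → endAt J (ofVec z) (dInto (ofVec (k := k)) z w)
        = dInto (ofVec (k := k)) z (ε • mulI n w)) {ξ : Cn n} (hξ : ξ ≠ 0) (a : Cn n) :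
    endAt J (inftyChart ξ) (dInto (inftyChart (k := k)) ξ a)
      = dInto (inftyChart (k := k)) ξ (ε • mulI n a) := by
  have hρ : 0 < ‖ξ‖ ^ 2 := pow_pos (norm_pos_iff.2 hξ) 2
  have hη := invVec_ne_zero hξ
  obtain ⟨h1, h2, h3⟩ := hJ _ hη
  have hd := (hasFDerivAt_invVec hξ).fderiv
  have e0 : inner ℝ ξ (mulI n ξ) = 0 := inner_self_apply_eq_zero (I := mulI n) inner_mulI_left ξ
  -- the derivative of the inversion on the real line of `ξ` and on its orthogonal complement
  have d1 : fderiv ℝ invVec ξ ξ = -invVec ξ := by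
    rw [hd]
    simp only [sub_apply, smul_apply, ContinuousLinearMap.smulRight_apply, euclid_apply,
      ContinuousLinearMap.id_apply, real_inner_self_eq_norm_sq, invVec, smul_smul, ← sub_smul,
      ← neg_smul]
    congr 1
    field_simp
    ring
  have d2 : ∀ x, inner ℝ ξ x = 0 → fderiv ℝ invVec ξ x = (‖ξ‖ ^ 2)⁻¹ • x := by
    intro x hx
    rw [hd]
    simp [hx]
  have hL : (endAt J (inftyChart ξ)).comp (dInto (inftyChart (k := k)) ξ)
      = (dInto (inftyChart (k := k)) ξ).comp (ε • mulI n) := by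
    refine eq_of_eq_on_line hξ ?_ ?_ fun w hw => ?_
    · simp only [ContinuousLinearMap.comp_apply, smul_apply, dInto_inftyChart hξ, map_smul, d1, map_neg,
        d2 _ e0]
      change -endAt J (ofVec (invVec ξ)) _ = _
      rw [h1]
      simp only [invVec, map_smul, smul_smul, neg_smul, map_neg, neg_neg, neg_mul]
    · have e1 : fderiv ℝ invVec ξ (mulI n ξ) = mulI n (invVec ξ) := by
        rw [d2 _ e0, invVec, map_smul]
      simp only [ContinuousLinearMap.comp_apply, smul_apply, dInto_inftyChart hξ, e1]
      change endAt J (ofVec (invVec ξ)) _ = _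
      rw [h2]
      simp only [mulI_mulI, map_neg, map_smul, d1, smul_neg, neg_smul, neg_neg]
    · have hw2 : inner ℂ (invVec ξ) w = 0 := by
        have : invVec ξ = (((‖ξ‖ ^ 2)⁻¹ : ℝ) : ℂ) • ξ := rfl
        rw [this, inner_smul_left, hw, mul_zero]
      obtain ⟨o1, o2⟩ := inner_eq_zero_of_mulI hw
      simp only [ContinuousLinearMap.comp_apply, smul_apply, dInto_inftyChart hξ, d2 _ o1, map_smul,
        d2 _ o2]
      change _ • endAt J (ofVec (invVec ξ)) _ = _
      rw [h3 w hw2]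
      simp only [map_smul, smul_smul, mul_comm]
  exact congrArg (fun L : Cn n →L[ℝ] Cn n => L a) hL

/-- The conformal factor is unique up to scale. If the complex structure is, up to sign, the second
one, the factor is computed in the chart at infinity; the standard structure does not occur. -/
lemma IsInvariantKahlerFactor.exists_eq_mul_inv_momentum (h : IsInvariantKahlerFactor g v J)
    (hr : IsRadial g p) (hn : 2 ≤ n) (hk : 1 ≤ k) {τ : ℝ} (hτ : 0 < τ) (hale : IsALE g τ)
    {i j : Fin n} (hij : i ≠ j) :
    ∃ c : ℝ, 0 < c ∧ ∀ x, v x = c * (momentum g i j x)⁻¹ := by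
  obtain ⟨ε₁, ε₂, hε₁, hε₂, hJ⟩ := h.exists_constant_signs hr hn hk
  rcases sq_eq_sq_iff_eq_or_eq_neg.1 (hε₁.trans hε₂.symm) with heq | heq
  · -- the structure is `± stdJ`, the factor is constant, and this contradicts its decay
    exfalso
    have hJ' : ∀ z, z ≠ 0 → ∀ a, endAt J (ofVec z) (dInto (ofVec (k := k)) z a)
        = dInto (ofVec (k := k)) z (ε₂ • mulI n a) := by
      intro z hz a
      obtain ⟨h1, h2, h3⟩ := hJ z hz
      have hL : (endAt J (ofVec z)).comp (dInto (ofVec (k := k)) z)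
          = (dInto (ofVec (k := k)) z).comp (ε₂ • mulI n) :=
        eq_of_eq_on_line hz (by rw [← heq]; exact h1) (by rw [← heq]; exact h2) h3
      exact congrArg (fun L : Cn n →L[ℝ] Cn n => L a) hL
    obtain ⟨c, hc⟩ := h.isHermitianPair.exists_mul_eq hn h.pos h.closed
      (fun y hy => contMDiffAt_ofVec hy) (fun y hy => (dInto_ofVec_bijective hk hy).1)
      (c := fun _ => 1) (fun _ _ => differentiableAt_const _) (fun _ _ => one_pos)
      (fun r h0 => hr.contDiffAt h0) (fun y hy => by rw [hr.metric_eq y hy]; simp) hε₂ hJ'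
    have hconst := eq_const_of_eq_off_zeroSection hk (C := c) h.smooth.continuous
      (fun z hz => by rw [← hc z hz, mul_one])
    let x₀ : LineBundle n k := ofVec 0
    have hc0 : 0 < c := by rw [← hconst x₀]; exact h.pos _
    obtain ⟨C, R, hdec⟩ := h.decay x₀
    set D := max (max R 1) (|C| / c + 1)
    obtain ⟨x, hx⟩ := hr.exists_le_gdist hn hk hτ hale x₀ D
    have hD1 : 1 ≤ D := (le_max_right _ _).trans (le_max_left _ _)
    have hd : D ≤ (gdist g x₀ x).toReal :=
      (ENNReal.ofReal_le_iff_le_toReal (gdist_lt_top hn _ _).ne).1 hx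
    have h1 := hdec x ((ENNReal.ofReal_le_ofReal ((le_max_left _ _).trans (le_max_left _ _))).trans hx)
    rw [hconst x] at h1
    set d := (gdist g x₀ x).toReal
    have hd1 : 1 ≤ d := hD1.trans hd
    rw [le_div_iff₀ (by positivity)] at h1
    have h2 : |C| / c + 1 ≤ d := (le_max_right _ _).trans hd
    have h3 : |C| < c * d := by
      rw [← div_lt_iff₀' hc0]; linarith
    have h4 : c * d ≤ c * d ^ 2 := by
      refine mul_le_mul_of_nonneg_left ?_ hc0.le
      nlinarith
    linarith [le_abs_self C]
  · -- the structure is `± conjFiberJ`, which the chart at infinity turns into the standard one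
    obtain ⟨c, hc⟩ := h.isHermitianPair.exists_mul_eq hn h.pos h.closed
      (fun y hy => contMDiffAt_inftyChart hy) (fun y hy => (dInto_inftyChart_bijective hk hy).1)
      (c := fun y => momentum g i j (inftyChart y))
      (fun y hy => ((mdiffAt (hr.contMDiff_momentum hk hij _)).comp y
        (mdiffAt (contMDiffAt_inftyChart hy))).differentiableAt) (fun _ _ => momentum_pos _)
      (fun r h0 => hr.contDiffAt_invProfile hn hk h0)
      (fun y hy => by
        rw [hr.pullback_inftyChart hn hk hy, inftyChart, hr.momentum_ofVec hij (invVec_ne_zero hy),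
          norm_sq_invVec]) hε₂
      (fun y hy a => endAt_dInto_inftyChart (ε := ε₂) (by rw [← heq]; exact hJ) hy a)
    have hconst := eq_const_of_eq_off_zeroSection hk
      (f := fun x => v x * momentum g i j x) (C := c)
      (h.smooth.continuous.mul (hr.contMDiff_momentum hk hij).continuous)
      (fun z hz => by
        have := hc (invVec z) (invVec_ne_zero hz)
        rwa [inftyChart, invVec_invVec] at this)
    have hm : ∀ x : LineBundle n k, 0 < momentum g i j x := fun x => momentum_pos x
    refine ⟨c, ?_, fun x => ?_⟩
    · rw [← hconst (ofVec 0)]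
      exact mul_pos (h.pos _) (hm _)
    · rw [← hconst x, mul_assoc, mul_inv_cancel₀ (hm x).ne', mul_one]

end Uniqueness

/-! ### The orbifold compactification -/

section Orbifold

open LineBundle

variable {n k : ℕ}

lemma compactify_mem_dom {j : Fin n} {x : LineBundle n k} :
    compactify x ∈ WeightedProj.dom j ↔ x ∈ dom j := by
  induction x using Quotient.inductionOn with
  | h q =>
    obtain ⟨⟨v, w⟩, hv⟩ := q
    change compactify (mk v hv w) ∈ _ ↔ mk v hv w ∈ dom j
    rw [mk_mem_dom, compactify_mk]
    constructor
    · rintro ⟨v', w', h', hj, heq⟩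
      obtain ⟨c, hc, h1, -⟩ := WeightedProj.mk_eq_mk_iff.1 heq
      intro h0
      apply hj
      rw [h1, PiLp.smul_apply, h0, smul_zero]
    · intro hj
      exact ⟨v, _, _, hj, rfl⟩

variable [NeZero n] {g : RiemMetric n k} {p : ℝ → ℝ} {i j : Fin n}

omit [NeZero n] in
lemma pullback_conformal {V : Type*} [NormedAddCommGroup V] [NormedSpace ℝ V] (g : RiemMetric n k)
    (u : LineBundle n k → ℝ) (F : V → LineBundle n k) (y : V) :
    pullback F (conformal g u) y = u (F y) ^ 2 • pullback F g.inner y := rfl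

lemma IsRadial.pullback_inftyChart_momentum (hr : IsRadial g p) (hn : 2 ≤ n) (hk : 1 ≤ k)
    (hij : i ≠ j) {ξ : Cn n} (hξ : ξ ≠ 0) :
    pullback inftyChart g.inner ξ
      = momentum g i j (inftyChart ξ) ^ 2 • radialMetric (mulI n) (invProfile p) ξ := by
  rw [hr.pullback_inftyChart hn hk hξ, inftyChart, hr.momentum_ofVec hij (invVec_ne_zero hξ),
    norm_sq_invVec]

lemma IsRadial.pullback_conformal_inftyChart (hr : IsRadial g p) (hn : 2 ≤ n) (hk : 1 ≤ k)
    (hij : i ≠ j) {ξ : Cn n} (hξ : ξ ≠ 0) :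
    pullback inftyChart (conformal g fun x => (momentum g i j x)⁻¹) ξ
      = radialMetric (mulI n) (invProfile p) ξ := by
  rw [pullback_conformal, hr.pullback_inftyChart_momentum hn hk hij hξ, smul_smul, ← mul_pow,
    inv_mul_cancel₀ (momentum_pos _).ne', one_pow, one_smul]

lemma IsRadial.contMDiff_inv_momentum (hr : IsRadial g p) (hk : 1 ≤ k) (hij : i ≠ j) :
    ContMDiff 𝓘(ℝ, Cn n) 𝓘(ℝ, ℝ) ∞ (fun x : LineBundle n k => (momentum g i j x)⁻¹) := fun x =>
  (contDiffAt_inv ℝ (momentum_pos x).ne').contMDiffAt.comp x (hr.contMDiff_momentum hk hij x)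

/-- The metric `g` is Hermitian for the second complex structure. -/
lemma IsRadial.inner_conjFiberJ (hr : IsRadial g p) (hn : 2 ≤ n) (hk : 1 ≤ k) (x : LineBundle n k)
    (v w : Cn n) : tensorAt g.inner x (endAt conjFiberJ x v) (endAt conjFiberJ x w)
      = tensorAt g.inner x v w := by
  obtain ⟨l, a, rfl⟩ := exists_mem_dom x
  obtain ⟨v, rfl⟩ := (dInto_param_bijective (k := k) l a).2 v
  obtain ⟨w, rfl⟩ := (dInto_param_bijective (k := k) l a).2 w
  have hval : ∀ b, tensorAt g.inner (param l b)
      (endAt conjFiberJ (param (k := k) l b) (dInto (param (k := k) l) b v))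
      (endAt conjFiberJ (param (k := k) l b) (dInto (param (k := k) l) b w))
      = pullback (param l) g.inner b (chartEnd (k := k) conjFiberJ l b v) (chartEnd (k := k) conjFiberJ l b w) := by
    intro b
    rw [← dInto_chartEnd, ← dInto_chartEnd]
    rfl
  have hP := (contDiff_pullback_param g l).continuous
  have hE := ((isComplexStructure_conjFiberJ (n := n) (k := k)).contDiff_chartEnd l).continuous
  have heq : Set.EqOn (fun b => pullback (param l) g.inner b (chartEnd (k := k) conjFiberJ l b v)
      (chartEnd (k := k) conjFiberJ l b w)) (fun b => pullback (param l) g.inner b v w) {b | b l ≠ 0} := by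
    intro b hb
    obtain ⟨z, hzl, rfl⟩ := exists_param_eq_ofVec hk hb
    have hz := ne_zero_of_apply hzl
    have hξ := invVec_ne_zero hz
    simp only []
    rw [← hval, ← tensorAt_dInto]
    have hx : (param l (vecCoord k l z) : LineBundle n k) = inftyChart (invVec z) := by
      rw [inftyChart, invVec_invVec, ofVec_eq_param hzl]
    obtain ⟨α, hα⟩ := (dInto_inftyChart_bijective hk hξ).2 (dInto (param (k := k) l) (vecCoord k l z) v)
    obtain ⟨β, hβ⟩ := (dInto_inftyChart_bijective hk hξ).2 (dInto (param (k := k) l) (vecCoord k l z) w)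
    rw [← hα, ← hβ, hx, conjFiberJ_dInto_inftyChart hξ, conjFiberJ_dInto_inftyChart hξ,
      tensorAt_dInto, tensorAt_dInto, hr.pullback_inftyChart hn hk hξ]
    simp only [smul_apply]
    rw [radialMetric_hermitian mulI_mulI inner_mulI_left, mulI_mulI, map_neg, neg_neg]
  have := congrFun (Continuous.ext_on (dense_apply_ne_zero l)
    ((hP.clm_apply (hE.clm_apply continuous_const)).clm_apply (hE.clm_apply continuous_const))
    ((hP.clm_apply continuous_const).clm_apply continuous_const) heq) a
  rw [hval, tensorAt_dInto]
  exact this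

lemma IsRadial.isHermitianPair (hr : IsRadial g p) (hn : 2 ≤ n) (hk : 1 ≤ k) (hij : i ≠ j) :
    IsHermitianPair g (fun x => (momentum g i j x)⁻¹) conjFiberJ where
  smooth := hr.contMDiff_inv_momentum hk hij
  complex := isComplexStructure_conjFiberJ
  hermitian x v w := congrArg (fun t => ((momentum g i j x)⁻¹) ^ 2 * t) (hr.inner_conjFiberJ hn hk x v w)

/-- The rescaled metric is Kähler for the second complex structure. -/
lemma IsRadial.isClosedForm (hr : IsRadial g p) (hn : 2 ≤ n) (hk : 1 ≤ k) (hij : i ≠ j) :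
    IsClosedForm (fundamentalForm (conformal g fun x => (momentum g i j x)⁻¹) conjFiberJ) := by
  refine (hr.isHermitianPair hn hk hij).isClosedForm hk (F := inftyChart)
    (fun y hy => contMDiffAt_inftyChart hy) (fun y hy => dInto_inftyChart_bijective hk hy)
    (fun z hz => ⟨invVec z, invVec_ne_zero hz, by rw [inftyChart, invVec_invVec]⟩)
    fun y hy a b c => ?_
  have hy0 : 0 < ‖y‖ ^ 2 := pow_pos (norm_pos_iff.2 hy) 2
  have h1 : pullback inftyChart
      (fundamentalForm (conformal g fun x => (momentum g i j x)⁻¹) conjFiberJ)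
      =ᶠ[𝓝 y] fun y => (fun _ => (1 : ℝ)) (‖y‖ ^ 2) •
        (radialMetric (mulI n) (invProfile p) y).comp (mulI n) := by
    filter_upwards [isOpen_ne.mem_nhds hy] with ξ hξ
    rw [pullback_fundamentalForm g _ _ (conjFiberJ_dInto_inftyChart hξ),
      ← hr.pullback_conformal_inftyChart hn hk hij hξ, pullback_conformal, one_smul]
    rfl
  have h2 := extD_smul_radial (I := mulI n) mulI_mulI inner_mulI_left
    (hr.contDiffAt_invProfile hn hk hy0) (m := fun _ => 1) (differentiableAt_const _) a b c
  rw [deriv_const, mul_zero, zero_mul] at h2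
  rw [extD, h1.fderiv_eq]
  exact h2

lemma IsRadial.isInvariantKahlerFactor (hr : IsRadial g p) (hn : 2 ≤ n) (hk : 1 ≤ k) (hij : i ≠ j)
    {τ : ℝ} (hτ : 0 < τ) (h : IsALE g τ) :
    IsInvariantKahlerFactor g (fun x => (momentum g i j x)⁻¹) conjFiberJ where
  smooth := hr.contMDiff_inv_momentum hk hij
  pos x := inv_pos.2 (momentum_pos x)
  invariant A x := by rw [momentum_act]
  decay := hr.exists_inv_momentum_le hn hk hτ h hij
  complex := isComplexStructure_conjFiberJ
  complex_invariant := conjFiberJ_act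
  hermitian := (hr.isHermitianPair hn hk hij).hermitian
  closed := hr.isClosedForm hn hk hij

/-- The rescaled metric extends over the orbifold point. -/
lemma IsRadial.exists_orbifoldExtension (hr : IsRadial g p) (hn : 2 ≤ n) (hk : 1 ≤ k)
    (hij : i ≠ j) {τ : ℝ} (hτ : 0 < τ) (h : IsALE g τ) :
    ∃ (s : Cn n → LineBundle n k) (h : Cn n → Cn n →L[ℝ] Cn n →L[ℝ] ℝ),
    (∀ ξ, ξ ≠ 0 → compactify (s ξ) = WeightedProj.orbChart ξ) ∧
    ContMDiffOn 𝓘(ℝ, Cn n) 𝓘(ℝ, Cn n) ∞ s {0}ᶜ ∧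
    (∀ ξ, ξ ≠ 0 → Function.Bijective (mfderiv 𝓘(ℝ, Cn n) 𝓘(ℝ, Cn n) s ξ) ∧
      ∀ w : Cn n, mfderiv 𝓘(ℝ, Cn n) 𝓘(ℝ, Cn n) s ξ (mulI n w)
        = conjFiberJ (s ξ) (mfderiv 𝓘(ℝ, Cn n) 𝓘(ℝ, Cn n) s ξ w)) ∧
    (∀ ξ, ξ ≠ 0 → h ξ = pullback s (conformal g fun x => (momentum g i j x)⁻¹) ξ) ∧
    Continuous h ∧ (∀ w, w ≠ 0 → 0 < h 0 w w) ∧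
    (1 < τ → ContDiff ℝ 1 h ∧ ∃ α C δ : ℝ, 0 < α ∧ 0 < δ ∧
      ∀ ξ ∈ Metric.ball (0 : Cn n) δ, ∀ ξ' ∈ Metric.ball (0 : Cn n) δ, ∀ a b c : Cn n,
        |fderiv ℝ h ξ a b c - fderiv ℝ h ξ' a b c| ≤ C * ‖ξ - ξ'‖ ^ α * (‖a‖ * ‖b‖ * ‖c‖)) := by
  obtain ⟨c, hc, h0, h1, h2, h3⟩ := hr.exists_invProfile_asymptotics hn hk hτ h
  obtain ⟨hcont, hreg⟩ := extendedMetric_regularity (I := mulI n) norm_mulI hτ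
    (fun ρ hρ => hr.contDiffAt_invProfile hn hk hρ) h0 h1 h2 h3
  refine ⟨inftyChart, extendedMetric (mulI n) (invProfile p) c, fun ξ hξ => compactify_inftyChart hξ,
    fun ξ hξ => (contMDiffAt_inftyChart hξ).contMDiffWithinAt,
    fun ξ hξ => ⟨dInto_inftyChart_bijective hk hξ, fun w =>
      (conjFiberJ_dInto_inftyChart hξ w).symm⟩, fun ξ hξ => ?_, hcont, fun w hw => ?_, hreg⟩
  · rw [extendedMetric_of_ne hξ, hr.pullback_conformal_inftyChart hn hk hij hξ]
  · rw [extendedMetric_zero, smul_apply, smul_apply, euclid_apply, real_inner_self_eq_norm_sq,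
      smul_eq_mul]
    have := norm_pos_iff.2 hw
    positivity

lemma IsRadial.isOrbifoldCompactification (hr : IsRadial g p) (hn : 2 ≤ n) (hk : 1 ≤ k)
    (hij : i ≠ j) {τ : ℝ} (hτ : 0 < τ) (h : IsALE g τ) :
    IsOrbifoldCompactification g τ (fun x => (momentum g i j x)⁻¹) conjFiberJ compactify where
  compact := WeightedProj.compactSpace hk
  hausdorff := WeightedProj.t2Space hk
  openEmbedding := isOpenEmbedding_compactify
  range_eq := range_compactify hk
  equivariant := compactify_act
  biholomorphic _ _ hx :=
    have hx' := compactify_mem_dom.1 hx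
    ⟨contMDiffAt_projCoord hx', dOut_projCoord_bijective hx', dOut_projCoord_conjFiberJ hx'⟩
  orbifold_point := hr.exists_orbifoldExtension hn hk hij hτ h

end Orbifold

end KahlerALE

end

open KahlerALE in
theorem theorem1p1 (n k : ℕ) [NeZero n] (hn : 2 ≤ n) (hk : 1 ≤ k) (g : RiemMetric n k)
    (φ : ℝ → ℝ) (τ : ℝ) (hτ : 0 < τ) (hg : IsInvariantKahlerALE g φ τ) :
    ∃ u : LineBundle n k → ℝ,
      (∀ z : Cn n, z ≠ 0 →
        u (LineBundle.ofVec z) ^ 2 = (‖z‖ ^ 2 * deriv φ (‖z‖ ^ 2)) ^ (-2 : ℤ)) ∧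
      (∃ (J : EndField n k) (e : LineBundle n k → WeightedProj n k),
        IsInvariantKahlerFactor g u J ∧
        (∀ x, J x ≠ stdJ x ∧ J x ≠ -stdJ x) ∧
        IsOrbifoldCompactification g τ u J e) ∧
      ∀ (v : LineBundle n k → ℝ) (J : EndField n k), IsInvariantKahlerFactor g v J →
        ∃ c : ℝ, 0 < c ∧ ∀ x, v x = c * u x := by
  have hr := hg.isRadial
  let i : Fin n := ⟨0, by omega⟩
  let j : Fin n := ⟨1, by omega⟩
  have hij : i ≠ j := by simp [i, j]
  refine ⟨fun x => (momentum g i j x)⁻¹, fun z hz => ?_,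
    ⟨conjFiberJ, compactify, hr.isInvariantKahlerFactor hn hk hij hτ hg.ale, conjFiberJ_ne hn,
      hr.isOrbifoldCompactification hn hk hij hτ hg.ale⟩,
    fun v J h => h.exists_eq_mul_inv_momentum hr hn hk hτ hg.ale hij⟩
  simp only [hr.momentum_ofVec hij hz, zpow_neg, inv_pow, zpow_ofNat]
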